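/- Let $n\ge 1$, $\beta>0$, $g,g_0,g_1,g_0',g_1'\ge 0$, $q=e^{-\beta}$, $t=e^{-\beta g}$, $\gamma=i\beta/2$, $\mu=i\beta g$, $\mu_\delta=i\beta g_\delta$, $\mu'_\delta=i\beta g'_\delta$, $(a;q)_\infty=\prod_{m\ge 0}(1-aq^m)$. Put $$v_a(z)=\frac{\sin\frac12(\mu+z)}{\sin\frac12 z},\qquad v_b(z)=\frac{\sin\frac12(\mu_0+z)}{\sin\frac12 z}\,\frac{\cos\frac12(\mu_1+z)}{\cos\frac12 z}\,\frac{\sin\frac12(\mu_0'+\gamma+z)}{\sin\frac12(\gamma+z)}\,\frac{\cos\frac12(\mu_1'+\gamma+z)}{\cos\frac12(\gamma+z)},$$ $$V_{\varepsilon J;K}=\prod_{j\in J}v_b(\varepsilon_jx_j)\prod_{j<j'\in J}v_a(\varepsilon_jx_j+\varepsilon_{j'}x_{j'})v_a(\varepsilon_jx_j+\varepsilon_{j'}x_{j'}+2\gamma)\prod_{j\in J,k\in K}v_a(\varepsilon_jx_j+x_k)v_a(\varepsilon_jx_j-x_k),$$ and, for $1\le r\le n$, with $\hat\theta_j=-i\partial_{x_j}$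 (so that $e^{-\beta\hat\theta_j}$ is the shift $x_j\mapsto x_j+i\beta$), $\hat\theta_{\varepsilon J}=\sum_{j\in J}\varepsilon_j\hat\theta_j$, $J_0=\emptyset$, $$\hat D_r=\sum_{|J|=r,\ \varepsilon_j=\pm1\,(j\in J)}\ \sum_{\emptyset\subsetneq J_1\subsetneq\cdots\subsetneq J_s=J}(-1)^{s-1}\prod_{s'=1}^{s}V_{\varepsilon(J_{s'}\setminus J_{s'-1});J_{s'}^c}\,\bigl(e^{-\beta\hat\theta_{\varepsilon J_1}}-1\bigr).$$ Let further $$d_a^+(z)=\frac{(e^{iz};q)_\infty}{(te^{iz};q)_\infty},\qquad d_b^+(z)=\frac{(e^{2iz};q)_\infty}{(e^{-\beta g_0}e^{iz},\,-e^{-\beta g_1}e^{iz},\,e^{-\beta(g_0'+1/2)}e^{iz},\,-e^{-\beta(g_1'+1/2)}e^{iz};q)_\infty},$$ $d_c(z)=d_c^+(z)d_c^+(-z)$, and $\Delta(x)=\prod_{j<k}d_a(x_j+x_k)d_a(x_j-x_k)\prod_jd_b(x_j)$ on $\mathbb T=\mathbb R^n/2\pi\mathbb Z^n$, $\langle f,h\rangle_\Delta=\int_{\mathbb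 T}f\bar h\,\Delta\,dx$. Write $e^\lambda(x)=e^{i\sum\lambda_jx_j}$, $|\lambda|=\sum_j\lambda_j$, $\mathcal P^+=\{\lambda\in\mathbb Z^n:\lambda_1\ge\cdots\ge\lambda_n\ge0\}$, $\lambda'\le\lambda$ iff $\sum_{j\le k}\lambda'_j\le\sum_{j\le k}\lambda_j$ for all $k$, $m_\lambda=\sum e^{\nu}$ over the orbit of $\lambda$ under permutations and sign flips, and $m_{\lambda,lead}=\sum e^\nu$ over the orbit under permutations. Koornwinder's polynomial $p_\lambda=\sum_{\lambda'\in\mathcal P^+,\lambda'\le\lambda}c_{\lambda,\lambda'}m_{\lambda'}$, $\lambda\in\mathcal P^+$, is defined by $c_{\lambda,\lambda}=1$ and $\langle p_\lambda,m_{\lambda'}\rangle_\Delta=0$ for all $\lambda'\in\mathcal P^+$, $\lambda'<\lambda$; set $$p_{\lambda,lead}=\sum_{\lambda'\le\lambda,\ |\lambda'|=|\lambda|}c_{\lambda,\lambda'}m_{\lambda',lead},\qquad p_{\lambda,A_{n-1}}(x)=e^{-i|\lambda|(x_1+\cdots+x_n)/n}\,p_{\lambda,lead}(x).$$ Then the following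 hold. (1) Let $\hat D_{r,lead}=\sum_{|J|=r}V_{J;J^c}e^{-\beta\hat\theta_J}$ (all signs $+$), $\Lambda_R=e^{-iR(x_1+\cdots+x_n)}$ and $\tilde\Delta_+=\prod_{j<k}e^{g(x_j+x_k)/2i}d_a^+(x_j+x_k)\prod_je^{(g_0+g_1+g_0'+g_1')x_j/2i}d_b^+(x_j)$. For $1\le r\le n$, $$\hat D_{r,lead}=\lim_{R\to\infty}e^{-r\beta R}\Lambda_R^{-1}\hat D_r\Lambda_R,\qquad \tilde\Delta_+\hat D_{r,lead}\tilde\Delta_+^{-1}=\hat D'_r:=\sum_{|J|=r}\Bigl(\prod_{j\in J,\,k\in J^c}v_a(x_j-x_k)\Bigr)e^{-\beta\hat\theta_J},$$ the second identity at points that are not zeros of the numerators or denominators of the factors of $\tilde\Delta_+$. (2) For $1\le r\le n-1$ let $\hat D_{r,A_{n-1}}=e^{\beta r(\hat\theta_1+\cdots+\hat\theta_n)/n}\hat D'_r$. Then $\hat D'_r=e^{-\beta r(\hat\theta_1+\cdots+\hat\theta_n)/n}\hat D_{r,A_{n-1}}=\hat D_{r,A_{n-1}}e^{-\beta r(\hat\theta_1+\cdots+\hat\theta_n)/n}$,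 and at generic points $$E_{\omega_r}=e^{-\beta g r(n-r)/2}\,\hat D_{r,A_{n-1}},$$ where $E_{\omega_r}=\sum_{w\in S_n/(S_n)_{\omega_r}}w\,(\Phi_rT_r)\,w^{-1}$ is Macdonald's operator for the fundamental weight $\omega_r=e_1+\cdots+e_r-\frac rn(e_1+\cdots+e_n)$: $(T_rf)(x)=f(x+i\beta\omega_r)$, $\Phi_r=(T_r\Delta_+)/\Delta_+$, $\Delta_+=\prod_{j<k}d_a^+(x_j-x_k)$. (3) For every $\lambda\in\mathcal P^+$ the polynomial $p_\lambda$ exists and is unique; with $\omega=e_1+\cdots+e_n$, $p_{\lambda,lead}(x)=\lim_{R\to\infty}e^{-R|\lambda|}p_\lambda(x-iR\omega)$ for all $x\in\mathbb C^n$; $p_{\lambda,A_{n-1}}\ne0$; and for $1\le r\le n-1$ $$\hat D_{r,A_{n-1}}\,p_{\lambda,A_{n-1}}=E_{r,A_{n-1}}(\lambda+\rho')\,p_{\lambda,A_{n-1}}$$ (at all $x$ with $x_j\notin x_k+2\pi\mathbb Z$ for $j\ne k$), where $\rho'_j=g(n+1-2j)/2$ and $E_{r,A_{n-1}}(\theta)=e^{\beta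 r(\theta_1+\cdots+\theta_n)/n}S_r(e^{-\beta\theta_1},\dots,e^{-\beta\theta_n})$, $S_r$ being the $r$th elementary symmetric function. (4) Let $V=\{x\in\mathbb R^n:\sum x_j=0\}$ with the root system $\{e_j-e_k\}$ of type $A_{n-1}$, root lattice $Q$ $(=Q^\vee)$, and $\langle f,h\rangle_A=\int_{V/2\pi Q^\vee}f\bar h\prod_{j<k}d_a(x_j-x_k)\,dx$. There is exactly one family $(P_\mu)$, indexed by the dominant weights $\mu$ of $A_{n-1}$, with $P_\mu=m^A_\mu+\sum_{\nu<\mu}u_{\mu\nu}m^A_\nu$ ($m^A_\nu$ the orbit sum of $e^\nu$ under $S_n$; $\nu\le\mu$ iff $\mu-\nu$ is a sum of simple roots with non-negative integer coefficients) and $\langle P_\mu,P_\nu\rangle_A=0$ for $\mu\ne\nu$: the $A_{n-1}$ Macdonald polynomials with parameters $q=e^{-\beta}$, $t=e^{-\beta g}$. For every $\lambda\in\mathcal P^+$, $\lambda-\frac{|\lambda|}n\omega$ is a dominant weight of $A_{n-1}$ and $$p_{\lambda,A_{n-1}}=P_{\lambda-|\lambda|\omega/n}.$$ -/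

import Mathlib

open Filter Topology

noncomputable section

namespace KoornA

/-- The parameters of the Koornwinder family: `q = exp (-β)`, and the coupling constants
`g, g₀, g₁, g₀', g₁'`. -/
structure Params where
  β : ℝ
  g : ℝ
  g0 : ℝ
  g1 : ℝ
  g0' : ℝ
  g1' : ℝ

/-- Positivity of the scale `β` and non-negativity of the couplings. -/
structure Params.Admissible (p : Params) : Prop where
  β_pos : 0 < p.β
  g_nonneg : 0 ≤ p.g
  g0_nonneg : 0 ≤ p.g0
  g1_nonneg : 0 ≤ p.g1
  g0'_nonneg : 0 ≤ p.g0'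
  g1'_nonneg : 0 ≤ p.g1'

/-! ### The elementary functions -/

/-- `γ = iβ/2`. -/
def Params.γ (p : Params) : ℂ := Complex.I * p.β / 2

/-- `v_a(z) = sin((μ+z)/2) / sin(z/2)` with `μ = iβg`. -/
def va (p : Params) (z : ℂ) : ℂ :=
  Complex.sin ((Complex.I * p.β * p.g + z) / 2) / Complex.sin (z / 2)

/-- `v_b(z)`, with `μ_δ = iβg_δ`, `μ_δ' = iβg_δ'`. -/
def vb (p : Params) (z : ℂ) : ℂ :=
  Complex.sin ((Complex.I * p.β * p.g0 + z) / 2) / Complex.sin (z / 2)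
    * (Complex.cos ((Complex.I * p.β * p.g1 + z) / 2) / Complex.cos (z / 2))
    * (Complex.sin ((Complex.I * p.β * p.g0' + p.γ + z) / 2) / Complex.sin ((p.γ + z) / 2))
    * (Complex.cos ((Complex.I * p.β * p.g1' + p.γ + z) / 2) / Complex.cos ((p.γ + z) / 2))

/-- The infinite `q`-shifted factorial `(a;q)_∞ = ∏_{m ≥ 0} (1 - a q^m)` with `q = exp (-β)`. -/
def qPoch (p : Params) (a : ℂ) : ℂ := ∏' m : ℕ, (1 - a * (Real.exp (-p.β) : ℂ) ^ m)

def daPlusNum (p : Params) (z : ℂ) : ℂ := qPoch p (Complex.exp (Complex.I * z))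

def daPlusDen (p : Params) (z : ℂ) : ℂ :=
  qPoch p (Real.exp (-p.β * p.g) * Complex.exp (Complex.I * z))

/-- `d_a⁺(z) = (e^{iz};q)_∞ / (t e^{iz};q)_∞` with `t = exp (-βg)`. -/
def daPlus (p : Params) (z : ℂ) : ℂ := daPlusNum p z / daPlusDen p z

def dbPlusNum (p : Params) (z : ℂ) : ℂ := qPoch p (Complex.exp (2 * Complex.I * z))

def dbPlusDen (p : Params) (z : ℂ) : ℂ :=
  qPoch p (Real.exp (-p.β * p.g0) * Complex.exp (Complex.I * z))
    * qPoch p (-Real.exp (-p.β * p.g1) * Complex.exp (Complex.I * z))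
    * qPoch p (Real.exp (-p.β * (p.g0' + 1 / 2)) * Complex.exp (Complex.I * z))
    * qPoch p (-Real.exp (-p.β * (p.g1' + 1 / 2)) * Complex.exp (Complex.I * z))

/-- `d_b⁺(z)`. -/
def dbPlus (p : Params) (z : ℂ) : ℂ := dbPlusNum p z / dbPlusDen p z

def da (p : Params) (z : ℂ) : ℂ := daPlus p z * daPlus p (-z)

def db (p : Params) (z : ℂ) : ℂ := dbPlus p z * dbPlus p (-z)

variable {n : ℕ}

/-! ### The difference operators `D̂_r` -/

/-- The real number `±1` attached to a sign, as a complex number. -/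
def sgn (e : ℤˣ) : ℂ := ((e : ℤ) : ℂ)

/-- `V_{εJ;K}`. -/
def V (p : Params) (ε : Fin n → ℤˣ) (J K : Finset (Fin n)) (x : Fin n → ℂ) : ℂ :=
  (∏ j ∈ J, vb p (sgn (ε j) * x j))
    * (∏ j ∈ J, ∏ k ∈ J with j < k,
        va p (sgn (ε j) * x j + sgn (ε k) * x k)
          * va p (sgn (ε j) * x j + sgn (ε k) * x k + 2 * p.γ))
    * (∏ j ∈ J, ∏ k ∈ K,
        va p (sgn (ε j) * x j + x k) * va p (sgn (ε j) * x j - x k))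

/-- The point `x + iβ ∑_{j ∈ J} ε_j e_j`. -/
def shiftPt (p : Params) (ε : Fin n → ℤˣ) (J : Finset (Fin n)) (x : Fin n → ℂ) : Fin n → ℂ :=
  fun j => if j ∈ J then x j + Complex.I * p.β * sgn (ε j) else x j

/-- The strictly increasing sequences `∅ = J_0 ⊊ J_1 ⊊ ⋯ ⊊ J_s = J` with `s = s' + 1 ≥ 1`. -/
def chains (J : Finset (Fin n)) (s' : ℕ) : Finset (Fin (s' + 2) → Finset (Fin n)) :=
  open Classical in
  {C | C 0 = ∅ ∧ StrictMono C ∧ C (Fin.last (s' + 1)) = J}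

/-- The families of signs `(ε_j)_{j ∈ J}` (extended by `+1` outside `J`). -/
def signsOn (J : Finset (Fin n)) : Finset (Fin n → ℤˣ) := {ε | ∀ j, j ∉ J → ε j = 1}

/-- The analytic difference operator `D̂_r`; `exp (-β θ̂_{εJ})` acts on functions of complex
variables as the shift `x ↦ x + iβ ∑_{j ∈ J} ε_j e_j`. The index `s'` is `s - 1`. -/
def Dhat (p : Params) (r : ℕ) (f : (Fin n → ℂ) → ℂ) (x : Fin n → ℂ) : ℂ :=
  ∑ J ∈ Finset.powersetCard r (Finset.univ : Finset (Fin n)), ∑ ε ∈ signsOn J,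
    ∑ s' ∈ Finset.range r, ∑ C ∈ chains J s',
      (-1) ^ s' * (∏ i : Fin (s' + 1), V p ε (C i.succ \ C i.castSucc) (C i.succ)ᶜ x)
        * (f (shiftPt p ε (C 1) x) - f x)

/-- The leading part `D̂_{r,lead} = ∑_{|J| = r} V_{J;Jᶜ} exp (-β θ̂_J)` (all signs `+`). -/
def Dlead (p : Params) (r : ℕ) (f : (Fin n → ℂ) → ℂ) (x : Fin n → ℂ) : ℂ :=
  ∑ J ∈ Finset.powersetCard r (Finset.univ : Finset (Fin n)),
    V p (fun _ => 1) J Jᶜ x * f (shiftPt p (fun _ => 1) J x)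

/-- `Λ_R(x) = exp (-iR(x_1 + ⋯ + x_n))`. -/
def Lam (R : ℝ) (x : Fin n → ℂ) : ℂ := Complex.exp (-Complex.I * R * ∑ j, x j)

/-- The conjugating function `Δ̃₊`. -/
def tDeltaPlus (p : Params) (x : Fin n → ℂ) : ℂ :=
  (∏ j : Fin n, ∏ k ∈ Finset.Ioi j,
      Complex.exp (p.g * (x j + x k) / (2 * Complex.I)) * daPlus p (x j + x k))
    * ∏ j : Fin n,
      Complex.exp ((p.g0 + p.g1 + p.g0' + p.g1') * x j / (2 * Complex.I)) * dbPlus p (x j)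

/-- `x` is not a zero of a numerator or denominator of `Δ̃₊`. -/
def RegularPlus (p : Params) (x : Fin n → ℂ) : Prop :=
  (∀ j k : Fin n, j < k → daPlusNum p (x j + x k) ≠ 0 ∧ daPlusDen p (x j + x k) ≠ 0)
    ∧ ∀ j : Fin n, dbPlusNum p (x j) ≠ 0 ∧ dbPlusDen p (x j) ≠ 0

/-- The `A_{n-1}`-type operator `D̂'_r`. -/
def Dprime (p : Params) (r : ℕ) (f : (Fin n → ℂ) → ℂ) (x : Fin n → ℂ) : ℂ :=
  ∑ J ∈ Finset.powersetCard r (Finset.univ : Finset (Fin n)),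
    (∏ j ∈ J, ∏ k ∈ Jᶜ, va p (x j - x k)) * f (shiftPt p (fun _ => 1) J x)

/-- `exp (-βa(θ̂_1 + ⋯ + θ̂_n))`, the translation `x ↦ x + iβa(e_1 + ⋯ + e_n)`. -/
def transl (p : Params) (a : ℝ) (f : (Fin n → ℂ) → ℂ) (x : Fin n → ℂ) : ℂ :=
  f (fun j => x j + Complex.I * p.β * a)

/-- `D̂_{r,A_{n-1}} = exp (βr(θ̂_1 + ⋯ + θ̂_n)/n) D̂'_r`. -/
def DA (p : Params) (r : ℕ) (f : (Fin n → ℂ) → ℂ) : (Fin n → ℂ) → ℂ :=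
  transl p (-((r : ℝ) / n)) (Dprime p r f)

/-! ### Koornwinder polynomials -/

/-- `e^μ(x) = exp (i ∑ μ_j x_j)`. -/
def expo (μ x : Fin n → ℂ) : ℂ := Complex.exp (Complex.I * ∑ j, μ j * x j)

/-- The cone `λ_1 ≥ ⋯ ≥ λ_n ≥ 0` in `ℤⁿ`. -/
def IsDom (lam : Fin n → ℤ) : Prop := Antitone lam ∧ ∀ j, 0 ≤ lam j

/-- The dominance partial order on `ℤⁿ`. -/
def DomLE (lam' lam : Fin n → ℤ) : Prop :=
  ∀ k, ∑ j ∈ Finset.Iic k, lam' j ≤ ∑ j ∈ Finset.Iic k, lam j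

/-- `|λ|`. -/
def wt (lam : Fin n → ℤ) : ℤ := ∑ j, lam j

/-- The orbit of `λ` under permutations and sign flips. -/
def orbitW (lam : Fin n → ℤ) : Finset (Fin n → ℤ) :=
  (Finset.univ : Finset ((Fin n → ℤˣ) × Equiv.Perm (Fin n))).image
    fun w => fun j => (w.1 j : ℤ) * lam (w.2 j)

/-- The monomial symmetric function `m_λ` for the hyperoctahedral group. -/
def mono (lam : Fin n → ℤ) (x : Fin n → ℂ) : ℂ :=
  ∑ ν ∈ orbitW lam, expo (fun j => (ν j : ℂ)) x

/-- The weight function `Δ` on the torus. -/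
def Delta (p : Params) (x : Fin n → ℂ) : ℂ :=
  (∏ j : Fin n, ∏ k ∈ Finset.Ioi j, da p (x j + x k) * da p (x j - x k)) * ∏ j : Fin n, db p (x j)

/-- `⟨f, h⟩_Δ = ∫_𝕋 f h̄ Δ dx`, `𝕋 = ℝⁿ/2πℤⁿ`. -/
def inner (p : Params) (f h : (Fin n → ℂ) → ℂ) : ℂ :=
  ∫ x in Set.Icc (fun _ : Fin n => -Real.pi) (fun _ => Real.pi),
    f (fun j => (x j : ℂ)) * (starRingEnd ℂ) (h fun j => (x j : ℂ)) * Delta p fun j => (x j : ℂ)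

/-- The invariant polynomial `∑ c_{λ'} m_{λ'}`. -/
def polyOf (c : (Fin n → ℤ) →₀ ℂ) (x : Fin n → ℂ) : ℂ := c.sum fun lam a => a * mono lam x

/-- `c` is the family of coefficients `c_{λ,λ'}` of the Koornwinder polynomial
`p_λ = ∑_{λ' ≤ λ} c_{λ,λ'} m_{λ'}`: `c_{λ,λ} = 1` and `p_λ` is orthogonal to every `m_{λ'}` with
`λ' < λ`. -/
structure IsKoornwinder (p : Params) (lam : Fin n → ℤ) (c : (Fin n → ℤ) →₀ ℂ) : Prop where
  supp : ∀ lam' ∈ c.support, IsDom lam' ∧ DomLE lam' lam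
  monic : c lam = 1
  orth : ∀ lam', IsDom lam' → DomLE lam' lam → lam' ≠ lam → inner p (polyOf c) (mono lam') = 0

/-- The orbit of `μ` under permutations. -/
def orbitS {α : Type*} (μ : Fin n → α) : Finset (Fin n → α) :=
  open Classical in
  (Finset.univ : Finset (Equiv.Perm (Fin n))).image fun σ => μ ∘ σ

/-- `m_{λ,lead}`. -/
def monoLead (lam : Fin n → ℤ) (x : Fin n → ℂ) : ℂ :=
  ∑ ν ∈ orbitS lam, expo (fun j => (ν j : ℂ)) x

/-- `p_{λ,lead} = ∑_{λ' ≤ λ, |λ'| = |λ|} c_{λ,λ'} m_{λ',lead}`. -/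
def pLead (lam : Fin n → ℤ) (c : (Fin n → ℤ) →₀ ℂ) (x : Fin n → ℂ) : ℂ :=
  ∑ lam' ∈ c.support with wt lam' = wt lam, c lam' * monoLead lam' x

/-- `p_{λ,A_{n-1}}(x) = exp (-i|λ|(x_1 + ⋯ + x_n)/n) p_{λ,lead}(x)`. -/
def pA (lam : Fin n → ℤ) (c : (Fin n → ℤ) →₀ ℂ) (x : Fin n → ℂ) : ℂ :=
  Complex.exp (-Complex.I * wt lam * (∑ j, x j) / n) * pLead lam c x

/-- `ρ'_j = g(n + 1 - 2j)/2`, `1 ≤ j ≤ n` (the index `j : Fin n` starts at `0`). -/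
def rhoA (p : Params) (j : Fin n) : ℝ := p.g * (n + 1 - 2 * ((j : ℕ) + 1 : ℝ)) / 2

/-- `E_{r,A_{n-1}}(θ) = exp (βr(θ_1 + ⋯ + θ_n)/n) S_r(e^{-βθ_1}, …, e^{-βθ_n})`. -/
def eigA (p : Params) (r : ℕ) (θ : Fin n → ℝ) : ℝ :=
  Real.exp (p.β * r * (∑ j, θ j) / n)
    * ∑ J ∈ Finset.powersetCard r (Finset.univ : Finset (Fin n)), ∏ j ∈ J, Real.exp (-p.β * θ j)

/-! ### Macdonald's operators and polynomials for the root system `A_{n-1}`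

The root system is `{e_j - e_k}` in the hyperplane `V = {x : ∑ x_j = 0}`; its Weyl group is the
symmetric group. Functions on `V` are identified with functions of `x` that are invariant under
translations along `e_1 + ⋯ + e_n`. -/

/-- The simple root (and coroot) `e_i - e_{i+1}`. -/
def simpleRoot (i : Fin (n - 1)) : Fin n → ℝ :=
  Pi.single ⟨i, by omega⟩ 1 - Pi.single ⟨i + 1, by omega⟩ 1

/-- The dominant weights: `μ ∈ V` with `⟨μ, α⟩ ∈ ℤ_{≥0}` for all simple coroots `α`. -/
def IsDomWeightA (μ : Fin n → ℝ) : Prop :=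
  ∑ j, μ j = 0 ∧ ∀ i : Fin (n - 1), ∃ a : ℕ, ∑ j, μ j * simpleRoot i j = a

/-- `ν ≤ μ` iff `μ - ν` is a sum of simple roots with coefficients in `ℤ_{≥0}`. -/
def WeightLEA (ν μ : Fin n → ℝ) : Prop :=
  ∃ a : Fin (n - 1) → ℕ, μ - ν = ∑ i, (a i : ℝ) • simpleRoot i

/-- The orbit sum of `e^μ`. -/
def monoA (μ : Fin n → ℝ) (x : Fin n → ℂ) : ℂ :=
  ∑ ν ∈ orbitS μ, expo (fun j => (ν j : ℂ)) x

/-- `Δ₊ = ∏_{α > 0} (e^α;q)_∞ / (t e^α;q)_∞`. -/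
def DeltaAPlus (p : Params) (x : Fin n → ℂ) : ℂ :=
  ∏ j : Fin n, ∏ k ∈ Finset.Ioi j, daPlus p (x j - x k)

/-- `Δ = ∏_α (e^α;q)_∞ / (t e^α;q)_∞`, the product over all roots. -/
def DeltaA (p : Params) (x : Fin n → ℂ) : ℂ :=
  ∏ j : Fin n, ∏ k ∈ Finset.Ioi j, da p (x j - x k)

/-- The inner product over the torus `V / 2πQ^∨`, in the coordinates
`x = ∑ s_i (e_i - e_{i+1})`, `s_i ∈ [-π, π]`. -/
def innerA (p : Params) (f h : (Fin n → ℂ) → ℂ) : ℂ :=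
  ∫ s in Set.Icc (fun _ : Fin (n - 1) => -Real.pi) (fun _ => Real.pi),
    let x : Fin n → ℂ := fun j => ((∑ i, s i * simpleRoot i j : ℝ) : ℂ)
    f x * (starRingEnd ℂ) (h x) * DeltaA p x

/-- `P = m_μ + ∑_{ν < μ} u_ν m_ν`. -/
def IsMonicTriangularA (μ : Fin n → ℝ) (P : (Fin n → ℂ) → ℂ) : Prop :=
  ∃ u : (Fin n → ℝ) →₀ ℂ, (∀ ν ∈ u.support, IsDomWeightA ν ∧ WeightLEA ν μ) ∧ u μ = 1
    ∧ P = fun x => u.sum fun ν a => a * monoA ν x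

/-- `(P_μ)` is the family of Macdonald polynomials of type `A_{n-1}`, with `q = exp (-β)` and
`t = exp (-βg)`: monic, triangular and mutually orthogonal. (Only the values at dominant
weights matter.) -/
def IsMacdonaldA (p : Params) (P : (Fin n → ℝ) → (Fin n → ℂ) → ℂ) : Prop :=
  (∀ μ, IsDomWeightA μ → IsMonicTriangularA μ (P μ))
    ∧ ∀ μ ν, IsDomWeightA μ → IsDomWeightA ν → μ ≠ ν → innerA p (P μ) (P ν) = 0

/-- The fundamental (minuscule) weight `ω_r = e_1 + ⋯ + e_r - (r/n)(e_1 + ⋯ + e_n)`. -/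
def fundWeight (n r : ℕ) : Fin n → ℝ := fun j => (if (j : ℕ) < r then 1 else 0) - (r : ℝ) / n

/-- `T_π e^λ = q^{⟨π,λ⟩} e^λ`, that is, `(T_π f)(x) = f(x + iβπ)`. -/
def TOp (p : Params) (π : Fin n → ℝ) (f : (Fin n → ℂ) → ℂ) (x : Fin n → ℂ) : ℂ :=
  f (fun j => x j + Complex.I * p.β * π j)

/-- The action of permutations on functions. -/
def permOp (σ : Equiv.Perm (Fin n)) (f : (Fin n → ℂ) → ℂ) (x : Fin n → ℂ) : ℂ := f (x ∘ σ)

/-- Macdonald's operator `E_π = ∑_{w ∈ W/W_π} w (Φ_π T_π) w⁻¹`, `Φ_π = (T_π Δ₊)/Δ₊`, for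
`π = ω_r`. The sum over cosets is written as the sum over `W = S_n`, divided by the order
`r!(n-r)!` of the stabilizer. -/
def EOp (p : Params) (r : ℕ) (f : (Fin n → ℂ) → ℂ) (x : Fin n → ℂ) : ℂ :=
  ((r.factorial * (n - r).factorial : ℕ) : ℂ)⁻¹ * ∑ σ : Equiv.Perm (Fin n),
    permOp σ (fun y => TOp p (fundWeight n r) (DeltaAPlus p) y / DeltaAPlus p y
      * TOp p (fundWeight n r) (permOp σ⁻¹ f) y) x

/-- `x` is not a zero of a numerator or denominator of `Δ`. -/
def RegularA (p : Params) (x : Fin n → ℂ) : Prop :=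
  ∀ j k : Fin n, j ≠ k → daPlusNum p (x j - x k) ≠ 0 ∧ daPlusDen p (x j - x k) ≠ 0

/-- The projection `λ - |λ|(e_1 + ⋯ + e_n)/n` of `λ` to a weight of `A_{n-1}`. -/
def projA (lam : Fin n → ℤ) : Fin n → ℝ := fun j => (lam j : ℝ) - (wt lam : ℝ) / n

end KoornA

end

/-! The assertions on operators are direct. A shift by iβ multiplies e^{iz} by q, so one step of the
functional equation `qPoch_step` shows that each d⁺ satisfies a first order difference equation
whose coefficient is, up to a constant, the corresponding v (`dfac_shift`). Hence conjugation by
`Δ̃₊` removes every factor of V depending on one x_j or on x_j + x_k, and Φ_r in Macdonald's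
operator is a product of v_a(x_j - x_k). In the limit R → ∞, conjugation by Λ_R weights each shift
by an exponential of R, and only the largest one survives.

The assertions on polynomials rest on one scheme, used for both root systems: an operator that is
triangular on orbit sums and symmetric for the inner product is diagonal on the family obtained by
Gram-Schmidt (`IsForm.eigen`). Triangularity follows after multiplication by an alternating
denominator: everything becomes a sum of alternants, which sorting of exponents turns into
alternants of smaller dominant weights (`sort_dominance`, `Dprime_triangular`, `DK_triangular`).
Symmetry follows from a shift of contour: the coefficient of a shift times the weight is holomorphic
in the strip -β ≤ Im z ≤ 0, and its value on the lower edge is the conjugate of its value on the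
real line (`FactorData.form_shift`).

In type A this makes the Gram-Schmidt family a family of joint eigenfunctions of all `D̂'_r`. The
eigenvalues jointly separate the dominant weights, so polynomials of incomparable weights are
orthogonal too: these are the Macdonald polynomials. On the other side only Koornwinder's second
order operator `DK` is used. Its eigenvalue equation for p_λ, translated by -iRω and passed to the
limit, becomes an equation for p_{λ,lead}. Without the center of mass it says that p_{λ,A} is an
eigenfunction of e^{-u} D̂'_1 + e^{u} D̂'_{n-1} with an explicit real u
(`IsKoornwinder.limL_eigen`).

The eigenvalues of this one combination are the sums of 2 cosh(β(gρ + μ)_j + u). By convexity they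
increase strictly along the dominance order (`evL_lt`), so a monic triangular eigenfunction is the
Macdonald polynomial (`IsKoornwinder.pA_eq_macA`). The eigenvalue equations for all r are then
inherited from the Macdonald side; neither commutativity nor triangularity of the higher Koornwinder
operators is needed. -/

noncomputable section

namespace KoornA

/-! ### The infinite `q`-shifted factorial -/

/-- The base `q = exp (-β)`. -/
def Params.q (p : Params) : ℝ := Real.exp (-p.β)

lemma Params.q_pos (p : Params) : 0 < p.q := Real.exp_pos _

lemma Params.q_lt_one {p : Params} (hp : p.Admissible) : p.q < 1 := by
  have := hp.β_pos
  unfold Params.q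
  rw [Real.exp_lt_one_iff]
  linarith

lemma qPoch_eq (p : Params) (a : ℂ) : qPoch p a = ∏' m : ℕ, (1 + -a * (p.q : ℂ) ^ m) := by
  simp only [qPoch, Params.q, sub_eq_add_neg, neg_mul]

lemma summable_q_pow {p : Params} (hp : p.Admissible) (a : ℂ) :
    Summable fun m : ℕ => ‖-a * (p.q : ℂ) ^ m‖ := by
  simp only [norm_mul, norm_pow, norm_neg, Complex.norm_real, Real.norm_eq_abs,
    abs_of_pos p.q_pos]
  exact (summable_geometric_of_lt_one p.q_pos.le (Params.q_lt_one hp)).mul_left _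

lemma multipliable_q {p : Params} (hp : p.Admissible) (a : ℂ) :
    Multipliable fun m : ℕ => (1 + -a * (p.q : ℂ) ^ m) :=
  multipliable_one_add_of_summable (summable_q_pow hp a)

lemma qPoch_step {p : Params} (hp : p.Admissible) (a : ℂ) :
    qPoch p a = (1 - a) * qPoch p (p.q * a) := by
  rw [qPoch_eq, qPoch_eq, tprod_eq_zero_mul']
  · congr 1
    · simp [sub_eq_add_neg]
    · exact tprod_congr fun m => by ring
  · refine (multipliable_q hp (p.q * a)).congr fun m => by ring

lemma qPoch_ne_zero {p : Params} (hp : p.Admissible) {a : ℂ} (ha : ‖a‖ < 1) :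
    qPoch p a ≠ 0 := by
  rw [qPoch_eq]
  refine tprod_one_add_ne_zero_of_summable (fun m h => ?_) (summable_q_pow hp a)
  have h1 : a * (p.q : ℂ) ^ m = 1 := by linear_combination -h
  have h2 := congrArg norm h1
  rw [norm_mul, norm_pow, Complex.norm_real, Real.norm_eq_abs, abs_of_pos p.q_pos, norm_one] at h2
  have h3 : p.q ^ m ≤ 1 := pow_le_one₀ p.q_pos.le (Params.q_lt_one hp).le
  nlinarith [norm_nonneg a, pow_pos p.q_pos m]

/-- On the closed unit disc only the factor with m = 0 can vanish. -/
lemma qPoch_ne_zero' {p : Params} (hp : p.Admissible) {a : ℂ} (ha : ‖a‖ ≤ 1) (h1 : a ≠ 1) :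
    qPoch p a ≠ 0 := by
  rw [qPoch_step hp]
  refine mul_ne_zero (sub_ne_zero.2 h1.symm) (qPoch_ne_zero hp ?_)
  rw [norm_mul, Complex.norm_real, Real.norm_eq_abs, abs_of_pos p.q_pos]
  nlinarith [p.q_pos, Params.q_lt_one hp]

/-- The product converges uniformly on every ball, with a geometric majorant. -/
lemma qPoch_differentiable {p : Params} (hp : p.Admissible) : Differentiable ℂ (qPoch p) := by
  have h : qPoch p = fun a => ∏' m : ℕ, (1 + -a * (p.q : ℂ) ^ m) := funext (qPoch_eq p)
  rw [h]
  intro a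
  have hs : Summable fun m : ℕ => (‖a‖ + 1) * p.q ^ m :=
    (summable_geometric_of_lt_one p.q_pos.le (Params.q_lt_one hp)).mul_left _
  have := Summable.hasProdLocallyUniformlyOn_nat_one_add (K := Metric.ball (0 : ℂ) (‖a‖ + 1))
    (f := fun (m : ℕ) (a : ℂ) => -a * (p.q : ℂ) ^ m) Metric.isOpen_ball hs
    (Eventually.of_forall fun m x hx => by
      rw [norm_mul, norm_neg, norm_pow, Complex.norm_real, Real.norm_eq_abs, abs_of_pos p.q_pos]
      have := p.q_pos
      have : ‖x‖ < ‖a‖ + 1 := by simpa using hx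
      gcongr) (fun m => by fun_prop)
  have hd := this.differentiableOn (.of_forall fun _ => by
      simpa [Finset.prod_fn] using DifferentiableOn.finsetProd (fun _ _ => by fun_prop))
      Metric.isOpen_ball
  exact hd.differentiableAt (Metric.isOpen_ball.mem_nhds (by simp))

lemma qPoch_conj {p : Params} (hp : p.Admissible) (a : ℂ) :
    (starRingEnd ℂ) (qPoch p a) = qPoch p ((starRingEnd ℂ) a) := by
  rw [qPoch_eq, qPoch_eq, (multipliable_q hp a).map_tprod (starRingEnd ℂ) Complex.continuous_conj]
  exact tprod_congr fun m => by simp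

lemma qPoch_mul_neg {p : Params} (hp : p.Admissible) (b : ℂ) :
    HasProd (fun m : ℕ => (1 + -b ^ 2 * (p.q : ℂ) ^ (2 * m))) (qPoch p b * qPoch p (-b)) := by
  rw [qPoch_eq, qPoch_eq]
  convert (multipliable_q hp b).hasProd.mul (multipliable_q hp (-b)).hasProd using 2 with m
  ring

/-- The factors 1 - a²q^m of even and odd index split as differences of squares, with roots ±a and
±sa. This puts the numerator of d_b⁺ in the same four-factor form as its denominator. -/
lemma qPoch_sq {p : Params} (hp : p.Admissible) (s a : ℂ) (hs : s ^ 2 = p.q) :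
    qPoch p (a ^ 2) = qPoch p a * qPoch p (-a) * (qPoch p (s * a) * qPoch p (-(s * a))) := by
  have h2 := qPoch_mul_neg hp (s * a)
  have h3 : HasProd (fun m : ℕ => (1 + -a ^ 2 * (p.q : ℂ) ^ (2 * m + 1)))
      (qPoch p (s * a) * qPoch p (-(s * a))) := by
    convert h2 using 2 with m
    rw [mul_pow, hs]
    ring
  have h4 := HasProd.even_mul_odd (f := fun m : ℕ => (1 + -a ^ 2 * (p.q : ℂ) ^ m))
    (qPoch_mul_neg hp a) h3
  rw [qPoch_eq p (a ^ 2), h4.tprod_eq]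

/-! ### Elementary factors -/

/-- A factor `τ^{-1/2} (1 - cτe^{iz}) / (1 - ce^{iz})`, `τ = exp (-βκ)`, of `v_a` and `v_b`. -/
def vfac (p : Params) (c κ : ℝ) (z : ℂ) : ℂ :=
  Real.exp (p.β * κ / 2) * ((1 - c * Real.exp (-p.β * κ) * Complex.exp (Complex.I * z))
    / (1 - c * Complex.exp (Complex.I * z)))

/-- A factor `(ce^{iz};q)_∞ / (cτe^{iz};q)_∞`, `τ = exp (-βκ)`, of `d_a⁺` and `d_b⁺`. -/
def dfac (p : Params) (c κ : ℝ) (z : ℂ) : ℂ :=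
  qPoch p (c * Complex.exp (Complex.I * z))
    / qPoch p (c * Real.exp (-p.β * κ) * Complex.exp (Complex.I * z))

/-- The square root of `q`. -/
def Params.sq (p : Params) : ℝ := Real.exp (-p.β / 2)

lemma Params.sq_sq (p : Params) : p.sq ^ 2 = p.q := by
  rw [Params.sq, Params.q, ← Real.exp_nat_mul]
  congr 1
  push_cast
  ring

lemma Params.sq_pos (p : Params) : 0 < p.sq := Real.exp_pos _

lemma Params.sq_lt_one {p : Params} (hp : p.Admissible) : p.sq < 1 := by
  have := hp.β_pos
  unfold Params.sq
  rw [Real.exp_lt_one_iff]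
  linarith

/-- The four values of `c` in `v_b` and `d_b`. -/
def Params.cs (p : Params) : Fin 4 → ℝ := ![1, -1, p.sq, -p.sq]

/-- The four couplings in `v_b` and `d_b`. -/
def Params.κs (p : Params) : Fin 4 → ℝ := ![p.g0, p.g1, p.g0', p.g1']

lemma Params.κs_nonneg {p : Params} (hp : p.Admissible) (i : Fin 4) : 0 ≤ p.κs i := by
  fin_cases i
  · exact hp.g0_nonneg
  · exact hp.g1_nonneg
  · exact hp.g0'_nonneg
  · exact hp.g1'_nonneg

lemma Params.abs_cs_le {p : Params} (hp : p.Admissible) (i : Fin 4) : |p.cs i| ≤ 1 := by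
  have h := (Params.sq_lt_one hp).le
  have h0 := p.sq_pos
  fin_cases i <;> simp [Params.cs, abs_of_pos h0, h]

lemma sin_half (w : ℂ) : Complex.sin (w / 2)
    = Complex.I / 2 * Complex.exp (-(Complex.I * w / 2)) * (1 - Complex.exp (Complex.I * w)) := by
  have h : Complex.exp (-(w / 2 * Complex.I)) * Complex.exp (Complex.I * w)
      = Complex.exp (w / 2 * Complex.I) := by
    rw [← Complex.exp_add]; ring_nf
  rw [Complex.sin, show -(Complex.I * w / 2) = -(w / 2 * Complex.I) by ring]
  rw [show -(w/2) * Complex.I = -(w / 2 * Complex.I) by ring]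
  linear_combination (-Complex.I / 2) * -h

/-- After e^{-i(·)/2} is taken out of both sines, the prefactors leave the constant e^{βκ/2} and the
rest is a quotient in e^{iz}. The offset w covers γ, and w + π turns sines into cosines, so all
factors of v_a and v_b have the one form `vfac`. -/
lemma sin_ratio (p : Params) (κ : ℝ) (w z : ℂ) (c : ℝ)
    (hc : Complex.exp (Complex.I * w) = c) :
    Complex.sin ((Complex.I * p.β * κ + w + z) / 2) / Complex.sin ((w + z) / 2)
      = vfac p c κ z := by
  rw [sin_half, sin_half, vfac]
  have h1 : Complex.exp (-(Complex.I * (Complex.I * p.β * κ + w + z) / 2))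
      = Real.exp (p.β * κ / 2) * Complex.exp (-(Complex.I * (w + z) / 2)) := by
    rw [Complex.ofReal_exp, ← Complex.exp_add]
    congr 1
    push_cast
    linear_combination (-(p.β : ℂ) * κ / 2) * Complex.I_sq
  have h2 : Complex.exp (Complex.I * (Complex.I * p.β * κ + w + z))
      = c * Real.exp (-p.β * κ) * Complex.exp (Complex.I * z) := by
    rw [← hc, Complex.ofReal_exp, ← Complex.exp_add, ← Complex.exp_add]
    congr 1
    push_cast
    linear_combination ((p.β : ℂ) * κ) * Complex.I_sq
  have h3 : Complex.exp (Complex.I * (w + z)) = c * Complex.exp (Complex.I * z) := by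
    rw [← hc, ← Complex.exp_add]; ring_nf
  rw [h1, h2, h3]
  have h4 := Complex.exp_ne_zero (-(Complex.I * (w + z) / 2))
  have h5 := Complex.I_ne_zero
  rw [show ∀ A B C D : ℂ, Complex.I / 2 * (A * B) * C / (Complex.I / 2 * B * D)
    = ((Complex.I / 2 * B) * (A * C)) / ((Complex.I / 2 * B) * D) by intros; ring,
    mul_div_mul_left _ _ (by simp [h4]), mul_div_assoc]

lemma cos_ratio (p : Params) (κ : ℝ) (w z : ℂ) (c : ℝ)
    (hc : Complex.exp (Complex.I * w) = c) :
    Complex.cos ((Complex.I * p.β * κ + w + z) / 2) / Complex.cos ((w + z) / 2)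
      = vfac p (-c) κ z := by
  have hI : Complex.exp (Complex.I * Real.pi) = -1 := by
    rw [mul_comm, Complex.exp_pi_mul_I]
  have := sin_ratio p κ (w + Real.pi) z (-c) (by rw [mul_add, Complex.exp_add, hI, hc]; simp)
  rw [← this, show (Complex.I * p.β * κ + (w + Real.pi) + z) / 2
    = (Complex.I * p.β * κ + w + z) / 2 + Real.pi / 2 by ring,
    show (w + Real.pi + z) / 2 = (w + z) / 2 + Real.pi / 2 by ring,
    Complex.sin_add_pi_div_two, Complex.sin_add_pi_div_two]

lemma va_eq (p : Params) (z : ℂ) : va p z = vfac p 1 p.g z := by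
  simpa [va] using sin_ratio p p.g 0 z 1 (by simp)

lemma exp_I_γ (p : Params) : Complex.exp (Complex.I * p.γ) = (p.sq : ℂ) := by
  rw [Params.sq, Params.γ, Complex.ofReal_exp]
  congr 1
  push_cast
  linear_combination ((p.β : ℂ) / 2) * Complex.I_sq

lemma vb_eq (p : Params) (z : ℂ) : vb p z = ∏ i, vfac p (p.cs i) (p.κs i) z := by
  rw [Fin.prod_univ_four]
  have h0 := sin_ratio p p.g0 0 z 1 (by simp)
  have h1 := cos_ratio p p.g1 0 z 1 (by simp)
  have h2 := sin_ratio p p.g0' p.γ z p.sq (exp_I_γ p)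
  have h3 := cos_ratio p p.g1' p.γ z p.sq (exp_I_γ p)
  simp only [add_zero, zero_add] at h0 h1
  rw [vb, h0, h1, h2, h3]
  rfl

lemma daPlus_eq (p : Params) (z : ℂ) : daPlus p z = dfac p 1 p.g z := by
  simp [daPlus, daPlusNum, daPlusDen, dfac]

lemma dbPlusDen_eq (p : Params) (z : ℂ) : dbPlusDen p z
    = ∏ i, qPoch p (p.cs i * Real.exp (-p.β * p.κs i) * Complex.exp (Complex.I * z)) := by
  have h : ∀ x : ℝ, Real.exp (-p.β * (x + 1 / 2)) = p.sq * Real.exp (-p.β * x) := by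
    intro x
    rw [Params.sq, ← Real.exp_add]
    ring_nf
  rw [dbPlusDen, Fin.prod_univ_four, h, h]
  simp [Params.cs, Params.κs]

lemma dbPlusNum_eq {p : Params} (hp : p.Admissible) (z : ℂ) : dbPlusNum p z
    = ∏ i, qPoch p (p.cs i * Complex.exp (Complex.I * z)) := by
  have h : Complex.exp (2 * Complex.I * z) = Complex.exp (Complex.I * z) ^ 2 := by
    rw [← Complex.exp_nat_mul]; push_cast; ring_nf
  rw [dbPlusNum, Fin.prod_univ_four, h, qPoch_sq hp p.sq _ (by exact_mod_cast p.sq_sq)]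
  simp [Params.cs]
  ring

lemma dbPlus_eq {p : Params} (hp : p.Admissible) (z : ℂ) :
    dbPlus p z = ∏ i, dfac p (p.cs i) (p.κs i) z := by
  rw [dbPlus, dbPlusNum_eq hp, dbPlusDen_eq]
  simp only [dfac, Finset.prod_div_distrib]

lemma exp_I_shift (p : Params) (z : ℂ) :
    Complex.exp (Complex.I * (z + Complex.I * p.β)) = p.q * Complex.exp (Complex.I * z) := by
  rw [Params.q, Complex.ofReal_exp, ← Complex.exp_add]
  congr 1
  push_cast
  linear_combination (p.β : ℂ) * Complex.I_sq

/-- `qPoch_step` is applied once in the numerator and once in the denominator; the two linear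
factors split off are those of `vfac`. All later relations between operators and weights come from
this identity. -/
lemma dfac_shift {p : Params} (hp : p.Admissible) (c κ : ℝ) (z : ℂ)
    (h1 : qPoch p (c * Complex.exp (Complex.I * z)) ≠ 0)
    (h2 : qPoch p (c * Real.exp (-p.β * κ) * Complex.exp (Complex.I * z)) ≠ 0) :
    vfac p c κ z * dfac p c κ z = Real.exp (p.β * κ / 2) * dfac p c κ (z + Complex.I * p.β) := by
  have e1 : ∀ d : ℂ, d * Complex.exp (Complex.I * (z + Complex.I * p.β))
      = p.q * (d * Complex.exp (Complex.I * z)) := fun d => by rw [exp_I_shift]; ring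
  rw [dfac, dfac, vfac, e1, e1]
  rw [qPoch_step hp] at h1 h2
  rw [qPoch_step hp (c * Complex.exp (Complex.I * z)),
    qPoch_step hp (c * Real.exp (-p.β * κ) * Complex.exp (Complex.I * z))]
  have h3 := left_ne_zero_of_mul h1
  have h4 := left_ne_zero_of_mul h2
  have h5 := right_ne_zero_of_mul h2
  generalize (p.q : ℂ) * (c * Complex.exp (Complex.I * z)) = A at *
  generalize (p.q : ℂ) * (c * Real.exp (-p.β * κ) * Complex.exp (Complex.I * z)) = B at *
  generalize 1 - (c : ℂ) * Real.exp (-p.β * κ) * Complex.exp (Complex.I * z) = D at *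
  generalize 1 - (c : ℂ) * Complex.exp (Complex.I * z) = E at *
  field_simp

lemma qPoch_shift_ne_zero {p : Params} (hp : p.Admissible) {c : ℂ} {z : ℂ}
    (h1 : qPoch p (c * Complex.exp (Complex.I * z)) ≠ 0) :
    qPoch p (c * Complex.exp (Complex.I * (z + Complex.I * p.β))) ≠ 0 := by
  rw [exp_I_shift, show c * (p.q * Complex.exp (Complex.I * z))
    = p.q * (c * Complex.exp (Complex.I * z)) by ring]
  rw [qPoch_step hp] at h1
  exact right_ne_zero_of_mul h1

end KoornA

end

/-! ### The leading operators: conjugation by `Δ̃₊` and limit in R. -/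

noncomputable section

namespace KoornA

variable {n : ℕ}

/-! ### Products over pairs -/

lemma prod_Ioi_of_symm (F : Fin n → Fin n → ℂ) (hF : ∀ j, F j j = 1) :
    ∏ j, ∏ k, F j k = ∏ j, ∏ k ∈ Finset.Ioi j, F j k * F k j := by
  have h := Finset.prod_prod_Ioi_mul_eq_prod_prod_off_diag fun j k => F k j
  rw [h]
  refine Finset.prod_congr rfl fun j _ => ?_
  rw [← Finset.mul_prod_erase Finset.univ _ (Finset.mem_univ j), hF, one_mul]
  refine Finset.prod_congr ?_ fun _ _ => rfl
  ext k
  simp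

/-- Coefficients of operators are products over J × Jᶜ, weights are products over j < k; this form
lets them be compared factor by factor. -/
lemma prod_cross (J : Finset (Fin n)) (φ : Fin n → Fin n → ℂ) :
    ∏ j ∈ J, ∏ k ∈ Jᶜ, φ j k = ∏ j, ∏ k ∈ Finset.Ioi j,
      (if j ∈ J ∧ k ∉ J then φ j k else if j ∉ J ∧ k ∈ J then φ k j else 1) := by
  have h := prod_Ioi_of_symm (fun j k => if j ∈ J ∧ k ∉ J then φ j k else 1) (by simp)
  have h2 : ∏ j ∈ J, ∏ k ∈ Jᶜ, φ j k = ∏ j, ∏ k, if j ∈ J ∧ k ∉ J then φ j k else 1 := by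
    rw [← Finset.prod_subset (Finset.subset_univ J)]
    · refine Finset.prod_congr rfl fun j hj => ?_
      rw [← Finset.prod_subset (Finset.subset_univ Jᶜ)]
      · refine Finset.prod_congr rfl fun k hk => ?_
        rw [if_pos ⟨hj, by simpa using hk⟩]
      · intro k _ hk
        simp only [Finset.mem_compl, not_not] at hk
        simp [hk]
    · intro j _ hj
      simp [hj]
  rw [h2, h]
  refine Finset.prod_congr rfl fun j _ => Finset.prod_congr rfl fun k _ => ?_
  by_cases h1 : j ∈ J <;> by_cases h2 : k ∈ J <;> simp [h1, h2]

lemma prod_inside (J : Finset (Fin n)) (φ : Fin n → Fin n → ℂ) :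
    ∏ j ∈ J, ∏ k ∈ J with j < k, φ j k = ∏ j, ∏ k ∈ Finset.Ioi j,
      (if j ∈ J ∧ k ∈ J then φ j k else 1) := by
  rw [← Finset.prod_subset (Finset.subset_univ J)]
  · refine Finset.prod_congr rfl fun j hj => ?_
    rw [← Finset.prod_filter]
    refine Finset.prod_congr ?_ fun _ _ => rfl
    ext k
    simp [hj, and_comm]
  · intro j _ hj
    simp [hj]

lemma prod_mem_ite (J : Finset (Fin n)) (φ : Fin n → ℂ) :
    ∏ j ∈ J, φ j = ∏ j, if j ∈ J then φ j else 1 := by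
  rw [Finset.prod_ite_mem, Finset.univ_inter]

/-! ### The leading part of `D̂_r` -/

lemma shiftPt_one (p : Params) (J : Finset (Fin n)) (x : Fin n → ℂ) (j : Fin n) :
    shiftPt p (fun _ => 1) J x j = x j + Complex.I * p.β * (if j ∈ J then 1 else 0) := by
  by_cases h : j ∈ J <;> simp [shiftPt, sgn, h]

lemma two_γ (p : Params) : 2 * p.γ = Complex.I * p.β := by rw [Params.γ]; ring

/-- A factor of `Δ̃₊` attached to a pair. -/
def pairPlus (p : Params) (z : ℂ) : ℂ :=
  Complex.exp (p.g * z / (2 * Complex.I)) * daPlus p z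

/-- A factor of `Δ̃₊` attached to a coordinate. -/
def coordPlus (p : Params) (z : ℂ) : ℂ :=
  Complex.exp ((p.g0 + p.g1 + p.g0' + p.g1') * z / (2 * Complex.I)) * dbPlus p z

lemma exp_half_shift (p : Params) (κ : ℝ) (z : ℂ) :
    Complex.exp (κ * (z + Complex.I * p.β) / (2 * Complex.I))
      = Real.exp (p.β * κ / 2) * Complex.exp (κ * z / (2 * Complex.I)) := by
  rw [Complex.ofReal_exp, ← Complex.exp_add]
  congr 1
  push_cast
  field_simp
  ring

/-- The exponential prefactor absorbs exactly the constant e^{βg/2} of `dfac_shift`. -/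
lemma pairPlus_shift {p : Params} (hp : p.Admissible) {z : ℂ} (h1 : daPlusNum p z ≠ 0)
    (h2 : daPlusDen p z ≠ 0) : pairPlus p (z + Complex.I * p.β) = va p z * pairPlus p z := by
  have := dfac_shift hp 1 p.g z (by simpa [daPlusNum] using h1) (by simpa [daPlusDen] using h2)
  rw [pairPlus, pairPlus, exp_half_shift, daPlus_eq, daPlus_eq, va_eq]
  linear_combination (-Complex.exp (p.g * z / (2 * Complex.I))) * this

lemma prod_qPoch_ne_zero {f : Fin 4 → ℂ} (h : ∏ i, f i ≠ 0) (i : Fin 4) : f i ≠ 0 :=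
  Finset.prod_ne_zero_iff.1 h i (Finset.mem_univ i)

lemma coordPlus_shift {p : Params} (hp : p.Admissible) {z : ℂ} (h1 : dbPlusNum p z ≠ 0)
    (h2 : dbPlusDen p z ≠ 0) : coordPlus p (z + Complex.I * p.β) = vb p z * coordPlus p z := by
  rw [dbPlusNum_eq hp] at h1
  rw [dbPlusDen_eq] at h2
  have h : ∀ i, _ := fun i => dfac_shift hp (p.cs i) (p.κs i) z (prod_qPoch_ne_zero h1 i)
    (prod_qPoch_ne_zero h2 i)
  have h3 := exp_half_shift p (p.g0 + p.g1 + p.g0' + p.g1') z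
  have h4 : (Real.exp (p.β * (p.g0 + p.g1 + p.g0' + p.g1') / 2) : ℂ)
      = ∏ i, (Real.exp (p.β * p.κs i / 2) : ℂ) := by
    rw [← Complex.ofReal_prod, ← Real.exp_sum]
    simp only [Fin.sum_univ_four, Params.κs, Matrix.cons_val]
    congr 2
    ring
  push_cast at h3 h4
  rw [coordPlus, coordPlus, h3, h4, dbPlus_eq hp, dbPlus_eq hp, vb_eq]
  have h5 : (∏ i, vfac p (p.cs i) (p.κs i) z) * ∏ i, dfac p (p.cs i) (p.κs i) z
      = (∏ i, Complex.exp (p.β * p.κs i / 2)) *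
        ∏ i, dfac p (p.cs i) (p.κs i) (z + Complex.I * p.β) := by
    rw [← Finset.prod_mul_distrib, ← Finset.prod_mul_distrib]
    refine Finset.prod_congr rfl fun i _ => ?_
    simpa using h i
  linear_combination
    (-Complex.exp ((p.g0 + p.g1 + p.g0' + p.g1') * z / (2 * Complex.I))) * h5

lemma daPlusNum_shift {p : Params} (hp : p.Admissible) {z : ℂ} (h1 : daPlusNum p z ≠ 0) :
    daPlusNum p (z + Complex.I * p.β) ≠ 0 := by
  have := qPoch_shift_ne_zero hp (c := 1) (z := z) (by simpa [daPlusNum] using h1)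
  simpa [daPlusNum] using this

lemma daPlusDen_shift {p : Params} (hp : p.Admissible) {z : ℂ} (h1 : daPlusDen p z ≠ 0) :
    daPlusDen p (z + Complex.I * p.β) ≠ 0 := qPoch_shift_ne_zero hp h1

lemma pairPlus_ne_zero {p : Params} {z : ℂ} (h1 : daPlusNum p z ≠ 0)
    (h2 : daPlusDen p z ≠ 0) : pairPlus p z ≠ 0 :=
  mul_ne_zero (Complex.exp_ne_zero _) (div_ne_zero h1 h2)

lemma coordPlus_shift_ne_zero {p : Params} (hp : p.Admissible) {z : ℂ} (h1 : dbPlusNum p z ≠ 0)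
    (h2 : dbPlusDen p z ≠ 0) : coordPlus p (z + Complex.I * p.β) ≠ 0 := by
  rw [dbPlusNum_eq hp] at h1
  rw [dbPlusDen_eq] at h2
  refine mul_ne_zero (Complex.exp_ne_zero _) (div_ne_zero ?_ ?_)
  · rw [dbPlusNum_eq hp]
    exact Finset.prod_ne_zero_iff.2 fun i _ => qPoch_shift_ne_zero hp (prod_qPoch_ne_zero h1 i)
  · rw [dbPlusDen_eq]
    exact Finset.prod_ne_zero_iff.2 fun i _ => qPoch_shift_ne_zero hp (prod_qPoch_ne_zero h2 i)

lemma coordPlus_ne_zero {p : Params} {z : ℂ} (h1 : dbPlusNum p z ≠ 0)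
    (h2 : dbPlusDen p z ≠ 0) : coordPlus p z ≠ 0 :=
  mul_ne_zero (Complex.exp_ne_zero _) (div_ne_zero h1 h2)

lemma tDeltaPlus_eq (p : Params) (x : Fin n → ℂ) : tDeltaPlus p x
    = (∏ j : Fin n, ∏ k ∈ Finset.Ioi j, pairPlus p (x j + x k)) * ∏ j, coordPlus p (x j) := rfl

/-- A pair with both indices in J has its argument x_j + x_k moved by 2iβ = 4γ, which yields v_a(z)
v_a(z + 2γ); a pair with one index in J yields a single v_a(z). Thus the quotient of the shifted and
unshifted `tDeltaPlus` is V without the factors v_a(x_j - x_k). -/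
lemma tDeltaPlus_shift {p : Params} (hp : p.Admissible) {x : Fin n → ℂ} (hx : RegularPlus p x)
    (J : Finset (Fin n)) :
    tDeltaPlus p (shiftPt p (fun _ => 1) J x) ≠ 0 ∧
    tDeltaPlus p x * V p (fun _ => 1) J Jᶜ x
      = tDeltaPlus p (shiftPt p (fun _ => 1) J x) * ∏ j ∈ J, ∏ k ∈ Jᶜ, va p (x j - x k) := by
  obtain ⟨hx1, hx2⟩ := hx
  constructor
  · rw [tDeltaPlus_eq]
    refine mul_ne_zero ?_ ?_
    · refine Finset.prod_ne_zero_iff.2 fun j _ => Finset.prod_ne_zero_iff.2 fun k hk => ?_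
      obtain ⟨h1, h2⟩ := hx1 j k (Finset.mem_Ioi.1 hk)
      rw [shiftPt_one, shiftPt_one]
      have e : ∀ a b : ℂ, x j + Complex.I * p.β * a + (x k + Complex.I * p.β * b)
        = x j + x k + Complex.I * p.β * a + Complex.I * p.β * b := by intros; ring
      rw [e]
      by_cases hj : j ∈ J <;> by_cases hk : k ∈ J <;> simp only [hj, hk, if_true, if_false,
        mul_one, mul_zero, add_zero]
      · exact pairPlus_ne_zero (daPlusNum_shift hp (daPlusNum_shift hp h1))
          (daPlusDen_shift hp (daPlusDen_shift hp h2))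
      · exact pairPlus_ne_zero (daPlusNum_shift hp h1) (daPlusDen_shift hp h2)
      · exact pairPlus_ne_zero (daPlusNum_shift hp h1) (daPlusDen_shift hp h2)
      · exact pairPlus_ne_zero h1 h2
    · refine Finset.prod_ne_zero_iff.2 fun j _ => ?_
      obtain ⟨h1, h2⟩ := hx2 j
      rw [shiftPt_one]
      by_cases hj : j ∈ J <;> simp only [hj, if_true, if_false, mul_one, mul_zero, add_zero]
      · exact coordPlus_shift_ne_zero hp h1 h2
      · exact coordPlus_ne_zero h1 h2
  · have hs : sgn 1 = 1 := by simp [sgn]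
    simp only [V, hs, one_mul, two_γ, Finset.prod_mul_distrib (f := fun k => va p (_ + _))]
    rw [tDeltaPlus_eq, tDeltaPlus_eq]
    have hB : ∏ j, coordPlus p (shiftPt p (fun _ => 1) J x j)
        = (∏ j ∈ J, vb p (x j)) * ∏ j, coordPlus p (x j) := by
      rw [prod_mem_ite J, ← Finset.prod_mul_distrib]
      refine Finset.prod_congr rfl fun j _ => ?_
      obtain ⟨h1, h2⟩ := hx2 j
      rw [shiftPt_one]
      by_cases hj : j ∈ J
      · simp only [hj, if_true, mul_one]; exact coordPlus_shift hp h1 h2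
      · simp [hj]
    have hA : ∏ j : Fin n, ∏ k ∈ Finset.Ioi j,
          pairPlus p (shiftPt p (fun _ => 1) J x j + shiftPt p (fun _ => 1) J x k)
        = (∏ j ∈ J, ∏ k ∈ J with j < k, va p (x j + x k) * va p (x j + x k + Complex.I * p.β))
          * (∏ j ∈ J, ∏ k ∈ Jᶜ, va p (x j + x k))
          * ∏ j : Fin n, ∏ k ∈ Finset.Ioi j, pairPlus p (x j + x k) := by
      rw [prod_cross, prod_inside]
      simp only [← Finset.prod_mul_distrib]
      refine Finset.prod_congr rfl fun j _ => Finset.prod_congr rfl fun k hk => ?_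
      obtain ⟨h1, h2⟩ := hx1 j k (Finset.mem_Ioi.1 hk)
      rw [shiftPt_one, shiftPt_one]
      have e : ∀ a b : ℂ, x j + Complex.I * p.β * a + (x k + Complex.I * p.β * b)
        = x j + x k + Complex.I * p.β * a + Complex.I * p.β * b := by intros; ring
      rw [e]
      by_cases hj : j ∈ J <;> by_cases hk : k ∈ J <;> simp only [hj, hk, if_true, if_false,
        mul_one, mul_zero, add_zero, not_true, not_false_iff, and_self, and_true, and_false,
        one_mul]
      · rw [pairPlus_shift hp (daPlusNum_shift hp h1) (daPlusDen_shift hp h2),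
          pairPlus_shift hp h1 h2]
        ring
      · rw [pairPlus_shift hp h1 h2]
      · rw [pairPlus_shift hp h1 h2, add_comm (x k)]
    rw [hA, hB]
    simp only [Finset.prod_mul_distrib]
    ring

theorem tDeltaPlus_conj {p : Params} (hp : p.Admissible) (r : ℕ) (f : (Fin n → ℂ) → ℂ)
    (x : Fin n → ℂ) (hx : RegularPlus p x) :
    tDeltaPlus p x * Dlead p r (fun y => (tDeltaPlus p y)⁻¹ * f y) x = Dprime p r f x := by
  rw [Dlead, Dprime, Finset.mul_sum]
  refine Finset.sum_congr rfl fun J _ => ?_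
  obtain ⟨h1, h2⟩ := tDeltaPlus_shift hp hx J
  rw [← mul_assoc, h2]
  field_simp

lemma Lam_shift (p : Params) (R : ℝ) (ε : Fin n → ℤˣ) (J : Finset (Fin n)) (x : Fin n → ℂ) :
    Lam R (shiftPt p ε J x) = Real.exp (p.β * R * ∑ j ∈ J, ((ε j : ℤ) : ℝ)) * Lam R x := by
  rw [Lam, Lam, Complex.ofReal_exp, ← Complex.exp_add]
  congr 1
  have : ∑ j, shiftPt p ε J x j = ∑ j, x j + Complex.I * p.β * ∑ j ∈ J, sgn (ε j) := by
    have h : ∀ j, shiftPt p ε J x j = x j + if j ∈ J then Complex.I * p.β * sgn (ε j) else 0 := by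
      intro j
      by_cases h : j ∈ J <;> simp [shiftPt, h]
    simp only [h, Finset.sum_add_distrib, Finset.sum_ite_mem, Finset.univ_inter, Finset.mul_sum]
  rw [this]
  simp only [sgn]
  push_cast
  linear_combination (-(p.β : ℂ) * R * ∑ j ∈ J, ((ε j : ℤ) : ℂ)) * Complex.I_sq

lemma chains_zero {J : Finset (Fin n)} (hJ : J.Nonempty) :
    chains J 0 = {![∅, J]} := by
  ext C
  simp only [chains, Finset.mem_filter, Finset.mem_univ, true_and, Finset.mem_singleton]
  constructor
  · rintro ⟨h1, -, h2⟩
    ext i : 1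
    fin_cases i
    · exact h1
    · exact h2
  · rintro rfl
    refine ⟨rfl, ?_, rfl⟩
    intro i j hij
    fin_cases i <;> fin_cases j <;> simp at hij ⊢
    exact hJ

lemma sum_sign_le (ε : Fin n → ℤˣ) (C : Finset (Fin n)) : ∑ j ∈ C, ((ε j : ℤ)) ≤ C.card := by
  have : ∑ j ∈ C, ((ε j : ℤ)) ≤ ∑ j ∈ C, (1 : ℤ) := Finset.sum_le_sum fun j _ => by
    rcases Int.units_eq_one_or (ε j) with h | h <;> simp [h]
  simpa using this

lemma chains_subset {J : Finset (Fin n)} {s : ℕ} {C : Fin (s + 2) → Finset (Fin n)}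
    (hC : C ∈ chains J s) : C 1 ⊆ J ∧ (s ≠ 0 → C 1 ⊂ J) := by
  simp only [chains, Finset.mem_filter, Finset.mem_univ, true_and] at hC
  obtain ⟨-, h2, rfl⟩ := hC
  refine ⟨h2.monotone (Fin.le_last _), fun hs => h2 ?_⟩
  rw [Fin.lt_def]
  simp only [Fin.val_one, Fin.val_last]
  omega

lemma eq_one_of_sum_sign {ε : Fin n → ℤˣ} {J : Finset (Fin n)} (hε : ε ∈ signsOn J)
    (h : ∑ j ∈ J, ((ε j : ℤ)) = J.card) : ε = fun _ => 1 := by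
  have h1 : ∑ j ∈ J, ((1 : ℤ) - ε j) = 0 := by
    rw [Finset.sum_sub_distrib, h]; simp
  rw [Finset.sum_eq_zero_iff_of_nonneg] at h1
  · ext j
    by_cases hj : j ∈ J
    · have := h1 j hj
      simp only [Units.val_one]
      omega
    · rw [(Finset.mem_filter.1 hε).2 j hj]
  · intro j _
    rcases Int.units_eq_one_or (ε j) with h | h <;> simp [h]

lemma tendsto_exp_mul_atTop {a : ℝ} (ha : a < 0) :
    Tendsto (fun R : ℝ => (Real.exp (a * R) : ℂ)) atTop (𝓝 0) := by
  have h : Tendsto (fun R : ℝ => Real.exp (a * R)) atTop (𝓝 0) :=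
    Real.tendsto_exp_atBot.comp ((tendsto_const_mul_atBot_of_neg ha).2 tendsto_id)
  exact_mod_cast (Complex.continuous_ofReal.tendsto 0).comp h

/-- The shift belonging to J_1 acquires the factor exp(βR ∑_{J_1} ε_j), and this sum is at most
|J_1| ≤ r. After normalisation by e^{-rβR} a term survives only if the sum equals r, which forces
all signs to be + and J_1 = J, so that the chain has length one. -/
theorem Dhat_tendsto_Dlead {p : Params} (hp : p.Admissible) {r : ℕ} (hr : 1 ≤ r)
    (f : (Fin n → ℂ) → ℂ) (x : Fin n → ℂ) :
    Tendsto (fun R : ℝ => (Real.exp (-(r * p.β * R)) : ℂ)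
      * ((Lam R x)⁻¹ * Dhat p r (fun y => Lam R y * f y) x)) atTop (𝓝 (Dlead p r f x)) := by
  have hβ := hp.β_pos
  have hterm : ∀ (ε : Fin n → ℤˣ) (C : Finset (Fin n)) (a : ℂ), C.card ≤ r →
      Tendsto (fun R : ℝ => (Real.exp (-(r * p.β * R)) : ℂ) * ((Lam R x)⁻¹
        * (a * (Lam R (shiftPt p ε C x) * f (shiftPt p ε C x) - Lam R x * f x)))) atTop
        (𝓝 (if ∑ j ∈ C, ((ε j : ℤ)) = r then a * f (shiftPt p ε C x) else 0)) := by
    intro ε C a hC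
    have hle := (sum_sign_le ε C).trans (Nat.cast_le.2 hC)
    have e : ∀ R : ℝ, (Real.exp (-(r * p.β * R)) : ℂ) * ((Lam R x)⁻¹
        * (a * (Lam R (shiftPt p ε C x) * f (shiftPt p ε C x) - Lam R x * f x)))
        = a * (Real.exp (p.β * (((∑ j ∈ C, ((ε j : ℤ)) : ℤ) : ℝ) - r) * R) * f (shiftPt p ε C x)
          - Real.exp (-(r * p.β) * R) * f x) := by
      intro R
      have hL : Lam R x ≠ 0 := Complex.exp_ne_zero _
      have e2 : (Real.exp (p.β * (((∑ j ∈ C, ((ε j : ℤ)) : ℤ) : ℝ) - r) * R) : ℂ)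
          = Real.exp (-(r * p.β) * R) * Real.exp (p.β * R * ∑ j ∈ C, ((ε j : ℤ) : ℝ)) := by
        rw [← Complex.ofReal_mul, ← Real.exp_add]
        congr 2
        push_cast
        ring
      rw [Lam_shift, e2, ← neg_mul]
      field_simp
    simp only [e]
    -- The contributions of the -1 in each term carry the bare factor e^{-rβR}, which tends to 0
    -- because r ≥ 1.
    have h0 : Tendsto (fun R : ℝ => (Real.exp (-(r * p.β) * R) : ℂ) * f x) atTop (𝓝 (0 * f x)) :=
      (tendsto_exp_mul_atTop (by
        have : (1 : ℝ) ≤ r := by exact_mod_cast hr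
        nlinarith)).mul_const _
    split_ifs with h
    · rw [h]
      have := (tendsto_const_nhds (x := f (shiftPt p ε C x))).sub h0 |>.const_mul a
      simpa using this
    · have hlt : ((∑ j ∈ C, ((ε j : ℤ)) : ℤ) : ℝ) < r := by exact_mod_cast lt_of_le_of_ne hle h
      have h1 := (tendsto_exp_mul_atTop (a := p.β * (((∑ j ∈ C, ((ε j : ℤ)) : ℤ) : ℝ) - r))
        (by nlinarith)).mul_const (f (shiftPt p ε C x))
      simpa using (h1.sub h0).const_mul a
  simp only [Dhat, Finset.mul_sum]
  have hD : Dlead p r f x = ∑ J ∈ Finset.powersetCard r (Finset.univ : Finset (Fin n)),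
      ∑ ε ∈ signsOn J, ∑ s' ∈ Finset.range r, ∑ C ∈ chains J s',
        if ∑ j ∈ C 1, ((ε j : ℤ)) = r then
          (-1) ^ s' * (∏ i : Fin (s' + 1), V p ε (C i.succ \ C i.castSucc) (C i.succ)ᶜ x)
            * f (shiftPt p ε (C 1) x) else 0 := by
    rw [Dlead]
    refine Finset.sum_congr rfl fun J hJ => ?_
    have hJr : J.card = r := (Finset.mem_powersetCard.1 hJ).2
    have hJne : J.Nonempty := Finset.card_pos.1 (by omega)
    rw [Finset.sum_eq_single (fun _ => 1), Finset.sum_eq_single 0]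
    · rw [chains_zero hJne, Finset.sum_singleton]
      simp [hJr]
    · intro s' _ hs
      refine Finset.sum_eq_zero fun C hC => if_neg fun h => ?_
      have h1 := sum_sign_le (fun _ => 1) (C 1)
      have h2 := Finset.card_lt_card ((chains_subset hC).2 hs)
      rw [h] at h1
      omega
    · intro h
      exact absurd (Finset.mem_range.2 (by omega)) h
    · intro ε hε hne
      refine Finset.sum_eq_zero fun s' _ => Finset.sum_eq_zero fun C hC => if_neg fun h => hne ?_
      have h1 := sum_sign_le ε (C 1)
      have h2 := (chains_subset hC).1
      -- The set C 1 has at least ∑ ε_j = r = |J| elements.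
      have h3 : C 1 = J := Finset.eq_of_subset_of_card_le h2 (by omega)
      rw [h3] at h
      exact eq_one_of_sum_sign hε (by omega)
    · intro h
      exact absurd (by simp [signsOn]) h
  rw [hD]
  refine tendsto_finsetSum _ fun J hJ => tendsto_finsetSum _ fun ε _ => tendsto_finsetSum _
    fun s' _ => tendsto_finsetSum _ fun C hC => hterm ε (C 1) _ ?_
  rw [← (Finset.mem_powersetCard.1 hJ).2]
  exact Finset.card_le_card (chains_subset hC).1

end KoornA

end

noncomputable section

namespace KoornA

variable {n : ℕ}

/-! ### Splitting off the center of mass, and Macdonald's operators -/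

lemma exists_perm_map_eq {S J : Finset (Fin n)} (h : S.card = J.card) :
    ∃ τ : Equiv.Perm (Fin n), S.map τ.toEmbedding = J := by
  classical
  let e : {x // x ∈ S} ≃ {x // x ∈ J} := Finset.equivOfCardEq h
  refine ⟨e.extendSubtype, Finset.eq_of_subset_of_card_le ?_ (by simp [h])⟩
  intro y hy
  obtain ⟨x, hx, rfl⟩ := Finset.mem_map.1 hy
  exact e.extendSubtype_mem x hx

/-- Left multiplication by a permutation carrying J to S identifies the fibres of σ ↦ σ(S), so all
of them have n! / C(n, |S|) elements. -/
lemma card_perm_map_eq {S J : Finset (Fin n)} (h : S.card = J.card) :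
    (Finset.univ.filter fun σ : Equiv.Perm (Fin n) => S.map σ.toEmbedding = J).card
      = S.card.factorial * (n - S.card).factorial := by
  classical
  have hle : S.card ≤ n := by simpa using S.card_le_univ
  have key : ∀ J : Finset (Fin n), J.card = S.card →
      (Finset.univ.filter fun σ : Equiv.Perm (Fin n) => S.map σ.toEmbedding = J).card
      = (Finset.univ.filter fun σ : Equiv.Perm (Fin n) => S.map σ.toEmbedding = S).card := by
    intro J hJ
    obtain ⟨τ, hτ⟩ := exists_perm_map_eq hJ
    refine Finset.card_bij' (fun σ _ => τ * σ) (fun σ _ => τ⁻¹ * σ) ?_ ?_ ?_ ?_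
    · intro σ hσ
      simp only [Finset.mem_filter, Finset.mem_univ, true_and] at hσ ⊢
      exact (Finset.map_map σ.toEmbedding τ.toEmbedding S).symm.trans ((congrArg _ hσ).trans hτ)
    · intro σ hσ
      simp only [Finset.mem_filter, Finset.mem_univ, true_and] at hσ ⊢
      have : (S.map σ.toEmbedding).map (τ⁻¹).toEmbedding = J := by
        rw [hσ, ← hτ, Finset.map_map]
        convert Finset.map_refl
        ext x
        simp
      rw [Finset.map_map] at this
      exact this
    · intro σ _; simp
    · intro σ _; simp
  have hsum := Finset.card_eq_sum_card_fiberwise (s := (Finset.univ : Finset (Equiv.Perm (Fin n))))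
    (f := fun σ => S.map σ.toEmbedding)
    (t := Finset.powersetCard S.card (Finset.univ : Finset (Fin n)))
    (fun σ _ => by simp [Finset.mem_powersetCard])
  rw [Finset.sum_congr rfl fun J hJ => key J (Finset.mem_powersetCard.1 hJ).2, Finset.sum_const,
    Finset.card_powersetCard, Finset.card_univ, Finset.card_univ, Fintype.card_perm,
    Fintype.card_fin, smul_eq_mul, ← Nat.choose_mul_factorial_mul_factorial hle, mul_assoc] at hsum
  rw [key J h.symm]
  exact (Nat.eq_of_mul_eq_mul_left (Nat.choose_pos hle) hsum).symm

lemma sum_perm_map (S : Finset (Fin n)) (F : Finset (Fin n) → ℂ) :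
    ∑ σ : Equiv.Perm (Fin n), F (S.map σ.toEmbedding)
      = ((S.card.factorial * (n - S.card).factorial : ℕ) : ℂ)
        * ∑ J ∈ Finset.powersetCard S.card (Finset.univ : Finset (Fin n)), F J := by
  classical
  rw [← Finset.sum_fiberwise_of_maps_to (s := (Finset.univ : Finset (Equiv.Perm (Fin n))))
    (t := Finset.powersetCard S.card (Finset.univ : Finset (Fin n)))
    (g := fun σ => S.map σ.toEmbedding) (fun σ _ => by simp [Finset.mem_powersetCard]),
    Finset.mul_sum]
  refine Finset.sum_congr rfl fun J hJ => ?_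
  rw [← card_perm_map_eq (Finset.mem_powersetCard.1 hJ).2.symm, ← nsmul_eq_mul,
    ← Finset.sum_const]
  refine Finset.sum_congr rfl fun σ hσ => ?_
  rw [(Finset.mem_filter.1 hσ).2]

lemma daPlus_shift {p : Params} (hp : p.Admissible) {z : ℂ} (h1 : daPlusNum p z ≠ 0)
    (h2 : daPlusDen p z ≠ 0) : daPlus p (z + Complex.I * p.β) / daPlus p z
      = (Real.exp (-p.β * p.g / 2) : ℂ) * va p z := by
  have := dfac_shift hp 1 p.g z (by simpa [daPlusNum] using h1) (by simpa [daPlusDen] using h2)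
  rw [← daPlus_eq, ← daPlus_eq, ← va_eq] at this
  have h0 : daPlus p z ≠ 0 := div_ne_zero h1 h2
  rw [div_eq_iff h0, mul_assoc, this, ← mul_assoc, ← Complex.ofReal_mul,
    ← Real.exp_add]
  ring_nf
  simp

/-- The first `r` indices. -/
def initSet (n r : ℕ) : Finset (Fin n) := Finset.univ.filter fun j => (j : ℕ) < r

lemma mem_initSet {r : ℕ} {j : Fin n} : j ∈ initSet n r ↔ (j : ℕ) < r := by simp [initSet]

lemma card_initSet {r : ℕ} (hr : r ≤ n) : (initSet n r).card = r := by
  rw [initSet, Fin.card_filter_val_lt, min_eq_right hr]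

/-- Conjugation by σ turns the shift along ω_r into the shift along the image of {1, …, r}; the part
-r/n of ω_r is the same in all coordinates and becomes a common translation. -/
lemma shift_perm (p : Params) (r : ℕ) (f : (Fin n → ℂ) → ℂ) (x : Fin n → ℂ)
    (σ : Equiv.Perm (Fin n)) : TOp p (fundWeight n r) (permOp σ⁻¹ f) (x ∘ σ)
      = f (shiftPt p (fun _ => 1) ((initSet n r).map σ.toEmbedding)
          fun j => x j + Complex.I * p.β * (-(r / n) : ℝ)) := by
  rw [TOp, permOp]
  congr 1
  ext j
  have hσj : σ (σ⁻¹ j) = j := σ.apply_symm_apply j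
  have hj : j ∈ (initSet n r).map σ.toEmbedding ↔ ((σ⁻¹ j : Fin n) : ℕ) < r := by
    rw [Finset.mem_map_equiv, mem_initSet]
    rfl
  rw [shiftPt_one]
  by_cases h : ((σ⁻¹ j : Fin n) : ℕ) < r
  · simp only [Function.comp, hj.2 h, if_true, fundWeight, h, hσj]
    push_cast
    ring
  · simp only [Function.comp, mt hj.1 h, if_false, fundWeight, h, hσj]
    push_cast
    ring

/-- The weight ω_r is minuscule: y_j - y_k with j < k moves by iβ if j is among the first r indices
and k is not, and is otherwise fixed. Each of the r(n - r) moving pairs contributes e^{-βg/2} v_a.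
-/
lemma Phi_eq {p : Params} (hp : p.Admissible) {r : ℕ} (hr : r < n) (y : Fin n → ℂ)
    (hreg : ∀ j k : Fin n, j < k → daPlusNum p (y j - y k) ≠ 0 ∧ daPlusDen p (y j - y k) ≠ 0) :
    TOp p (fundWeight n r) (DeltaAPlus p) y / DeltaAPlus p y
      = (Real.exp (-p.β * p.g * r * (n - r) / 2) : ℂ)
        * ∏ j ∈ initSet n r, ∏ k ∈ (initSet n r)ᶜ, va p (y j - y k) := by
  have hconst : (Real.exp (-p.β * p.g * r * (n - r) / 2) : ℂ)
      = ∏ j ∈ initSet n r, ∏ k ∈ (initSet n r)ᶜ, (Real.exp (-p.β * p.g / 2) : ℂ) := by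
    rw [Finset.prod_const, Finset.prod_const, Finset.card_compl, card_initSet hr.le,
      Fintype.card_fin, ← Complex.ofReal_pow, ← Complex.ofReal_pow, ← Real.exp_nat_mul,
      ← Real.exp_nat_mul]
    congr 2
    rw [Nat.cast_sub hr.le]
    ring
  rw [hconst]
  simp only [← Finset.prod_mul_distrib]
  rw [prod_cross, TOp, DeltaAPlus, DeltaAPlus, ← Finset.prod_div_distrib]
  refine Finset.prod_congr rfl fun j _ => ?_
  rw [← Finset.prod_div_distrib]
  refine Finset.prod_congr rfl fun k hk => ?_
  have hjk := Finset.mem_Ioi.1 hk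
  have hjk' : (j : ℕ) < k := hjk
  obtain ⟨h1, h2⟩ := hreg j k hjk
  have h3 : daPlus p (y j - y k) ≠ 0 := div_ne_zero h1 h2
  have e : ∀ a b c : ℝ, y j + Complex.I * p.β * ((a - c : ℝ) : ℂ)
      - (y k + Complex.I * p.β * ((b - c : ℝ) : ℂ))
      = y j - y k + Complex.I * p.β * (a - b) := by
    intro a b c; push_cast; ring
  simp only [fundWeight, e, mem_initSet]
  by_cases hj : (j : ℕ) < r
  · by_cases hk : (k : ℕ) < r
    · simp only [hj, hk, if_true, not_true, and_false, if_false, sub_self, mul_zero, add_zero]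
      rw [div_self h3]
      simp
    · simp only [hj, hk, if_true, not_false_iff, and_self, if_false]
      rw [← daPlus_shift hp h1 h2]
      simp
  -- Since j < k, the case of a root moved by -iβ does not occur.
  · have hk : ¬ (k : ℕ) < r := by omega
    simp only [hj, hk, if_false, sub_self, false_and, and_false, mul_zero, add_zero]
    rw [div_self h3]

lemma EOp_term {p : Params} (hp : p.Admissible) {r : ℕ} (hr : r < n)
    (f : (Fin n → ℂ) → ℂ) (x : Fin n → ℂ) (hx : RegularA p x) (σ : Equiv.Perm (Fin n))
    (J : Finset (Fin n)) (hJ : (initSet n r).map σ.toEmbedding = J) :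
    permOp σ (fun y => TOp p (fundWeight n r) (DeltaAPlus p) y / DeltaAPlus p y
        * TOp p (fundWeight n r) (permOp σ⁻¹ f) y) x
      = (Real.exp (-p.β * p.g * r * (n - r) / 2) : ℂ)
          * ((∏ j ∈ J, ∏ k ∈ Jᶜ, va p (x j - x k))
            * f (shiftPt p (fun _ => 1) J fun j => x j + Complex.I * p.β * (-(r / n) : ℝ))) := by
  change TOp p (fundWeight n r) (DeltaAPlus p) (x ∘ σ) / DeltaAPlus p (x ∘ σ)
    * TOp p (fundWeight n r) (permOp σ⁻¹ f) (x ∘ σ) = _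
  have hc : Jᶜ = (initSet n r)ᶜ.map σ.toEmbedding := by
    rw [← hJ]
    ext y
    simp only [Finset.mem_compl, Finset.mem_map_equiv]
  rw [shift_perm, hJ, Phi_eq hp hr (x ∘ σ) fun j k hjk => hx _ _ fun h => hjk.ne (σ.injective h),
    mul_assoc]
  congr 2
  rw [hc, ← hJ, Finset.prod_map]
  refine Finset.prod_congr rfl fun j _ => ?_
  rw [Finset.prod_map]
  rfl

theorem EOp_eq {p : Params} (hp : p.Admissible) {r : ℕ} (hr : r < n)
    (f : (Fin n → ℂ) → ℂ) (x : Fin n → ℂ) (hx : RegularA p x) :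
    EOp p r f x = (Real.exp (-p.β * p.g * r * (n - r) / 2) : ℂ) * DA p r f x := by
  obtain ⟨F, hF⟩ : ∃ F : Finset (Fin n) → ℂ, ∀ J, F J = (∏ j ∈ J, ∏ k ∈ Jᶜ, va p (x j - x k))
        * f (shiftPt p (fun _ => 1) J fun j => x j + Complex.I * p.β * (-(r / n) : ℝ)) :=
    ⟨_, fun _ => rfl⟩
  have hDA : DA p r f x = ∑ J ∈ Finset.powersetCard r (Finset.univ : Finset (Fin n)), F J := by
    simp only [DA, transl, Dprime, hF, add_sub_add_right_eq_sub]
  have hσ : ∀ σ : Equiv.Perm (Fin n), permOp σ (fun y => TOp p (fundWeight n r) (DeltaAPlus p) y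
      / DeltaAPlus p y * TOp p (fundWeight n r) (permOp σ⁻¹ f) y) x
      = (Real.exp (-p.β * p.g * r * (n - r) / 2) : ℂ)
        * F ((initSet n r).map σ.toEmbedding) := fun σ => by
    rw [hF, EOp_term hp hr f x hx σ _ rfl]
  have hS := sum_perm_map (initSet n r) F
  rw [card_initSet hr.le] at hS
  rw [EOp, hDA]
  simp only [hσ]
  rw [← Finset.mul_sum, hS]
  have h0 : ((r.factorial * (n - r).factorial : ℕ) : ℂ) ≠ 0 :=
    Nat.cast_ne_zero.2 (by positivity)
  generalize ((r.factorial * (n - r).factorial : ℕ) : ℂ) = N at *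
  field_simp

lemma transl_transl (p : Params) (a b : ℝ) (f : (Fin n → ℂ) → ℂ) :
    transl p a (transl p b f) = transl p (a + b) f := by
  ext x
  simp only [transl]
  congr 1
  ext j
  push_cast
  ring

lemma transl_zero (p : Params) (f : (Fin n → ℂ) → ℂ) : transl p 0 f = f := by
  ext x
  simp [transl]

lemma transl_Dprime (p : Params) (r : ℕ) (a : ℝ) (f : (Fin n → ℂ) → ℂ) :
    transl p a (Dprime p r f) = Dprime p r (transl p a f) := by
  ext x
  simp only [transl, Dprime, add_sub_add_right_eq_sub]
  refine Finset.sum_congr rfl fun J _ => ?_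
  congr 2
  ext j
  rw [shiftPt_one, shiftPt_one]
  ring

lemma Dprime_eq_transl_DA (p : Params) (r : ℕ) (f : (Fin n → ℂ) → ℂ) :
    Dprime p r f = transl p ((r : ℝ) / n) (DA p r f) := by
  rw [DA, transl_transl, add_neg_cancel, transl_zero]

lemma Dprime_eq_DA_transl (p : Params) (r : ℕ) (f : (Fin n → ℂ) → ℂ) :
    Dprime p r f = DA p r (transl p ((r : ℝ) / n) f) := by
  rw [DA, transl_Dprime, transl_transl, neg_add_cancel, transl_zero]

end KoornA

end

/-! ### General tools: triangular symmetric operators, integrals over tori, sorting. -/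

noncomputable section

namespace KoornA

/-! ### Triangular families and Hermitian forms -/

section Abstract

variable {W I : Type*} [AddCommGroup W] [Module ℂ W] [PartialOrder I]

/-- A unitriangular change of family does not alter the spans of initial segments; the inverse
change is triangular by well-founded induction. -/
lemma span_image_Iio_eq [WellFoundedLT I] {m a : I → W}
    (h : ∀ j, m j - a j ∈ Submodule.span ℂ (a '' Set.Iio j)) (i : I) :
    Submodule.span ℂ (m '' Set.Iio i) = Submodule.span ℂ (a '' Set.Iio i) := by
  induction i using WellFoundedLT.induction with
  | _ i ih =>
  have hmono : ∀ (b : I → W) {j : I}, j < i →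
      Submodule.span ℂ (b '' Set.Iio j) ≤ Submodule.span ℂ (b '' Set.Iio i) := fun b j hj =>
    Submodule.span_mono (Set.image_mono (Set.Iio_subset_Iio hj.le))
  apply le_antisymm
  · rw [Submodule.span_le]
    rintro _ ⟨j, hj, rfl⟩
    have h1 := hmono a hj (h j)
    have h2 : a j ∈ Submodule.span ℂ (a '' Set.Iio i) := Submodule.subset_span ⟨j, hj, rfl⟩
    simpa using Submodule.add_mem _ h1 h2
  · rw [Submodule.span_le]
    rintro _ ⟨j, hj, rfl⟩
    have h0 := h j
    rw [← ih j hj] at h0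
    have h1 := hmono m hj h0
    have h2 : m j ∈ Submodule.span ℂ (m '' Set.Iio i) := Submodule.subset_span ⟨j, hj, rfl⟩
    simpa using Submodule.sub_mem _ h2 h1

lemma span_Iic_eq (m : I → W) (i : I) : Submodule.span ℂ (m '' Set.Iic i)
    = Submodule.span ℂ {m i} ⊔ Submodule.span ℂ (m '' Set.Iio i) := by
  rw [← Set.Iio_insert, Set.image_insert_eq, Submodule.span_insert]

lemma span_image_Iic_eq [WellFoundedLT I] {m a : I → W}
    (h : ∀ j, m j - a j ∈ Submodule.span ℂ (a '' Set.Iio j)) (i : I) :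
    Submodule.span ℂ (m '' Set.Iic i) = Submodule.span ℂ (a '' Set.Iic i) := by
  have h0 := span_image_Iio_eq h i
  apply le_antisymm
  · rw [span_Iic_eq, span_Iic_eq, h0, sup_le_iff]
    refine ⟨?_, le_sup_right⟩
    rw [Submodule.span_singleton_le_iff_mem, show m i = a i + (m i - a i) by abel]
    exact Submodule.add_mem_sup (Submodule.mem_span_singleton_self _) (h i)
  · rw [span_Iic_eq, span_Iic_eq, h0, sup_le_iff]
    refine ⟨?_, le_sup_right⟩
    rw [Submodule.span_singleton_le_iff_mem, show a i = m i + -(m i - a i) by abel]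
    exact Submodule.add_mem_sup (Submodule.mem_span_singleton_self _)
      (Submodule.neg_mem _ (h i))

/-- `B` is a definite Hermitian form on the subspace `T`. -/
structure IsForm (T : Submodule ℂ W) (B : W → W → ℂ) : Prop where
  add_left : ∀ f ∈ T, ∀ g ∈ T, ∀ h ∈ T, B (f + g) h = B f h + B g h
  smul_left : ∀ (c : ℂ), ∀ f ∈ T, ∀ h ∈ T, B (c • f) h = c * B f h
  conj : ∀ f ∈ T, ∀ h ∈ T, B h f = (starRingEnd ℂ) (B f h)
  definite : ∀ f ∈ T, B f f = 0 → f = 0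

namespace IsForm

variable {T : Submodule ℂ W} {B : W → W → ℂ}

lemma add_right (hB : IsForm T B) {f g h : W} (hf : f ∈ T) (hg : g ∈ T) (hh : h ∈ T) :
    B f (g + h) = B f g + B f h := by
  rw [hB.conj _ (T.add_mem hg hh) _ hf, hB.add_left _ hg _ hh _ hf, map_add,
    ← hB.conj _ hg _ hf, ← hB.conj _ hh _ hf]

lemma smul_right (hB : IsForm T B) (c : ℂ) {f g : W} (hf : f ∈ T) (hg : g ∈ T) :
    B f (c • g) = (starRingEnd ℂ) c * B f g := by
  rw [hB.conj _ (T.smul_mem c hg) _ hf, hB.smul_left _ _ hg _ hf, map_mul, ← hB.conj _ hg _ hf]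

lemma sub_left (hB : IsForm T B) {f g h : W} (hf : f ∈ T) (hg : g ∈ T) (hh : h ∈ T) :
    B (f - g) h = B f h - B g h := by
  rw [sub_eq_add_neg, ← neg_one_smul ℂ g, hB.add_left _ hf _ (T.smul_mem _ hg) _ hh,
    hB.smul_left _ _ hg _ hh]
  ring

lemma zero_left (hB : IsForm T B) {h : W} (hh : h ∈ T) : B 0 h = 0 := by
  simpa using hB.smul_left 0 0 T.zero_mem h hh

lemma zero_right (hB : IsForm T B) {h : W} (hh : h ∈ T) : B h 0 = 0 := by
  simpa using hB.smul_right 0 hh T.zero_mem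

lemma sum_left (hB : IsForm T B)
    {ι : Type*} (s : Finset ι) (f : ι → W) (hf : ∀ i ∈ s, f i ∈ T) {h : W}
    (hh : h ∈ T) : B (∑ i ∈ s, f i) h = ∑ i ∈ s, B (f i) h := by
  classical
  induction s using Finset.induction_on with
  | empty => simpa using hB.zero_left hh
  | insert a s ha ih =>
    rw [Finset.sum_insert ha, Finset.sum_insert ha, hB.add_left _ (hf a (by simp)) _
      (T.sum_mem fun i hi => hf i (by simp [hi])) _ hh, ih fun i hi => hf i (by simp [hi])]

lemma orth_span (hB : IsForm T B)
    {s : Set W} (hs : s ⊆ T) {f : W} (hf : f ∈ T) (h : ∀ g ∈ s, B f g = 0)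
    {g : W} (hg : g ∈ Submodule.span ℂ s) : B f g = 0 := by
  have hle : Submodule.span ℂ s ≤ T := Submodule.span_le.2 hs
  induction hg using Submodule.span_induction with
  | mem g hg => exact h g hg
  | zero => exact hB.zero_right hf
  | add a b ha hb iha ihb => rw [hB.add_right hf (hle ha) (hle hb), iha, ihb, add_zero]
  | smul c a ha iha => rw [hB.smul_right c hf (hle ha), iha, mul_zero]

lemma eq_zero_of_orth (hB : IsForm T B)
    {s : Set W} (hs : s ⊆ T) {f : W} (hf : f ∈ Submodule.span ℂ s)
    (h : ∀ g ∈ s, B f g = 0) : f = 0 := by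
  have hfT := Submodule.span_le.2 hs hf
  exact hB.definite f hfT (hB.orth_span hs hfT h hf)

/-- Gram-Schmidt, adding one index at a time in any order: `m k` is first corrected to be orthogonal
to the indices already treated, and then the component along it is subtracted. -/
lemma exists_orth (hB : IsForm T B) {ι : Type*} (m : ι → W) (hm : ∀ i, m i ∈ T) (S : Finset ι) :
    ∀ v ∈ T, ∃ u ∈ Submodule.span ℂ (m '' (S : Set ι)), ∀ j ∈ S, B (v + u) (m j) = 0 := by
  classical
  induction S using Finset.induction_on with
  | empty => intro v hv; exact ⟨0, Submodule.zero_mem _, by simp⟩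
  | insert k S hk ih =>
    intro v hv
    have hT : ∀ S : Finset ι, Submodule.span ℂ (m '' (S : Set ι)) ≤ T := fun S => by
      rw [Submodule.span_le]; rintro _ ⟨i, -, rfl⟩; exact hm i
    obtain ⟨u, hu, hu0⟩ := ih v hv
    obtain ⟨e, he, he0⟩ := ih (m k) (hm k)
    have hmono : Submodule.span ℂ (m '' (S : Set ι))
        ≤ Submodule.span ℂ (m '' (insert k S : Finset ι)) :=
      Submodule.span_mono (Set.image_mono (by simp))
    have hmk : m k ∈ Submodule.span ℂ (m '' (insert k S : Finset ι)) :=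
      Submodule.subset_span ⟨k, by simp, rfl⟩
    have hsT : m '' (S : Set ι) ⊆ T := by rintro _ ⟨i, -, rfl⟩; exact hm i
    have huT := hT S hu
    have heT := hT S he
    have hvu := T.add_mem hv huT
    have hmke := T.add_mem (hm k) heT
    have key : ∀ w ∈ T, (∀ j ∈ S, B w (m j) = 0) → B w (m k) = B w (m k + e) := by
      intro w hw h0
      rw [hB.add_right hw (hm k) heT, hB.orth_span hsT hw (by
        rintro _ ⟨i, hi, rfl⟩; exact h0 i hi) he, add_zero]
    set c : ℂ := B (v + u) (m k + e) / B (m k + e) (m k + e) with hc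
    refine ⟨u - c • (m k + e), Submodule.sub_mem _ (hmono hu) (Submodule.smul_mem _ _
      (Submodule.add_mem _ hmk (hmono he))), ?_⟩
    rw [← add_sub_assoc]
    have hw := T.sub_mem hvu (T.smul_mem c hmke)
    have h0 : ∀ j ∈ S, B (v + u - c • (m k + e)) (m j) = 0 := by
      intro j hj
      rw [hB.sub_left hvu (T.smul_mem c hmke) (hm j), hB.smul_left _ _ hmke _ (hm j), hu0 j hj,
        he0 j hj, mul_zero, sub_zero]
    intro j hj
    rcases Finset.mem_insert.1 hj with rfl | hj
    · rw [key _ hw h0, hB.sub_left hvu (T.smul_mem c hmke) hmke, hB.smul_left _ _ hmke _ hmke]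
      -- If the corrected vector has norm zero it vanishes by definiteness, and nothing remains to
      -- be subtracted.
      by_cases hz : B (m j + e) (m j + e) = 0
      · have hz' := hB.definite _ hmke hz
        rw [hz', hB.zero_right hvu, hB.zero_right T.zero_mem]
        simp
      · rw [hc, div_mul_cancel₀ _ hz, sub_self]
    · exact h0 j hj

/-- A triangular symmetric operator is diagonal on the orthogonalised family; the equations hold
modulo a subspace `N` of negligible vectors. -/
lemma eigen (hB : IsForm T B) (m : I → W) (hm : ∀ i, m i ∈ T) (N : Submodule ℂ W) (D : W →ₗ[ℂ] W)
    (htri : ∀ j, ∃ y ∈ Submodule.span ℂ (m '' Set.Iic j), D (m j) - y ∈ N)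
    (hsymm : ∀ f ∈ Submodule.span ℂ (Set.range m), ∀ g ∈ Submodule.span ℂ (Set.range m),
      ∀ f' ∈ T, ∀ g' ∈ T, D f - f' ∈ N → D g - g' ∈ N → B f' g = B f g')
    {i : I} {e : ℂ} {y : W} (hy : y ∈ Submodule.span ℂ (m '' Set.Iio i))
    (he : D (m i) - (e • m i + y) ∈ N) {u : W}
    (hu : u ∈ Submodule.span ℂ (m '' Set.Iio i)) (horth : ∀ j < i, B (m i + u) (m j) = 0) :
    D (m i + u) - e • (m i + u) ∈ N := by
  have hIic : ∀ j < i, Submodule.span ℂ (m '' Set.Iic j) ≤ Submodule.span ℂ (m '' Set.Iio i) :=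
    fun j hj => Submodule.span_mono (Set.image_mono fun k hk => lt_of_le_of_lt hk hj)
  have hrange : ∀ s : Set I, Submodule.span ℂ (m '' s) ≤ Submodule.span ℂ (Set.range m) :=
    fun s => Submodule.span_mono (Set.image_subset_range _ _)
  have hrT : Submodule.span ℂ (Set.range m) ≤ T := by
    rw [Submodule.span_le]; rintro _ ⟨i, rfl⟩; exact hm i
  have hDu : ∃ w ∈ Submodule.span ℂ (m '' Set.Iio i), D u - w ∈ N := by
    have aux : ∀ a ∈ Submodule.span ℂ (m '' Set.Iio i),
        ∃ w ∈ Submodule.span ℂ (m '' Set.Iio i), D a - w ∈ N := by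
      intro a ha
      induction ha using Submodule.span_induction with
      | mem u hu =>
        obtain ⟨j, hj, rfl⟩ := hu
        obtain ⟨w, hw, hw'⟩ := htri j
        exact ⟨w, hIic j hj hw, hw'⟩
      | zero => exact ⟨0, Submodule.zero_mem _, by simp⟩
      | add a b _ _ iha ihb =>
        obtain ⟨w, hw, hw'⟩ := iha
        obtain ⟨x, hx, hx'⟩ := ihb
        refine ⟨w + x, Submodule.add_mem _ hw hx, ?_⟩
        rw [map_add, add_sub_add_comm]
        exact N.add_mem hw' hx'
      | smul c a _ iha =>
        obtain ⟨w, hw, hw'⟩ := iha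
        refine ⟨c • w, Submodule.smul_mem _ _ hw, ?_⟩
        rw [map_smul, ← smul_sub]
        exact N.smul_mem _ hw'
    exact aux u hu
  obtain ⟨w, hw, hw'⟩ := hDu
  have hpr : m i + u ∈ Submodule.span ℂ (Set.range m) :=
    Submodule.add_mem _ (Submodule.subset_span ⟨i, rfl⟩) (hrange _ hu)
  have hz : y + w - e • u ∈ Submodule.span ℂ (m '' Set.Iio i) :=
    Submodule.sub_mem _ (Submodule.add_mem _ hy hw) (Submodule.smul_mem _ _ hu)
  have hsT : m '' Set.Iio i ⊆ T := by rintro _ ⟨j, -, rfl⟩; exact hm j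
  have hDp : D (m i + u) - (e • (m i + u) + (y + w - e • u)) ∈ N := by
    have := N.add_mem he hw'
    rw [map_add]
    convert this using 1
    module
  have hepT := T.smul_mem e (hrT hpr)
  have hzT := hrT (hrange _ hz)
  -- This vector is D(m_i + u) - e(m_i + u) modulo N and lies in the lower span. By symmetry its
  -- pairing with m_j, j < i, is that of m_i + u with D m_j, which lies in the span of the m_k with
  -- k ≤ j < i; hence it is 0, and definiteness applies.
  have hz0 : y + w - e • u = 0 := by
    refine hB.eq_zero_of_orth hsT hz ?_
    rintro _ ⟨j, hj, rfl⟩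
    obtain ⟨v, hv, hv'⟩ := htri j
    have hvT := hIic j hj hv
    have h1 := hsymm _ hpr _ (Submodule.subset_span ⟨j, rfl⟩) _ (T.add_mem hepT hzT) _
      (hrT (hrange _ hv)) hDp hv'
    rw [hB.orth_span hsT (hrT hpr) (by rintro _ ⟨k, hk, rfl⟩; exact horth k hk) hvT,
      hB.add_left _ hepT _ hzT _ (hm j), hB.smul_left _ _ (hrT hpr) _ (hm j), horth j hj,
      mul_zero, zero_add] at h1
    exact h1
  rw [hz0, add_zero] at hDp
  exact hDp

/-- A monic triangular eigenvector whose eigenvalues are separated is the orthogonal one. -/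
lemma eq_of_eigen (hB : IsForm T B) [WellFoundedLT I] (P : I → W) (hP : ∀ i, P i ∈ T)
    (horth : ∀ i j, i ≠ j → B (P i) (P j) = 0) (hne : ∀ i, P i ≠ 0)
    (N : Submodule ℂ W) (hN : ∀ f ∈ T, f ∈ N → f = 0) (L : W →ₗ[ℂ] W) (ε : I → ℂ)
    (hL : ∀ i, L (P i) - ε i • P i ∈ N) {i : I} (hε : ∀ j < i, ε j ≠ ε i) {f : W} {E : ℂ}
    (hf : f - P i ∈ Submodule.span ℂ (P '' Set.Iio i)) (hfE : L f - E • f ∈ N) : f = P i := by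
  classical
  obtain ⟨b, hb, hbf⟩ := (Finsupp.mem_span_image_iff_linearCombination ℂ).1 hf
  rw [Finsupp.mem_supported] at hb
  rw [Finsupp.linearCombination_apply, Finsupp.sum] at hbf
  -- The expansion of L f - E f in the family P, modulo N. Pairing it with P i gives E = ε i, and
  -- pairing it with a smaller P k then kills the coefficient b k.
  set z : W := (ε i - E) • P i + ∑ j ∈ b.support, (b j * (ε j - E)) • P j with hz
  have hzT : z ∈ T := T.add_mem (T.smul_mem _ (hP i)) (T.sum_mem fun j _ => T.smul_mem _ (hP j))
  have hfe : f = P i + ∑ j ∈ b.support, b j • P j := by rw [hbf]; abel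
  have hzN : z ∈ N := by
    have h1 := N.sub_mem hfE (hL i)
    have h2 : ∑ j ∈ b.support, b j • (L (P j) - ε j • P j) ∈ N :=
      N.sum_mem fun j _ => N.smul_mem _ (hL j)
    have h3 := N.sub_mem h1 h2
    have h4 : z = (L f - E • f - (L (P i) - ε i • P i)
        - ∑ j ∈ b.support, b j • (L (P j) - ε j • P j)) + 0 := by
      have e1 : ∑ j ∈ b.support, b j • (L (P j) - ε j • P j)
          = ∑ j ∈ b.support, b j • L (P j) - ∑ j ∈ b.support, (b j * ε j) • P j := by
        rw [← Finset.sum_sub_distrib]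
        refine Finset.sum_congr rfl fun j _ => ?_
        module
      have e2 : ∑ j ∈ b.support, (b j * (ε j - E)) • P j
          = ∑ j ∈ b.support, (b j * ε j) • P j - E • ∑ j ∈ b.support, b j • P j := by
        rw [Finset.smul_sum, ← Finset.sum_sub_distrib]
        refine Finset.sum_congr rfl fun j _ => ?_
        module
      rw [hz, e1, e2, hfe, map_add, map_sum]
      simp only [map_smul]
      module
    rw [h4, add_zero]
    exact h3
  have hz0 := hN z hzT hzN
  have hcoef : ∀ k, (ε i - E) * B (P i) (P k)
      + ∑ j ∈ b.support, (b j * (ε j - E)) * B (P j) (P k) = 0 := by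
    intro k
    have := hB.zero_left (hP k)
    rw [← hz0, hz, hB.add_left _ (T.smul_mem _ (hP i)) _ (T.sum_mem fun j _ =>
      T.smul_mem _ (hP j)) _ (hP k), hB.smul_left _ _ (hP i) _ (hP k),
      hB.sum_left _ _ (fun j _ => T.smul_mem _ (hP j)) (hP k)] at this
    rw [← this]
    congr 1
    exact Finset.sum_congr rfl fun j _ => (hB.smul_left _ _ (hP j) _ (hP k)).symm
  have hBne : ∀ k, B (P k) (P k) ≠ 0 := fun k h => hne k (hB.definite _ (hP k) h)
  have hE : ε i = E := by
    have h1 := hcoef i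
    rw [Finset.sum_eq_zero fun j hj => by rw [horth j i (ne_of_lt (hb hj)), mul_zero], add_zero]
      at h1
    exact sub_eq_zero.1 ((mul_eq_zero.1 h1).resolve_right (hBne i))
  have hb0 : ∀ k ∈ b.support, b k = 0 := by
    intro k hk
    have h1 := hcoef k
    rw [horth i k (ne_of_gt (hb hk)), mul_zero, zero_add, Finset.sum_eq_single k
      (fun j _ hj => by rw [horth j k hj, mul_zero]) (fun h => absurd hk h)] at h1
    have h2 := (mul_eq_zero.1 h1).resolve_right (hBne k)
    refine (mul_eq_zero.1 h2).resolve_right ?_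
    rw [← hE]
    exact sub_ne_zero.2 (hε k (hb hk))
  rw [hfe, Finset.sum_eq_zero fun j hj => by rw [hb0 j hj, zero_smul], add_zero]

end IsForm

end Abstract

end KoornA

end

noncomputable section

namespace KoornA

open MeasureTheory

/-! ### Integrals over the torus -/

/-- The fundamental box `[-π, π]^m` of the torus. -/
def box (m : ℕ) : Set (Fin m → ℝ) := Set.Icc (fun _ => -Real.pi) (fun _ => Real.pi)

lemma isCompact_box (m : ℕ) : IsCompact (box m) := isCompact_Icc

/-- Translation by `c` modulo `2π`. -/
def wrap (c x : ℝ) : ℝ := toIocMod Real.two_pi_pos (-Real.pi) (x + c)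

lemma wrap_eq (c x : ℝ) : ∃ k : ℤ, wrap c x = x + c + 2 * Real.pi * k := by
  refine ⟨-toIocDiv Real.two_pi_pos (-Real.pi) (x + c), ?_⟩
  have h := toIocMod_add_toIocDiv_zsmul Real.two_pi_pos (-Real.pi) (x + c)
  rw [zsmul_eq_mul] at h
  rw [wrap]
  push_cast
  linarith

/-- Through the identification with the circle ℝ/2πℤ this is the invariance of Haar measure under
rotation. -/
lemma measurePreserving_wrap (c : ℝ) : MeasurePreserving (wrap c)
    (volume.restrict (Set.Icc (-Real.pi) Real.pi))
    (volume.restrict (Set.Icc (-Real.pi) Real.pi)) := by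
  have : Fact (0 < 2 * Real.pi) := ⟨Real.two_pi_pos⟩
  rw [← Measure.restrict_congr_set Ioc_ae_eq_Icc]
  have h1 := AddCircle.measurePreserving_mk (2 * Real.pi) (-Real.pi)
  have h2 := measurePreserving_add_right (volume : Measure (AddCircle (2 * Real.pi)))
    (c : AddCircle (2 * Real.pi))
  have h3 := AddCircle.measurePreserving_equivIoc (T := 2 * Real.pi) (a := -Real.pi)
  have h4 : MeasurePreserving (Subtype.val : Set.Ioc (-Real.pi) (-Real.pi + 2 * Real.pi) → ℝ)
      (Measure.comap Subtype.val volume) (volume.restrict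
        (Set.Ioc (-Real.pi) (-Real.pi + 2 * Real.pi))) :=
    measurePreserving_subtype_coe measurableSet_Ioc
  have h : MeasurePreserving (wrap c)
      (volume.restrict (Set.Ioc (-Real.pi) (-Real.pi + 2 * Real.pi)))
      (volume.restrict (Set.Ioc (-Real.pi) (-Real.pi + 2 * Real.pi))) :=
    h4.comp (h3.comp (h2.comp h1))
  have e : -Real.pi + 2 * Real.pi = Real.pi := by ring
  rwa [e] at h

lemma volume_restrict_box (m : ℕ) : (volume : Measure (Fin m → ℝ)).restrict (box m)
    = Measure.pi fun _ => (volume : Measure ℝ).restrict (Set.Icc (-Real.pi) Real.pi) := by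
  rw [box, ← Set.pi_univ_Icc, volume_pi, Measure.restrict_pi_pi]

/-- `F` is `2π`-periodic in every coordinate. -/
def TorusPeriodic {m : ℕ} (F : (Fin m → ℝ) → ℂ) : Prop :=
  ∀ (s : Fin m → ℝ) (k : Fin m → ℤ), F (fun i => s i + 2 * Real.pi * k i) = F s

lemma integral_box_translate {m : ℕ} {F : (Fin m → ℝ) → ℂ} (hF : Continuous F)
    (hper : TorusPeriodic F) (v : Fin m → ℝ) :
    ∫ s in box m, F (fun i => s i + v i) = ∫ s in box m, F s := by
  have h := measurePreserving_pi (fun _ : Fin m => (volume : Measure ℝ).restrict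
    (Set.Icc (-Real.pi) Real.pi)) (fun _ : Fin m => (volume : Measure ℝ).restrict
    (Set.Icc (-Real.pi) Real.pi)) (f := fun i => wrap (v i))
    (fun i => measurePreserving_wrap (v i))
  rw [← volume_restrict_box] at h
  have h2 : ∀ s : Fin m → ℝ, F (fun i => s i + v i) = F (fun i => wrap (v i) (s i)) := by
    intro s
    choose k hk using fun i => wrap_eq (v i) (s i)
    simp only [hk]
    exact (hper _ k).symm
  simp only [h2]
  rw [← integral_map (φ := fun s : Fin m → ℝ => fun i => wrap (v i) (s i))
    h.measurable.aemeasurable hF.aestronglyMeasurable, h.map_eq]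

lemma exists_box_rep {m : ℕ} (s : Fin m → ℝ) :
    ∃ k : Fin m → ℤ, (fun i => s i + 2 * Real.pi * k i) ∈ box m := by
  choose k hk using fun i => wrap_eq 0 (s i)
  refine ⟨k, ?_⟩
  have : ∀ i, s i + 2 * Real.pi * k i ∈ Set.Ioc (-Real.pi) (-Real.pi + 2 * Real.pi) := fun i => by
    have h := toIocMod_mem_Ioc Real.two_pi_pos (-Real.pi) (s i + 0)
    have h2 := hk i
    rw [wrap] at h2
    rwa [h2, add_zero] at h
  refine ⟨fun i => (this i).1.le, fun i => ?_⟩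
  have := (this i).2
  simp only
  linarith

/-- The closed strip `-b ≤ Im z ≤ 0`. -/
def strip (b : ℝ) : Set ℂ := {z | -b ≤ z.im ∧ z.im ≤ 0}

/-- Cauchy's theorem on the rectangle with corners -ib and P: the vertical sides cancel by
periodicity. -/
lemma integral_shift_strip {b P : ℝ} (hb : 0 < b) {f : ℂ → ℂ}
    (hd : ∀ z ∈ strip b, DifferentiableAt ℂ f z) (hper : ∀ z ∈ strip b, f (z + P) = f z) :
    ∫ θ in (0 : ℝ)..P, f θ = ∫ θ in (0 : ℝ)..P, f (θ - Complex.I * b) := by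
  have h := Complex.integral_boundary_rect_eq_zero_of_differentiableOn f (-Complex.I * b) P (by
    intro z hz
    refine (hd z ?_).differentiableWithinAt
    have := hz.2
    simp only [Set.mem_preimage] at this
    rw [Set.uIcc_of_le (by simp [hb.le])] at this
    simpa [strip] using this)
  have hv : ∀ y ∈ Set.uIcc (-b) 0, f (P + y * Complex.I) = f (y * Complex.I) := by
    intro y hy
    rw [Set.uIcc_of_le (by linarith)] at hy
    rw [add_comm]
    exact hper _ (by simpa [strip] using hy)
  simp only [Complex.mul_re, Complex.neg_re, Complex.I_re, Complex.ofReal_re, Complex.neg_im,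
    Complex.I_im, Complex.ofReal_im, Complex.mul_im, neg_zero, zero_mul, mul_zero, sub_zero,
    zero_add, add_zero, neg_mul, one_mul, Complex.ofReal_zero, Complex.ofReal_neg] at h
  rw [intervalIntegral.integral_congr (fun y hy => hv y hy)] at h
  rw [add_sub_cancel_right, sub_eq_zero] at h
  rw [← h]
  refine intervalIntegral.integral_congr fun x _ => ?_
  congr 1
  ring

lemma integrable_prod_of_continuousOn {m : ℕ} {P : ℝ} {H : (Fin m → ℝ) → ℝ → ℂ}
    (hH : Continuous (Function.uncurry H)) :
    Integrable (Function.uncurry H) ((volume.restrict (box m)).prod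
      (volume.restrict (Set.Ioc 0 P))) := by
  rw [Measure.prod_restrict, ← IntegrableOn]
  refine IntegrableOn.mono_set (t := box m ×ˢ Set.Icc 0 P) ?_
    (Set.prod_mono le_rfl Set.Ioc_subset_Icc_self)
  exact hH.continuousOn.integrableOn_compact ((isCompact_box m).prod isCompact_Icc)

/-- Shift of the contour of integration along a direction of the torus. -/
lemma integral_box_shift {m : ℕ} {b P : ℝ} (hb : 0 < b) (hP : 0 < P)
    (G : (Fin m → ℝ) → ℂ → ℂ)
    (hc : ∀ s, ∀ z ∈ strip b, ContinuousAt (Function.uncurry G) (s, z))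
    (hd : ∀ s, ∀ z ∈ strip b, DifferentiableAt ℂ (G s) z)
    (hper : ∀ s, ∀ z ∈ strip b, G s (z + P) = G s z)
    (h0 : ∀ θ : ℝ, ∫ s in box m, G s θ = ∫ s in box m, G s 0)
    (h1 : ∀ θ : ℝ, ∫ s in box m, G s (θ - Complex.I * b) = ∫ s in box m, G s (-Complex.I * b)) :
    ∫ s in box m, G s 0 = ∫ s in box m, G s (-Complex.I * b) := by
  have hs0 : ∀ θ : ℝ, (θ : ℂ) ∈ strip b := fun θ => by simp [strip, hb.le]
  have hs1 : ∀ θ : ℝ, (θ : ℂ) - Complex.I * b ∈ strip b := fun θ => by simp [strip, hb.le]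
  have hc0 : Continuous (Function.uncurry fun (s : Fin m → ℝ) (θ : ℝ) => G s θ) :=
    continuous_iff_continuousAt.2 fun ⟨s, θ⟩ => by
      have := hc s θ (hs0 θ)
      exact ContinuousAt.comp (f := fun x : (Fin m → ℝ) × ℝ => (x.1, (x.2 : ℂ)))
        (g := Function.uncurry G) this (by fun_prop)
  have hc1 : Continuous (Function.uncurry fun (s : Fin m → ℝ) (θ : ℝ) =>
      G s (θ - Complex.I * b)) :=
    continuous_iff_continuousAt.2 fun ⟨s, θ⟩ => by
      have := hc s _ (hs1 θ)
      exact ContinuousAt.comp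
        (f := fun x : (Fin m → ℝ) × ℝ => (x.1, (x.2 : ℂ) - Complex.I * b))
        (g := Function.uncurry G) this (by fun_prop)
  -- Averaging over θ makes the one-dimensional contour shift available for each fixed s, after
  -- Fubini. By `h0` and `h1` the inner integrals do not depend on θ, so averaging only multiplies
  -- by P.
  have key : ∫ θ in (0 : ℝ)..P, ∫ s in box m, G s θ
      = ∫ θ in (0 : ℝ)..P, ∫ s in box m, G s (θ - Complex.I * b) := by
    rw [intervalIntegral.integral_of_le hP.le, intervalIntegral.integral_of_le hP.le,
      ← integral_integral_swap (integrable_prod_of_continuousOn hc0),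
      ← integral_integral_swap (integrable_prod_of_continuousOn hc1)]
    refine integral_congr_ae (Eventually.of_forall fun s => ?_)
    have := integral_shift_strip hb (hd s) (hper s)
    rwa [intervalIntegral.integral_of_le hP.le, intervalIntegral.integral_of_le hP.le] at this
  simp only [h0, h1, intervalIntegral.integral_const, sub_zero] at key
  exact smul_right_injective ℂ hP.ne' key

/-! ### Exponentials and Hermitian forms on the torus -/

variable {m n : ℕ}

lemma expo_add (μ ν x : Fin n → ℂ) : expo (μ + ν) x = expo μ x * expo ν x := by
  simp only [expo, ← Complex.exp_add, Pi.add_apply, add_mul, Finset.sum_add_distrib, mul_add]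

lemma expo_add_right (μ x y : Fin n → ℂ) : expo μ (x + y) = expo μ x * expo μ y := by
  simp only [expo, ← Complex.exp_add, Pi.add_apply, mul_add, Finset.sum_add_distrib]

/-- The exponential `e^μ` with a real exponent. -/
def ex (μ : Fin n → ℝ) (x : Fin n → ℂ) : ℂ := expo (fun j => (μ j : ℂ)) x

lemma ex_continuous (μ : Fin n → ℝ) : Continuous (ex μ) := by
  unfold ex expo
  fun_prop

/-- The vector of complex numbers attached to a real vector. -/
def cvec (s : Fin n → ℝ) : Fin n → ℂ := fun j => (s j : ℂ)

lemma cvec_continuous : Continuous (cvec : (Fin n → ℝ) → Fin n → ℂ) := by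
  unfold cvec
  fun_prop

/-- Dedekind's independence of characters. Two exponents that differ in coordinate j give opposite
values at π/(μ_j - ν_j) times the j-th unit vector. -/
lemma linearIndependent_ex_real :
    LinearIndependent ℂ fun (μ : Fin m → ℝ) => fun s : Fin m → ℝ => ex μ (cvec s) := by
  let χ : (Fin m → ℝ) → (Multiplicative (Fin m → ℝ) →* ℂ) := fun μ =>
    { toFun := fun s => ex μ (cvec s.toAdd)
      map_one' := by simp [ex, expo, cvec]
      map_mul' := fun a b => by
        have : cvec (Multiplicative.toAdd (a * b)) = cvec a.toAdd + cvec b.toAdd := by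
          ext j; simp [cvec]
        rw [this, ex, expo_add_right]
        rfl }
  have hχ : Function.Injective χ := by
    intro μ ν h
    by_contra hne
    obtain ⟨j, hj⟩ := Function.ne_iff.1 hne
    have hd : μ j - ν j ≠ 0 := sub_ne_zero.2 hj
    have h1 := DFunLike.congr_fun h (Multiplicative.ofAdd (Pi.single j (Real.pi / (μ j - ν j))))
    have h2 : ∀ κ : Fin m → ℝ, χ κ (Multiplicative.ofAdd (Pi.single j (Real.pi / (μ j - ν j))))
        = Complex.exp (Complex.I * (κ j * (Real.pi / (μ j - ν j)) : ℝ)) := by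
      intro κ
      simp only [χ, ex, expo, cvec, MonoidHom.coe_mk, OneHom.coe_mk, toAdd_ofAdd]
      rw [Finset.sum_eq_single j]
      · simp
      · intro k _ hk; simp [hk]
      · simp
    rw [h2, h2] at h1
    have h3 : Complex.exp (Complex.I * (μ j * (Real.pi / (μ j - ν j)) : ℝ))
        = -Complex.exp (Complex.I * (ν j * (Real.pi / (μ j - ν j)) : ℝ)) := by
      rw [show μ j * (Real.pi / (μ j - ν j)) = ν j * (Real.pi / (μ j - ν j)) + Real.pi by
        field_simp; ring, Complex.ofReal_add, mul_add, Complex.exp_add, mul_comm Complex.I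
        (Real.pi : ℂ), Complex.exp_pi_mul_I]
      ring
    rw [h3] at h1
    have h4 := Complex.exp_ne_zero (Complex.I * (ν j * (Real.pi / (μ j - ν j)) : ℝ))
    exact h4 (by linear_combination (-1 / 2 : ℂ) * h1)
  have h := (linearIndependent_monoidHom (Multiplicative (Fin m → ℝ)) ℂ).comp χ hχ
  exact h

/-- The Hermitian form with weight `w` on a torus with coordinates `s ↦ ℓ s`. -/
def form (ℓ : (Fin m → ℝ) → Fin n → ℝ) (w : (Fin m → ℝ) → ℂ) (f h : (Fin n → ℂ) → ℂ) : ℂ :=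
  ∫ s in box m, f (cvec (ℓ s)) * (starRingEnd ℂ) (h (cvec (ℓ s))) * w s

/-- Data making `form ℓ w` a definite Hermitian form on the span of the `e^μ`, `μ ∈ S`. -/
structure TorusData (ℓ : (Fin m → ℝ) → Fin n → ℝ) (w : (Fin m → ℝ) → ℂ)
    (w' : (Fin m → ℝ) → ℝ) (S : Set (Fin n → ℝ)) : Prop where
  ℓ_cont : Continuous ℓ
  w_eq : w =ᵐ[volume.restrict (box m)] fun s => (w' s : ℂ)
  w'_cont : Continuous w'
  w'_nonneg : ∀ s, 0 ≤ w' s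
  w'_ne : ∀ᵐ s ∂volume.restrict (box m), w' s ≠ 0
  exps : ∃ K : (Fin n → ℝ) → Fin m → ℤ, (∀ μ ∈ S, ∀ s,
    ex μ (cvec (ℓ s)) = ex (fun i => (K μ i : ℝ)) (cvec s)) ∧ Set.InjOn K S

/-- The span of the exponentials `e^μ`, `μ ∈ S`. -/
def expSpan (S : Set (Fin n → ℝ)) : Submodule ℂ ((Fin n → ℂ) → ℂ) :=
  Submodule.span ℂ (ex '' S)

lemma expSpan_continuous {S : Set (Fin n → ℝ)} {f : (Fin n → ℂ) → ℂ} (hf : f ∈ expSpan S) :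
    Continuous f := by
  induction hf using Submodule.span_induction with
  | mem f hf => obtain ⟨μ, -, rfl⟩ := hf; exact ex_continuous μ
  | zero => exact continuous_const
  | add a b _ _ ha hb => exact ha.add hb
  | smul c a _ ha => exact ha.const_smul c

lemma ex_int_periodic (k l : Fin m → ℤ) (s : Fin m → ℝ) :
    ex (fun i => (k i : ℝ)) (cvec fun i => s i + 2 * Real.pi * l i)
      = ex (fun i => (k i : ℝ)) (cvec s) := by
  change Complex.exp _ = Complex.exp _
  rw [Complex.exp_eq_exp_iff_exists_int]
  refine ⟨∑ i, k i * l i, ?_⟩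
  push_cast
  rw [Finset.sum_mul, Finset.mul_sum, Finset.mul_sum, ← Finset.sum_add_distrib]
  refine Finset.sum_congr rfl fun i _ => ?_
  simp only [cvec]
  push_cast
  ring

lemma box_subset_closure_interior : box m ⊆ closure (interior (box m)) := by
  have hc : Convex ℝ (box m) := convex_Icc _ _
  have hne : (interior (box m)).Nonempty := by
    refine ⟨0, ?_⟩
    rw [box, ← Set.pi_univ_Icc, interior_pi_set Set.finite_univ]
    intro i _
    rw [interior_Icc]
    exact ⟨by simp [Real.pi_pos], by simp [Real.pi_pos]⟩
  rw [hc.closure_interior_eq_closure_of_nonempty_interior hne]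
  exact subset_closure

namespace TorusData

variable {ℓ : (Fin m → ℝ) → Fin n → ℝ} {w : (Fin m → ℝ) → ℂ} {w' : (Fin m → ℝ) → ℝ}
  {S : Set (Fin n → ℝ)}

lemma form_eq (hT : TorusData ℓ w w' S) (f h : (Fin n → ℂ) → ℂ) : form ℓ w f h
    = ∫ s in box m, f (cvec (ℓ s)) * (starRingEnd ℂ) (h (cvec (ℓ s))) * (w' s : ℂ) := by
  refine integral_congr_ae ?_
  filter_upwards [hT.w_eq] with s hs
  rw [hs]

lemma integrable (hT : TorusData ℓ w w' S)
    {f h : (Fin n → ℂ) → ℂ} (hf : f ∈ expSpan S) (hh : h ∈ expSpan S) :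
    IntegrableOn (fun s => f (cvec (ℓ s)) * (starRingEnd ℂ) (h (cvec (ℓ s))) * (w' s : ℂ))
      (box m) := by
  refine ContinuousOn.integrableOn_compact (isCompact_box m) (Continuous.continuousOn ?_)
  have h1 := expSpan_continuous hf
  have h2 := expSpan_continuous hh
  have h3 := hT.ℓ_cont
  have h4 := hT.w'_cont
  have h5 := cvec_continuous (n := n)
  exact ((h1.comp (h5.comp h3)).mul (Complex.continuous_conj.comp (h2.comp (h5.comp h3)))).mul
    (Complex.continuous_ofReal.comp h4)

/-- For definiteness, a zero integral of |f|² w' gives f = 0 almost everywhere on the box, then on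
the whole box by continuity. Integrality of the exponents extends this to all s, and independence of
characters, with `K` injective on S, makes all coefficients of f vanish, hence f itself on ℂⁿ. -/
lemma isForm (hT : TorusData ℓ w w' S) : IsForm (expSpan S) (form ℓ w) where
  add_left f hf g hg h hh := by
    rw [hT.form_eq, hT.form_eq, hT.form_eq, ← integral_add (hT.integrable hf hh)
      (hT.integrable hg hh)]
    simp only [Pi.add_apply, add_mul]
  smul_left c f hf h hh := by
    rw [hT.form_eq, hT.form_eq, ← integral_const_mul]
    simp only [Pi.smul_apply, smul_eq_mul, mul_assoc]
  conj f hf h hh := by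
    rw [hT.form_eq, hT.form_eq, ← integral_conj]
    refine integral_congr_ae (Eventually.of_forall fun s => ?_)
    simp only [map_mul, Complex.conj_conj, Complex.conj_ofReal]
    ring
  definite f hf h0 := by
    obtain ⟨K, hK, hinj⟩ := hT.exps
    have hfc := expSpan_continuous hf
    have hcont : Continuous fun s => f (cvec (ℓ s)) :=
      hfc.comp (cvec_continuous.comp hT.ℓ_cont)
    have h1 : ∫ s in box m, Complex.normSq (f (cvec (ℓ s))) * w' s = 0 := by
      rw [hT.form_eq] at h0
      have : ((∫ s in box m, Complex.normSq (f (cvec (ℓ s))) * w' s : ℝ) : ℂ) = 0 := by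
        rw [← integral_complex_ofReal, ← h0]
        refine integral_congr_ae (Eventually.of_forall fun s => ?_)
        simp only [Complex.mul_conj, Complex.ofReal_mul]
      exact_mod_cast this
    have hcont2 : Continuous fun s => Complex.normSq (f (cvec (ℓ s))) * w' s :=
      (Complex.continuous_normSq.comp hcont).mul hT.w'_cont
    rw [integral_eq_zero_iff_of_nonneg (fun s => mul_nonneg (Complex.normSq_nonneg _)
      (hT.w'_nonneg s)) (hcont2.continuousOn.integrableOn_compact (isCompact_box m))] at h1
    have h2 : (fun s => f (cvec (ℓ s))) =ᵐ[volume.restrict (box m)] fun _ => 0 := by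
      filter_upwards [h1, hT.w'_ne] with s hs hw
      exact Complex.normSq_eq_zero.1 ((mul_eq_zero.1 hs).resolve_right hw)
    have h3 := Measure.eqOn_of_ae_eq h2 hcont.continuousOn continuousOn_const
      box_subset_closure_interior
    obtain ⟨c, hc, hcf⟩ := (Finsupp.mem_span_image_iff_linearCombination ℂ).1 hf
    rw [Finsupp.mem_supported] at hc
    rw [Finsupp.linearCombination_apply, Finsupp.sum] at hcf
    have hfs : ∀ s, f (cvec (ℓ s))
        = ∑ μ ∈ c.support, c μ * ex (fun i => (K μ i : ℝ)) (cvec s) := by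
      intro s
      rw [← hcf, Finset.sum_apply]
      refine Finset.sum_congr rfl fun μ hμ => ?_
      rw [Pi.smul_apply, smul_eq_mul, hK μ (hc hμ)]
    have h4 : ∀ s, ∑ μ ∈ c.support, c μ * ex (fun i => (K μ i : ℝ)) (cvec s) = 0 := by
      intro s
      obtain ⟨l, hl⟩ := exists_box_rep s
      have := h3 hl
      simp only [hfs, ex_int_periodic] at this
      exact this
    have hLI := linearIndependent_ex_real (m := m)
    have hinj2 : Set.InjOn (fun μ => fun i => (K μ i : ℝ)) (c.support : Set (Fin n → ℝ)) := by
      intro μ hμ ν hν h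
      refine hinj (hc hμ) (hc hν) ?_
      ext i
      exact Int.cast_injective (congrFun h i)
    have hLI2 := hLI.comp (fun μ : (c.support : Set (Fin n → ℝ)) => fun i => (K μ i : ℝ))
      (fun a b h => Subtype.ext (hinj2 a.2 b.2 h))
    rw [Fintype.linearIndependent_iff] at hLI2
    have h5 := hLI2 (fun μ => c μ) (by
      ext s
      rw [Finset.sum_apply, Pi.zero_apply, ← h4 s]
      exact Finset.sum_coe_sort c.support fun μ => c μ * ex (fun i => (K μ i : ℝ)) (cvec s))
    rw [← hcf]
    refine Finset.sum_eq_zero fun μ hμ => ?_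
    rw [h5 ⟨μ, hμ⟩, zero_smul]

end TorusData

end KoornA

end

noncomputable section

namespace KoornA

variable {n : ℕ}

/-! ### Dominance order and sorting -/


lemma sum_add_sdiff_eq {R : Type*} [AddCommGroup R] (f : Fin n → R) (S K : Finset (Fin n)) :
    ∑ i ∈ S, f i = ∑ i ∈ S ∩ K, f i + ∑ i ∈ S \ K, f i :=
  (Finset.sum_inter_add_sum_sdiff S K f).symm

lemma eq_of_sum_Iic_eq {R : Type*} [AddCommGroup R] {f g : Fin n → R}
    (h : ∀ k, ∑ i ∈ Finset.Iic k, f i = ∑ i ∈ Finset.Iic k, g i) : f = g := by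
  ext k
  induction k using WellFoundedLT.induction with
  | _ k ih =>
  have h1 := h k
  rw [← Finset.Iio_insert, Finset.sum_insert (by simp), Finset.sum_insert (by simp),
    Finset.sum_congr rfl fun i hi => ih i (Finset.mem_Iio.1 hi)] at h1
  exact add_right_cancel h1

lemma exists_sort_strictAnti {R : Type*} [LinearOrder R] {κ : Fin n → R} (hκ : Function.Injective κ) :
    ∃ τ : Equiv.Perm (Fin n), StrictAnti (κ ∘ τ) := by
  refine ⟨Tuple.sort (OrderDual.toDual ∘ κ), ?_⟩
  have h := Tuple.monotone_sort (OrderDual.toDual ∘ κ)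
  have h2 : StrictMono ((OrderDual.toDual ∘ κ) ∘ Tuple.sort (OrderDual.toDual ∘ κ)) :=
    h.strictMono_of_injective
      ((OrderDual.toDual.injective.comp hκ).comp (Equiv.injective _))
  exact fun i j hij => h2 hij

section Comb

variable {R : Type*} [AddCommGroup R] [LinearOrder R] [IsOrderedAddMonoid R]

/-- Exchange argument: elements of S outside the initial segment have values at most f k, and as
many elements of the segment are missing, with values at least f k. -/
lemma sum_le_sum_Iic {f : Fin n → R} (hf : Antitone f) {S : Finset (Fin n)} {k : Fin n}
    (hS : S.card = (Finset.Iic k).card) : ∑ i ∈ S, f i ≤ ∑ i ∈ Finset.Iic k, f i := by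
  rw [sum_add_sdiff_eq f S (Finset.Iic k), sum_add_sdiff_eq f (Finset.Iic k) S,
    Finset.inter_comm]
  have hc : (S \ Finset.Iic k).card = (Finset.Iic k \ S).card := Finset.card_sdiff_comm hS
  refine add_le_add le_rfl ?_
  calc ∑ i ∈ S \ Finset.Iic k, f i ≤ (S \ Finset.Iic k).card • f k :=
        Finset.sum_le_card_nsmul _ _ _ fun i hi => hf (by
          have := (Finset.mem_sdiff.1 hi).2
          rw [Finset.mem_Iic, not_le] at this
          exact this.le)
    _ = (Finset.Iic k \ S).card • f k := by rw [hc]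
    _ ≤ _ := Finset.card_nsmul_le_sum _ _ _ fun i hi =>
        hf (Finset.mem_Iic.1 (Finset.mem_sdiff.1 hi).1)

lemma eq_Iic_of_sum_eq {f : Fin n → R} (hf : StrictAnti f) {S : Finset (Fin n)} {k : Fin n}
    (hS : S.card = (Finset.Iic k).card) (h : ∑ i ∈ Finset.Iic k, f i ≤ ∑ i ∈ S, f i) :
    S = Finset.Iic k := by
  by_contra hne
  rw [sum_add_sdiff_eq f S (Finset.Iic k), sum_add_sdiff_eq f (Finset.Iic k) S,
    Finset.inter_comm] at h
  have hc : (S \ Finset.Iic k).card = (Finset.Iic k \ S).card := Finset.card_sdiff_comm hS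
  have hne' : (S \ Finset.Iic k).Nonempty := by
    rw [Finset.sdiff_nonempty]
    exact fun hsub => hne (Finset.eq_of_subset_of_card_le hsub hS.ge)
  have h1 : ∑ i ∈ S \ Finset.Iic k, f i < ∑ i ∈ S \ Finset.Iic k, f k :=
    Finset.sum_lt_sum_of_nonempty hne' fun i hi => hf (by
      have := (Finset.mem_sdiff.1 hi).2
      rwa [Finset.mem_Iic, not_le] at this)
  have h2 : (Finset.Iic k \ S).card • f k ≤ ∑ i ∈ Finset.Iic k \ S, f i :=
    Finset.card_nsmul_le_sum _ _ _ fun i hi =>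
        hf.antitone (Finset.mem_Iic.1 (Finset.mem_sdiff.1 hi).1)
  rw [Finset.sum_const, hc] at h1
  exact absurd (le_of_add_le_add_left h) (not_le.2 (h1.trans_le h2))

/-- The combinatorial heart of triangularity: an alternant with exponents κ bounded by ρ plus a
rearrangement of l is, after sorting, the one of ρ + μ with μ ≤ l. Partial sums of the sorted κ are
sums of ρ and of l over sets of k elements, hence at most the sums over the first k indices. -/
lemma sort_dominance {ρ l κ μ : Fin n → R} (hρ : StrictAnti ρ) (hl : Antitone l)
    (σ τ : Equiv.Perm (Fin n)) (hκ : ∀ i, κ i ≤ ρ i + l (σ i))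
    (hμ : ∀ i, κ (τ i) = ρ i + μ i) :
    (∀ k, ∑ i ∈ Finset.Iic k, μ i ≤ ∑ i ∈ Finset.Iic k, l i)
      ∧ (μ = l → (∀ i, l (σ i) = l i) ∧ ∀ i, κ i = ρ i + l i) := by
  have hcard : ∀ k (π : Equiv.Perm (Fin n)),
      ((Finset.Iic k).map π.toEmbedding).card = (Finset.Iic k).card := by simp
  have h1 : ∀ k, ∑ i ∈ Finset.Iic k, ρ i + ∑ i ∈ Finset.Iic k, μ i
      ≤ ∑ i ∈ (Finset.Iic k).map τ.toEmbedding, ρ i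
        + ∑ i ∈ ((Finset.Iic k).map τ.toEmbedding).map σ.toEmbedding, l i := by
    intro k
    rw [← Finset.sum_add_distrib, Finset.sum_map _ σ.toEmbedding, ← Finset.sum_add_distrib,
      Finset.sum_map]
    refine Finset.sum_le_sum fun i _ => ?_
    rw [← hμ]
    exact hκ _
  have h2 : ∀ k, ∑ i ∈ (Finset.Iic k).map τ.toEmbedding, ρ i ≤ ∑ i ∈ Finset.Iic k, ρ i :=
    fun k => sum_le_sum_Iic hρ.antitone (hcard k τ)
  have h3 : ∀ k, ∑ i ∈ ((Finset.Iic k).map τ.toEmbedding).map σ.toEmbedding, l i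
      ≤ ∑ i ∈ Finset.Iic k, l i := fun k => sum_le_sum_Iic hl (by simp)
  refine ⟨fun k => ?_, ?_⟩
  · have := (h1 k).trans (add_le_add (h2 k) (h3 k))
    exact le_of_add_le_add_left this
  · rintro rfl
    -- In the case of equality the sum of ρ over the image of each initial segment is maximal; as ρ
    -- decreases strictly, the image is that segment.
    have hτ : ∀ k, (Finset.Iic k).map τ.toEmbedding = Finset.Iic k := fun k =>
      eq_Iic_of_sum_eq hρ (hcard k τ)
        (le_of_add_le_add_right ((h1 k).trans (add_le_add le_rfl (h3 k))))
    have hτ1 : ∀ i, τ i = i := by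
      have hmem : ∀ i k, i ≤ k ↔ τ i ≤ k := by
        intro i k
        have : τ i ∈ (Finset.Iic k).map τ.toEmbedding ↔ i ∈ Finset.Iic k :=
          Finset.mem_map' τ.toEmbedding
        rw [hτ, Finset.mem_Iic, Finset.mem_Iic] at this
        exact this.symm
      exact fun i => le_antisymm ((hmem i i).1 le_rfl) ((hmem i (τ i)).2 le_rfl)
    constructor
    · have : (fun i => μ (σ i)) = μ := eq_of_sum_Iic_eq fun k => by
        have ha := h1 k
        have hb := h3 k
        rw [hτ, Finset.sum_map] at ha hb
        exact le_antisymm hb (le_of_add_le_add_left ha)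
      exact congrFun this
    · intro i
      rw [← hμ, hτ1]

end Comb

/-! ### Alternants -/

/-- The alternant `det (φ_{κ_i}(x_j))`. -/
def alt {R : Type*} (φ : R → ℂ → ℂ) (κ : Fin n → R) (x : Fin n → ℂ) : ℂ :=
  (Matrix.of fun i j => φ (κ i) (x j)).det

lemma alt_comp {R : Type*} (φ : R → ℂ → ℂ) (κ : Fin n → R) (τ : Equiv.Perm (Fin n)) :
    alt φ (κ ∘ τ) = ((Equiv.Perm.sign τ : ℤ) : ℂ) • alt φ κ := by
  ext x
  exact Matrix.det_permute τ (Matrix.of fun i j => φ (κ i) (x j))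

lemma alt_eq_zero {R : Type*} (φ : R → ℂ → ℂ) {κ : Fin n → R} (h : ¬ Function.Injective κ) :
    alt φ κ = 0 := by
  simp only [Function.Injective, not_forall] at h
  obtain ⟨i, j, hij, hne⟩ := h
  ext x
  exact Matrix.det_zero_of_row_eq hne (by ext k; simp [hij])

lemma alt_eq_sum {R : Type*} (φ : R → ℂ → ℂ) (κ : Fin n → R) (x : Fin n → ℂ) :
    alt φ κ x = ∑ w : Equiv.Perm (Fin n), ((Equiv.Perm.sign w : ℤ) : ℂ) * ∏ i, φ (κ (w i)) (x i) :=
  by rw [alt, Matrix.det_apply']; rfl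

lemma mem_orbitS {α : Type*} {μ ν : Fin n → α} :
    ν ∈ orbitS μ ↔ ∃ σ : Equiv.Perm (Fin n), μ ∘ σ = ν := by
  simp [orbitS]

lemma orbitS_sum_comp {α M : Type*} [AddCommMonoid M] (μ : Fin n → α) (w : Equiv.Perm (Fin n))
    (F : (Fin n → α) → M) : ∑ ν ∈ orbitS μ, F ν = ∑ ν ∈ orbitS μ, F (ν ∘ w) := by
  classical
  have hmem : ∀ (v : Equiv.Perm (Fin n)) ν, ν ∈ orbitS μ → ν ∘ v ∈ orbitS μ := by
    intro v ν hν
    obtain ⟨σ, rfl⟩ := mem_orbitS.1 hν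
    exact mem_orbitS.2 ⟨σ * v, rfl⟩
  symm
  refine Finset.sum_bij' (fun ν _ => ν ∘ w) (fun ν _ => ν ∘ w.symm) (fun ν hν => hmem w ν hν)
    (fun ν hν => hmem w.symm ν hν) ?_ ?_ ?_
  · intro ν _; ext; simp
  · intro ν _; ext; simp
  · intro ν _; rfl

lemma self_mem_orbitS {α : Type*} (μ : Fin n → α) : μ ∈ orbitS μ := mem_orbitS.2 ⟨1, rfl⟩

/-- Division of a triangular system of functions by a common factor. -/
lemma exists_factor {X I : Type*} [PartialOrder I] [WellFoundedLT I] {A : X → ℂ}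
    {m a : I → X → ℂ} (h : ∀ j, A * m j - a j ∈ Submodule.span ℂ (a '' Set.Iio j)) {i : I}
    {e : ℂ} {U : X → ℂ} (hU : U - e • a i ∈ Submodule.span ℂ (a '' Set.Iio i)) :
    ∃ y ∈ Submodule.span ℂ (m '' Set.Iio i), U = A * (e • m i + y) := by
  have h1 := span_image_Iio_eq (m := fun j => A * m j) h i
  have h2 : U - e • (A * m i) ∈ Submodule.span ℂ ((fun j => A * m j) '' Set.Iio i) := by
    rw [h1]
    have := Submodule.sub_mem _ hU (Submodule.smul_mem _ e (h i))
    convert this using 1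
    module
  have h3 : (fun j => A * m j) '' Set.Iio i = LinearMap.mulLeft ℂ A '' (m '' Set.Iio i) := by
    rw [Set.image_image]; rfl
  rw [h3, Submodule.span_image] at h2
  obtain ⟨y, hy, hyU⟩ := h2
  refine ⟨y, hy, ?_⟩
  rw [LinearMap.mulLeft_apply] at hyU
  rw [mul_add, hyU, mul_smul_comm]
  abel

lemma wellFoundedLT_of_finite_Iic {I : Type*} [PartialOrder I] (h : ∀ i : I, (Set.Iic i).Finite) :
    WellFoundedLT I := by
  have : StrictMono fun i : I => (h i).toFinset.card := fun i j hij => by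
    apply Finset.card_lt_card
    rw [Set.Finite.toFinset_ssubset_toFinset]
    exact Set.Iic_ssubset_Iic.2 hij
  exact this.wellFoundedLT

end KoornA

end

/-! ### Type A: dominance order and triangularity of `D̂'_r`. -/

noncomputable section

namespace KoornA

variable {n : ℕ}

/-! ### Dominant weights of type `A` -/

lemma sum_mul_simpleRoot (μ : Fin n → ℝ) (i : Fin (n - 1)) :
    ∑ j, μ j * simpleRoot i j = μ ⟨i, by omega⟩ - μ ⟨i + 1, by omega⟩ := by
  simp [simpleRoot, mul_sub, Finset.sum_sub_distrib, Pi.single_apply]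

lemma sum_Iic_simpleRoot (i : Fin (n - 1)) (k : Fin n) :
    ∑ j ∈ Finset.Iic k, simpleRoot i j = if (i : ℕ) = k then 1 else 0 := by
  simp only [simpleRoot, Pi.sub_apply, Finset.sum_sub_distrib, Pi.single_apply,
    Finset.sum_ite_eq', Finset.mem_Iic, Fin.le_def]
  split_ifs <;> first | omega | norm_num

/-- Summation by parts: the k-th partial sum of the i-th simple root is 1 for i = k and 0 otherwise,
so the partial sums of μ - ν are its coefficients in simple roots. The last partial sum is the
total, which vanishes. -/
lemma weightLEA_iff {ν μ : Fin n → ℝ} (h : ∑ j, ν j = ∑ j, μ j) : WeightLEA ν μ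
    ↔ ∀ k, ∃ a : ℕ, ∑ j ∈ Finset.Iic k, μ j - ∑ j ∈ Finset.Iic k, ν j = a := by
  have hps : ∀ (a : Fin (n - 1) → ℕ) (k : Fin n),
      ∑ j ∈ Finset.Iic k, (∑ i, (a i : ℝ) • simpleRoot i) j
        = if hk : (k : ℕ) < n - 1 then (a ⟨k, hk⟩ : ℝ) else 0 := by
    intro a k
    simp only [Finset.sum_apply, Pi.smul_apply, smul_eq_mul]
    rw [Finset.sum_comm]
    simp only [← Finset.mul_sum, sum_Iic_simpleRoot]
    split_ifs with hk
    · rw [Finset.sum_eq_single ⟨k, hk⟩]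
      · simp
      · intro b _ hb
        rw [if_neg, mul_zero]
        exact fun h => hb (Fin.ext h)
      · simp
    · refine Finset.sum_eq_zero fun b _ => ?_
      rw [if_neg, mul_zero]
      have := b.2
      omega
  constructor
  · rintro ⟨a, ha⟩ k
    have h1 := hps a k
    rw [← ha] at h1
    simp only [Pi.sub_apply, Finset.sum_sub_distrib] at h1
    rw [h1]
    split_ifs with hk
    · exact ⟨_, rfl⟩
    · exact ⟨0, by simp⟩
  · intro hk
    choose a ha using hk
    refine ⟨fun i => a ⟨i, by omega⟩, eq_of_sum_Iic_eq fun k => ?_⟩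
    rw [hps]
    simp only [Pi.sub_apply, Finset.sum_sub_distrib, ha]
    split_ifs with hk
    · rfl
    · have hI : Finset.Iic k = Finset.univ := by
        ext j
        simp only [Finset.mem_Iic, Finset.mem_univ, iff_true, Fin.le_def]
        omega
      rw [← ha, hI, h, sub_self]

lemma isDomWeightA_iff {μ : Fin n → ℝ} : IsDomWeightA μ ↔ ∑ j, μ j = 0
    ∧ ∀ j k : Fin n, j ≤ k → ∃ a : ℕ, μ j - μ k = a := by
  refine and_congr_right fun _ => ?_
  simp only [sum_mul_simpleRoot]
  constructor
  · intro h j k hjk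
    obtain ⟨d, hd⟩ := Nat.exists_eq_add_of_le (Fin.le_def.1 hjk)
    induction d generalizing k with
    | zero => exact ⟨0, by simp [Fin.ext (by omega : (k : ℕ) = j)]⟩
    | succ d ih =>
      obtain ⟨a, ha⟩ := ih ⟨j + d, by omega⟩ (Fin.le_def.2 (by simp)) rfl
      obtain ⟨b, hb⟩ := h ⟨j + d, by omega⟩
      have hk : μ k = μ ⟨j + d + 1, by omega⟩ := congrArg μ (Fin.ext (by simp; omega))
      refine ⟨a + b, ?_⟩
      push_cast
      rw [← ha, ← hb, hk]
      ring
  · intro h i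
    exact h _ _ (Fin.le_def.2 (by simp))

lemma IsDomWeightA.antitone {μ : Fin n → ℝ} (h : IsDomWeightA μ) : Antitone μ := by
  intro j k hjk
  obtain ⟨a, ha⟩ := (isDomWeightA_iff.1 h).2 j k hjk
  have : (0 : ℝ) ≤ a := Nat.cast_nonneg a
  linarith

/-- The dominant weights of type `A_{n-1}`, with their partial order. -/
@[ext]
structure DomA (n : ℕ) where
  val : Fin n → ℝ
  prop : IsDomWeightA val

lemma DomA.le_iff {μ ν : DomA n} : WeightLEA ν.1 μ.1
    ↔ ∀ k, ∃ a : ℕ, ∑ j ∈ Finset.Iic k, μ.1 j - ∑ j ∈ Finset.Iic k, ν.1 j = a :=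
  weightLEA_iff (by rw [ν.2.1, μ.2.1])

instance : PartialOrder (DomA n) where
  le ν μ := WeightLEA ν.1 μ.1
  le_refl μ := DomA.le_iff.2 fun k => ⟨0, by simp⟩
  le_trans μ ν κ h1 h2 := by
    rw [DomA.le_iff] at h1 h2 ⊢
    intro k
    obtain ⟨a, ha⟩ := h1 k
    obtain ⟨b, hb⟩ := h2 k
    exact ⟨a + b, by push_cast; linarith⟩
  le_antisymm μ ν h1 h2 := by
    rw [DomA.le_iff] at h1 h2
    refine DomA.ext (eq_of_sum_Iic_eq fun k => ?_)
    obtain ⟨a, ha⟩ := h1 k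
    obtain ⟨b, hb⟩ := h2 k
    have ha' : (0 : ℝ) ≤ a := Nat.cast_nonneg a
    have hb' : (0 : ℝ) ≤ b := Nat.cast_nonneg b
    linarith

lemma DomA.le_def {μ ν : DomA n} : ν ≤ μ ↔ WeightLEA ν.1 μ.1 := Iff.rfl

lemma WeightLEA.exists_int {ν μ : Fin n → ℝ} (h : WeightLEA ν μ) (j : Fin n) :
    ∃ z : ℤ, ν j = μ j + z := by
  obtain ⟨a, ha⟩ := h
  have h1 := congrFun ha j
  simp only [Pi.sub_apply, Finset.sum_apply, Pi.smul_apply, smul_eq_mul] at h1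
  refine ⟨-∑ i, (a i : ℤ) * ((if (j : ℕ) = i then 1 else 0) - if (j : ℕ) = i + 1 then 1 else 0),
    ?_⟩
  have h2 : ∀ i, simpleRoot i j
      = (if (j : ℕ) = i then 1 else 0) - if (j : ℕ) = i + 1 then 1 else 0 := by
    intro i
    simp only [simpleRoot, Pi.sub_apply, Pi.single_apply, Fin.ext_iff]
  simp only [h2] at h1
  push_cast
  linarith

/-- A smaller dominant ν has all entries at most ν_1 ≤ μ_1, hence also bounded below because they
sum to 0; and ν - μ is integral. -/
lemma DomA.finite_Iic (μ : DomA n) : (Set.Iic μ).Finite := by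
  rcases Nat.eq_zero_or_pos n with rfl | hn
  · have : Subsingleton (DomA 0) := ⟨fun a b => DomA.ext (Subsingleton.elim _ _)⟩
    exact Set.toFinite _
  let j0 : Fin n := ⟨0, hn⟩
  obtain ⟨M, hM⟩ := exists_nat_gt (∑ j, |μ.1 j| + n * |μ.1 j0|)
  have hmuM : ∀ j, |μ.1 j| + n * |μ.1 j0| ≤ M := fun j => by
    have := Finset.single_le_sum (f := fun j => |μ.1 j|) (fun j _ => abs_nonneg _)
      (Finset.mem_univ j)
    linarith
  have hfin : (Set.Icc (fun _ : Fin n => -(M : ℤ)) (fun _ => (M : ℤ))).Finite := Set.finite_Icc _ _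
  refine Set.Finite.of_finite_image (f := fun ν : DomA n => ν.1)
    ((hfin.image fun z : Fin n → ℤ => fun j => μ.1 j + (z j : ℝ)).subset ?_)
    (fun a _ b _ h => DomA.ext h)
  rintro _ ⟨ν, hν, rfl⟩
  have hν' : WeightLEA ν.1 μ.1 := hν
  choose z hz using hν'.exists_int
  refine ⟨z, ?_, funext fun j => (hz j).symm⟩
  have h0 : ν.1 j0 ≤ μ.1 j0 := by
    obtain ⟨a, ha⟩ := DomA.le_iff.1 hν' j0
    have hI : Finset.Iic j0 = {j0} := by
      ext j
      simp only [Finset.mem_Iic, Finset.mem_singleton, Fin.le_def, Fin.ext_iff, j0]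
      omega
    rw [hI, Finset.sum_singleton, Finset.sum_singleton] at ha
    have ha' : (0 : ℝ) ≤ a := Nat.cast_nonneg a
    linarith
  have hup : ∀ j, ν.1 j ≤ |μ.1 j0| := fun j =>
    ((ν.2.antitone (Fin.le_def.2 (by simp [j0]))).trans h0).trans (le_abs_self _)
  have hn1 : (1 : ℝ) ≤ n := by exact_mod_cast hn
  have hlow : ∀ j, -(n * |μ.1 j0|) ≤ ν.1 j := by
    intro j
    have hs := ν.2.1
    rw [← Finset.add_sum_erase _ _ (Finset.mem_univ j)] at hs
    have h3 : ∑ k ∈ Finset.univ.erase j, ν.1 k ≤ ∑ k ∈ Finset.univ.erase j, |μ.1 j0| :=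
      Finset.sum_le_sum fun k _ => hup k
    rw [Finset.sum_const, Finset.card_erase_of_mem (Finset.mem_univ j), Finset.card_univ,
      Fintype.card_fin, nsmul_eq_mul, Nat.cast_sub hn] at h3
    have := abs_nonneg (μ.1 j0)
    push_cast at h3
    nlinarith
  have hz2 : ∀ j, |(z j : ℝ)| ≤ M := by
    intro j
    rw [abs_le]
    have h4 := hmuM j
    have h5 := hup j
    have h6 := hlow j
    have h7 := hz j
    have h8 := abs_le.1 (le_refl |μ.1 j|)
    have h9 := abs_nonneg (μ.1 j0)
    constructor <;> nlinarith
  constructor <;> intro j <;> have := abs_le.1 (hz2 j)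
  · exact_mod_cast this.1
  · exact_mod_cast this.2

instance : WellFoundedLT (DomA n) := wellFoundedLT_of_finite_Iic DomA.finite_Iic

/-! ### Triangularity of the operators of type `A` -/

/-- The half sum of the positive roots. -/
def rhoHalf (n : ℕ) (j : Fin n) : ℝ := (n - 1) / 2 - j

lemma rhoHalf_strictAnti : StrictAnti (rhoHalf n) := by
  intro i j hij
  have : (i : ℝ) < j := by exact_mod_cast hij
  simp only [rhoHalf]
  linarith

lemma sum_rhoHalf : ∑ j, rhoHalf n j = 0 := by
  have h : ∑ j : Fin n, rhoHalf n j = ∑ j : Fin n, rhoHalf n (Fin.rev j) :=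
    (Equiv.sum_comp Fin.revPerm (rhoHalf n)).symm
  have h2 : ∑ j : Fin n, rhoHalf n (Fin.rev j) = ∑ j : Fin n, -rhoHalf n j := by
    refine Finset.sum_congr rfl fun j _ => ?_
    simp only [rhoHalf, Fin.val_rev]
    rw [Nat.cast_sub (by omega)]
    push_cast
    ring
  rw [h2, Finset.sum_neg_distrib] at h
  linarith

/-- The exponentials in one variable. -/
def ex1 (k : ℝ) (z : ℂ) : ℂ := Complex.exp (Complex.I * k * z)

lemma prod_ex1 (κ : Fin n → ℝ) (x : Fin n → ℂ) : ∏ i, ex1 (κ i) (x i) = ex κ x := by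
  simp only [ex1, ex, expo, ← Complex.exp_sum, Finset.mul_sum, mul_assoc]

lemma ex_add (μ ν : Fin n → ℝ) (x : Fin n → ℂ) : ex (μ + ν) x = ex μ x * ex ν x := by
  rw [ex, ex, ex, ← expo_add]
  congr 1
  ext j
  simp

lemma alt_ex1 (κ : Fin n → ℝ) (x : Fin n → ℂ) :
    alt ex1 κ x = ∑ w : Equiv.Perm (Fin n), ((Equiv.Perm.sign w : ℤ) : ℂ) * ex (κ ∘ w) x := by
  rw [alt_eq_sum]
  simp only [← prod_ex1, Function.comp]

/-- The Weyl denominator of type `A`. -/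
def denomA (x : Fin n → ℂ) : ℂ := alt ex1 (rhoHalf n) x

/-- The alternants `a_{ρ+μ}`. -/
def altA (μ : Fin n → ℝ) : (Fin n → ℂ) → ℂ := alt ex1 (rhoHalf n + μ)

/-- Weyl's denominator formula. The exponents (n-1)/2 - i give a Vandermonde determinant in
e^{-ix_j}; its prefactors cancel the half exponentials of the sines, of which each j meets n - 1. -/
lemma denomA_eq_prod (x : Fin n → ℂ) : denomA x
    = ∏ j : Fin n, ∏ k ∈ Finset.Ioi j, 2 * Complex.I * Complex.sin ((x j - x k) / 2) := by
  have h1 : (Matrix.of fun i j => ex1 (rhoHalf n i) (x j))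
      = Matrix.of fun i j => Complex.exp (Complex.I * ((n - 1) / 2) * x j)
        * (Matrix.vandermonde fun j => Complex.exp (-(Complex.I * x j))).transpose i j := by
    ext i j
    simp only [Matrix.of_apply, Matrix.transpose_apply, Matrix.vandermonde_apply, ex1, rhoHalf,
      ← Complex.exp_nat_mul, ← Complex.exp_add]
    congr 1
    push_cast
    ring
  have h2 : ∀ j k, Complex.exp (-(Complex.I * x k)) - Complex.exp (-(Complex.I * x j))
      = Complex.exp (-(Complex.I * x j / 2)) * Complex.exp (-(Complex.I * x k / 2))
        * (2 * Complex.I * Complex.sin ((x j - x k) / 2)) := by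
    intro j k
    rw [Complex.sin, show ∀ a b c : ℂ, a * b * (2 * Complex.I * (c * Complex.I / 2))
      = -(a * b * c) * -(Complex.I * Complex.I) by intros; ring, Complex.I_mul_I, mul_sub,
      ← Complex.exp_add, ← Complex.exp_add, ← Complex.exp_add]
    ring_nf
  have h3 : ∏ j : Fin n, ∏ k ∈ Finset.Ioi j,
      Complex.exp (-(Complex.I * x j / 2)) * Complex.exp (-(Complex.I * x k / 2))
      = ∏ j : Fin n, Complex.exp (-(Complex.I * x j / 2)) ^ (n - 1) := by
    have := Finset.prod_prod_Ioi_mul_eq_prod_prod_off_diag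
      fun (j k : Fin n) => Complex.exp (-(Complex.I * x k / 2))
    rw [this]
    refine Finset.prod_congr rfl fun j _ => ?_
    rw [Finset.prod_const, Finset.card_compl]
    simp
  rw [denomA, alt, h1, Matrix.det_mul_row, Matrix.det_transpose, Matrix.det_vandermonde]
  simp only [h2]
  rw [Finset.prod_congr rfl fun j _ => Finset.prod_mul_distrib (s := Finset.Ioi j)
    (f := fun k => Complex.exp (-(Complex.I * x j / 2)) * Complex.exp (-(Complex.I * x k / 2))),
    Finset.prod_mul_distrib, h3, ← mul_assoc, ← Finset.prod_mul_distrib, Finset.prod_eq_one, one_mul]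
  intro j _
  rw [← Complex.exp_nat_mul, ← Complex.exp_add, Nat.cast_sub (by have := j.2; omega)]
  push_cast
  ring_nf
  simp

/-- The points at which the operators of type `A` have no poles. -/
def RegA (x : Fin n → ℂ) : Prop := ∀ j k : Fin n, j ≠ k → Complex.sin ((x j - x k) / 2) ≠ 0

lemma denomA_ne_zero {x : Fin n → ℂ} (hx : RegA x) : denomA x ≠ 0 := by
  rw [denomA_eq_prod]
  refine Finset.prod_ne_zero_iff.2 fun j _ => Finset.prod_ne_zero_iff.2 fun k hk => ?_
  have := hx j k (Finset.mem_Ioi.1 hk).ne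
  simp [this]

/-- The denominators sin(z/2) of the v_a cancel against the product formula, and the numerators are
the same sines at the shifted arguments. The coefficient of each shift thus becomes a translate of
the Weyl denominator itself, by iβg along J. -/
lemma denomA_mul_va (p : Params) {x : Fin n → ℂ} (hx : RegA x) (J : Finset (Fin n)) :
    denomA x * ∏ j ∈ J, ∏ k ∈ Jᶜ, va p (x j - x k)
      = denomA fun j => x j + if j ∈ J then Complex.I * p.β * p.g else 0 := by
  rw [denomA_eq_prod, denomA_eq_prod, prod_cross, ← Finset.prod_mul_distrib]
  refine Finset.prod_congr rfl fun j _ => ?_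
  rw [← Finset.prod_mul_distrib]
  refine Finset.prod_congr rfl fun k hk => ?_
  have h1 := hx j k (Finset.mem_Ioi.1 hk).ne
  have h2 := hx k j (Finset.mem_Ioi.1 hk).ne'
  have h3 : ∀ z : ℂ, Complex.sin (z / 2) ≠ 0 → Complex.sin (z / 2) * va p z
      = Complex.sin ((Complex.I * p.β * p.g + z) / 2) := by
    intro z hz
    rw [va]; field_simp
  by_cases hj : j ∈ J <;> by_cases hk : k ∈ J <;> simp only [hj, hk, if_true, if_false,
    not_true, not_false_iff, and_self, and_true, and_false, mul_one]
  · ring_nf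
  · rw [mul_assoc, h3 _ h1]
    ring_nf
  · rw [show (x j - x k) / 2 = -((x k - x j) / 2) by ring, Complex.sin_neg, mul_neg, neg_mul,
      mul_assoc, h3 _ h2, ← mul_neg, ← Complex.sin_neg]
    ring_nf
  · simp

/-- The elementary symmetric functions of `exp (-β θ_j)`. -/
def esA (p : Params) (r : ℕ) (θ : Fin n → ℝ) : ℝ :=
  ∑ J ∈ Finset.powersetCard r (Finset.univ : Finset (Fin n)), ∏ j ∈ J, Real.exp (-p.β * θ j)

lemma esA_eq_esymm (p : Params) (r : ℕ) (θ : Fin n → ℝ) : esA p r θ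
    = (Multiset.map (fun j => Real.exp (-p.β * θ j)) (Finset.univ : Finset (Fin n)).val).esymm r :=
  (Finset.esymm_map_val _ _ _).symm

lemma esA_comp (p : Params) (r : ℕ) (θ : Fin n → ℝ) (w : Equiv.Perm (Fin n)) :
    esA p r (θ ∘ w) = esA p r θ := by
  rw [esA_eq_esymm, esA_eq_esymm]
  congr 1
  have : (Finset.univ : Finset (Fin n)).val.map w = (Finset.univ : Finset (Fin n)).val := by
    have := congrArg Finset.val (Finset.map_univ_equiv w)
    rwa [Finset.map_val] at this
  conv_rhs => rw [← this, Multiset.map_map]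
  rfl

/-- Replacing α by α ∘ w within its orbit makes the exponent (ρ + α) ∘ w, and the sum over w is then
an alternant; the invariance of F keeps its value unchanged. -/
lemma alt_mul_monoA (μ : Fin n → ℝ) (F : (Fin n → ℝ) → (Fin n → ℝ) → ℂ)
    (hF : ∀ (α κ : Fin n → ℝ) (w : Equiv.Perm (Fin n)), F (α ∘ w) (κ ∘ w) = F α κ)
    (x : Fin n → ℂ) :
    ∑ w : Equiv.Perm (Fin n), ∑ α ∈ orbitS μ, ((Equiv.Perm.sign w : ℤ) : ℂ)
        * F (rhoHalf n ∘ w) α * (ex (rhoHalf n ∘ w) x * ex α x)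
      = ∑ α ∈ orbitS μ, F (rhoHalf n) α * altA α x := by
  have h : ∀ w : Equiv.Perm (Fin n), ∑ α ∈ orbitS μ, ((Equiv.Perm.sign w : ℤ) : ℂ)
        * F (rhoHalf n ∘ w) α * (ex (rhoHalf n ∘ w) x * ex α x)
      = ∑ α ∈ orbitS μ, F (rhoHalf n) α * (((Equiv.Perm.sign w : ℤ) : ℂ)
        * ex ((rhoHalf n + α) ∘ w) x) := by
    intro w
    rw [orbitS_sum_comp μ w]
    refine Finset.sum_congr rfl fun α _ => ?_
    rw [hF, ← ex_add]
    have : rhoHalf n ∘ w + α ∘ w = (rhoHalf n + α) ∘ w := rfl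
    rw [this]
    ring
  simp only [h]
  rw [Finset.sum_comm]
  refine Finset.sum_congr rfl fun α _ => ?_
  rw [← Finset.mul_sum, altA, alt_ex1]

lemma denomA_mul_monoA (μ : Fin n → ℝ) :
    denomA * monoA μ = ∑ α ∈ orbitS μ, altA α := by
  ext x
  have h := alt_mul_monoA μ (fun _ _ => 1) (fun _ _ _ => rfl) x
  simp only [one_mul, mul_one] at h
  rw [Finset.sum_apply, ← h, Pi.mul_apply, denomA, alt_ex1, monoA, Finset.sum_mul_sum]
  refine Finset.sum_congr rfl fun w _ => Finset.sum_congr rfl fun α _ => ?_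
  rw [ex, ex]
  ring

lemma ex_shift (p : Params) (κ : Fin n → ℝ) (x : Fin n → ℂ) (J : Finset (Fin n)) (a : ℝ) :
    ex κ (fun j => x j + if j ∈ J then Complex.I * p.β * a else 0)
      = (∏ j ∈ J, Real.exp (-p.β * (a * κ j)) : ℝ) * ex κ x := by
  rw [← Real.exp_sum, Complex.ofReal_exp, ex, ex, expo, expo, ← Complex.exp_add]
  congr 1
  have : ∑ j, (κ j : ℂ) * (x j + if j ∈ J then Complex.I * p.β * a else 0)
      = ∑ j, (κ j : ℂ) * x j + Complex.I * p.β * a * ∑ j ∈ J, (κ j : ℂ) := by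
    rw [Finset.mul_sum, ← Finset.sum_filter_add_sum_filter_not Finset.univ (· ∈ J)
      (fun j => (κ j : ℂ) * (x j + if j ∈ J then Complex.I * p.β * a else 0))]
    rw [← Finset.sum_filter_add_sum_filter_not Finset.univ (· ∈ J) (fun j => (κ j : ℂ) * x j)]
    have e : Finset.univ.filter (· ∈ J) = J := by ext; simp
    rw [e, add_right_comm, ← Finset.sum_add_distrib]
    congr 1
    · refine Finset.sum_congr rfl fun j hj => ?_
      simp only [hj, if_true]
      ring
    · refine Finset.sum_congr rfl fun j hj => ?_
      simp only [(Finset.mem_filter.1 hj).2, if_false, add_zero]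
  rw [this]
  push_cast
  rw [← Finset.mul_sum, ← Finset.mul_sum]
  linear_combination ((p.β : ℂ) * a * ∑ j ∈ J, (κ j : ℂ)) * Complex.I_sq

/-- The exponentials of the denominator are translated by iβg and those of the orbit sum by iβ along
J, which produces the product of e^{-β(gρ_j + α_j)} over J. Summation over J gives an elementary
symmetric function. -/
lemma denomA_mul_Dprime (p : Params) (r : ℕ) (μ : Fin n → ℝ) {x : Fin n → ℂ} (hx : RegA x) :
    denomA x * Dprime p r (monoA μ) x
      = ∑ α ∈ orbitS μ, (esA p r (fun j => p.g * rhoHalf n j + α j) : ℂ) * altA α x := by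
  rw [← alt_mul_monoA μ (fun ρ α => (esA p r (fun j => p.g * ρ j + α j) : ℂ))
    (fun α κ w => by exact_mod_cast esA_comp p r (fun j => p.g * α j + κ j) w) x]
  have hJ : ∀ J : Finset (Fin n), denomA x * ((∏ j ∈ J, ∏ k ∈ Jᶜ, va p (x j - x k))
      * monoA μ (shiftPt p (fun _ => 1) J x))
      = ∑ w : Equiv.Perm (Fin n), ∑ α ∈ orbitS μ, ((Equiv.Perm.sign w : ℤ) : ℂ)
        * ((∏ j ∈ J, Real.exp (-p.β * (p.g * (rhoHalf n ∘ w) j + α j)) : ℝ) : ℂ)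
          * (ex (rhoHalf n ∘ w) x * ex α x) := by
    intro J
    have hs : shiftPt p (fun _ => 1) J x
        = fun j => x j + if j ∈ J then Complex.I * p.β * (1 : ℝ) else 0 := by
      ext j
      rw [shiftPt_one]
      split_ifs <;> simp
    rw [← mul_assoc, denomA_mul_va p hx, denomA, alt_ex1, hs, monoA, Finset.sum_mul_sum]
    refine Finset.sum_congr rfl fun w _ => Finset.sum_congr rfl fun α _ => ?_
    change _ * ex α _ = _
    rw [ex_shift, ex_shift]
    have : ∏ j ∈ J, Real.exp (-p.β * (p.g * (rhoHalf n ∘ w) j + α j))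
        = (∏ j ∈ J, Real.exp (-p.β * (p.g * (rhoHalf n ∘ w) j)))
          * ∏ j ∈ J, Real.exp (-p.β * (1 * α j)) := by
      rw [← Finset.prod_mul_distrib]
      refine Finset.prod_congr rfl fun j _ => ?_
      rw [← Real.exp_add]
      ring_nf
    rw [this]
    push_cast
    ring
  rw [Dprime, Finset.mul_sum, Finset.sum_congr rfl fun J _ => hJ J, Finset.sum_comm]
  refine Finset.sum_congr rfl fun w _ => ?_
  rw [Finset.sum_comm]
  refine Finset.sum_congr rfl fun α _ => ?_
  rw [esA]
  push_cast
  rw [Finset.mul_sum, Finset.sum_mul]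

/-- Straightening: the alternant vanishes if ρ + α has equal entries; otherwise sorting changes only
its sign, and `sort_dominance` shows that the sorted exponent belongs to a smaller dominant weight.
-/
lemma altA_mem (μ : DomA n) {α : Fin n → ℝ} (hα : α ∈ orbitS μ.1) (hne : α ≠ μ.1) :
    altA α ∈ Submodule.span ℂ ((fun ν : DomA n => altA ν.1) '' Set.Iio μ) := by
  obtain ⟨σ, hσ⟩ := mem_orbitS.1 hα
  by_cases hinj : Function.Injective (rhoHalf n + α)
  swap
  · rw [altA, alt_eq_zero _ hinj]
    exact Submodule.zero_mem _
  obtain ⟨τ, hτ⟩ := exists_sort_strictAnti hinj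
  set ν : Fin n → ℝ := fun i => (rhoHalf n + α) (τ i) - rhoHalf n i with hν
  have hμ := isDomWeightA_iff.1 μ.2
  have hint : ∀ i j, ∃ z : ℤ, α i - α j = z := by
    intro i j
    rw [← hσ]
    simp only [Function.comp]
    rcases le_total (σ i) (σ j) with h | h
    · obtain ⟨a, ha⟩ := hμ.2 _ _ h
      exact ⟨a, by simpa using ha⟩
    · obtain ⟨a, ha⟩ := hμ.2 _ _ h
      exact ⟨-a, by push_cast; linarith⟩
  have hsum : ∑ i, ν i = 0 := by
    rw [hν, Finset.sum_sub_distrib, Equiv.sum_comp τ (rhoHalf n + α)]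
    simp only [Pi.add_apply, Finset.sum_add_distrib, ← hσ, Function.comp]
    rw [Equiv.sum_comp σ μ.1, μ.2.1]
    ring
  have hdom : IsDomWeightA ν := by
    refine ⟨hsum, fun i => ?_⟩
    rw [sum_mul_simpleRoot]
    have hlt := hτ (show (⟨i, by omega⟩ : Fin n) < ⟨i + 1, by omega⟩ from by simp [Fin.lt_def])
    obtain ⟨z, hz⟩ := hint (τ ⟨i, by omega⟩) (τ ⟨i + 1, by omega⟩)
    have hval : ν ⟨i, by omega⟩ - ν ⟨i + 1, by omega⟩
        = (z - ((τ ⟨i, by omega⟩ : ℕ) : ℤ) + ((τ ⟨i + 1, by omega⟩ : ℕ) : ℤ) - 1 : ℤ) := by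
      push_cast
      rw [← hz]
      simp only [hν, Pi.add_apply, rhoHalf]
      push_cast
      ring
    have hpos : (0 : ℝ) < (z - ((τ ⟨i, by omega⟩ : ℕ) : ℤ) + ((τ ⟨i + 1, by omega⟩ : ℕ) : ℤ) : ℤ) := by
      push_cast
      rw [← hz]
      simp only [Function.comp, Pi.add_apply, rhoHalf] at hlt
      linarith
    rw [Int.cast_pos] at hpos
    obtain ⟨a, ha⟩ := Int.eq_ofNat_of_zero_le (Int.le_sub_one_of_lt hpos)
    refine ⟨a, ?_⟩
    rw [hval, ha]
    simp
  obtain ⟨hle, heq⟩ := sort_dominance (κ := rhoHalf n + α) rhoHalf_strictAnti μ.2.antitone σ τ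
    (μ := ν) (fun i => by rw [← hσ]; simp) (fun i => by simp [hν])
  -- The case of equality in `sort_dominance` would give α = μ.
  have hνμ : ν ≠ μ.1 := fun h => hne (by rw [← hσ]; exact funext (heq h).1)
  have hlt : (⟨ν, hdom⟩ : DomA n) < μ := by
    refine lt_of_le_of_ne ?_ fun h => hνμ (congrArg DomA.val h)
    rw [DomA.le_def, DomA.le_iff]
    intro k
    have hz : ∃ z : ℤ, ∑ j ∈ Finset.Iic k, μ.1 j - ∑ j ∈ Finset.Iic k, ν j = z := by
      have : ∀ j, ∃ z : ℤ, μ.1 j - ν j = z := by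
        intro j
        obtain ⟨z, hz⟩ := hint (σ⁻¹ j) (τ j)
        rw [← hσ] at hz
        have hσj : σ (σ⁻¹ j) = j := σ.apply_symm_apply j
        simp only [Function.comp, hσj] at hz
        refine ⟨z + ((τ j : ℕ) : ℤ) - ((j : ℕ) : ℤ), ?_⟩
        push_cast
        simp only [hν, Pi.add_apply, rhoHalf, ← hz, ← hσ, Function.comp]
        ring
      choose z hz using this
      refine ⟨∑ j ∈ Finset.Iic k, z j, ?_⟩
      rw [← Finset.sum_sub_distrib, Finset.sum_congr rfl fun j _ => hz j]
      push_cast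
      rfl
    obtain ⟨z, hz⟩ := hz
    have h0 : (0 : ℝ) ≤ z := by
      rw [← hz]
      exact sub_nonneg.2 (hle k)
    obtain ⟨a, ha⟩ := Int.eq_ofNat_of_zero_le (by exact_mod_cast h0 : (0 : ℤ) ≤ z)
    exact ⟨a, by rw [hz, ha]; simp⟩
  have hcomp : (rhoHalf n + α) ∘ τ = rhoHalf n + ν := by
    ext i
    simp [hν]
  have h1 := alt_comp ex1 (rhoHalf n + α) τ
  rw [hcomp] at h1
  have h2 : altA α = ((Equiv.Perm.sign τ : ℤ) : ℂ) • altA ν := by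
    rw [altA, altA, h1, smul_smul, ← Int.cast_mul, ← Units.val_mul, Int.units_mul_self]
    simp
  rw [h2]
  exact Submodule.smul_mem _ _ (Submodule.subset_span ⟨⟨ν, hdom⟩, hlt, rfl⟩)

/-- Multiplied by the Weyl denominator, both m_μ and its image are combinations of alternants whose
top term is a_{ρ+μ}. The term α = μ supplies the eigenvalue; all others are lower by `altA_mem`, and
the denominator is divided out at regular points. -/
theorem Dprime_triangular (p : Params) (r : ℕ) (μ : DomA n) :
    ∃ y ∈ Submodule.span ℂ ((fun ν : DomA n => monoA ν.1) '' Set.Iio μ), ∀ x, RegA x →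
      Dprime p r (monoA μ.1) x
        = (esA p r (fun j => p.g * rhoHalf n j + μ.1 j) : ℂ) * monoA μ.1 x + y x := by
  classical
  have hm : ∀ ν : DomA n, denomA * monoA ν.1 - altA ν.1
      ∈ Submodule.span ℂ ((fun ν : DomA n => altA ν.1) '' Set.Iio ν) := by
    intro ν
    rw [denomA_mul_monoA, ← Finset.add_sum_erase _ _ (self_mem_orbitS ν.1), add_sub_cancel_left]
    exact Submodule.sum_mem _ fun α hα => altA_mem ν (Finset.mem_of_mem_erase hα)
      (Finset.ne_of_mem_erase hα)
  have hU : (∑ α ∈ orbitS μ.1, (esA p r (fun j => p.g * rhoHalf n j + α j) : ℂ) • altA α)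
      - (esA p r (fun j => p.g * rhoHalf n j + μ.1 j) : ℂ) • altA μ.1
      ∈ Submodule.span ℂ ((fun ν : DomA n => altA ν.1) '' Set.Iio μ) := by
    rw [← Finset.add_sum_erase _ _ (self_mem_orbitS μ.1), add_sub_cancel_left]
    exact Submodule.sum_mem _ fun α hα => Submodule.smul_mem _ _
      (altA_mem μ (Finset.mem_of_mem_erase hα) (Finset.ne_of_mem_erase hα))
  obtain ⟨y, hy, hyU⟩ := exists_factor hm hU
  refine ⟨y, hy, fun x hx => ?_⟩
  have h1 := denomA_mul_Dprime p r μ.1 hx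
  have h2 := congrFun hyU x
  simp only [Finset.sum_apply, Pi.smul_apply, smul_eq_mul, Pi.mul_apply, Pi.add_apply] at h2
  rw [h2] at h1
  exact mul_left_cancel₀ (denomA_ne_zero hx) h1

end KoornA

end

/-! ### The contour shift: symmetry of difference operators with product weights. -/

noncomputable section

namespace KoornA

open MeasureTheory

/-! ### Analytic factors of the weight functions -/

/-- The product `v d` of an elementary factor and of the corresponding factor of the weight,
up to a constant, continued to the strip. -/
def Fs (p : Params) (c κ : ℝ) (z : ℂ) : ℂ :=
  if κ = 0 then 1 else
    qPoch p (c * (p.q * Complex.exp (Complex.I * z))) * qPoch p (c * Complex.exp (-(Complex.I * z)))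
      / (qPoch p (c * Real.exp (-p.β * κ) * (p.q * Complex.exp (Complex.I * z)))
        * qPoch p (c * Real.exp (-p.β * κ) * Complex.exp (-(Complex.I * z))))

/-- A factor of the weight, on the real line. -/
def wfac (p : Params) (c κ : ℝ) (t : ℝ) : ℝ :=
  if κ = 0 then 1 else Complex.normSq (dfac p c κ t)

section

variable {p : Params} {c κ : ℝ}

lemma norm_exp_I_mul (z : ℂ) : ‖Complex.exp (Complex.I * z)‖ = Real.exp (-z.im) := by
  rw [Complex.norm_exp]; simp

lemma norm_exp_neg_I_mul (z : ℂ) : ‖Complex.exp (-(Complex.I * z))‖ = Real.exp z.im := by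
  rw [Complex.norm_exp]; simp

lemma norm_cτ_lt (hp : p.Admissible) (hc : |c| ≤ 1) (hκ : 0 ≤ κ)
    (h0 : κ ≠ 0) : ‖(c : ℂ) * Real.exp (-p.β * κ)‖ < 1 := by
  rw [norm_mul, Complex.norm_real, Complex.norm_real, Real.norm_eq_abs, Real.norm_eq_abs,
    abs_of_pos (Real.exp_pos _)]
  have : Real.exp (-p.β * κ) < 1 := by
    rw [Real.exp_lt_one_iff]
    have := hp.β_pos
    have : 0 < κ := lt_of_le_of_ne hκ h0.symm
    nlinarith
  nlinarith [abs_nonneg c, Real.exp_pos (-p.β * κ)]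

/-- In the strip both q e^{iz} and e^{-iz} have modulus at most 1, and |cτ| < 1 keeps the
denominators away from 0. For κ = 0 one has τ = 1 and this fails on the boundary, but there
numerator and denominator agree, whence the value 1 prescribed in `Fs`. -/
lemma Fs_differentiableAt (hp : p.Admissible) (hc : |c| ≤ 1) (hκ : 0 ≤ κ)
    {z : ℂ} (hz : z ∈ strip p.β) : DifferentiableAt ℂ (Fs p c κ) z := by
  by_cases h0 : κ = 0
  · have : Fs p c κ = fun _ => 1 := by ext; simp [Fs, h0]
    rw [this]
    exact differentiableAt_const _
  have hq := qPoch_differentiable hp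
  have hlt := norm_cτ_lt hp hc hκ h0
  have hF : Fs p c κ = fun z => qPoch p (c * (p.q * Complex.exp (Complex.I * z)))
      * qPoch p (c * Complex.exp (-(Complex.I * z)))
      / (qPoch p (c * Real.exp (-p.β * κ) * (p.q * Complex.exp (Complex.I * z)))
        * qPoch p (c * Real.exp (-p.β * κ) * Complex.exp (-(Complex.I * z)))) := by
    ext; rw [Fs, if_neg h0]
  rw [hF]
  refine DifferentiableAt.div ?_ ?_ (mul_ne_zero ?_ ?_)
  · exact (by fun_prop : Differentiable ℂ _) _
  · exact (by fun_prop : Differentiable ℂ _) _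
  · refine qPoch_ne_zero hp ?_
    rw [norm_mul, norm_mul (p.q : ℂ), norm_exp_I_mul, Complex.norm_real, Real.norm_eq_abs,
      abs_of_pos p.q_pos, Params.q, ← Real.exp_add]
    have : Real.exp (-p.β + -z.im) ≤ 1 := Real.exp_le_one_iff.2 (by linarith [hz.1])
    nlinarith [norm_nonneg ((c : ℂ) * Real.exp (-p.β * κ)), Real.exp_pos (-p.β + -z.im)]
  · refine qPoch_ne_zero hp ?_
    rw [norm_mul, norm_exp_neg_I_mul]
    have : Real.exp z.im ≤ 1 := Real.exp_le_one_iff.2 hz.2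
    nlinarith [norm_nonneg ((c : ℂ) * Real.exp (-p.β * κ)), Real.exp_pos z.im]

lemma dfac_continuous (hp : p.Admissible) (hc : |c| ≤ 1) (hκ : 0 ≤ κ)
    (h0 : κ ≠ 0) : Continuous fun t : ℝ => dfac p c κ t := by
  have hq := (qPoch_differentiable hp).continuous
  have hlt := norm_cτ_lt hp hc hκ h0
  unfold dfac
  refine Continuous.div (by fun_prop) (by fun_prop) fun t => qPoch_ne_zero hp ?_
  rw [norm_mul, norm_exp_I_mul]
  simpa using hlt

lemma wfac_continuous (hp : p.Admissible) (hc : |c| ≤ 1) (hκ : 0 ≤ κ)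
    : Continuous (wfac p c κ) := by
  by_cases h0 : κ = 0
  · have : wfac p c κ = fun _ => 1 := by ext; simp [wfac, h0]
    rw [this]
    exact continuous_const
  · have : wfac p c κ = fun t : ℝ => Complex.normSq (dfac p c κ t) := by
      ext; rw [wfac, if_neg h0]
    rw [this]
    exact Complex.continuous_normSq.comp (dfac_continuous hp hc hκ h0)

lemma qPoch_real_ne_zero (hp : p.Admissible) (hc : |c| ≤ 1) {t : ℝ} (h1 : (c : ℂ) * Complex.exp (Complex.I * t) ≠ 1) :
    qPoch p (c * Complex.exp (Complex.I * t)) ≠ 0 := by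
  refine qPoch_ne_zero' hp ?_ h1
  rw [norm_mul, norm_exp_I_mul]
  simpa using hc

lemma qPoch_den_ne_zero (hp : p.Admissible) (hc : |c| ≤ 1) (hκ : 0 ≤ κ)
    {t : ℝ} (h1 : (c : ℂ) * Complex.exp (Complex.I * t) ≠ 1) :
    qPoch p (c * Real.exp (-p.β * κ) * Complex.exp (Complex.I * t)) ≠ 0 := by
  by_cases h0 : κ = 0
  · subst h0
    simpa using qPoch_real_ne_zero hp hc h1
  · refine qPoch_ne_zero hp ?_
    rw [norm_mul, norm_exp_I_mul]
    simpa using norm_cτ_lt hp hc hκ h0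

lemma dfac_conj (hp : p.Admissible) (t : ℝ) : (starRingEnd ℂ) (dfac p c κ t) = dfac p c κ (-t) := by
  simp only [dfac, map_div₀, qPoch_conj hp, map_mul, Complex.conj_ofReal, ← Complex.exp_conj,
    Complex.conj_I, mul_neg, neg_mul]

/-- On the real line d(-t) is the conjugate of d(t). The excluded points matter for κ = 0, where the
quotient reads 0/0. -/
lemma dfac_mul_eq_wfac (hp : p.Admissible) (hc : |c| ≤ 1) (hκ : 0 ≤ κ)
    {t : ℝ} (h1 : (c : ℂ) * Complex.exp (Complex.I * t) ≠ 1) :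
    dfac p c κ t * dfac p c κ (-t) = wfac p c κ t := by
  rw [← dfac_conj hp, Complex.mul_conj, wfac]
  split_ifs with h0
  · subst h0
    have := qPoch_real_ne_zero hp hc h1
    simp [dfac, div_self this]
  · rfl

lemma wfac_ne_zero (hp : p.Admissible) (hc : |c| ≤ 1) (hκ : 0 ≤ κ)
    {t : ℝ} (h1 : (c : ℂ) * Complex.exp (Complex.I * t) ≠ 1) :
    wfac p c κ t ≠ 0 := by
  rw [wfac]
  split_ifs with h0
  · exact one_ne_zero
  · rw [Ne, Complex.normSq_eq_zero]
    exact div_ne_zero (qPoch_real_ne_zero hp hc h1) (qPoch_den_ne_zero hp hc hκ h1)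

/-- By `dfac_shift`, v(t) d⁺(t) is a constant times d⁺(t + iβ): the pole of v is cancelled by a zero
of the weight. -/
lemma vfac_mul_dfac (hp : p.Admissible) (hc : |c| ≤ 1) (hκ : 0 ≤ κ)
    {t : ℝ} (h1 : (c : ℂ) * Complex.exp (Complex.I * t) ≠ 1)
    (h2 : (c : ℂ) * Complex.exp (-(Complex.I * t)) ≠ 1) :
    vfac p c κ t * (dfac p c κ t * dfac p c κ (-t)) = Real.exp (p.β * κ / 2) * Fs p c κ t := by
  have ha := qPoch_real_ne_zero hp hc h1
  have hb := qPoch_den_ne_zero hp hc hκ h1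
  have e1 : Complex.exp (-(Complex.I * t)) = Complex.exp (Complex.I * (-t : ℝ)) := by
    congr 1; push_cast; ring
  rw [← mul_assoc, dfac_shift hp c κ t ha hb, mul_assoc]
  congr 1
  rw [Fs]
  have e2 : dfac p c κ (t + Complex.I * p.β)
      = qPoch p (c * (p.q * Complex.exp (Complex.I * t)))
        / qPoch p (c * Real.exp (-p.β * κ) * (p.q * Complex.exp (Complex.I * t))) := by
    rw [dfac, exp_I_shift]
  rw [e2, dfac, mul_neg]
  split_ifs with h0
  · subst h0
    rw [e1] at h2
    have hc' := qPoch_real_ne_zero hp hc h2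
    rw [← e1] at hc'
    have hd : qPoch p (c * (p.q * Complex.exp (Complex.I * t))) ≠ 0 := by
      rw [qPoch_step hp] at ha
      have := right_ne_zero_of_mul ha
      rwa [show (c : ℂ) * (p.q * Complex.exp (Complex.I * t))
        = p.q * (c * Complex.exp (Complex.I * t)) by ring]
    simp [div_self hd, div_self hc']
  · rw [div_mul_div_comm]

lemma wfac_nonneg (t : ℝ) : 0 ≤ wfac p c κ t := by
  rw [wfac]
  split_ifs
  · exact zero_le_one
  · exact Complex.normSq_nonneg _

/-- The translation interchanges the roles of q e^{iz} and e^{-iz}. Together with `Fs_conj` it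
identifies the lower edge of the strip with the conjugate of the upper one. -/
lemma Fs_shift (z : ℂ) : Fs p c κ (z - Complex.I * p.β) = Fs p c κ (-z) := by
  have e1 : (p.q : ℂ) * Complex.exp (Complex.I * (z - Complex.I * p.β))
      = Complex.exp (Complex.I * z) := by
    rw [← exp_I_shift]; ring_nf
  have e2 : Complex.exp (-(Complex.I * (z - Complex.I * p.β)))
      = p.q * Complex.exp (-(Complex.I * z)) := by
    rw [show -(Complex.I * (z - Complex.I * p.β)) = Complex.I * (-z + Complex.I * p.β) by ring,
      exp_I_shift]
    ring_nf
  simp only [Fs, e1, e2, mul_neg, neg_neg]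
  split_ifs
  · rfl
  · ring

lemma Fs_conj (hp : p.Admissible) (t : ℝ) : (starRingEnd ℂ) (Fs p c κ t) = Fs p c κ (-t) := by
  simp only [Fs]
  split_ifs
  · simp
  · simp only [map_div₀, qPoch_conj hp, map_mul, Complex.conj_ofReal, ← Complex.exp_conj,
      Complex.conj_I, mul_neg, neg_mul, map_neg, neg_neg]

lemma Fs_periodic (z : ℂ) (k : ℤ) : Fs p c κ (z + 2 * Real.pi * k) = Fs p c κ z := by
  have e1 : Complex.exp (Complex.I * (z + 2 * Real.pi * k)) = Complex.exp (Complex.I * z) := by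
    rw [Complex.exp_eq_exp_iff_exists_int]
    exact ⟨k, by ring⟩
  have e2 : Complex.exp (-(Complex.I * (z + 2 * Real.pi * k)))
      = Complex.exp (-(Complex.I * z)) := by
    rw [Complex.exp_eq_exp_iff_exists_int]
    exact ⟨-k, by push_cast; ring⟩
  simp only [Fs, e1, e2]

lemma wfac_periodic (t : ℝ) (k : ℤ) : wfac p c κ (t + 2 * Real.pi * k) = wfac p c κ t := by
  have e1 : Complex.exp (Complex.I * (t + 2 * Real.pi * k : ℝ)) = Complex.exp (Complex.I * t) := by
    rw [Complex.exp_eq_exp_iff_exists_int]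
    exact ⟨k, by push_cast; ring⟩
  simp only [wfac, dfac, e1]

end

/-! ### Symmetry of difference operators, term by term -/

variable {m n : ℕ}

lemma form_integrable {ℓ : (Fin m → ℝ) → Fin n → ℝ} (hℓ : Continuous ℓ) {u : (Fin m → ℝ) → ℂ}
    (hu : Continuous u) {S : Set (Fin n → ℝ)} {f h : (Fin n → ℂ) → ℂ} (hf : f ∈ expSpan S)
    (hh : h ∈ expSpan S) :
    IntegrableOn (fun s => f (cvec (ℓ s)) * (starRingEnd ℂ) (h (cvec (ℓ s))) * u s) (box m) := by
  refine ContinuousOn.integrableOn_compact (isCompact_box m) (Continuous.continuousOn ?_)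
  have h1 := (expSpan_continuous hf).comp (cvec_continuous.comp hℓ)
  have h2 := (expSpan_continuous hh).comp (cvec_continuous.comp hℓ)
  exact (h1.mul (Complex.continuous_conj.comp h2)).mul hu

/-- Both sides are sesquilinear in (f, g), so exponentials suffice. -/
lemma form_shift_symm {ℓ : (Fin m → ℝ) → Fin n → ℝ} (hℓ : Continuous ℓ)
    {u v : (Fin m → ℝ) → ℂ} (hu : Continuous u) (hv : Continuous v) {S : Set (Fin n → ℝ)}
    (Sh : ((Fin n → ℂ) → ℂ) →ₗ[ℂ] (Fin n → ℂ) → ℂ) (hSh : ∀ f ∈ expSpan S, Sh f ∈ expSpan S)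
    (hexp : ∀ μ ∈ S, ∀ ν ∈ S, form ℓ u (Sh (ex μ)) (ex ν) = form ℓ v (ex μ) (Sh (ex ν)))
    {f g : (Fin n → ℂ) → ℂ} (hf : f ∈ expSpan S) (hg : g ∈ expSpan S) :
    form ℓ u (Sh f) g = form ℓ v f (Sh g) := by
  have add_l : ∀ {u : (Fin m → ℝ) → ℂ}, Continuous u → ∀ {f₁ f₂ h : (Fin n → ℂ) → ℂ},
      f₁ ∈ expSpan S → f₂ ∈ expSpan S → h ∈ expSpan S →
      form ℓ u (f₁ + f₂) h = form ℓ u f₁ h + form ℓ u f₂ h := by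
    intro u hu f₁ f₂ h h1 h2 h3
    simp only [form]
    rw [← integral_add (form_integrable hℓ hu h1 h3) (form_integrable hℓ hu h2 h3)]
    simp only [Pi.add_apply, add_mul]
  have add_r : ∀ {u : (Fin m → ℝ) → ℂ}, Continuous u → ∀ {f₁ f₂ h : (Fin n → ℂ) → ℂ},
      f₁ ∈ expSpan S → f₂ ∈ expSpan S → h ∈ expSpan S →
      form ℓ u h (f₁ + f₂) = form ℓ u h f₁ + form ℓ u h f₂ := by
    intro u hu f₁ f₂ h h1 h2 h3
    simp only [form]
    rw [← integral_add (form_integrable hℓ hu h3 h1) (form_integrable hℓ hu h3 h2)]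
    simp only [Pi.add_apply, map_add, mul_add, add_mul]
  have smul_l : ∀ (u : (Fin m → ℝ) → ℂ) (c : ℂ) (f₁ h : (Fin n → ℂ) → ℂ),
      form ℓ u (c • f₁) h = c * form ℓ u f₁ h := by
    intro u c f₁ h
    simp only [form, ← integral_const_mul, Pi.smul_apply, smul_eq_mul, mul_assoc]
  have smul_r : ∀ (u : (Fin m → ℝ) → ℂ) (c : ℂ) (f₁ h : (Fin n → ℂ) → ℂ),
      form ℓ u h (c • f₁) = (starRingEnd ℂ) c * form ℓ u h f₁ := by
    intro u c f₁ h
    simp only [form, ← integral_const_mul, Pi.smul_apply, smul_eq_mul, map_mul]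
    congr 1
    ext s
    ring
  have zero_l : ∀ (u : (Fin m → ℝ) → ℂ) h, form ℓ u (0 : (Fin n → ℂ) → ℂ) h = 0 := fun u h => by
    simp [form]
  have zero_r : ∀ (u : (Fin m → ℝ) → ℂ) h, form ℓ u h (0 : (Fin n → ℂ) → ℂ) = 0 := fun u h => by
    simp [form]
  have hex : ∀ μ ∈ S, ex μ ∈ expSpan S := fun μ hμ => Submodule.subset_span ⟨μ, hμ, rfl⟩
  have step : ∀ μ ∈ S, form ℓ u (Sh (ex μ)) g = form ℓ v (ex μ) (Sh g) := by
    intro μ hμ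
    induction hg using Submodule.span_induction with
    | mem g hg => obtain ⟨ν, hν, rfl⟩ := hg; exact hexp μ hμ ν hν
    | zero => rw [map_zero, zero_r, zero_r]
    | add a b ha hb iha ihb =>
      rw [map_add, add_r hu ha hb (hSh _ (hex μ hμ)), add_r hv (hSh _ ha) (hSh _ hb) (hex μ hμ),
        iha, ihb]
    | smul c a _ iha => rw [map_smul, smul_r, smul_r, iha]
  induction hf using Submodule.span_induction with
  | mem f hf => obtain ⟨μ, hμ, rfl⟩ := hf; exact step μ hμ
  | zero => rw [map_zero, zero_l, zero_l]
  | add a b ha hb iha ihb =>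
    rw [map_add, add_l hu (hSh _ ha) (hSh _ hb) hg, add_l hv ha hb (hSh _ hg), iha, ihb]
  | smul c a _ iha => rw [map_smul, smul_l, smul_l, iha]

/-- The coefficients have poles and only their products `U a` with the weight are continuous. Since
the weight is real almost everywhere, moving a coefficient to the second argument replaces `U a` by
its conjugate. -/
lemma form_symm_of_terms {A : Type*} [Fintype A] {ℓ : (Fin m → ℝ) → Fin n → ℝ}
    {w : (Fin m → ℝ) → ℂ} {w' : (Fin m → ℝ) → ℝ} {S : Set (Fin n → ℝ)}
    (hT : TorusData ℓ w w' S) (Vc : A → (Fin n → ℂ) → ℂ)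
    (Sh : A → ((Fin n → ℂ) → ℂ) →ₗ[ℂ] (Fin n → ℂ) → ℂ) (U : A → (Fin m → ℝ) → ℂ)
    (hUc : ∀ a, Continuous (U a))
    (hU : ∀ a, ∀ᵐ s ∂volume.restrict (box m), Vc a (cvec (ℓ s)) * w s = U a s)
    (hSh : ∀ a, ∀ f ∈ expSpan S, Sh a f ∈ expSpan S)
    (hexp : ∀ a, ∀ μ ∈ S, ∀ ν ∈ S, form ℓ (U a) (Sh a (ex μ)) (ex ν)
      = form ℓ (fun s => (starRingEnd ℂ) (U a s)) (ex μ) (Sh a (ex ν)))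
    {f g : (Fin n → ℂ) → ℂ} (hf : f ∈ expSpan S) (hg : g ∈ expSpan S) :
    form ℓ w (fun x => ∑ a, Vc a x * Sh a f x) g
      = form ℓ w f (fun x => ∑ a, Vc a x * Sh a g x) := by
  have hall : ∀ᵐ s ∂volume.restrict (box m), ∀ a, Vc a (cvec (ℓ s)) * w s = U a s :=
    ae_all_iff.2 hU
  have h1 : form ℓ w (fun x => ∑ a, Vc a x * Sh a f x) g = ∑ a, form ℓ (U a) (Sh a f) g := by
    simp only [form]
    rw [← integral_finsetSum _ fun a _ => form_integrable hT.ℓ_cont (hUc a) (hSh a f hf) hg]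
    refine integral_congr_ae ?_
    filter_upwards [hall] with s hs
    rw [Finset.sum_mul, Finset.sum_mul]
    refine Finset.sum_congr rfl fun a _ => ?_
    rw [← hs a]
    ring
  have h2 : form ℓ w f (fun x => ∑ a, Vc a x * Sh a g x)
      = ∑ a, form ℓ (fun s => (starRingEnd ℂ) (U a s)) f (Sh a g) := by
    simp only [form]
    rw [← integral_finsetSum _ fun a _ => form_integrable hT.ℓ_cont
      (show Continuous fun s => (starRingEnd ℂ) (U a s) from
        Complex.continuous_conj.comp (hUc a)) hf (hSh a g hg)]
    refine integral_congr_ae ?_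
    filter_upwards [hall, hT.w_eq] with s hs hw
    rw [map_sum, Finset.mul_sum, Finset.sum_mul]
    refine Finset.sum_congr rfl fun a _ => ?_
    rw [← hs a, hw]
    simp only [map_mul, Complex.conj_ofReal]
    ring
  rw [h1, h2]
  exact Finset.sum_congr rfl fun a _ => form_shift_symm hT.ℓ_cont (hUc a)
    (Complex.continuous_conj.comp (hUc a)) (Sh a) (hSh a) (hexp a) hf hg

end KoornA

end

noncomputable section

namespace KoornA

open MeasureTheory

/-! ### Weights that are products of elementary factors -/

lemma countable_exp_eq (a : ℂ) : {t : ℝ | Complex.exp (Complex.I * t) = a}.Countable := by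
  rcases Set.eq_empty_or_nonempty {t : ℝ | Complex.exp (Complex.I * t) = a} with h | ⟨t₀, h₀⟩
  · rw [h]
    exact Set.countable_empty
  · refine (Set.countable_range fun k : ℤ => t₀ + 2 * Real.pi * k).mono fun t ht => ?_
    have h1 : Complex.exp (Complex.I * t) = Complex.exp (Complex.I * t₀) := by
      rw [show Complex.exp (Complex.I * t) = a from ht, h₀]
    obtain ⟨k, hk⟩ := Complex.exp_eq_exp_iff_exists_int.1 h1
    refine ⟨k, ?_⟩
    have h2 : (t : ℂ) = t₀ + 2 * Real.pi * k := by
      have : Complex.I * t = Complex.I * (t₀ + 2 * Real.pi * k) := by rw [hk]; ring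
      exact mul_left_cancel₀ Complex.I_ne_zero this
    have h3 : ((t₀ + 2 * Real.pi * k : ℝ) : ℂ) = t := by rw [h2]; push_cast; ring
    exact_mod_cast h3

variable {m n : ℕ}

/-- The image of Lebesgue measure under a nonzero functional is a multiple of Lebesgue measure on
the line, and the exceptional set there is countable. -/
lemma ae_exp_ne {L : (Fin m → ℝ) →ₗ[ℝ] ℝ} (hL : L ≠ 0) (a : ℂ) :
    ∀ᵐ s : Fin m → ℝ, Complex.exp (Complex.I * L s) ≠ a := by
  have hs : Function.Surjective L := LinearMap.surjective hL
  obtain ⟨c, -, hc⟩ := L.exists_map_addHaar_eq_smul_addHaar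
    (volume : Measure (Fin m → ℝ)) (volume : Measure ℝ) hs
  have hcont : Continuous L := L.continuous_of_finiteDimensional
  have h0 : (Measure.map L volume) {t : ℝ | Complex.exp (Complex.I * t) = a} = 0 := by
    rw [hc, Measure.smul_apply, (countable_exp_eq a).measure_zero, smul_zero]
  rw [Measure.map_apply hcont.measurable (countable_exp_eq a).measurableSet] at h0
  rw [ae_iff]
  simpa using h0

/-- A torus with coordinates `s ↦ ℓ s`, finitely many integral linear functionals `L ρ` with
elementary factors attached to them, and a set `S` of exponents. -/
structure FactorData (p : Params) (R : Type*) [Fintype R] (ℓ : (Fin m → ℝ) →ₗ[ℝ] Fin n → ℝ)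
    (L : R → (Fin m → ℝ) →ₗ[ℝ] ℝ) (c κ : R → ℝ) (S : Set (Fin n → ℝ)) : Prop where
  c_le : ∀ ρ, |c ρ| ≤ 1
  κ_nonneg : ∀ ρ, 0 ≤ κ ρ
  L_ne : ∀ ρ, L ρ ≠ 0
  L_int : ∀ ρ (k : Fin m → ℤ), ∃ l : ℤ, L ρ (fun i => (k i : ℝ)) = l
  exps : ∃ K : (Fin n → ℝ) → Fin m → ℤ, (∀ μ ∈ S, ∀ s,
    ex μ (cvec (ℓ s)) = ex (fun i => (K μ i : ℝ)) (cvec s)) ∧ Set.InjOn K S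

/-- Data of a shift along `d`, along which the functionals change by `0` or `±1`. -/
structure ShiftData {R : Type*} (ℓ : (Fin m → ℝ) →ₗ[ℝ] Fin n → ℝ)
    (L : R → (Fin m → ℝ) →ₗ[ℝ] ℝ) (S : Set (Fin n → ℝ)) (ε : R → ℤ) (v : Fin m → ℝ)
    (d : Fin n → ℝ) (N : ℕ) : Prop where
  ε_eq : ∀ ρ, L ρ v = ε ρ
  ε_mem : ∀ ρ, ε ρ = 0 ∨ (ε ρ : ℝ) * ε ρ = 1
  d_eq : ∀ μ ∈ S, ∑ j, μ j * ℓ v j = ∑ j, μ j * d j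
  N_pos : 0 < N
  N_int : ∀ μ ∈ S, ∃ k : ℤ, (∑ j, μ j * d j) * N = k

/-- The shift `x ↦ x + iβd`. -/
def shiftL (p : Params) (d : Fin n → ℝ) : ((Fin n → ℂ) → ℂ) →ₗ[ℂ] (Fin n → ℂ) → ℂ where
  toFun f x := f fun j => x j + Complex.I * p.β * d j
  map_add' _ _ := rfl
  map_smul' _ _ := rfl

lemma shiftL_ex (p : Params) (d μ : Fin n → ℝ) :
    shiftL p d (ex μ) = ((Real.exp (-p.β * ∑ j, μ j * d j) : ℝ) : ℂ) • ex μ := by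
  ext x
  simp only [shiftL, LinearMap.coe_mk, AddHom.coe_mk, Pi.smul_apply, smul_eq_mul, ex, expo]
  rw [Complex.ofReal_exp, ← Complex.exp_add]
  congr 1
  push_cast
  simp only [mul_add, Finset.sum_add_distrib, Finset.mul_sum]
  rw [add_comm]
  congr 1
  refine Finset.sum_congr rfl fun j _ => ?_
  linear_combination (p.β * μ j * d j : ℂ) * Complex.I_sq

lemma shiftL_mem (p : Params) (d : Fin n → ℝ) {S : Set (Fin n → ℝ)} {f : (Fin n → ℂ) → ℂ}
    (hf : f ∈ expSpan S) : shiftL p d f ∈ expSpan S := by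
  induction hf using Submodule.span_induction with
  | mem f hf =>
    obtain ⟨μ, hμ, rfl⟩ := hf
    rw [shiftL_ex]
    exact Submodule.smul_mem _ _ (Submodule.subset_span ⟨μ, hμ, rfl⟩)
  | zero => rw [map_zero]; exact Submodule.zero_mem _
  | add a b _ _ ha hb => rw [map_add]; exact Submodule.add_mem _ ha hb
  | smul c a _ ha => rw [map_smul]; exact Submodule.smul_mem _ _ ha

lemma ex_conj (ν : Fin n → ℝ) (x : Fin n → ℝ) :
    (starRingEnd ℂ) (ex ν (cvec x)) = ex (-ν) (cvec x) := by
  simp only [ex, expo, cvec, ← Complex.exp_conj, map_mul, map_sum, Complex.conj_I,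
    Complex.conj_ofReal, Pi.neg_apply]
  congr 1
  push_cast
  simp only [neg_mul, Finset.sum_neg_distrib, mul_neg]

lemma ex_translate (κ x v : Fin n → ℝ) (θ : ℝ) : ex κ (cvec (x + θ • v))
    = ex κ (cvec x) * Complex.exp (Complex.I * θ * (∑ j, κ j * v j : ℝ)) := by
  simp only [ex, expo, cvec, ← Complex.exp_add]
  congr 1
  push_cast [Pi.add_apply, Pi.smul_apply, smul_eq_mul]
  simp only [mul_add, Finset.sum_add_distrib, Finset.mul_sum]
  congr 1
  exact Finset.sum_congr rfl fun j _ => by ring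

section

variable {p : Params} {R : Type*} [Fintype R] {ℓ : (Fin m → ℝ) →ₗ[ℝ] Fin n → ℝ}
  {L : R → (Fin m → ℝ) →ₗ[ℝ] ℝ} {c κ : R → ℝ} {S : Set (Fin n → ℝ)} {ε : R → ℤ}
  {v : Fin m → ℝ} {d : Fin n → ℝ} {N : ℕ}

lemma FactorData.ae_ne (hF : FactorData p R ℓ L c κ S) : ∀ᵐ s : Fin m → ℝ, ∀ ρ,
    (c ρ : ℂ) * Complex.exp (Complex.I * L ρ s) ≠ 1
      ∧ (c ρ : ℂ) * Complex.exp (-(Complex.I * L ρ s)) ≠ 1 := by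
  refine ae_all_iff.2 fun ρ => ?_
  filter_upwards [ae_exp_ne (hF.L_ne ρ) (c ρ : ℂ)⁻¹, ae_exp_ne (hF.L_ne ρ) (c ρ : ℂ)] with s h1 h2
  constructor
  · intro h
    exact h1 (eq_inv_of_mul_eq_one_right h)
  · intro h
    rw [Complex.exp_neg, ← div_eq_mul_inv, div_eq_one_iff_eq (Complex.exp_ne_zero _)] at h
    exact h2 h.symm

/-- The weight. -/
def weightOf (p : Params) (L : R → (Fin m → ℝ) →ₗ[ℝ] ℝ) (c κ : R → ℝ) (s : Fin m → ℝ) : ℝ :=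
  ∏ ρ, wfac p (c ρ) (κ ρ) (L ρ s)

/-- The weight multiplied by the coefficient of a shift, continued in the direction of the
shift. -/
def shiftWeight (p : Params) (L : R → (Fin m → ℝ) →ₗ[ℝ] ℝ) (c κ : R → ℝ) (ε : R → ℤ)
    (s : Fin m → ℝ) (z : ℂ) : ℂ :=
  ∏ ρ, if ε ρ = 0 then (wfac p (c ρ) (κ ρ) (L ρ s) : ℂ)
    else Real.exp (p.β * κ ρ / 2) * Fs p (c ρ) (κ ρ) (ε ρ * L ρ s + z)

lemma FactorData.torusData (hF : FactorData p R ℓ L c κ S) (hp : p.Admissible)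
    {w : (Fin m → ℝ) → ℂ} (hw : ∀ s, w s = ∏ ρ,
      dfac p (c ρ) (κ ρ) (L ρ s) * dfac p (c ρ) (κ ρ) (-(L ρ s))) :
    TorusData ℓ w (weightOf p L c κ) S where
  ℓ_cont := ℓ.continuous_of_finiteDimensional
  w_eq := by
    refine ae_restrict_of_ae ?_
    filter_upwards [hF.ae_ne] with s hs
    rw [hw, weightOf, Complex.ofReal_prod]
    exact Finset.prod_congr rfl fun ρ _ =>
      dfac_mul_eq_wfac hp (hF.c_le ρ) (hF.κ_nonneg ρ) (hs ρ).1
  w'_cont := continuous_finsetProd _ fun ρ _ =>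
    (wfac_continuous hp (hF.c_le ρ) (hF.κ_nonneg ρ)).comp (L ρ).continuous_of_finiteDimensional
  w'_nonneg s := Finset.prod_nonneg fun ρ _ => wfac_nonneg _
  w'_ne := by
    refine ae_restrict_of_ae ?_
    filter_upwards [hF.ae_ne] with s hs
    exact Finset.prod_ne_zero_iff.2 fun ρ _ =>
      wfac_ne_zero hp (hF.c_le ρ) (hF.κ_nonneg ρ) (hs ρ).1
  exps := hF.exps

lemma FactorData.shiftWeight_eq (hF : FactorData p R ℓ L c κ S) (hp : p.Admissible)
    (hS : ShiftData ℓ L S ε v d N) {w : (Fin m → ℝ) → ℂ} (hw : ∀ s, w s = ∏ ρ,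
      dfac p (c ρ) (κ ρ) (L ρ s) * dfac p (c ρ) (κ ρ) (-(L ρ s)))
    {Vc : (Fin n → ℂ) → ℂ} (hV : ∀ s, Vc (cvec (ℓ s))
      = ∏ ρ, if ε ρ = 0 then 1 else vfac p (c ρ) (κ ρ) (ε ρ * L ρ s)) :
    ∀ᵐ s ∂volume.restrict (box m), Vc (cvec (ℓ s)) * w s = shiftWeight p L c κ ε s 0 := by
  refine ae_restrict_of_ae ?_
  filter_upwards [hF.ae_ne] with s hs
  rw [hV, hw, shiftWeight, ← Finset.prod_mul_distrib]
  refine Finset.prod_congr rfl fun ρ _ => ?_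
  split_ifs with h0
  · rw [one_mul]
    exact dfac_mul_eq_wfac hp (hF.c_le ρ) (hF.κ_nonneg ρ) (hs ρ).1
  · have h1 := (hS.ε_mem ρ).resolve_left h0
    have h2 : ε ρ = 1 ∨ ε ρ = -1 := by
      have : ε ρ * ε ρ = 1 := by exact_mod_cast h1
      rwa [mul_self_eq_one_iff] at this
    rw [add_zero]
    rcases h2 with h2 | h2
    · simp only [h2, Int.cast_one, one_mul]
      exact vfac_mul_dfac hp (hF.c_le ρ) (hF.κ_nonneg ρ) (hs ρ).1 (hs ρ).2
    · have h3 := vfac_mul_dfac hp (hF.c_le ρ) (hF.κ_nonneg ρ) (t := -(L ρ s))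
        (by simpa using (hs ρ).2) (by simpa using (hs ρ).1)
      simp only [h2, Int.cast_neg, Int.cast_one, neg_mul, one_mul]
      simp only [Complex.ofReal_neg, neg_neg] at h3
      rw [← h3, mul_comm (dfac p (c ρ) (κ ρ) (L ρ s))]

/-- Factors not touched by the shift are real; for the others `Fs_conj` and `Fs_shift` combine. -/
lemma shiftWeight_conj (hp : p.Admissible) (s : Fin m → ℝ) :
    (starRingEnd ℂ) (shiftWeight p L c κ ε s 0)
      = shiftWeight p L c κ ε s (-Complex.I * p.β) := by
  rw [shiftWeight, shiftWeight, map_prod]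
  refine Finset.prod_congr rfl fun ρ _ => ?_
  split_ifs
  · exact Complex.conj_ofReal _
  · rw [map_mul, Complex.conj_ofReal, add_zero]
    have h1 := Fs_conj hp (c := c ρ) (κ := κ ρ) (ε ρ * L ρ s)
    have h2 := Fs_shift (p := p) (c := c ρ) (κ := κ ρ) (ε ρ * L ρ s)
    push_cast at h1
    rw [h1, ← h2]
    congr 2
    ring

/-- Conjugation reverses the direction of the shift. It makes the sum of the coefficients over
opposite shifts, times the weight, real. -/
lemma shiftWeight_conj' (hp : p.Admissible) (s : Fin m → ℝ) :
    (starRingEnd ℂ) (shiftWeight p L c κ ε s 0) = shiftWeight p L c κ (-ε) s 0 := by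
  rw [shiftWeight, shiftWeight, map_prod]
  refine Finset.prod_congr rfl fun ρ _ => ?_
  simp only [Pi.neg_apply, neg_eq_zero]
  split_ifs
  · exact Complex.conj_ofReal _
  · rw [map_mul, Complex.conj_ofReal, add_zero, add_zero]
    have h1 := Fs_conj hp (c := c ρ) (κ := κ ρ) (ε ρ * L ρ s)
    push_cast at h1 ⊢
    rw [h1, neg_mul]

/-- Where ε ≠ 0 one has ε² = 1, so translation along v adds the same θ to every argument ε L. Hence
the complex variable z continues real translations of the torus along v. -/
lemma ShiftData.shiftWeight_translate (hS : ShiftData ℓ L S ε v d N) (s : Fin m → ℝ) (θ : ℝ)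
    (z : ℂ) : shiftWeight p L c κ ε (s + θ • v) z = shiftWeight p L c κ ε s (θ + z) := by
  refine Finset.prod_congr rfl fun ρ _ => ?_
  have h1 : L ρ (s + θ • v) = L ρ s + θ * ε ρ := by
    rw [map_add, map_smul, hS.ε_eq, smul_eq_mul]
  rw [h1]
  split_ifs with h0
  · rw [h0]; simp
  · have h2 := (hS.ε_mem ρ).resolve_left h0
    have h3 : (ε ρ : ℂ) * ε ρ = 1 := by exact_mod_cast h2
    congr 2
    push_cast
    linear_combination (θ : ℂ) * h3

lemma FactorData.shiftWeight_periodic (hF : FactorData p R ℓ L c κ S) (k : Fin m → ℤ)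
    (s : Fin m → ℝ) (z : ℂ) :
    shiftWeight p L c κ ε (fun i => s i + 2 * Real.pi * k i) z = shiftWeight p L c κ ε s z := by
  refine Finset.prod_congr rfl fun ρ _ => ?_
  obtain ⟨l, hl⟩ := hF.L_int ρ k
  have h1 : L ρ (fun i => s i + 2 * Real.pi * k i) = L ρ s + 2 * Real.pi * l := by
    rw [← hl, show (fun i => s i + 2 * Real.pi * k i)
      = s + (2 * Real.pi) • fun i => (k i : ℝ) from rfl, map_add, map_smul, smul_eq_mul]
  rw [h1]
  split_ifs with h0
  · rw [wfac_periodic]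
  · have h2 := Fs_periodic (p := p) (c := c ρ) (κ := κ ρ) (ε ρ * L ρ s + z) (ε ρ * l)
    rw [← h2]
    congr 2
    push_cast
    ring

lemma shiftWeight_periodic' (s : Fin m → ℝ) (z : ℂ) (N : ℕ) :
    shiftWeight p L c κ ε s (z + (2 * Real.pi * N : ℝ)) = shiftWeight p L c κ ε s z := by
  refine Finset.prod_congr rfl fun ρ _ => ?_
  split_ifs with h0
  · rfl
  · have h2 := Fs_periodic (p := p) (c := c ρ) (κ := κ ρ) (ε ρ * L ρ s + z) N
    rw [← h2]
    congr 2
    push_cast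
    ring

lemma FactorData.shiftWeight_continuousAt (hF : FactorData p R ℓ L c κ S) (hp : p.Admissible)
    (s : Fin m → ℝ) {z : ℂ} (hz : z ∈ strip p.β) :
    ContinuousAt (Function.uncurry (shiftWeight p L c κ ε)) (s, z) := by
  unfold shiftWeight Function.uncurry
  refine tendsto_finsetProd _ fun ρ _ => ?_
  have hL : Continuous (L ρ) := (L ρ).continuous_of_finiteDimensional
  split_ifs with h0
  · exact ((Complex.continuous_ofReal.comp ((wfac_continuous hp (hF.c_le ρ) (hF.κ_nonneg ρ)).comp
      hL)).comp continuous_fst).continuousAt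
  · refine Tendsto.const_mul _ ?_
    have h1 : ContinuousAt (Fs p (c ρ) (κ ρ)) (ε ρ * L ρ s + z) :=
      (Fs_differentiableAt hp (hF.c_le ρ) (hF.κ_nonneg ρ) (by
        simpa [strip] using hz)).continuousAt
    exact ContinuousAt.comp (f := fun x : (Fin m → ℝ) × ℂ => (ε ρ : ℂ) * L ρ x.1 + x.2)
      (g := Fs p (c ρ) (κ ρ)) h1 (by fun_prop)

lemma FactorData.shiftWeight_differentiableAt (hF : FactorData p R ℓ L c κ S)
    (hp : p.Admissible) (s : Fin m → ℝ) {z : ℂ} (hz : z ∈ strip p.β) :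
    DifferentiableAt ℂ (shiftWeight p L c κ ε s) z := by
  unfold shiftWeight
  refine DifferentiableAt.fun_finsetProd fun ρ _ => ?_
  split_ifs with h0
  · exact differentiableAt_const _
  · refine DifferentiableAt.const_mul ?_ _
    have h1 : DifferentiableAt ℂ (Fs p (c ρ) (κ ρ)) (ε ρ * L ρ s + z) :=
      Fs_differentiableAt hp (hF.c_le ρ) (hF.κ_nonneg ρ) (by simpa [strip] using hz)
    exact DifferentiableAt.comp (f := fun z : ℂ => (ε ρ : ℂ) * L ρ s + z)
      (g := Fs p (c ρ) (κ ρ)) z h1 (by fun_prop)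

lemma zero_mem_strip {b : ℝ} (hb : 0 < b) : (0 : ℂ) ∈ strip b := by simp [strip, hb.le]

lemma FactorData.shiftWeight_continuous (hF : FactorData p R ℓ L c κ S) (hp : p.Admissible) :
    Continuous fun s => shiftWeight p L c κ ε s 0 :=
  continuous_iff_continuousAt.2 fun s => by
    have := hF.shiftWeight_continuousAt (ε := ε) hp s (zero_mem_strip hp.β_pos)
    exact ContinuousAt.comp (f := fun s : Fin m → ℝ => (s, (0 : ℂ)))
      (g := Function.uncurry (shiftWeight p L c κ ε)) this (by fun_prop)

/-- The shift of the contour of integration. -/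
lemma FactorData.integral_shift (hF : FactorData p R ℓ L c κ S) (hp : p.Admissible)
    (hS : ShiftData ℓ L S ε v d N) {μ ν : Fin n → ℝ} (hμ : μ ∈ S) (hν : ν ∈ S) :
    ∫ s in box m, shiftWeight p L c κ ε s 0 * ex (μ - ν) (cvec (ℓ s))
      = Real.exp (p.β * (∑ j, μ j * d j - ∑ j, ν j * d j))
        * ∫ s in box m, shiftWeight p L c κ ε s (-Complex.I * p.β) * ex (μ - ν) (cvec (ℓ s)) := by
  set b : ℝ := ∑ j, μ j * d j - ∑ j, ν j * d j with hb
  have hbv : ∑ j, (μ - ν) j * ℓ v j = b := by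
    simp only [Pi.sub_apply, sub_mul, Finset.sum_sub_distrib, hS.d_eq μ hμ, hS.d_eq ν hν, hb]
  -- The integrand at the point s + z v with z complex. On the lower edge z = -iβ its exponential
  -- contributes e^{βb}.
  set G : (Fin m → ℝ) → ℂ → ℂ := fun s z =>
    shiftWeight p L c κ ε s z * (ex (μ - ν) (cvec (ℓ s)) * Complex.exp (Complex.I * z * b)) with hG
  have hℓ : Continuous ℓ := ℓ.continuous_of_finiteDimensional
  have hex : Continuous fun s => ex (μ - ν) (cvec (ℓ s)) :=
    (ex_continuous _).comp (cvec_continuous.comp hℓ)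
  have hexper : ∀ s (k : Fin m → ℤ), ex (μ - ν) (cvec (ℓ fun i => s i + 2 * Real.pi * k i))
      = ex (μ - ν) (cvec (ℓ s)) := by
    intro s k
    obtain ⟨K, hK, -⟩ := hF.exps
    rw [sub_eq_add_neg, ex_add, ex_add, ← ex_conj, ← ex_conj, hK μ hμ, hK ν hν, hK μ hμ, hK ν hν,
      ex_int_periodic, ex_int_periodic]
  have htr : ∀ (θ : ℝ) (z : ℂ), (∀ s, ContinuousAt (Function.uncurry G) (s, z)) →
      ∫ s in box m, G s (θ + z) = ∫ s in box m, G s z := by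
    intro θ z hc
    rw [← integral_box_translate (F := fun s => G s z) (continuous_iff_continuousAt.2 fun s =>
      ContinuousAt.comp (f := fun s : Fin m → ℝ => (s, z)) (g := Function.uncurry G) (hc s)
        (by fun_prop)) (fun s k => by simp only [hG, hF.shiftWeight_periodic, hexper]) (θ • v)]
    refine integral_congr_ae (Eventually.of_forall fun s => ?_)
    change _ = G (s + θ • v) z
    simp only [hG]
    rw [hS.shiftWeight_translate, map_add, map_smul, ex_translate, hbv,
      mul_assoc (ex (μ - ν) (cvec (ℓ s))), ← Complex.exp_add]
    congr 3
    ring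
  have hcont : ∀ s, ∀ z ∈ strip p.β, ContinuousAt (Function.uncurry G) (s, z) := by
    intro s z hz
    refine (hF.shiftWeight_continuousAt hp s hz).mul (Continuous.continuousAt ?_)
    exact (hex.comp continuous_fst).mul (by fun_prop)
  -- The exponent b lies in ℤ/N only, so e^{izb} has period 2πN.
  have hP : 0 < 2 * Real.pi * N := by
    have := hS.N_pos
    have : (0 : ℝ) < N := by exact_mod_cast this
    have := Real.pi_pos
    positivity
  have h0 := hp.β_pos
  have key := integral_box_shift hp.β_pos hP G hcont (fun s z hz => by
      refine (hF.shiftWeight_differentiableAt hp s hz).mul ?_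
      fun_prop) (fun s z _ => by
      simp only [hG]
      rw [shiftWeight_periodic']
      congr 2
      rw [Complex.exp_eq_exp_iff_exists_int]
      obtain ⟨k, hk⟩ := hS.N_int μ hμ
      obtain ⟨l, hl⟩ := hS.N_int ν hν
      have : (b : ℂ) * N = k - l := by
        have : b * N = k - l := by rw [hb, sub_mul, hk, hl]
        exact_mod_cast this
      refine ⟨k - l, ?_⟩
      push_cast
      linear_combination (2 * Real.pi * Complex.I) * this)
    (fun θ => by simpa using htr θ 0 fun s => hcont s 0 (zero_mem_strip h0))
    (fun θ => by
      have := htr θ (-Complex.I * p.β) fun s => hcont s _ (by simp [strip, h0.le])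
      rw [← this]
      simp only [neg_mul, sub_eq_add_neg])
  simp only [hG, mul_zero, zero_mul, Complex.exp_zero, mul_one] at key
  rw [key, ← integral_const_mul]
  congr 1
  ext s
  have : Complex.exp (Complex.I * (-Complex.I * p.β) * b) = (Real.exp (p.β * b) : ℂ) := by
    rw [Complex.ofReal_exp]
    congr 1
    push_cast
    linear_combination (-(p.β : ℂ) * b) * Complex.I_sq
  rw [this]
  ring

/-- The shift multiplies e^μ by e^{-β⟨μ,d⟩}; the contour shift supplies e^{β⟨μ-ν,d⟩}, leaving
e^{-β⟨ν,d⟩}, which is the factor by which the shift acts on e^ν. The weight turns into its conjugate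
by `shiftWeight_conj`. -/
lemma FactorData.form_shift (hF : FactorData p R ℓ L c κ S) (hp : p.Admissible)
    (hS : ShiftData ℓ L S ε v d N) {μ ν : Fin n → ℝ} (hμ : μ ∈ S) (hν : ν ∈ S) :
    form ℓ (fun s => shiftWeight p L c κ ε s 0) (shiftL p d (ex μ)) (ex ν)
      = form ℓ (fun s => (starRingEnd ℂ) (shiftWeight p L c κ ε s 0)) (ex μ)
        (shiftL p d (ex ν)) := by
  have key := hF.integral_shift hp hS hμ hν
  have e : ∀ s, ex μ (cvec (ℓ s)) * ex (-ν) (cvec (ℓ s)) = ex (μ - ν) (cvec (ℓ s)) := fun s => by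
    rw [sub_eq_add_neg, ex_add]
  simp only [form, shiftL_ex, Pi.smul_apply, smul_eq_mul, map_mul, Complex.conj_ofReal, ex_conj,
    shiftWeight_conj hp]
  have h1 : ∀ s, ((Real.exp (-p.β * ∑ j, μ j * d j) : ℝ) : ℂ) * ex μ (cvec (ℓ s))
      * ex (-ν) (cvec (ℓ s)) * shiftWeight p L c κ ε s 0
      = ((Real.exp (-p.β * ∑ j, μ j * d j) : ℝ) : ℂ)
        * (shiftWeight p L c κ ε s 0 * ex (μ - ν) (cvec (ℓ s))) := fun s => by
    rw [← e]; ring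
  have h2 : ∀ s, ex μ (cvec (ℓ s)) * (((Real.exp (-p.β * ∑ j, ν j * d j) : ℝ) : ℂ)
      * ex (-ν) (cvec (ℓ s))) * shiftWeight p L c κ ε s (-Complex.I * p.β)
      = ((Real.exp (-p.β * ∑ j, ν j * d j) : ℝ) : ℂ)
        * (shiftWeight p L c κ ε s (-Complex.I * p.β) * ex (μ - ν) (cvec (ℓ s))) := fun s => by
    rw [← e]; ring
  simp only [h1, h2, integral_const_mul, key]
  rw [← mul_assoc, ← Complex.ofReal_mul, ← Real.exp_add]
  congr 3
  ring

end

end KoornA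

end

/-! ### Type A: symmetry of the operators and the Macdonald polynomials. -/

noncomputable section

namespace KoornA

open MeasureTheory

variable {n : ℕ}

/-! ### Symmetry of the operators of type `A` -/

/-- Coordinates on the torus of type `A`. -/
def ellA (n : ℕ) : (Fin (n - 1) → ℝ) →ₗ[ℝ] Fin n → ℝ where
  toFun s j := ∑ i, s i * simpleRoot i j
  map_add' s t := by
    ext j
    simp [add_mul, Finset.sum_add_distrib]
  map_smul' c s := by
    ext j
    simp [Finset.mul_sum, mul_assoc]

lemma ellA_apply (s : Fin (n - 1) → ℝ) (j : Fin n) : ellA n s j = ∑ i, s i * simpleRoot i j := rfl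

lemma sum_mul_ellA (μ : Fin n → ℝ) (s : Fin (n - 1) → ℝ) :
    ∑ j, μ j * ellA n s j = ∑ i : Fin (n - 1), (μ ⟨i, by omega⟩ - μ ⟨i + 1, by omega⟩) * s i := by
  simp only [ellA_apply, Finset.mul_sum]
  rw [Finset.sum_comm]
  refine Finset.sum_congr rfl fun i _ => ?_
  rw [← sum_mul_simpleRoot, Finset.sum_mul]
  exact Finset.sum_congr rfl fun j _ => by ring

lemma exists_ellA_eq {x : Fin n → ℝ} (hx : ∑ j, x j = 0) : ∃ s, ellA n s = x := by
  refine ⟨fun i => ∑ j ∈ Finset.Iic (⟨i, by omega⟩ : Fin n), x j, eq_of_sum_Iic_eq fun k => ?_⟩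
  simp only [ellA_apply]
  rw [Finset.sum_comm]
  simp only [← Finset.mul_sum, sum_Iic_simpleRoot]
  by_cases hk : (k : ℕ) < n - 1
  · rw [Finset.sum_eq_single ⟨k, hk⟩]
    · simp
    · intro b _ hb
      rw [if_neg, mul_zero]
      exact fun h => hb (Fin.ext h)
    · simp
  · have hI : Finset.Iic k = Finset.univ := by
      ext j
      simp only [Finset.mem_Iic, Finset.mem_univ, iff_true, Fin.le_def]
      omega
    rw [hI, hx]
    refine Finset.sum_eq_zero fun b _ => ?_
    rw [if_neg, mul_zero]
    have := b.2
    omega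

/-- The positive roots. -/
abbrev PosA (n : ℕ) : Type := (j : Fin n) × {k // k ∈ Finset.Ioi j}

lemma prod_posA (φ : Fin n → Fin n → ℂ) :
    ∏ j, ∏ k ∈ Finset.Ioi j, φ j k = ∏ ρ : PosA n, φ ρ.1 ρ.2 := by
  rw [Fintype.prod_sigma]
  exact Finset.prod_congr rfl fun j _ => (Finset.prod_coe_sort (Finset.Ioi j) (φ j)).symm

/-- The positive roots as functionals. -/
def rootA (ρ : PosA n) : (Fin (n - 1) → ℝ) →ₗ[ℝ] ℝ :=
  (LinearMap.proj (R := ℝ) (φ := fun _ : Fin n => ℝ) ρ.1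
    - LinearMap.proj (R := ℝ) (φ := fun _ : Fin n => ℝ) ρ.2) ∘ₗ ellA n

lemma rootA_apply (ρ : PosA n) (s : Fin (n - 1) → ℝ) :
    rootA ρ s = ellA n s ρ.1 - ellA n s ρ.2 := rfl

/-- The integral weights. -/
def latA (n : ℕ) : Set (Fin n → ℝ) := {μ | ∑ j, μ j = 0 ∧ ∀ j k, ∃ z : ℤ, μ j - μ k = z}

lemma PosA.lt (ρ : PosA n) : ρ.1 < ρ.2 := Finset.mem_Ioi.1 ρ.2.2

lemma sum_single_sub {j k : Fin n} :
    ∑ i, (Pi.single j (1 : ℝ) - Pi.single k 1 : Fin n → ℝ) i = 0 := by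
  simp [Finset.sum_sub_distrib]

lemma factorDataA {p : Params} (hp : p.Admissible) :
    FactorData p (PosA n) (ellA n) rootA (fun _ => 1) (fun _ => p.g) (latA n) where
  c_le _ := by simp
  κ_nonneg _ := hp.g_nonneg
  L_ne ρ h := by
    obtain ⟨s, hs⟩ := exists_ellA_eq (sum_single_sub (j := ρ.1) (k := ρ.2))
    have h1 := LinearMap.congr_fun h s
    rw [rootA_apply, hs] at h1
    have h2 := ρ.lt.ne
    have h3 := ρ.lt.ne'
    simp [h2, h3] at h1
  L_int ρ k := by
    have h : ∀ j : Fin n, ∃ l : ℤ, ellA n (fun i => (k i : ℝ)) j = l := fun j =>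
      ⟨∑ i, k i * ((Pi.single (⟨i, by omega⟩ : Fin n) (1 : ℤ) : Fin n → ℤ) j
        - (Pi.single (⟨i + 1, by omega⟩ : Fin n) (1 : ℤ) : Fin n → ℤ) j), by
        rw [ellA_apply]
        push_cast
        refine Finset.sum_congr rfl fun i _ => ?_
        simp only [simpleRoot, Pi.sub_apply, Pi.single_apply]
        push_cast
        rfl⟩
    obtain ⟨a, ha⟩ := h ρ.1
    obtain ⟨b, hb⟩ := h ρ.2
    exact ⟨a - b, by rw [rootA_apply, ha, hb]; push_cast; rfl⟩
  exps := by
    choose! K hK using fun (μ : Fin n → ℝ) (hμ : μ ∈ latA n) (i : Fin (n - 1)) =>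
      hμ.2 ⟨i, by omega⟩ ⟨i + 1, by omega⟩
    have key : ∀ μ ∈ latA n, ∀ s, ∑ j, μ j * ellA n s j = ∑ i, (K μ i : ℝ) * s i := by
      intro μ hμ s
      rw [sum_mul_ellA]
      exact Finset.sum_congr rfl fun i _ => congrArg (· * s i) (hK μ hμ i)
    refine ⟨K, fun μ hμ s => ?_, fun μ hμ ν hν h => ?_⟩
    · have := key μ hμ s
      simp only [ex, expo, cvec]
      congr 2
      exact_mod_cast this
    · have h0 : ∑ j, (μ - ν) j = 0 := by
        simp [Finset.sum_sub_distrib, hμ.1, hν.1]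
      obtain ⟨s, hs⟩ := exists_ellA_eq h0
      have h1 := key μ hμ s
      have h2 := key ν hν s
      rw [hs] at h1 h2
      -- The vector μ - ν is itself a point of the hyperplane, so the equal pairings of μ and ν can
      -- be tested on it.
      have h3 : ∑ j, (μ - ν) j * (μ - ν) j = 0 := by
        have : ∑ j, (μ - ν) j * (μ - ν) j
            = ∑ j, μ j * (μ - ν) j - ∑ j, ν j * (μ - ν) j := by
          rw [← Finset.sum_sub_distrib]
          exact Finset.sum_congr rfl fun j _ => by simp only [Pi.sub_apply]; ring
        rw [this, h1, h2, h, sub_self]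
      ext j
      have h4 := (Finset.sum_eq_zero_iff_of_nonneg fun j _ => mul_self_nonneg _).1 h3 j
        (Finset.mem_univ j)
      exact sub_eq_zero.1 (mul_self_eq_zero.1 h4)

/-- The indicator of `J`. -/
def indic (J : Finset (Fin n)) (j : Fin n) : ℝ := if j ∈ J then 1 else 0

/-- The change of the positive roots along the indicator of `J`. -/
def epsA (J : Finset (Fin n)) (ρ : PosA n) : ℤ :=
  (if ρ.1 ∈ J then 1 else 0) - if (ρ.2 : Fin n) ∈ J then 1 else 0

/-- The indicator of J minus its mean lies in the hyperplane and pairs with roots and weights like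
the indicator itself. Weights have entries in ℤ/n, which gives the denominator n; the maximum with 1
serves n = 0. -/
lemma exists_shiftDataA (J : Finset (Fin n)) :
    ∃ v, ShiftData (ellA n) rootA (latA n) (epsA J) v (indic J) (max n 1) := by
  set a : ℝ := (∑ j, indic J j) / n with ha
  have hsum : ∑ j, (indic J j - a) = 0 := by
    rcases Nat.eq_zero_or_pos n with rfl | hn
    · simp
    · have : (n : ℝ) ≠ 0 := by positivity
      rw [Finset.sum_sub_distrib, Finset.sum_const, Finset.card_univ, Fintype.card_fin,
        nsmul_eq_mul, ha]
      field_simp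
      ring
  obtain ⟨v, hv⟩ := exists_ellA_eq hsum
  refine ⟨v, fun ρ => ?_, fun ρ => ?_, fun μ hμ => ?_, ?_, fun μ hμ => ?_⟩
  · rw [rootA_apply, hv]
    simp only [epsA, indic]
    push_cast
    ring
  · simp only [epsA]
    split_ifs <;> norm_num
  · rw [hv]
    simp only [mul_sub, Finset.sum_sub_distrib, ← Finset.sum_mul, hμ.1, zero_mul, sub_zero]
  · omega
  · rcases Nat.eq_zero_or_pos n with rfl | hn
    · exact ⟨0, by simp⟩
    -- Because μ has sum 0, n μ_j is the sum over k of the integers μ_j - μ_k.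
    have h1 : ∀ j, ∃ z : ℤ, μ j * n = z := by
      intro j
      choose z hz using hμ.2 j
      refine ⟨∑ k, z k, ?_⟩
      push_cast
      simp only [← hz]
      rw [Finset.sum_sub_distrib, hμ.1, Finset.sum_const, Finset.card_univ, Fintype.card_fin,
        nsmul_eq_mul, sub_zero, mul_comm]
    choose z hz using h1
    refine ⟨∑ j, if j ∈ J then z j else 0, ?_⟩
    rw [max_eq_left hn, Finset.sum_mul]
    push_cast
    refine Finset.sum_congr rfl fun j _ => ?_
    rw [← hz j, indic]
    split_ifs <;> ring

lemma prod_va_eq (p : Params) (J : Finset (Fin n)) (s : Fin (n - 1) → ℝ) :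
    ∏ j ∈ J, ∏ k ∈ Jᶜ, va p (cvec (ellA n s) j - cvec (ellA n s) k)
      = ∏ ρ : PosA n, if epsA J ρ = 0 then 1
        else vfac p 1 p.g (epsA J ρ * rootA ρ s) := by
  rw [prod_cross J fun j k => va p (cvec (ellA n s) j - cvec (ellA n s) k), prod_posA]
  refine Finset.prod_congr rfl fun ρ _ => ?_
  simp only [epsA, rootA_apply, va_eq, cvec]
  by_cases h1 : ρ.1 ∈ J <;> by_cases h2 : (ρ.2 : Fin n) ∈ J <;> simp [h1, h2]

lemma DeltaA_eq {p : Params} (s : Fin (n - 1) → ℝ) : DeltaA p (cvec (ellA n s))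
    = ∏ ρ : PosA n, dfac p 1 p.g (rootA ρ s) * dfac p 1 p.g (-(rootA ρ s)) := by
  rw [DeltaA, prod_posA fun j k => da p (cvec (ellA n s) j - cvec (ellA n s) k)]
  refine Finset.prod_congr rfl fun ρ _ => ?_
  simp only [da, daPlus_eq, rootA_apply, cvec]
  push_cast
  rfl

lemma innerA_eq (p : Params) (f h : (Fin n → ℂ) → ℂ) :
    innerA p f h = form (ellA n) (fun s => DeltaA p (cvec (ellA n s))) f h := rfl

lemma torusDataA {p : Params} (hp : p.Admissible) : TorusData (ellA n)
    (fun s => DeltaA p (cvec (ellA n s))) (weightOf p rootA (fun _ => 1) fun _ => p.g) (latA n) := by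
  refine (factorDataA hp).torusData hp fun s => ?_
  rw [DeltaA_eq]

lemma isFormA {p : Params} (hp : p.Admissible) : IsForm (expSpan (latA n)) (innerA p) :=
  (torusDataA hp).isForm

lemma Dprime_eq_sum (p : Params) (r : ℕ) (f : (Fin n → ℂ) → ℂ) : Dprime p r f
    = fun x => ∑ J : {J // J ∈ Finset.powersetCard r (Finset.univ : Finset (Fin n))},
      (∏ j ∈ J.1, ∏ k ∈ J.1ᶜ, va p (x j - x k)) * shiftL p (indic J.1) f x := by
  ext x
  rw [Dprime, ← Finset.sum_coe_sort]
  refine Finset.sum_congr rfl fun J _ => ?_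
  congr 1
  simp only [shiftL, LinearMap.coe_mk, AddHom.coe_mk]
  congr 1
  ext j
  rw [shiftPt_one, indic]
  split_ifs <;> simp

lemma innerA_Dprime {p : Params} (hp : p.Admissible) (r : ℕ) {f g : (Fin n → ℂ) → ℂ}
    (hf : f ∈ expSpan (latA n)) (hg : g ∈ expSpan (latA n)) :
    innerA p (Dprime p r f) g = innerA p f (Dprime p r g) := by
  have hF := factorDataA (n := n) hp
  rw [innerA_eq, innerA_eq, Dprime_eq_sum, Dprime_eq_sum]
  refine form_symm_of_terms (torusDataA hp)
    (fun J : {J // J ∈ Finset.powersetCard r (Finset.univ : Finset (Fin n))} =>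
      fun x => ∏ j ∈ J.1, ∏ k ∈ J.1ᶜ, va p (x j - x k)) (fun J => shiftL p (indic J.1))
    (fun J s => shiftWeight p rootA (fun _ => 1) (fun _ => p.g) (epsA J.1) s 0)
    (fun J => hF.shiftWeight_continuous hp) (fun J => ?_) (fun J f hf => shiftL_mem p _ hf)
    (fun J μ hμ ν hν => ?_) hf hg
  · obtain ⟨v, hv⟩ := exists_shiftDataA J.1
    exact hF.shiftWeight_eq hp hv (w := fun s => DeltaA p (cvec (ellA n s)))
      (fun s => by rw [DeltaA_eq])
      (Vc := fun x => ∏ j ∈ J.1, ∏ k ∈ J.1ᶜ, va p (x j - x k))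
      (fun s => by rw [prod_va_eq])
  · obtain ⟨v, hv⟩ := exists_shiftDataA J.1
    exact hF.form_shift hp hv hμ hν

/-- The functions that vanish at the regular points. -/
def nullA (n : ℕ) : Submodule ℂ ((Fin n → ℂ) → ℂ) where
  carrier := {f | ∀ x, RegA x → f x = 0}
  add_mem' ha hb x hx := by simp [ha x hx, hb x hx]
  zero_mem' _ _ := rfl
  smul_mem' c f hf x hx := by simp [hf x hx]

lemma exp_eq_one_of_sin {z : ℂ} (h : Complex.sin (z / 2) = 0) :
    Complex.exp (Complex.I * z) = 1 := by
  obtain ⟨k, hk⟩ := Complex.sin_eq_zero_iff.1 h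
  rw [Complex.exp_eq_one_iff]
  exact ⟨k, by linear_combination (2 * Complex.I) * hk⟩

lemma ae_regA {p : Params} (hp : p.Admissible) :
    ∀ᵐ s : Fin (n - 1) → ℝ, RegA (cvec (ellA n s)) := by
  filter_upwards [(factorDataA (n := n) hp).ae_ne] with s hs
  have key : ∀ j k : Fin n, j < k →
      Complex.sin ((cvec (ellA n s) j - cvec (ellA n s) k) / 2) ≠ 0 := by
    intro j k hjk h0
    have h1 := (hs ⟨j, k, Finset.mem_Ioi.2 hjk⟩).1
    have h2 := exp_eq_one_of_sin h0
    apply h1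
    rw [← h2, rootA_apply]
    simp [cvec]
  intro j k hjk
  rcases hjk.lt_or_gt with h | h
  · exact key j k h
  · intro h0
    apply key k j h
    rw [← neg_sub, neg_div, Complex.sin_neg, h0, neg_zero]

lemma innerA_congr {p : Params} (hp : p.Admissible) {f f' g g' : (Fin n → ℂ) → ℂ}
    (hf : f - f' ∈ nullA n) (hg : g - g' ∈ nullA n) : innerA p f g = innerA p f' g' := by
  rw [innerA_eq, innerA_eq]
  refine integral_congr_ae (ae_restrict_of_ae ?_)
  filter_upwards [ae_regA hp] with s hs
  rw [sub_eq_zero.1 (hf _ hs), sub_eq_zero.1 (hg _ hs)]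

lemma eq_zero_of_nullA {p : Params} (hp : p.Admissible) {f : (Fin n → ℂ) → ℂ}
    (hf : f ∈ expSpan (latA n)) (h0 : f ∈ nullA n) : f = 0 := by
  refine (isFormA hp).definite f hf ?_
  rw [innerA_congr hp (f' := 0) (g' := f) (by simpa using h0) (by simp)]
  exact (isFormA hp).zero_left hf

/-- `D̂'_r` as a linear map. -/
def DprimeL (p : Params) (r : ℕ) : ((Fin n → ℂ) → ℂ) →ₗ[ℂ] (Fin n → ℂ) → ℂ where
  toFun := Dprime p r
  map_add' f g := by
    ext x
    simp only [Dprime, Pi.add_apply, mul_add, Finset.sum_add_distrib]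
  map_smul' c f := by
    ext x
    simp only [Dprime, Pi.smul_apply, smul_eq_mul, RingHom.id_apply, Finset.mul_sum]
    exact Finset.sum_congr rfl fun J _ => by ring

/-- The orbit sum attached to a dominant weight. -/
def mA (μ : DomA n) : (Fin n → ℂ) → ℂ := monoA μ.1

lemma DomA.mem_latA (μ : DomA n) {ν : Fin n → ℝ} (hν : ν ∈ orbitS μ.1) : ν ∈ latA n := by
  obtain ⟨σ, rfl⟩ := mem_orbitS.1 hν
  have h := isDomWeightA_iff.1 μ.2
  have h2 : ∀ j k, ∃ z : ℤ, μ.1 j - μ.1 k = z := by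
    intro j k
    rcases le_total j k with hjk | hjk
    · obtain ⟨a, ha⟩ := h.2 j k hjk
      exact ⟨a, by exact_mod_cast ha⟩
    · obtain ⟨a, ha⟩ := h.2 k j hjk
      exact ⟨-a, by push_cast; linarith⟩
  exact ⟨by rw [← h.1]; exact Equiv.sum_comp σ μ.1, fun j k => h2 _ _⟩

lemma mA_mem (μ : DomA n) : mA μ ∈ expSpan (latA n) := by
  have : mA μ = ∑ ν ∈ orbitS μ.1, ex ν := by
    ext x
    rw [Finset.sum_apply]
    rfl
  rw [this]
  exact Submodule.sum_mem _ fun ν hν => Submodule.subset_span ⟨ν, μ.mem_latA hν, rfl⟩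

lemma span_mA_le : Submodule.span ℂ (Set.range (mA (n := n))) ≤ expSpan (latA n) := by
  rw [Submodule.span_le]
  rintro _ ⟨μ, rfl⟩
  exact mA_mem μ

lemma span_mA_image_le (s : Set (DomA n)) : Submodule.span ℂ (mA '' s) ≤ expSpan (latA n) :=
  (Submodule.span_mono (Set.image_subset_range _ _)).trans span_mA_le

/-- At this stage orthogonality is required only against smaller weights; for incomparable ones it
comes from the eigenvalues, in `macA_orthogonal`. -/
lemma exists_macdonald {p : Params} (hp : p.Admissible) (μ : DomA n) :
    ∃ u ∈ Submodule.span ℂ (mA '' Set.Iio μ), ∀ ν < μ, innerA p (mA μ + u) (mA ν) = 0 := by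
  have hfin : (Set.Iio μ).Finite := μ.finite_Iic.subset Set.Iio_subset_Iic_self
  obtain ⟨u, hu, h⟩ := (isFormA hp).exists_orth mA mA_mem hfin.toFinset (mA μ) (mA_mem μ)
  exact ⟨u, by simpa using hu, fun ν hν => h ν (by simpa using hν)⟩

/-- The eigenvalues of `D̂'_r`. -/
def evA (p : Params) (r : ℕ) (μ : Fin n → ℝ) : ℝ := esA p r fun j => p.g * rhoHalf n j + μ j

lemma macdonald_eigen {p : Params} (hp : p.Admissible) (r : ℕ) {μ : DomA n}
    {u : (Fin n → ℂ) → ℂ} (hu : u ∈ Submodule.span ℂ (mA '' Set.Iio μ))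
    (horth : ∀ ν < μ, innerA p (mA μ + u) (mA ν) = 0) :
    DprimeL p r (mA μ + u) - (evA p r μ.1 : ℂ) • (mA μ + u) ∈ nullA n := by
  have htri : ∀ μ : DomA n, ∃ y ∈ Submodule.span ℂ (mA '' Set.Iio μ),
      DprimeL p r (mA μ) - ((evA p r μ.1 : ℂ) • mA μ + y) ∈ nullA n := by
    intro μ
    obtain ⟨y, hy, h⟩ := Dprime_triangular p r μ
    refine ⟨y, hy, fun x hx => ?_⟩
    have := h x hx
    simp only [Pi.sub_apply, Pi.add_apply, Pi.smul_apply, smul_eq_mul, DprimeL, LinearMap.coe_mk,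
      AddHom.coe_mk, mA, evA]
    rw [this, sub_self]
  obtain ⟨y, hy, he⟩ := htri μ
  refine (isFormA hp).eigen mA mA_mem (nullA n) (DprimeL p r) (fun j => ?_) ?_ hy he hu horth
  · obtain ⟨y, hy, h⟩ := htri j
    refine ⟨_, Submodule.add_mem _ (Submodule.smul_mem _ _ (Submodule.subset_span ⟨j, Set.mem_Iic.2 le_rfl, rfl⟩))
      (Submodule.span_mono (Set.image_mono Set.Iio_subset_Iic_self) hy), h⟩
  · intro f hf g hg f' hf' g' hg' h1 h2
    have h := innerA_Dprime hp r (span_mA_le hf) (span_mA_le hg)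
    rwa [innerA_congr hp (f := Dprime p r f) (f' := f') (g := g) (g' := g) h1 (by simp),
      innerA_congr hp (f := f) (f' := f) (g := Dprime p r g) (g' := g') (by simp) h2] at h

end KoornA

end

noncomputable section

namespace KoornA

variable {n : ℕ}

/-! ### The Macdonald polynomials of type `A` -/

/-- The Macdonald polynomials of type `A`, constructed by orthogonalisation. -/
def macA {p : Params} (hp : p.Admissible) (μ : DomA n) : (Fin n → ℂ) → ℂ :=
  mA μ + (exists_macdonald hp μ).choose

lemma macA_sub_mem {p : Params} (hp : p.Admissible) (μ : DomA n) :
    macA hp μ - mA μ ∈ Submodule.span ℂ (mA '' Set.Iio μ) := by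
  rw [macA, add_sub_cancel_left]
  exact (exists_macdonald hp μ).choose_spec.1

lemma macA_orth {p : Params} (hp : p.Admissible) {μ ν : DomA n} (h : ν < μ) :
    innerA p (macA hp μ) (mA ν) = 0 := (exists_macdonald hp μ).choose_spec.2 ν h

lemma macA_eigen {p : Params} (hp : p.Admissible) (r : ℕ) (μ : DomA n) :
    DprimeL p r (macA hp μ) - (evA p r μ.1 : ℂ) • macA hp μ ∈ nullA n :=
  macdonald_eigen hp r (exists_macdonald hp μ).choose_spec.1
    (exists_macdonald hp μ).choose_spec.2

lemma span_mac_eq {Q : DomA n → (Fin n → ℂ) → ℂ}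
    (hQ : ∀ μ, Q μ - mA μ ∈ Submodule.span ℂ (mA '' Set.Iio μ)) (μ : DomA n) :
    Submodule.span ℂ (Q '' Set.Iio μ) = Submodule.span ℂ (mA '' Set.Iio μ) :=
  span_image_Iio_eq hQ μ

lemma mem_of_sub_mem {Q : DomA n → (Fin n → ℂ) → ℂ}
    (hQ : ∀ μ, Q μ - mA μ ∈ Submodule.span ℂ (mA '' Set.Iio μ)) (μ : DomA n) :
    Q μ ∈ expSpan (latA n) := by
  have := Submodule.add_mem _ (span_mA_image_le _ (hQ μ)) (mA_mem μ)
  rwa [sub_add_cancel] at this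

lemma macA_mem {p : Params} (hp : p.Admissible) (μ : DomA n) : macA hp μ ∈ expSpan (latA n) :=
  mem_of_sub_mem (macA_sub_mem hp) μ

/-- The elementary symmetric functions are the coefficients, up to sign, of ∏(X - f_j) and so
determine the multiset of its roots; monotonicity fixes their order. -/
lemma eq_of_esymm_eq {f g : Fin n → ℝ} (hf : Monotone f) (hg : Monotone g)
    (h : ∀ r, 1 ≤ r → r ≤ n → (Multiset.map f (Finset.univ : Finset (Fin n)).val).esymm r
      = (Multiset.map g (Finset.univ : Finset (Fin n)).val).esymm r) : f = g := by
  set s := Multiset.map f (Finset.univ : Finset (Fin n)).val with hs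
  set t := Multiset.map g (Finset.univ : Finset (Fin n)).val with ht
  have hcs : Multiset.card s = n := by simp [hs]
  have hct : Multiset.card t = n := by simp [ht]
  have h1 : s = t := by
    rw [← Polynomial.roots_multiset_prod_X_sub_C s, ← Polynomial.roots_multiset_prod_X_sub_C t,
      Multiset.prod_X_sub_X_eq_sum_esymm, Multiset.prod_X_sub_X_eq_sum_esymm, hcs, hct]
    congr 1
    refine Finset.sum_congr rfl fun r hr => ?_
    rcases Nat.eq_zero_or_pos r with rfl | h0
    · simp [Multiset.esymm]
    · rw [h r h0 (by simpa [Nat.lt_succ_iff] using hr)]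
  have hl : (List.ofFn f).Perm (List.ofFn g) := by
    rw [← Multiset.coe_eq_coe]
    simpa [hs, ht, Fin.univ_val_map] using h1
  exact List.ofFn_injective (hl.eq_of_pairwise' hf.sortedLE_ofFn.pairwise
    hg.sortedLE_ofFn.pairwise)

/-- As g ≥ 0 and μ is dominant, the numbers e^{-β(gρ_j + μ_j)} are monotone in j and can be read off
from their elementary symmetric functions. -/
lemma evA_injective {p : Params} (hp : p.Admissible) {μ ν : DomA n}
    (h : ∀ r, 1 ≤ r → r ≤ n → evA p r μ.1 = evA p r ν.1) : μ = ν := by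
  have hβ := hp.β_pos
  have hmono : ∀ μ : DomA n, Monotone fun j => Real.exp (-p.β * (p.g * rhoHalf n j + μ.1 j)) := by
    intro μ i j hij
    refine Real.exp_le_exp.2 ?_
    have h1 := mul_le_mul_of_nonneg_left (rhoHalf_strictAnti.antitone hij) hp.g_nonneg
    have h2 := μ.2.antitone hij
    nlinarith
  have h1 := eq_of_esymm_eq (hmono μ) (hmono ν) fun r h1 h2 => by
    simpa [evA, esA_eq_esymm] using h r h1 h2
  ext j
  have h2 := Real.exp_injective (congrFun h1 j)
  have h3 := mul_left_cancel₀ (neg_ne_zero.2 hβ.ne') h2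
  linarith

/-- If the inner product were nonzero, symmetry of each `D̂'_r` would make the real eigenvalues at μ
and ν agree for all r, so μ = ν. -/
lemma macA_orthogonal {p : Params} (hp : p.Admissible) {μ ν : DomA n} (h : μ ≠ ν) :
    innerA p (macA hp μ) (macA hp ν) = 0 := by
  by_contra h0
  refine h (evA_injective hp fun r _ _ => ?_)
  have hμ := macA_mem hp μ
  have hν := macA_mem hp ν
  have hB := isFormA (n := n) hp
  have h1 := innerA_Dprime hp r hμ hν
  rw [innerA_congr hp (f := Dprime p r _) (g := macA hp ν) (g' := macA hp ν) (macA_eigen hp r μ)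
      (by simp), innerA_congr hp (f := macA hp μ) (f' := macA hp μ) (g := Dprime p r _) (by simp)
      (macA_eigen hp r ν), hB.smul_left _ _ hμ _ hν, hB.smul_right _ hμ hν, Complex.conj_ofReal] at h1
  exact_mod_cast mul_right_cancel₀ h0 h1

lemma isMonicTriangularA_iff {μ : DomA n} {P : (Fin n → ℂ) → ℂ} : IsMonicTriangularA μ.1 P
    ↔ P - mA μ ∈ Submodule.span ℂ (mA '' Set.Iio μ) := by
  constructor
  · rintro ⟨u, hu, h1, rfl⟩
    have hμ : μ.1 ∈ u.support := by simp [h1]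
    have e : (fun x => u.sum fun ν a => a * monoA ν x) - mA μ
        = ∑ ν ∈ u.support.erase μ.1, u ν • monoA ν := by
      ext x
      rw [Pi.sub_apply, Finsupp.sum, ← Finset.add_sum_erase _ _ hμ, h1, one_mul, mA,
        add_sub_cancel_left, Finset.sum_apply]
      rfl
    rw [e]
    refine Submodule.sum_mem _ fun ν hν => Submodule.smul_mem _ _ ?_
    obtain ⟨hne, hν⟩ := Finset.mem_erase.1 hν
    obtain ⟨hd, hle⟩ := hu ν hν
    refine Submodule.subset_span ⟨⟨ν, hd⟩, ?_, rfl⟩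
    exact lt_of_le_of_ne (DomA.le_def.2 hle) fun h => hne (congrArg DomA.val h)
  · intro h
    obtain ⟨l, hl, hP⟩ := (Finsupp.mem_span_image_iff_linearCombination ℂ).1 h
    rw [Finsupp.mem_supported] at hl
    have hinj : Function.Injective (DomA.val : DomA n → Fin n → ℝ) := fun _ _ h => DomA.ext h
    have hμ : l μ = 0 := by
      by_contra h0
      exact lt_irrefl μ (hl (Finsupp.mem_support_iff.2 h0))
    classical
    refine ⟨Finsupp.mapDomain DomA.val (l + Finsupp.single μ 1), fun ν hν => ?_, ?_, ?_⟩
    · obtain ⟨κ, hκ, rfl⟩ := Finset.mem_image.1 (Finsupp.mapDomain_support hν)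
      refine ⟨κ.2, DomA.le_def.1 ?_⟩
      rcases Finset.mem_union.1 (Finsupp.support_add hκ) with h1 | h1
      · exact le_of_lt (hl h1)
      · rw [Finset.mem_singleton.1 (Finsupp.support_single_subset h1)]
    · rw [Finsupp.mapDomain_apply hinj]
      simp [hμ]
    · ext x
      rw [Finsupp.sum_mapDomain_index (by simp) (by intros; ring), Finsupp.sum_add_index'
        (by simp) (by intros; ring), Finsupp.sum_single_index (by simp), one_mul]
      have h1 := congrFun hP x
      rw [Finsupp.linearCombination_apply, Finsupp.sum, Finset.sum_apply, Pi.sub_apply] at h1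
      rw [← sub_eq_iff_eq_add]
      exact h1.symm

/-- The family of Macdonald polynomials, extended by zero. -/
def macFam {p : Params} (hp : p.Admissible) (μ : Fin n → ℝ) : (Fin n → ℂ) → ℂ :=
  open Classical in if h : IsDomWeightA μ then macA hp ⟨μ, h⟩ else 0

lemma macFam_eq {p : Params} (hp : p.Admissible) (μ : DomA n) : macFam hp μ.1 = macA hp μ := by
  rw [macFam, dif_pos μ.2]

lemma isMacdonaldA_macFam {p : Params} (hp : p.Admissible) :
    IsMacdonaldA (n := n) p (macFam hp) := by
  refine ⟨fun μ hμ => ?_, fun μ ν hμ hν hne => ?_⟩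
  · rw [macFam_eq hp ⟨μ, hμ⟩]
    exact isMonicTriangularA_iff.2 (macA_sub_mem hp ⟨μ, hμ⟩)
  · rw [macFam_eq hp ⟨μ, hμ⟩, macFam_eq hp ⟨ν, hν⟩]
    exact macA_orthogonal hp fun h => hne (congrArg DomA.val h)

/-- The lower members of Q span the same space as the lower orbit sums, so Q ν is orthogonal to that
space, as is `macA`; their difference belongs to it and hence vanishes. -/
theorem macdonaldA_unique {p : Params} (hp : p.Admissible)
    {Q : (Fin n → ℝ) → (Fin n → ℂ) → ℂ} (hQ : IsMacdonaldA p Q) {μ : Fin n → ℝ}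
    (hμ : IsDomWeightA μ) : Q μ = macFam hp μ := by
  have hB := isFormA (n := n) hp
  have hQ1 : ∀ μ : DomA n, Q μ.1 - mA μ ∈ Submodule.span ℂ (mA '' Set.Iio μ) := fun μ =>
    isMonicTriangularA_iff.1 (hQ.1 μ.1 μ.2)
  have hQm : ∀ μ : DomA n, Q μ.1 ∈ expSpan (latA n) := mem_of_sub_mem (Q := fun μ => Q μ.1) hQ1
  obtain ⟨ν, rfl⟩ : ∃ ν : DomA n, ν.1 = μ := ⟨⟨μ, hμ⟩, rfl⟩
  rw [macFam_eq]
  have hs : mA '' Set.Iio ν ⊆ (expSpan (latA n) : Set ((Fin n → ℂ) → ℂ)) := by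
    rintro _ ⟨κ, -, rfl⟩
    exact mA_mem κ
  have hd : Q ν.1 - macA hp ν ∈ Submodule.span ℂ (mA '' Set.Iio ν) := by
    have := Submodule.sub_mem _ (hQ1 ν) (macA_sub_mem hp ν)
    rwa [sub_sub_sub_cancel_right] at this
  refine sub_eq_zero.1 (hB.eq_zero_of_orth hs hd ?_)
  have hQorth : ∀ y ∈ Submodule.span ℂ (mA '' Set.Iio ν), innerA p (Q ν.1) y = 0 := by
    intro y hy
    rw [← span_mac_eq (Q := fun μ => Q μ.1) hQ1] at hy
    refine hB.orth_span (s := (fun μ : DomA n => Q μ.1) '' Set.Iio ν) ?_ (hQm ν) ?_ hy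
    · rintro _ ⟨κ, -, rfl⟩
      exact hQm κ
    · rintro _ ⟨κ, hκ, rfl⟩
      exact hQ.2 _ _ ν.2 κ.2 fun h => (ne_of_gt hκ) (DomA.ext h)
  rintro _ ⟨κ, hκ, rfl⟩
  rw [hB.sub_left (hQm ν) (macA_mem hp ν) (mA_mem κ), macA_orth hp hκ,
    hQorth _ (Submodule.subset_span ⟨κ, hκ, rfl⟩), sub_zero]

lemma linearIndependent_ex : LinearIndependent ℂ (ex (n := n)) := by
  have h := linearIndependent_ex_real (m := n)
  let T : ((Fin n → ℂ) → ℂ) →ₗ[ℂ] (Fin n → ℝ) → ℂ :=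
    { toFun := fun f s => f (cvec s), map_add' := fun _ _ => rfl, map_smul' := fun _ _ => rfl }
  exact LinearIndependent.of_comp T h

/-- Sums of exponentials over disjoint orbits are linearly independent. -/
lemma linearIndependent_orbitSum {I J : Type*} {e : J → Fin n → ℝ} (he : Function.Injective e)
    (orb : I → Finset J) (pt : I → J) (h : ∀ i j, pt i ∈ orb j ↔ i = j) :
    LinearIndependent ℂ fun i => fun x => ∑ ν ∈ orb i, ex (e ν) x := by
  classical
  have hex : LinearIndependent ℂ fun ν => ex (e ν) := linearIndependent_ex.comp e he
  have h1 : LinearIndependent ℂ fun i => ∑ ν ∈ orb i, Finsupp.single ν (1 : ℂ) := by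
    rw [linearIndependent_iff']
    intro s c hc i hi
    have h2 := DFunLike.congr_fun hc (pt i)
    simp only [Finsupp.coe_finsetSum, Finset.sum_apply, Finsupp.smul_apply, smul_eq_mul,
      Finsupp.coe_zero, Pi.zero_apply, Finsupp.single_apply, Finset.sum_ite_eq', h, mul_ite,
      mul_one, mul_zero, Finset.sum_ite_eq, hi, if_true] at h2
    exact h2
  have h3 := h1.map' (Finsupp.linearCombination ℂ fun ν => ex (e ν)) (LinearMap.ker_eq_bot.2 hex)
  have h4 : (fun i => fun x => ∑ ν ∈ orb i, ex (e ν) x)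
      = (Finsupp.linearCombination ℂ fun ν => ex (e ν))
        ∘ fun i => ∑ ν ∈ orb i, Finsupp.single ν (1 : ℂ) := by
    ext i x
    simp [map_sum, Finset.sum_apply]
  rw [h4]
  exact h3

lemma antitone_eq_of_comp {α : Type*} [PartialOrder α] {f g : Fin n → α} (hf : Antitone f)
    (hg : Antitone g) {σ : Equiv.Perm (Fin n)} (h : g ∘ σ = f) : f = g := by
  have h0 : (OrderDual.toDual ∘ g) ∘ σ = OrderDual.toDual ∘ f := by rw [Function.comp_assoc, h]
  have h1 := Tuple.unique_monotone (f := OrderDual.toDual ∘ g) (σ := σ) (τ := 1)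
    (by rw [h0]; exact hf.dual_right) hg.dual_right
  rw [h0] at h1
  ext i
  exact OrderDual.toDual.injective (congrFun h1 i)

lemma mA_linearIndependent : LinearIndependent ℂ (mA (n := n)) :=
  linearIndependent_orbitSum (e := id) Function.injective_id (fun μ : DomA n => orbitS μ.1)
    DomA.val fun μ ν => by
      constructor
      · intro h
        obtain ⟨σ, hσ⟩ := mem_orbitS.1 h
        exact DomA.ext (antitone_eq_of_comp μ.2.antitone ν.2.antitone hσ)
      · rintro rfl
        exact self_mem_orbitS _

lemma macA_ne_zero {p : Params} (hp : p.Admissible) (μ : DomA n) : macA hp μ ≠ 0 := by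
  intro h
  have h1 := macA_sub_mem hp μ
  rw [h, zero_sub, Submodule.neg_mem_iff] at h1
  exact mA_linearIndependent.notMem_span_image (by simp) h1

end KoornA

end

/-! ### Koornwinder's operator: triangularity, symmetry and eigenfunctions. -/

noncomputable section

namespace KoornA

/-! ### Even Laurent polynomials in one variable -/

/-- The exponential `e^{ikx}`. -/
def lau (k : ℤ) (x : ℂ) : ℂ := Complex.exp (Complex.I * k * x)

lemma lau_mul (k l : ℤ) : lau k * lau l = lau (k + l) := by
  ext x
  simp only [Pi.mul_apply, lau, ← Complex.exp_add]
  congr 1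
  push_cast
  ring

lemma lau_zero : lau 0 = 1 := by
  ext x
  simp [lau]

lemma lau_neg (k : ℤ) (x : ℂ) : lau k (-x) = lau (-k) x := by
  simp [lau]

lemma lau_mul_apply (k l : ℤ) (x : ℂ) : lau k x * lau l x = lau (k + l) x := congrFun (lau_mul k l) x

/-- Laurent polynomials in `e^{ix}` with exponents in `[a, b]`. -/
def Lau (a b : ℤ) : Submodule ℂ (ℂ → ℂ) := Submodule.span ℂ (lau '' Set.Icc a b)

lemma lau_mem {a b k : ℤ} (h1 : a ≤ k) (h2 : k ≤ b) : lau k ∈ Lau a b :=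
  Submodule.subset_span ⟨k, ⟨h1, h2⟩, rfl⟩

lemma Lau_mul {a b c d : ℤ} {f g : ℂ → ℂ} (hf : f ∈ Lau a b) (hg : g ∈ Lau c d) :
    f * g ∈ Lau (a + c) (b + d) := by
  have h := Submodule.mul_mem_mul hf hg
  rw [Lau, Lau, Submodule.span_mul_span] at h
  refine Submodule.span_le.2 ?_ h
  rintro _ ⟨_, ⟨k, hk, rfl⟩, _, ⟨l, hl, rfl⟩, rfl⟩
  simp only
  rw [lau_mul]
  exact lau_mem (add_le_add hk.1 hl.1) (add_le_add hk.2 hl.2)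

/-- The symmetrised exponential: `1` for `k = 0` and `2 cos kx` otherwise. -/
def gsym (k : ℤ) : ℂ → ℂ := fun x => ∑ e ∈ ({k, -k} : Finset ℤ), lau e x

lemma gsym_zero : gsym 0 = 1 := by
  ext x
  simp [gsym, lau_zero]

lemma gsym_of_ne {k : ℤ} (h : k ≠ 0) : gsym k = lau k + lau (-k) := by
  ext x
  rw [gsym, Finset.sum_pair (by omega)]
  rfl

lemma gsym_neg (k : ℤ) (x : ℂ) : gsym k (-x) = gsym k x := by
  by_cases h : k = 0
  · simp [h, gsym_zero]
  · simp only [gsym_of_ne h, Pi.add_apply, lau_neg, neg_neg, add_comm]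

/-- The span of the `gsym k`, `0 ≤ k ≤ d`. -/
def Sym1 (d : ℤ) : Submodule ℂ (ℂ → ℂ) := Submodule.span ℂ (gsym '' Set.Icc 0 d)

lemma gsym_mem {k d : ℤ} (h0 : 0 ≤ k) (h : k ≤ d) : gsym k ∈ Sym1 d :=
  Submodule.subset_span ⟨k, ⟨h0, h⟩, rfl⟩

lemma Sym1_mono {d e : ℤ} (h : d ≤ e) : Sym1 d ≤ Sym1 e :=
  Submodule.span_mono (Set.image_mono (Set.Icc_subset_Icc_right h))

/-- The addition formula for cosines. Small k are separate: for k = 0 there is no remainder, and for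
k = 1 it is 2 `gsym 0`, since `gsym 0` is 1 and not 2. -/
lemma gsym_one_mul_gsym {k : ℤ} (h0 : 0 ≤ k) : gsym 1 * gsym k - gsym (k + 1) ∈ Sym1 (k - 1) := by
  rcases h0.eq_or_lt with rfl | h0
  · rw [gsym_zero, mul_one, zero_add, sub_self]
    exact Submodule.zero_mem _
  rcases (Int.add_one_le_iff.2 h0).eq_or_lt with h1 | h1
  · obtain rfl : k = 1 := by omega
    have : gsym 1 * gsym 1 - gsym (1 + 1) = (2 : ℂ) • gsym 0 := by
      rw [gsym_zero, gsym_of_ne one_ne_zero, gsym_of_ne (by norm_num), mul_add, add_mul, add_mul,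
        lau_mul, lau_mul, lau_mul, lau_mul, show (1 : ℤ) + -1 = 0 by norm_num,
        show (-1 : ℤ) + 1 = 0 by norm_num, lau_zero]
      norm_num
      module
    rw [this]
    exact Submodule.smul_mem _ _ (gsym_mem le_rfl (by norm_num))
  · have : gsym 1 * gsym k - gsym (k + 1) = gsym (k - 1) := by
      rw [gsym_of_ne one_ne_zero, gsym_of_ne (by omega), gsym_of_ne (by omega),
        gsym_of_ne (by omega), mul_add, add_mul, add_mul, lau_mul, lau_mul, lau_mul, lau_mul]
      rw [show 1 + k = k + 1 by ring, show -1 + k = k - 1 by ring, show 1 + -k = -(k - 1) by ring,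
        show -1 + -k = -(k + 1) by ring]
      abel
    rw [this]
    exact gsym_mem (by omega) le_rfl

lemma gsym_one_mul_mem {d : ℤ} {f : ℂ → ℂ} (hf : f ∈ Sym1 d) : gsym 1 * f ∈ Sym1 (d + 1) := by
  induction hf using Submodule.span_induction with
  | mem f hf =>
    obtain ⟨k, hk, rfl⟩ := hf
    have h1 := Sym1_mono (by linarith [hk.2] : k - 1 ≤ d + 1) (gsym_one_mul_gsym hk.1)
    have h2 := gsym_mem (by linarith [hk.1] : 0 ≤ k + 1) (by linarith [hk.2] : k + 1 ≤ d + 1)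
    simpa using Submodule.add_mem _ h1 h2
  | zero => rw [mul_zero]; exact Submodule.zero_mem _
  | add a b _ _ ha hb => rw [mul_add]; exact Submodule.add_mem _ ha hb
  | smul c a _ ha => rw [mul_smul_comm]; exact Submodule.smul_mem _ _ ha

lemma pow_mul_gsym (u : ℕ) {k : ℤ} (h0 : 0 ≤ k) :
    gsym 1 ^ u * gsym k - gsym (u + k) ∈ Sym1 (u + k - 1) := by
  induction u with
  | zero => simp
  | succ u ih =>
    have h1 := gsym_one_mul_mem ih
    have h2 := Sym1_mono (by linarith : (u + k - 1 : ℤ) ≤ u + k)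
      (gsym_one_mul_gsym (by positivity : (0 : ℤ) ≤ u + k))
    rw [sub_add_cancel] at h1
    have h3 := Submodule.add_mem _ h1 h2
    push_cast
    rw [show (u : ℤ) + 1 + k - 1 = u + k by ring, show (u : ℤ) + 1 + k = u + k + 1 by ring]
    convert h3 using 1
    rw [pow_succ]
    ring

/-- The quotient sin mx / sin x is a Chebyshev polynomial of the second kind; passing from m to m +
2 adds 2 cos((m+1)x). -/
lemma exists_sine_quotient (m : ℕ) :
    ∃ b ∈ Sym1 (m - 1), b * (lau 1 - lau (-1)) = lau m - lau (-m) := by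
  induction m using Nat.twoStepInduction with
  | zero => exact ⟨0, Submodule.zero_mem _, by simp⟩
  | one => exact ⟨gsym 0, gsym_mem le_rfl (by norm_num), by rw [gsym_zero]; simp⟩
  | more m ih _ =>
    obtain ⟨b, hb, h⟩ := ih
    refine ⟨b + gsym (m + 1), Submodule.add_mem _ (Sym1_mono (by push_cast; linarith) hb)
      (gsym_mem (by positivity) (by push_cast; linarith)), ?_⟩
    rw [add_mul, h, gsym_of_ne (by positivity), add_mul, mul_sub, mul_sub, lau_mul, lau_mul, lau_mul,
      lau_mul]
    push_cast
    rw [show (m : ℤ) + 1 + 1 = m + 2 by ring, show (m : ℤ) + 1 + -1 = m by ring,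
      show -((m : ℤ) + 1) + 1 = -m by ring, show -((m : ℤ) + 1) + -1 = -(m + 2) by ring]
    abel

/-- For h = e^{iex} the right side is e^{ix} times a multiple of sin((e-1)x), while 1 - e^{2ix} is
e^{ix} times a multiple of sin x. The range of exponents, symmetric about 1, bounds |e - 1| by D +
1. -/
lemma exists_reflection_quotient {D : ℤ} {h : ℂ → ℂ} (hh : h ∈ Lau (-D) (D + 2)) :
    ∃ b ∈ Sym1 D, ∀ x, b x * (1 - lau 2 x) = h x - lau 2 x * h (-x) := by
  induction hh using Submodule.span_induction with
  | mem f hf =>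
    obtain ⟨e, he, rfl⟩ := hf
    have key : ∀ x, lau 1 x * (lau (e - 1) x - lau (-(e - 1)) x) = lau e x - lau 2 x * lau e (-x) := by
      intro x
      rw [lau_neg, mul_sub, lau_mul_apply, lau_mul_apply, lau_mul_apply]
      congr 2 <;> ring
    have key2 : ∀ x, 1 - lau 2 x = -(lau 1 x * (lau 1 x - lau (-1) x)) := by
      intro x
      rw [mul_sub, lau_mul_apply, lau_mul_apply, show (1 : ℤ) + -1 = 0 by norm_num, lau_zero]
      norm_num
    obtain ⟨b, hb, h⟩ := exists_sine_quotient (e - 1).natAbs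
    have hb' : b ∈ Sym1 D := Sym1_mono (by have := he.1; have := he.2; omega) hb
    rcases le_total 0 (e - 1) with h0 | h0
    · refine ⟨-b, Submodule.neg_mem _ hb', fun x => ?_⟩
      rw [Int.natAbs_of_nonneg h0] at h
      have h2 := congrFun h x
      simp only [Pi.mul_apply, Pi.sub_apply] at h2
      rw [← key, ← h2, key2, Pi.neg_apply]
      ring
    · refine ⟨b, hb', fun x => ?_⟩
      rw [Int.ofNat_natAbs_of_nonpos h0, neg_neg] at h
      have h2 := congrFun h x
      simp only [Pi.mul_apply, Pi.sub_apply] at h2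
      rw [← key, key2, ← neg_sub (lau (-(e - 1)) x), ← h2]
      ring
  | zero => exact ⟨0, Submodule.zero_mem _, by simp⟩
  | add f g _ _ hf hg =>
    obtain ⟨b, hb, h1⟩ := hf
    obtain ⟨c, hc, h2⟩ := hg
    refine ⟨b + c, Submodule.add_mem _ hb hc, fun x => ?_⟩
    simp only [Pi.add_apply]
    linear_combination h1 x + h2 x
  | smul a f _ hf =>
    obtain ⟨b, hb, h1⟩ := hf
    refine ⟨a • b, Submodule.smul_mem _ _ hb, fun x => ?_⟩
    simp only [Pi.smul_apply, smul_eq_mul]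
    linear_combination a * h1 x

/-! ### The action of the difference operator in one variable -/

/-- The points where the coefficients `vb(±x)` are regular. -/
def Reg1 (p : Params) (x : ℂ) : Prop :=
  1 - lau 2 x ≠ 0 ∧ 1 - p.q * lau 2 x ≠ 0 ∧ 1 - p.q * lau (-2) x ≠ 0

lemma Reg1.neg {p : Params} {x : ℂ} (h : Reg1 p x) : Reg1 p (-x) := by
  refine ⟨?_, ?_, ?_⟩
  · rw [lau_neg]
    intro h0
    apply h.1
    have h1 := lau_mul_apply 2 (-2) x
    rw [show (2 : ℤ) + -2 = 0 by norm_num, lau_zero, Pi.one_apply] at h1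
    linear_combination -h1 - lau 2 x * h0
  · rw [lau_neg]
    exact h.2.2
  · rw [lau_neg]
    exact h.2.1

/-- The factor contributed by one sign. -/
def bTerm (p : Params) (u : ℕ) (v : ℤ) (x : ℂ) : ℂ :=
  vb p x * (gsym 1 (x + Complex.I * p.β * p.g) ^ u * (gsym v (x + Complex.I * p.β) - gsym v x))

lemma lau_shift (p : Params) (a : ℝ) (k : ℤ) (x : ℂ) :
    lau k (x + Complex.I * p.β * a) = Real.exp (-p.β * a * k) * lau k x := by
  simp only [lau]
  rw [Complex.ofReal_exp, ← Complex.exp_add]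
  congr 1
  push_cast
  linear_combination (p.β * a * k : ℂ) * Complex.I_sq

lemma lau_two_pow (x : ℂ) (l : ℕ) : lau 2 x ^ l = lau (2 * l) x := by
  rw [lau, lau, ← Complex.exp_nat_mul]
  congr 1
  push_cast
  ring

/-- Where q e^{2ix} = 1 the points x + iβ and -x agree modulo 2π, so the difference of the even
function vanishes there. This zero cancels the pole of v_b that comes from the factors with γ. -/
lemma gsym_shift_sub (p : Params) (v : ℕ) : ∃ h ∈ Lau (-(v : ℤ)) (v - 2), ∀ x,
    gsym v (x + Complex.I * p.β) - gsym v x = (1 - p.q * lau 2 x) * h x := by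
  rcases Nat.eq_zero_or_pos v with rfl | hv
  · exact ⟨0, Submodule.zero_mem _, by simp [gsym_zero]⟩
  refine ⟨((p.q : ℂ)⁻¹ ^ v * (1 - (p.q : ℂ) ^ v)) •
    ∑ l ∈ Finset.range v, (p.q : ℂ) ^ l • lau (-v + 2 * l), ?_, fun x => ?_⟩
  · refine Submodule.smul_mem _ _ (Submodule.sum_mem _ fun l hl => Submodule.smul_mem _ _
      (lau_mem (by omega) ?_))
    have := Finset.mem_range.1 hl
    omega
  · have hq : (p.q : ℂ) ≠ 0 := by exact_mod_cast p.q_pos.ne'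
    have h1 : ∀ k : ℤ, lau k (x + Complex.I * p.β) = (p.q : ℂ) ^ k * lau k x := by
      intro k
      have := lau_shift p 1 k x
      rw [Complex.ofReal_one, mul_one] at this
      rw [this, Params.q, Complex.ofReal_exp, Complex.ofReal_exp, ← Complex.exp_int_mul]
      congr 2
      push_cast
      ring
    have h2 : ∑ l ∈ Finset.range v, (p.q : ℂ) ^ l * lau (-v + 2 * l) x
        = lau (-v) x * ∑ l ∈ Finset.range v, ((p.q : ℂ) * lau 2 x) ^ l := by
      rw [Finset.mul_sum]
      refine Finset.sum_congr rfl fun l _ => ?_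
      rw [mul_pow, lau_two_pow, ← lau_mul_apply]
      ring
    have h3 := mul_neg_geom_sum ((p.q : ℂ) * lau 2 x) v
    rw [gsym_of_ne (by exact_mod_cast hv.ne')]
    simp only [Pi.add_apply, Pi.smul_apply, Finset.sum_apply, smul_eq_mul]
    rw [h1, h1, h2, zpow_neg, zpow_natCast]
    have h4 : lau (-v) x * lau 2 x ^ v = lau v x := by
      rw [lau_two_pow, lau_mul_apply]
      congr 1
      ring
    rw [mul_pow] at h3
    have h5 : (p.q : ℂ) ^ v ≠ 0 := pow_ne_zero _ hq
    rw [inv_pow]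
    field_simp
    linear_combination (-(1 - (p.q : ℂ) ^ v) * lau (-v) x) * h3 + (p.q : ℂ) ^ v * (1 - (p.q : ℂ) ^ v) * h4

lemma gsym_one_shift_pow_mem (p : Params) (u : ℕ) :
    (fun x => gsym 1 (x + Complex.I * p.β * p.g) ^ u) ∈ Lau (-(u : ℤ)) u := by
  induction u with
  | zero =>
    have : (fun x => gsym 1 (x + Complex.I * p.β * p.g) ^ 0) = lau 0 := by
      ext x
      simp [lau_zero]
    rw [this]
    exact lau_mem (by simp) (by simp)
  | succ u ih =>
    have h1 : (fun x => gsym 1 (x + Complex.I * p.β * p.g)) ∈ Lau (-1) 1 := by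
      have : (fun x => gsym 1 (x + Complex.I * p.β * p.g))
          = ((Real.exp (-p.β * p.g * (1 : ℤ)) : ℝ) : ℂ) • lau 1
            + ((Real.exp (-p.β * p.g * (-1 : ℤ)) : ℝ) : ℂ) • lau (-1) := by
        ext x
        rw [gsym_of_ne one_ne_zero]
        simp only [Pi.add_apply, Pi.smul_apply, smul_eq_mul, lau_shift]
      rw [this]
      exact Submodule.add_mem _ (Submodule.smul_mem _ _ (lau_mem (by norm_num) (by norm_num)))
        (Submodule.smul_mem _ _ (lau_mem (by norm_num) (by norm_num)))
    have h2 := Lau_mul ih h1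
    convert h2 using 2
    · push_cast
      ring
    · push_cast
      ring
    · exact pow_succ _ _

lemma one_sub_mem (a : ℂ) : (fun x => 1 - a * lau 1 x) ∈ Lau 0 1 := by
  have : (fun x => 1 - a * lau 1 x) = lau 0 - a • lau 1 := by
    ext x
    simp [lau_zero]
  rw [this]
  exact Submodule.sub_mem _ (lau_mem (by norm_num) (by norm_num))
    (Submodule.smul_mem _ _ (lau_mem (by norm_num) (by norm_num)))

/-- The values c = ±1 and c = ±√q of the four denominators pair up to differences of squares. -/
lemma exists_vb_eq {p : Params} : ∃ N ∈ Lau 0 4, ∀ x,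
    vb p x = N x / ((1 - lau 2 x) * (1 - p.q * lau 2 x)) := by
  set a : Fin 4 → ℂ := fun i => p.cs i * Real.exp (-p.β * p.κs i) with ha
  have h := Lau_mul (Lau_mul (Lau_mul (one_sub_mem (a 0)) (one_sub_mem (a 1)))
    (one_sub_mem (a 2))) (one_sub_mem (a 3))
  norm_num at h
  refine ⟨_, Submodule.smul_mem _ (∏ i, (Real.exp (p.β * p.κs i / 2) : ℂ)) h, fun x => ?_⟩
  have h1 : ∀ i, vfac p (p.cs i) (p.κs i) x = Real.exp (p.β * p.κs i / 2)
      * ((1 - a i * lau 1 x) / (1 - p.cs i * lau 1 x)) := by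
    intro i
    rw [vfac, lau, ha]
    simp
  have h2 : ∏ i, (1 - (p.cs i : ℂ) * lau 1 x) = (1 - lau 2 x) * (1 - p.q * lau 2 x) := by
    have h3 : lau 2 x = lau 1 x * lau 1 x := by rw [lau_mul_apply]; norm_num
    have h4 : (p.q : ℂ) = p.sq * p.sq := by
      have := p.sq_sq
      rw [pow_two] at this
      exact_mod_cast this.symm
    rw [Fin.prod_univ_four, h3, h4]
    simp [Params.cs]
    ring
  rw [vb_eq, Finset.prod_congr rfl fun i _ => h1 i, Finset.prod_mul_distrib, Finset.prod_div_distrib,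
    h2, Fin.prod_univ_four (fun i => 1 - a i * lau 1 x), mul_div_assoc']
  rfl

/-- Only the pole at e^{2ix} = 1 is left, and it cancels when the term is added to its reflection.
The exponents add up from [0, 4], [-u, u] and [-v, v - 2]. -/
lemma exists_bTerm_eq (p : Params) (u v : ℕ) : ∃ h ∈ Lau (-(u + v : ℤ)) (u + v + 2), ∀ x,
    Reg1 p x → bTerm p u v x * (1 - lau 2 x) = h x := by
  obtain ⟨N, hN, hvb⟩ := exists_vb_eq (p := p)
  obtain ⟨k, hk, hkx⟩ := gsym_shift_sub p v
  have h1 := Lau_mul (Lau_mul hN (gsym_one_shift_pow_mem p u)) hk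
  refine ⟨_, by convert h1 using 2 <;> ring, fun x hx => ?_⟩
  rw [bTerm, hvb, hkx]
  have h2 := hx.1
  have h3 := hx.2.1
  simp only [Pi.mul_apply]
  rw [div_mul_eq_mul_div, div_mul_eq_mul_div, div_eq_iff (mul_ne_zero h2 h3)]
  ring

/-- The two signs together give an even Laurent polynomial. -/
lemma exists_bTerm_add_eq (p : Params) (u v : ℕ) : ∃ b ∈ Sym1 (u + v), ∀ x, Reg1 p x →
    bTerm p u v x + bTerm p u v (-x) = b x := by
  obtain ⟨h, hh, hx⟩ := exists_bTerm_eq p u v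
  obtain ⟨b, hb, hbx⟩ := exists_reflection_quotient hh
  refine ⟨b, hb, fun x hreg => mul_right_cancel₀ hreg.1 ?_⟩
  rw [hbx, ← hx x hreg, ← hx (-x) hreg.neg, lau_neg]
  have h1 := lau_mul_apply 2 (-2) x
  rw [show (2 : ℤ) + -2 = 0 by norm_num, lau_zero, Pi.one_apply] at h1
  linear_combination -(bTerm p u v (-x)) * h1

end KoornA

end

noncomputable section

namespace KoornA

variable {n : ℕ}

/-! ### Expansion of determinants -/

lemma multilinear_mem_span {ι M N : Type*} [Fintype ι] [DecidableEq ι] [AddCommGroup M]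
    [Module ℂ M] [AddCommGroup N] [Module ℂ N] (F : MultilinearMap ℂ (fun _ : ι => M) N)
    (S : ι → Set M) {f : ι → M} (hf : ∀ i, f i ∈ Submodule.span ℂ (S i)) :
    F f ∈ Submodule.span ℂ {y | ∃ g : ι → M, (∀ i, g i ∈ S i) ∧ F g = y} := by
  have key : ∀ (s : Finset ι) (f : ι → M), (∀ i ∈ s, f i ∈ Submodule.span ℂ (S i)) →
      (∀ i ∉ s, f i ∈ S i) → F f ∈ Submodule.span ℂ {y | ∃ g : ι → M, (∀ i, g i ∈ S i) ∧ F g = y} := by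
    intro s
    induction s using Finset.induction_on with
    | empty => exact fun f _ hf => Submodule.subset_span ⟨f, fun i => hf i (by simp), rfl⟩
    | insert a s ha ih =>
      intro f h1 h2
      have hle : Submodule.span ℂ (S a) ≤ (Submodule.span ℂ
          {y | ∃ g : ι → M, (∀ i, g i ∈ S i) ∧ F g = y}).comap (F.toLinearMap f a) := by
        rw [Submodule.span_le]
        intro z hz
        refine ih (Function.update f a z) (fun i hi => ?_) fun i hi => ?_
        · rw [Function.update_of_ne (by rintro rfl; exact ha hi)]
          exact h1 i (Finset.mem_insert_of_mem hi)
        · by_cases h : i = a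
          · subst h
            rwa [Function.update_self]
          · rw [Function.update_of_ne h]
            exact h2 i (by simp [h, hi])
      have := hle (h1 a (Finset.mem_insert_self a s))
      simpa using this
  exact key Finset.univ f (fun i _ => hf i) (by simp)

/-- The determinant `det (f_i(x_j))`, as a multilinear function of `f`. -/
def detF (n : ℕ) : MultilinearMap ℂ (fun _ : Fin n => ℂ → ℂ) ((Fin n → ℂ) → ℂ) :=
  MultilinearMap.pi fun x =>
    (Matrix.detRowAlternating (R := ℂ) (n := Fin n)).toMultilinearMap.compLinearMap fun _ => LinearMap.pi fun j => LinearMap.proj (R := ℂ) (φ := fun _ : ℂ => ℂ) (x j)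

lemma detF_apply (f : Fin n → ℂ → ℂ) (x : Fin n → ℂ) :
    detF n f x = (Matrix.of fun i j => f i (x j)).det := rfl

lemma detF_gsym (κ : Fin n → ℤ) : detF n (fun i => gsym (κ i)) = alt gsym κ := rfl

lemma detF_mem {f : Fin n → ℂ → ℂ} {e : Fin n → ℤ} (hf : ∀ i, f i ∈ Sym1 (e i)) :
    detF n f ∈ Submodule.span ℂ (alt gsym '' {κ | ∀ i, 0 ≤ κ i ∧ κ i ≤ e i}) := by
  have h := multilinear_mem_span (detF n) (fun i => gsym '' Set.Icc 0 (e i)) hf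
  refine Submodule.span_mono ?_ h
  rintro _ ⟨g, hg, rfl⟩
  choose κ hκ hκg using hg
  refine ⟨κ, fun i => hκ i, ?_⟩
  rw [← detF_gsym]
  congr 1
  exact funext hκg

/-- In the multilinear expansion every term but the leading one has a row whose exponent lies
strictly below e_i. -/
lemma detF_sub_mem {f : Fin n → ℂ → ℂ} {e : Fin n → ℤ} (he : ∀ i, 0 ≤ e i)
    (hf : ∀ i, f i - gsym (e i) ∈ Sym1 (e i - 1)) :
    detF n f - alt gsym e
      ∈ Submodule.span ℂ (alt gsym '' {κ | (∀ i, 0 ≤ κ i ∧ κ i ≤ e i) ∧ κ ≠ e}) := by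
  have h := (detF n).map_add_univ (fun i => gsym (e i)) (fun i => f i - gsym (e i))
  have h0 : (fun i => gsym (e i)) + (fun i => f i - gsym (e i)) = f := by
    ext i x
    simp
  rw [h0, ← Finset.add_sum_erase _ _ (Finset.mem_univ Finset.univ), Finset.piecewise_univ,
    detF_gsym] at h
  rw [h, add_sub_cancel_left]
  refine Submodule.sum_mem _ fun s hs => ?_
  have hs' : s ≠ Finset.univ := Finset.ne_of_mem_erase hs
  obtain ⟨i₀, hi₀⟩ : ∃ i, i ∉ s := by
    by_contra hall
    push Not at hall
    exact hs' (Finset.eq_univ_iff_forall.2 hall)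
  have h1 := multilinear_mem_span (detF n)
    (fun i => gsym '' (if i ∈ s then {e i} else Set.Icc 0 (e i - 1)))
    (f := s.piecewise (fun i => gsym (e i)) fun i => f i - gsym (e i)) (fun i => by
      by_cases hi : i ∈ s
      · simp only [Finset.piecewise_eq_of_mem _ _ _ hi, if_pos hi]
        exact Submodule.subset_span ⟨e i, rfl, rfl⟩
      · simp only [Finset.piecewise_eq_of_notMem _ _ _ hi, if_neg hi]
        exact hf i)
  refine Submodule.span_mono ?_ h1
  rintro _ ⟨g, hg, rfl⟩
  choose κ hκ hκg using hg
  refine ⟨κ, ⟨fun i => ?_, fun h => ?_⟩, ?_⟩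
  · have := hκ i
    split_ifs at this
    · rw [Set.mem_singleton_iff] at this
      exact ⟨this ▸ he i, this.le⟩
    · exact ⟨this.1, by linarith [this.2]⟩
  · have := hκ i₀
    rw [if_neg hi₀, h] at this
    linarith [this.2]
  · rw [← detF_gsym]
    congr 1
    exact funext hκg

/-! ### Dominant weights of the Koornwinder polynomials -/

/-- The cone of dominant weights with its partial order. -/
@[ext]
structure DomK (n : ℕ) where
  val : Fin n → ℤ
  prop : IsDom val

instance : PartialOrder (DomK n) where
  le ν μ := DomLE ν.1 μ.1
  le_refl _ _ := le_rfl
  le_trans _ _ _ h1 h2 k := (h1 k).trans (h2 k)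
  le_antisymm _ _ h1 h2 := DomK.ext (eq_of_sum_Iic_eq fun k => le_antisymm (h1 k) (h2 k))

lemma DomK.le_def {ν μ : DomK n} : ν ≤ μ ↔ DomLE ν.1 μ.1 := Iff.rfl

lemma DomK.finite_Iic (μ : DomK n) : (Set.Iic μ).Finite := by
  have hinj : Function.Injective (DomK.val : DomK n → Fin n → ℤ) := fun _ _ h => DomK.ext h
  refine Set.Finite.of_finite_image (f := DomK.val) ?_ hinj.injOn
  refine (Set.finite_Icc (0 : Fin n → ℤ) fun k => ∑ j ∈ Finset.Iic k, μ.1 j).subset ?_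
  rintro _ ⟨ν, hν, rfl⟩
  refine ⟨fun k => ν.2.2 k, fun k => le_trans ?_ (hν k)⟩
  exact Finset.single_le_sum (f := ν.1) (fun j _ => ν.2.2 j) (Finset.mem_Iic.2 le_rfl)

instance : WellFoundedLT (DomK n) := wellFoundedLT_of_finite_Iic DomK.finite_Iic

/-- The exponents `n - 1, …, 1, 0`. -/
def deltaK (i : Fin n) : ℕ := (Fin.rev i : Fin n)

lemma deltaK_strictAnti : StrictAnti fun i : Fin n => (deltaK i : ℤ) := by
  intro i j hij
  have : Fin.rev j < Fin.rev i := Fin.rev_lt_rev.2 hij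
  exact Int.ofNat_lt.2 this

lemma deltaK_eq (i : Fin n) : (deltaK i : ℤ) = n - 1 - i := by
  rw [deltaK, Fin.val_rev]
  omega

lemma strictAnti_gap {f : Fin n → ℤ} (hf : StrictAnti f) (d : ℕ) :
    ∀ i j : Fin n, (j : ℕ) = i + d → f j + d ≤ f i := by
  induction d with
  | zero =>
    intro i j h
    rw [Fin.ext h]
    simp
  | succ d ih =>
    intro i j h
    have h1 := ih i ⟨i + d, by omega⟩ rfl
    have h2 : f j < f ⟨i + d, by omega⟩ := hf (by simp only [Fin.lt_def]; omega)
    push_cast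
    linarith

/-- The alternants `a_{δ+μ}`. -/
def altK (μ : DomK n) : (Fin n → ℂ) → ℂ := alt gsym fun i => deltaK i + μ.1 i

/-- The analogue of `altA_mem`. Here exponents may drop, not only be permuted, which is why
`sort_dominance` is stated with an inequality for κ. -/
lemma alt_gsym_mem {μ : DomK n} {α κ : Fin n → ℤ} (hα : α ∈ orbitS μ.1)
    (hκ : ∀ i, 0 ≤ κ i ∧ κ i ≤ deltaK i + α i) :
    alt gsym κ ∈ Submodule.span ℂ (altK '' Set.Iic μ)
      ∧ (¬ (α = μ.1 ∧ κ = fun i => deltaK i + μ.1 i) →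
        alt gsym κ ∈ Submodule.span ℂ (altK '' Set.Iio μ)) := by
  obtain ⟨σ, hσ⟩ := mem_orbitS.1 hα
  by_cases hinj : Function.Injective κ
  swap
  · rw [alt_eq_zero _ hinj]
    exact ⟨Submodule.zero_mem _, fun _ => Submodule.zero_mem _⟩
  obtain ⟨τ, hτ⟩ := exists_sort_strictAnti hinj
  set ν : Fin n → ℤ := fun i => κ (τ i) - deltaK i with hν
  have hdom : IsDom ν := by
    constructor
    · intro i j hij
      have h1 := strictAnti_gap hτ (j - i) i j (by have : (i : ℕ) ≤ j := hij; omega)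
      have : (i : ℕ) ≤ j := hij
      simp only [hν, deltaK_eq, Function.comp] at h1 ⊢
      push_cast [this] at h1
      linarith
    · intro i
      have hi := i.2
      -- The last sorted entry is nonnegative and the entries decrease by at least 1, so the i-th is
      -- at least n - 1 - i, the i-th entry of δ.
      have h1 := strictAnti_gap hτ (n - 1 - i) i ⟨n - 1, by omega⟩ (by simp only; omega)
      have h2 := (hκ (τ ⟨n - 1, by omega⟩)).1
      simp only [hν, deltaK_eq, Function.comp] at h1 ⊢
      have h3 : ((n - 1 - (i : ℕ) : ℕ) : ℤ) = n - 1 - i := by omega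
      linarith
  obtain ⟨hle, heq⟩ := sort_dominance (ρ := fun i => (deltaK i : ℤ)) (κ := κ) deltaK_strictAnti
    μ.2.1 σ τ (μ := ν) (fun i => by have := (hκ i).2; rwa [← hσ] at this) (fun i => by simp [hν])
  have hcomp : κ ∘ τ = fun i => deltaK i + ν i := by
    ext i
    simp [hν]
  have h1 := alt_comp gsym κ τ
  rw [hcomp] at h1
  have h2 : alt gsym κ = ((Equiv.Perm.sign τ : ℤ) : ℂ) • altK ⟨ν, hdom⟩ := by
    rw [altK, h1, smul_smul, ← Int.cast_mul, ← Units.val_mul, Int.units_mul_self]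
    simp
  rw [h2]
  have hle' : (⟨ν, hdom⟩ : DomK n) ≤ μ := hle
  refine ⟨Submodule.smul_mem _ _ (Submodule.subset_span ⟨_, hle', rfl⟩), fun hne =>
    Submodule.smul_mem _ _ (Submodule.subset_span ⟨_, lt_of_le_of_ne hle' fun h => hne ?_, rfl⟩)⟩
  have hνμ : ν = μ.1 := congrArg DomK.val h
  exact ⟨by rw [← hσ]; exact funext (heq hνμ).1, funext (heq hνμ).2⟩

/-! ### The symmetric monomials -/

/-- The hyperoctahedral orbit is a disjoint union of sign orbits of the nonnegative vectors α. As
{k, -k} is a set, zero entries are not counted twice. -/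
lemma mono_eq {lam : Fin n → ℤ} (h : ∀ j, 0 ≤ lam j) (x : Fin n → ℂ) :
    mono lam x = ∑ α ∈ orbitS lam, ∏ j, gsym (α j) (x j) := by
  classical
  have h0 : ∀ α ∈ orbitS lam, ∀ j, 0 ≤ α j := by
    intro α hα j
    obtain ⟨σ, rfl⟩ := mem_orbitS.1 hα
    exact h _
  have h1 : ∀ α : Fin n → ℤ, ∏ j, gsym (α j) (x j)
      = ∑ ν ∈ Fintype.piFinset fun j => ({α j, -α j} : Finset ℤ), expo (fun j => (ν j : ℂ)) x := by
    intro α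
    simp only [gsym]
    rw [Finset.prod_univ_sum]
    refine Finset.sum_congr rfl fun ν _ => ?_
    simp only [lau, expo, ← Complex.exp_sum, Finset.mul_sum, mul_assoc]
  simp only [h1]
  rw [← Finset.sum_biUnion]
  · refine Finset.sum_congr ?_ fun _ _ => rfl
    ext ν
    simp only [orbitW, Finset.mem_image, Finset.mem_univ, true_and, Finset.mem_biUnion,
      Fintype.mem_piFinset, Finset.mem_insert, Finset.mem_singleton, Prod.exists]
    constructor
    · rintro ⟨ε, σ, rfl⟩
      refine ⟨lam ∘ σ, mem_orbitS.2 ⟨σ, rfl⟩, fun j => ?_⟩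
      rcases Int.units_eq_one_or (ε j) with h | h <;> simp [h]
    · rintro ⟨α, hα, hν⟩
      obtain ⟨σ, rfl⟩ := mem_orbitS.1 hα
      refine ⟨fun j => if ν j = lam (σ j) then 1 else -1, σ, ?_⟩
      ext j
      rcases hν j with h | h
      · simp [h]
      · by_cases h2 : ν j = lam (σ j)
        · simp [h2]
        · simp only [if_neg h2]
          simp [h]
  · intro α hα β hβ hne
    rw [Function.onFun, Finset.disjoint_left]
    intro ν h1 h2
    apply hne
    ext j
    have h3 := Fintype.mem_piFinset.1 h1 j
    have h4 := Fintype.mem_piFinset.1 h2 j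
    have h5 := h0 α hα j
    have h6 := h0 β hβ j
    simp only [Finset.mem_insert, Finset.mem_singleton] at h3 h4
    omega

/-- Reindexing the orbit by w moves the permutation from the rows to the exponents as well, so the
sum over w becomes a determinant. -/
lemma sum_orbit_det (lam : Fin n → ℤ) (Ψ : Fin n → ℤ → ℂ → ℂ) (x : Fin n → ℂ) :
    ∑ α ∈ orbitS lam, ∑ w : Equiv.Perm (Fin n), ((Equiv.Perm.sign w : ℤ) : ℂ)
        * ∏ k, Ψ (w k) (α k) (x k)
      = ∑ α ∈ orbitS lam, detF n (fun i => Ψ i (α i)) x := by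
  simp only [detF_apply, Matrix.det_apply', Matrix.of_apply]
  rw [Finset.sum_comm, Finset.sum_comm (s := orbitS lam)]
  refine Finset.sum_congr rfl fun w _ => ?_
  rw [orbitS_sum_comp lam w fun α => ((Equiv.Perm.sign w : ℤ) : ℂ) * ∏ k, Ψ (w k) (α k) (x k)]
  rfl

/-- The Vandermonde determinant. -/
def vdm (y : Fin n → ℂ) : ℂ := ∏ i, ∏ j ∈ Finset.Ioi i, (y i - y j)

lemma vdm_eq (y : Fin n → ℂ) : vdm y = ∑ w : Equiv.Perm (Fin n),
    ((Equiv.Perm.sign w : ℤ) : ℂ) * ∏ k, y k ^ deltaK (w k) := by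
  have h := Matrix.det_projVandermonde (R := ℂ) (n := n) 1 y
  simp only [Pi.one_apply, one_mul] at h
  rw [vdm, ← h, ← Matrix.det_transpose, Matrix.det_apply']
  refine Finset.sum_congr rfl fun w _ => ?_
  congr 1
  refine Finset.prod_congr rfl fun k _ => ?_
  simp [Matrix.projVandermonde_apply, deltaK]

end KoornA

end

noncomputable section

namespace KoornA

variable {n : ℕ}

/-! ### Triangularity of the Koornwinder operator -/

/-- The orbit sum attached to a dominant weight. -/
def mK (μ : DomK n) : (Fin n → ℂ) → ℂ := mono μ.1

/-- The monomials `y_k^u g_v`. -/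
def rowP (u : ℕ) (v : ℤ) : ℂ → ℂ := gsym 1 ^ u * gsym v

lemma vdm_mul_mono {lam : Fin n → ℤ} (h : ∀ j, 0 ≤ lam j) (x : Fin n → ℂ) :
    vdm (fun k => gsym 1 (x k)) * mono lam x
      = ∑ α ∈ orbitS lam, detF n (fun i => rowP (deltaK i) (α i)) x := by
  rw [← sum_orbit_det lam (fun i v => rowP (deltaK i) v) x, mono_eq h, vdm_eq, Finset.mul_sum]
  refine Finset.sum_congr rfl fun α _ => ?_
  rw [Finset.sum_mul]
  refine Finset.sum_congr rfl fun w _ => ?_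
  rw [mul_assoc, ← Finset.prod_mul_distrib]
  rfl

lemma orbit_nonneg {μ : DomK n} {α : Fin n → ℤ} (hα : α ∈ orbitS μ.1) (i : Fin n) : 0 ≤ α i := by
  obtain ⟨σ, rfl⟩ := mem_orbitS.1 hα
  exact μ.2.2 _

/-- Each product of a power of 2 cos x and a `gsym` has a single top term, so the determinants of
the rows y^{δ_i} g_{α_i} reduce to alternants of δ + α plus lower ones. -/
lemma vdm_mul_mK (μ : DomK n) : (fun x => vdm fun k => gsym 1 (x k)) * mK μ - altK μ
    ∈ Submodule.span ℂ (altK '' Set.Iio μ) := by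
  classical
  have h1 : (fun x => vdm fun k => gsym 1 (x k)) * mK μ
      = ∑ α ∈ orbitS μ.1, detF n (fun i => rowP (deltaK i) (α i)) := by
    ext x
    rw [Finset.sum_apply, ← vdm_mul_mono μ.2.2]
    rfl
  have h2 : ∀ α ∈ orbitS μ.1, detF n (fun i => rowP (deltaK i) (α i))
      - alt gsym (fun i => deltaK i + α i) ∈ Submodule.span ℂ (altK '' Set.Iio μ) := by
    intro α hα
    have h3 := detF_sub_mem (f := fun i => rowP (deltaK i) (α i)) (e := fun i => deltaK i + α i)
      (fun i => add_nonneg (by positivity) (orbit_nonneg hα i))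
      (fun i => pow_mul_gsym (deltaK i) (orbit_nonneg hα i))
    refine Submodule.span_le.2 ?_ h3
    rintro _ ⟨κ, ⟨hκ, hne⟩, rfl⟩
    refine (alt_gsym_mem hα hκ).2 fun h => hne ?_
    rw [h.2, h.1]
  rw [h1, ← Finset.add_sum_erase _ _ (self_mem_orbitS μ.1), add_sub_right_comm]
  refine Submodule.add_mem _ (h2 _ (self_mem_orbitS μ.1)) (Submodule.sum_mem _ fun α hα => ?_)
  obtain ⟨hne, hα⟩ := Finset.mem_erase.1 hα
  have h4 := (alt_gsym_mem hα (κ := fun i => deltaK i + α i) fun i =>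
    ⟨add_nonneg (by positivity) (orbit_nonneg hα i), le_rfl⟩).2 fun h => hne h.1
  have := Submodule.add_mem _ (h2 α hα) h4
  rwa [sub_add_cancel] at this

/-- The direction of a shift. -/
def dirK (j : Fin n) (e : ℤˣ) (k : Fin n) : ℝ := if k = j then ((e : ℤ) : ℝ) else 0

/-- The coefficients of Koornwinder's operator. -/
def coefK (p : Params) (j : Fin n) (e : ℤˣ) (x : Fin n → ℂ) : ℂ :=
  vb p (sgn e * x j) * ∏ k ∈ ({j} : Finset (Fin n))ᶜ,
    va p (sgn e * x j + x k) * va p (sgn e * x j - x k)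

/-- Koornwinder's second order operator. -/
def DK (p : Params) (f : (Fin n → ℂ) → ℂ) (x : Fin n → ℂ) : ℂ :=
  ∑ j, ∑ e : ℤˣ, coefK p j e x * (shiftL p (dirK j e) f x - f x)

/-- The points where the coefficients are regular. -/
def RegK (p : Params) (x : Fin n → ℂ) : Prop :=
  (∀ j, Reg1 p (x j)) ∧ ∀ j k, j ≠ k → gsym 1 (x j) ≠ gsym 1 (x k)

lemma gsym_one_eq (z : ℂ) : gsym 1 z = 2 * Complex.cos z := by
  rw [gsym_of_ne one_ne_zero, Complex.cos]
  simp only [Pi.add_apply, lau]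
  push_cast
  rw [mul_div_cancel₀ _ two_ne_zero]
  congr 2 <;> ring

/-- By sin((a+b)/2) sin((a-b)/2) = (cos b - cos a)/2, the coefficient is rational in the cosines,
with the differences of a Vandermonde product as denominators. -/
lemma va_mul_va (p : Params) (z w : ℂ) : va p (z + w) * va p (z - w)
    = (gsym 1 (z + Complex.I * p.β * p.g) - gsym 1 w) / (gsym 1 z - gsym 1 w) := by
  have h : ∀ a b : ℂ, Complex.sin ((a + b) / 2) * Complex.sin ((a - b) / 2)
      = (Complex.cos b - Complex.cos a) / 2 := by
    intro a b
    rw [Complex.cos_sub_cos]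
    rw [show (b - a) / 2 = -((a - b) / 2) by ring, Complex.sin_neg, add_comm b a]
    ring
  have h1 := h (z + Complex.I * p.β * p.g) w
  have h2 := h z w
  simp only [va]
  rw [div_mul_div_comm, h2]
  rw [show Complex.I * p.β * p.g + (z + w) = z + Complex.I * p.β * p.g + w by ring,
    show Complex.I * p.β * p.g + (z - w) = z + Complex.I * p.β * p.g - w by ring, h1,
    gsym_one_eq, gsym_one_eq, gsym_one_eq, ← mul_sub, ← mul_sub,
    mul_div_mul_left _ _ two_ne_zero, ← neg_sub (Complex.cos w), ← neg_sub (Complex.cos w) (Complex.cos z),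
    neg_div_neg_eq, div_div_div_cancel_right₀ two_ne_zero]

/-- Only factors containing y_j change, and numerator and denominator change sign together. It plays
the part of `denomA_mul_va`. -/
lemma vdm_update {y : Fin n → ℂ} (hy : ∀ j k, j ≠ k → y j ≠ y k) (j : Fin n) (W : ℂ) :
    vdm y * ∏ k ∈ ({j} : Finset (Fin n))ᶜ, (W - y k) / (y j - y k)
      = vdm (Function.update y j W) := by
  have h := prod_cross {j} fun i k => (W - y k) / (y i - y k)
  rw [Finset.prod_singleton] at h
  rw [h, vdm, vdm, ← Finset.prod_mul_distrib]
  refine Finset.prod_congr rfl fun a _ => ?_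
  rw [← Finset.prod_mul_distrib]
  refine Finset.prod_congr rfl fun b hb => ?_
  have hab : a ≠ b := (Finset.mem_Ioi.1 hb).ne
  have h1 := sub_ne_zero.2 (hy a b hab)
  simp only [Finset.mem_singleton]
  by_cases ha : a = j
  · subst ha
    rw [if_pos ⟨rfl, hab.symm⟩, Function.update_self, Function.update_of_ne hab.symm]
    field_simp
  · by_cases hb' : b = j
    · subst hb'
      rw [if_neg (by simp), if_pos ⟨ha, rfl⟩, Function.update_self, Function.update_of_ne ha]
      have h2 := sub_ne_zero.2 (hy b a hab.symm)
      field_simp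
      ring
    · rw [if_neg (by simp [ha]), if_neg (by simp [hb']), Function.update_of_ne ha,
        Function.update_of_ne hb', mul_one]

lemma sgn_cases (e : ℤˣ) (z : ℂ) : sgn e * z = z ∨ sgn e * z = -z := by
  rcases Int.units_eq_one_or e with h | h <;> simp [h, sgn]

lemma gsym_sgn (k : ℤ) (e : ℤˣ) (z : ℂ) : gsym k (sgn e * z) = gsym k z := by
  rcases sgn_cases e z with h | h <;> rw [h]
  exact gsym_neg k z

lemma vdm_mul_coefK {p : Params} {x : Fin n → ℂ} (hx : RegK p x) (j : Fin n) (e : ℤˣ) :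
    vdm (fun k => gsym 1 (x k)) * coefK p j e x
      = vb p (sgn e * x j) * vdm (Function.update (fun k => gsym 1 (x k)) j
        (gsym 1 (sgn e * x j + Complex.I * p.β * p.g))) := by
  rw [← vdm_update hx.2, coefK]
  simp only [va_mul_va, gsym_sgn]
  ring

lemma shiftL_dirK_apply (p : Params) (j : Fin n) (e : ℤˣ) (f : (Fin n → ℂ) → ℂ) (x : Fin n → ℂ) :
    shiftL p (dirK j e) f x = f (Function.update x j (x j + Complex.I * p.β * sgn e)) := by
  simp only [shiftL, LinearMap.coe_mk, AddHom.coe_mk]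
  congr 1
  ext k
  by_cases h : k = j
  · subst h
    simp [dirK, sgn]
  · simp [dirK, h]

lemma mono_shift_sub {lam : Fin n → ℤ} (h : ∀ j, 0 ≤ lam j) (p : Params) (j : Fin n) (e : ℤˣ)
    (x : Fin n → ℂ) : shiftL p (dirK j e) (mono lam) x - mono lam x
      = ∑ α ∈ orbitS lam, (gsym (α j) (sgn e * x j + Complex.I * p.β) - gsym (α j) (sgn e * x j))
        * ∏ k ∈ ({j} : Finset (Fin n))ᶜ, gsym (α k) (x k) := by
  rw [shiftL_dirK_apply, mono_eq h, mono_eq h, ← Finset.sum_sub_distrib]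
  refine Finset.sum_congr rfl fun α _ => ?_
  rw [Fintype.prod_eq_mul_prod_compl j, Fintype.prod_eq_mul_prod_compl j (fun k => gsym (α k) (x k)),
    Function.update_self, gsym_sgn, sub_mul]
  have h1 : sgn e * (sgn e * x j + Complex.I * p.β) = x j + Complex.I * p.β * sgn e := by
    rcases Int.units_eq_one_or e with h | h <;> simp [h, sgn]
    ring
  have h2 := gsym_sgn (α j) e (sgn e * x j + Complex.I * p.β)
  rw [h1] at h2
  rw [h2]
  congr 2
  refine Finset.prod_congr rfl fun k hk => ?_
  rw [Function.update_of_ne (by simpa using hk)]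

/-- The shift and its coefficient alter only the variable x_j, so in each permutation term just the
j-th factor changes. -/
lemma vdm_mul_term {p : Params} {lam : Fin n → ℤ} (h : ∀ j, 0 ≤ lam j) {x : Fin n → ℂ}
    (hx : RegK p x) (j : Fin n) (e : ℤˣ) :
    vdm (fun k => gsym 1 (x k)) * (coefK p j e x
        * (shiftL p (dirK j e) (mono lam) x - mono lam x))
      = ∑ α ∈ orbitS lam, ∑ w : Equiv.Perm (Fin n), ((Equiv.Perm.sign w : ℤ) : ℂ)
        * (bTerm p (deltaK (w j)) (α j) (sgn e * x j)
          * ∏ k ∈ ({j} : Finset (Fin n))ᶜ, rowP (deltaK (w k)) (α k) (x k)) := by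
  rw [← mul_assoc, vdm_mul_coefK hx, mono_shift_sub h, Finset.mul_sum]
  refine Finset.sum_congr rfl fun α _ => ?_
  rw [vdm_eq, Finset.mul_sum, Finset.sum_mul]
  refine Finset.sum_congr rfl fun w _ => ?_
  rw [Fintype.prod_eq_mul_prod_compl j, Function.update_self]
  have h1 : ∏ k ∈ ({j} : Finset (Fin n))ᶜ, Function.update (fun k => gsym 1 (x k)) j
      (gsym 1 (sgn e * x j + Complex.I * p.β * p.g)) k ^ deltaK (w k)
      = ∏ k ∈ ({j} : Finset (Fin n))ᶜ, gsym 1 (x k) ^ deltaK (w k) :=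
    Finset.prod_congr rfl fun k hk => by rw [Function.update_of_ne (by simpa using hk)]
  simp only [rowP, Pi.mul_apply, Pi.pow_apply, Finset.prod_mul_distrib]
  rw [h1, bTerm]
  ring

lemma vdm_ne_zero {y : Fin n → ℂ} (hy : ∀ j k, j ≠ k → y j ≠ y k) : vdm y ≠ 0 :=
  Finset.prod_ne_zero_iff.2 fun j _ => Finset.prod_ne_zero_iff.2 fun k hk =>
    sub_ne_zero.2 (hy j k (Finset.mem_Ioi.1 hk).ne)

/-- Adding the two signs turns the altered factor into an even Laurent polynomial of unchanged
degree (`exists_bTerm_add_eq`). The result is a sum of determinants with one modified row l, all in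
the span of alternants of weights ≤ μ; the Vandermonde factor is then divided out. The eigenvalue
itself is not needed. -/
theorem DK_triangular (p : Params) (μ : DomK n) :
    ∃ y ∈ Submodule.span ℂ (mK '' Set.Iic μ), ∀ x, RegK p x → DK p (mK μ) x = y x := by
  classical
  choose b hb hbx using fun u v => exists_bTerm_add_eq p u v
  set Ψ : Fin n → Fin n → ℤ → ℂ → ℂ := fun l i v =>
    if i = l then b (deltaK i) v.toNat else rowP (deltaK i) v with hΨ
  set U : (Fin n → ℂ) → ℂ := ∑ l, ∑ α ∈ orbitS μ.1, detF n (fun i => Ψ l i (α i)) with hU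
  have hUmem : U ∈ Submodule.span ℂ (altK '' Set.Iic μ) := by
    refine Submodule.sum_mem _ fun l _ => Submodule.sum_mem _ fun α hα => ?_
    have h1 := detF_mem (f := fun i => Ψ l i (α i)) (e := fun i => deltaK i + α i) (fun i => by
      have h0 := orbit_nonneg hα i
      simp only [hΨ]
      split_ifs
      · have := hb (deltaK i) (α i).toNat
        rwa [Int.toNat_of_nonneg h0] at this
      · have := Submodule.add_mem _ (Sym1_mono (by linarith) (pow_mul_gsym (deltaK i) h0))
          (gsym_mem (by positivity : (0 : ℤ) ≤ deltaK i + α i) le_rfl)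
        rwa [sub_add_cancel] at this)
    refine Submodule.span_le.2 ?_ h1
    rintro _ ⟨κ, hκ, rfl⟩
    exact (alt_gsym_mem hα hκ).1
  have hUeq : ∀ x, RegK p x → vdm (fun k => gsym 1 (x k)) * DK p (mK μ) x = U x := by
    intro x hx
    have h1 : ∀ j : Fin n, vdm (fun k => gsym 1 (x k)) * ∑ e : ℤˣ, coefK p j e x
        * (shiftL p (dirK j e) (mK μ) x - mK μ x)
        = ∑ α ∈ orbitS μ.1, ∑ w : Equiv.Perm (Fin n), ((Equiv.Perm.sign w : ℤ) : ℂ)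
          * ∏ k, Ψ (w j) (w k) (α k) (x k) := by
      intro j
      rw [UnitsInt.univ, Finset.sum_pair (by decide), mul_add, mK, vdm_mul_term μ.2.2 hx,
        vdm_mul_term μ.2.2 hx, ← Finset.sum_add_distrib]
      refine Finset.sum_congr rfl fun α hα => ?_
      rw [← Finset.sum_add_distrib]
      refine Finset.sum_congr rfl fun w _ => ?_
      rw [← mul_add, ← add_mul, Fintype.prod_eq_mul_prod_compl j]
      congr 2
      · have h2 := hbx (deltaK (w j)) (α j).toNat (x j) (hx.1 j)
        rw [Int.toNat_of_nonneg (orbit_nonneg hα j)] at h2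
        simp only [hΨ, if_true]
        rw [← h2]
        simp [sgn]
      · refine Finset.prod_congr rfl fun k hk => ?_
        have : w k ≠ w j := fun h => absurd (w.injective h) (by simpa using hk)
        simp only [hΨ, if_neg this]
    rw [DK, Finset.mul_sum, Finset.sum_congr rfl fun j _ => h1 j, hU, Finset.sum_apply]
    simp only [Finset.sum_apply, ← sum_orbit_det]
    rw [Finset.sum_comm, Finset.sum_comm (s := Finset.univ (α := Fin n))]
    refine Finset.sum_congr rfl fun α _ => ?_
    rw [Finset.sum_comm, Finset.sum_comm (s := Finset.univ (α := Fin n))]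
    refine Finset.sum_congr rfl fun w _ => ?_
    -- Summing over the variable j that is shifted amounts to summing over the modified row l = w j.
    exact Equiv.sum_comp w fun l => ((Equiv.Perm.sign w : ℤ) : ℂ) * ∏ k, Ψ l (w k) (α k) (x k)
  set A : (Fin n → ℂ) → ℂ := fun x => vdm fun k => gsym 1 (x k) with hA
  have h3 : (fun j => A * mK j) '' Set.Iic μ = LinearMap.mulLeft ℂ A '' (mK '' Set.Iic μ) := by
    rw [Set.image_image]
    rfl
  rw [← span_image_Iic_eq (m := fun j => A * mK j) vdm_mul_mK, h3, Submodule.span_image] at hUmem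
  obtain ⟨y, hy, hyU⟩ := hUmem
  refine ⟨y, hy, fun x hx => mul_left_cancel₀ (vdm_ne_zero hx.2) ?_⟩
  rw [hUeq x hx, ← hyU]
  rfl

end KoornA

end

noncomputable section

namespace KoornA

open MeasureTheory

variable {n : ℕ}

/-! ### Symmetry of the Koornwinder operator -/

/-- The factors of the Koornwinder weight. -/
abbrev PosK (n : ℕ) : Type := (PosA n × ℤˣ) ⊕ (Fin n × Fin 4)

/-- The functionals attached to the factors. -/
def rootK : PosK n → (Fin n → ℝ) →ₗ[ℝ] ℝ
  | .inl (ρ, e) => LinearMap.proj (R := ℝ) (φ := fun _ : Fin n => ℝ) ρ.1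
      + ((e : ℤ) : ℝ) • LinearMap.proj (R := ℝ) (φ := fun _ : Fin n => ℝ) ρ.2
  | .inr (j, _) => LinearMap.proj (R := ℝ) (φ := fun _ : Fin n => ℝ) j

lemma rootK_inl (ρ : PosA n) (e : ℤˣ) (s : Fin n → ℝ) :
    rootK (.inl (ρ, e)) s = s ρ.1 + ((e : ℤ) : ℝ) * s ρ.2 := rfl

lemma rootK_inr (j : Fin n) (i : Fin 4) (s : Fin n → ℝ) : rootK (.inr (j, i)) s = s j := rfl

def cK (p : Params) : PosK n → ℝ
  | .inl _ => 1
  | .inr (_, i) => p.cs i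

def κK (p : Params) : PosK n → ℝ
  | .inl _ => p.g
  | .inr (_, i) => p.κs i

/-- The integral exponents. -/
def latK (n : ℕ) : Set (Fin n → ℝ) := Set.range fun (k : Fin n → ℤ) j => (k j : ℝ)

lemma factorDataK {p : Params} (hp : p.Admissible) :
    FactorData p (PosK n) LinearMap.id rootK (cK p) (κK p) (latK n) where
  c_le ρ := by
    rcases ρ with ⟨ρ, e⟩ | ⟨j, i⟩
    · simp [cK]
    · exact Params.abs_cs_le hp i
  κ_nonneg ρ := by
    rcases ρ with ⟨ρ, e⟩ | ⟨j, i⟩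
    · exact hp.g_nonneg
    · exact Params.κs_nonneg hp i
  L_ne ρ h := by
    rcases ρ with ⟨ρ, e⟩ | ⟨j, i⟩
    · have h1 := LinearMap.congr_fun h (Pi.single ρ.1 1)
      rw [rootK_inl] at h1
      have h2 := ρ.lt.ne'
      simp [h2] at h1
    · have h1 := LinearMap.congr_fun h (Pi.single j 1)
      rw [rootK_inr] at h1
      simp at h1
  L_int ρ k := by
    rcases ρ with ⟨ρ, e⟩ | ⟨j, i⟩
    · exact ⟨k ρ.1 + e * k ρ.2, by rw [rootK_inl]; push_cast; rfl⟩
    · exact ⟨k j, rfl⟩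
  exps := by
    choose! K hK using fun (μ : Fin n → ℝ) (hμ : μ ∈ latK n) => hμ
    refine ⟨K, fun μ hμ s => ?_, fun μ hμ ν hν h => ?_⟩
    · exact congrArg (fun κ => ex κ (cvec s)) (hK μ hμ).symm
    · rw [← hK μ hμ, ← hK ν hν, h]

/-- The change of the functionals along a shift. -/
def epsK (j : Fin n) (e : ℤˣ) : PosK n → ℤ
  | .inl (ρ, e') => (if ρ.1 = j then (e : ℤ) else 0) + if (ρ.2 : Fin n) = j then (e' * e : ℤ) else 0
  | .inr (k, _) => if k = j then (e : ℤ) else 0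

lemma units_mul_self (e : ℤˣ) : ((e : ℤ) : ℝ) * ((e : ℤ) : ℝ) = 1 := by
  rcases Int.units_eq_one_or e with h | h <;> simp [h]

lemma shiftDataK (j : Fin n) (e : ℤˣ) :
    ShiftData LinearMap.id rootK (latK n) (epsK j e) (dirK j e) (dirK j e) 1 where
  ε_eq ρ := by
    rcases ρ with ⟨ρ, e'⟩ | ⟨k, i⟩
    · rw [rootK_inl]
      simp [dirK, epsK]
    · rw [rootK_inr]
      simp [dirK, epsK]
  ε_mem ρ := by
    rcases ρ with ⟨ρ, e'⟩ | ⟨k, i⟩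
    · simp only [epsK]
      have h1 := ρ.lt.ne
      by_cases h2 : ρ.1 = j
      · have h3 : (ρ.2 : Fin n) ≠ j := fun h => h1 (h2.trans h.symm)
        rw [if_pos h2, if_neg h3, add_zero]
        exact Or.inr (units_mul_self e)
      · rw [if_neg h2]
        split_ifs
        · refine Or.inr ?_
          have := units_mul_self (e' * e)
          push_cast at this ⊢
          rwa [zero_add]
        · simp
    · simp only [epsK]
      split_ifs
      · exact Or.inr (units_mul_self e)
      · exact Or.inl rfl
  d_eq μ _ := rfl
  N_pos := one_pos
  N_int μ hμ := by
    obtain ⟨k, rfl⟩ := hμ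
    refine ⟨k j * e, ?_⟩
    simp [dirK]

lemma coefK_eq (p : Params) (j : Fin n) (e : ℤˣ) (s : Fin n → ℝ) : coefK p j e (cvec s)
    = ∏ ρ, if epsK j e ρ = 0 then 1 else vfac p (cK p ρ) (κK p ρ) (epsK j e ρ * rootK ρ s) := by
  have he : (e : ℤ) ≠ 0 := e.ne_zero
  have h1 := prod_cross {j} fun i k => va p (sgn e * cvec s i + cvec s k)
    * va p (sgn e * cvec s i - cvec s k)
  rw [Finset.prod_singleton] at h1
  rw [Fintype.prod_sum_type, Fintype.prod_prod_type, Fintype.prod_prod_type, coefK, h1, mul_comm,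
    prod_posA fun a k => (if a ∈ ({j} : Finset (Fin n)) ∧ k ∉ ({j} : Finset (Fin n)) then
      va p (sgn e * cvec s a + cvec s k) * va p (sgn e * cvec s a - cvec s k)
      else if a ∉ ({j} : Finset (Fin n)) ∧ k ∈ ({j} : Finset (Fin n)) then
        va p (sgn e * cvec s k + cvec s a) * va p (sgn e * cvec s k - cvec s a) else 1)]
  congr 1
  · refine Finset.prod_congr rfl fun ρ _ => ?_
    rw [UnitsInt.univ, Finset.prod_pair (by decide)]
    have h2 := ρ.lt.ne
    simp only [Finset.mem_singleton, epsK, rootK_inl, cK, κK, va_eq, cvec]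
    by_cases h3 : ρ.1 = j
    · have h4 : (ρ.2 : Fin n) ≠ j := fun h => h2 (h3.trans h.symm)
      rcases Int.units_eq_one_or e with h | h <;>
        simp [h3, h4, h, sgn, sub_eq_add_neg, add_comm, mul_comm]
    · by_cases h4 : (ρ.2 : Fin n) = j
      · rcases Int.units_eq_one_or e with h | h <;>
          simp [h3, h4, h, sgn, sub_eq_add_neg, add_comm, mul_comm]
      · simp [h3, h4]
  · rw [Fintype.prod_eq_single j]
    · rw [vb_eq]
      refine Finset.prod_congr rfl fun i _ => ?_
      simp [epsK, rootK_inr, cK, κK, sgn, cvec]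
    · intro k hk
      simp [epsK, hk]

lemma Delta_eq {p : Params} (hp : p.Admissible) (s : Fin n → ℝ) : Delta p (cvec s)
    = ∏ ρ, dfac p (cK p ρ) (κK p ρ) (rootK ρ s) * dfac p (cK p ρ) (κK p ρ) (-(rootK ρ s)) := by
  rw [Fintype.prod_sum_type, Fintype.prod_prod_type, Fintype.prod_prod_type, Delta,
    prod_posA fun j k => da p (cvec s j + cvec s k) * da p (cvec s j - cvec s k)]
  congr 1
  · refine Finset.prod_congr rfl fun ρ _ => ?_
    rw [UnitsInt.univ, Finset.prod_pair (by decide)]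
    simp [rootK_inl, cK, κK, da, daPlus_eq, cvec, sub_eq_add_neg]
  · refine Finset.prod_congr rfl fun j _ => ?_
    simp only [rootK_inr, cK, κK, db, dbPlus_eq hp, cvec, Finset.prod_mul_distrib]

lemma inner_eq (p : Params) (f h : (Fin n → ℂ) → ℂ) : inner p f h
    = form (LinearMap.id (R := ℝ) (M := Fin n → ℝ)) (fun s => Delta p (cvec s)) f h := rfl

lemma torusDataK {p : Params} (hp : p.Admissible) :
    TorusData (LinearMap.id (R := ℝ) (M := Fin n → ℝ))
    (fun s => Delta p (cvec s)) (weightOf p rootK (cK p) (κK p)) (latK n) :=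
  (factorDataK hp).torusData hp fun s => Delta_eq hp s

lemma isFormK {p : Params} (hp : p.Admissible) : IsForm (expSpan (latK n)) (inner p) :=
  (torusDataK hp).isForm

/-- The multiplication part of the operator is treated as one more term, indexed by `none`, with the
identity as its shift. -/
lemma DK_eq_sum (p : Params) (f : (Fin n → ℂ) → ℂ) : DK p f = fun x => ∑ a : Option (Fin n × ℤˣ),
    (a.elim (-∑ b : Fin n × ℤˣ, coefK p b.1 b.2 x) fun b => coefK p b.1 b.2 x)
      * a.elim (LinearMap.id (R := ℂ)) (fun b => shiftL p (dirK b.1 b.2)) f x := by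
  ext x
  rw [Fintype.sum_option, Fintype.sum_prod_type, DK]
  simp only [Option.elim_none, Option.elim_some, LinearMap.id_apply, mul_sub,
    Finset.sum_sub_distrib, Fintype.sum_prod_type, ← Finset.sum_mul]
  ring

lemma epsK_neg (j : Fin n) (e : ℤˣ) : epsK j (-e) = -epsK j e := by
  ext ρ
  rcases ρ with ⟨ρ, e'⟩ | ⟨k, i⟩
  · simp only [epsK, Pi.neg_apply, Units.val_neg]
    split_ifs <;> ring
  · simp only [epsK, Pi.neg_apply, Units.val_neg]
    split_ifs <;> ring

lemma inner_DK {p : Params} (hp : p.Admissible) {f g : (Fin n → ℂ) → ℂ}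
    (hf : f ∈ expSpan (latK n)) (hg : g ∈ expSpan (latK n)) :
    inner p (DK p f) g = inner p f (DK p g) := by
  have hF := factorDataK (n := n) hp
  rw [inner_eq, inner_eq, DK_eq_sum, DK_eq_sum]
  have hw : ∀ b : Fin n × ℤˣ, ∀ᵐ s ∂volume.restrict (box n),
      coefK p b.1 b.2 (cvec s) * Delta p (cvec s)
        = shiftWeight p rootK (cK p) (κK p) (epsK b.1 b.2) s 0 := fun b =>
    hF.shiftWeight_eq hp (shiftDataK b.1 b.2) (w := fun s => Delta p (cvec s)) (Delta_eq hp)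
      (Vc := coefK p b.1 b.2) (coefK_eq p b.1 b.2)
  -- Conjugation exchanges the coefficients of opposite shifts; hence the multiplication term is
  -- symmetric.
  have hreal : ∀ s : Fin n → ℝ, (starRingEnd ℂ) (-∑ b : Fin n × ℤˣ,
      shiftWeight p rootK (cK p) (κK p) (epsK b.1 b.2) s 0)
      = -∑ b : Fin n × ℤˣ, shiftWeight p rootK (cK p) (κK p) (epsK b.1 b.2) s 0 := by
    intro s
    rw [map_neg, map_sum]
    simp only [shiftWeight_conj' hp, ← epsK_neg, Fintype.sum_prod_type]
    congr 1
    exact Finset.sum_congr rfl fun j _ => Equiv.sum_comp (Equiv.neg ℤˣ) fun e =>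
      shiftWeight p rootK (cK p) (κK p) (epsK j e) s 0
  refine form_symm_of_terms (A := Option (Fin n × ℤˣ)) (torusDataK hp)
    (fun a x => a.elim (-∑ b : Fin n × ℤˣ, coefK p b.1 b.2 x) fun b => coefK p b.1 b.2 x)
    (fun a => a.elim (LinearMap.id (R := ℂ)) (fun b => shiftL p (dirK b.1 b.2)))
    (fun a s => a.elim (-∑ b : Fin n × ℤˣ, shiftWeight p rootK (cK p) (κK p) (epsK b.1 b.2) s 0)
      fun b => shiftWeight p rootK (cK p) (κK p) (epsK b.1 b.2) s 0)
    (fun a => ?_) (fun a => ?_) (fun a f hf => ?_) (fun a μ hμ ν hν => ?_) hf hg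
  · cases a with
    | none => exact (continuous_finsetSum _ fun b _ => hF.shiftWeight_continuous hp).neg
    | some b => exact hF.shiftWeight_continuous hp
  · cases a with
    | none =>
      filter_upwards [ae_all_iff.2 hw] with s hs
      simp only [Option.elim_none, LinearMap.id_apply]
      rw [neg_mul, Finset.sum_mul]
      congr 1
      exact Finset.sum_congr rfl fun b _ => hs b
    | some b => exact hw b
  · cases a with
    | none => exact hf
    | some b => exact shiftL_mem p _ hf
  · cases a with
    | none =>
      simp only [Option.elim_none, hreal]
      rfl
    | some b => exact hF.form_shift hp (shiftDataK b.1 b.2) hμ hν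

end KoornA

end

noncomputable section

namespace KoornA

open MeasureTheory

variable {n : ℕ}

/-! ### The Koornwinder polynomials -/

lemma ae_regK {p : Params} (hp : p.Admissible) : ∀ᵐ s : Fin n → ℝ, RegK p (cvec s) := by
  filter_upwards [(factorDataK (n := n) hp).ae_ne] with s hs
  have hq : ∀ (k : ℤ) (t : ℝ), 1 - (p.q : ℂ) * lau k t ≠ 0 := by
    intro k t h
    have h1 : (p.q : ℂ) * lau k t = 1 := by linear_combination -h
    have h2 : ‖lau k t‖ = 1 := by
      rw [lau, show Complex.I * k * t = ((k * t : ℝ) : ℂ) * Complex.I by push_cast; ring,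
        Complex.norm_exp_ofReal_mul_I]
    have h3 := congrArg norm h1
    rw [norm_mul, h2, Complex.norm_real, Real.norm_eq_abs, abs_of_pos p.q_pos, mul_one,
      norm_one] at h3
    exact (Params.q_lt_one hp).ne h3
  have hcos : ∀ j k : Fin n, j < k → gsym 1 (cvec s j) ≠ gsym 1 (cvec s k) := by
    intro j k hjk h
    rw [gsym_one_eq, gsym_one_eq, ← sub_eq_zero, ← mul_sub, Complex.cos_sub_cos] at h
    have h1 : Complex.sin ((cvec s j + cvec s k) / 2) = 0
        ∨ Complex.sin ((cvec s j - cvec s k) / 2) = 0 := by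
      rcases mul_eq_zero.1 h with h | h
      · norm_num at h
      · rcases mul_eq_zero.1 h with h | h
        · rcases mul_eq_zero.1 h with h | h
          · norm_num at h
          · exact Or.inl h
        · exact Or.inr h
    rcases h1 with h1 | h1
    · apply (hs (.inl (⟨j, k, Finset.mem_Ioi.2 hjk⟩, 1))).1
      rw [← exp_eq_one_of_sin h1, rootK_inl]
      simp [cK, cvec]
    · apply (hs (.inl (⟨j, k, Finset.mem_Ioi.2 hjk⟩, -1))).1
      rw [← exp_eq_one_of_sin h1, rootK_inl]
      simp [cK, cvec, sub_eq_add_neg]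
  refine ⟨fun j => ⟨?_, hq _ _, hq _ _⟩, fun j k hjk => ?_⟩
  · have h1 := (hs (.inr (j, 0))).1
    have h2 := (hs (.inr (j, 1))).1
    rw [rootK_inr] at h1 h2
    have h3 : lau 2 (cvec s j) = lau 1 (cvec s j) * lau 1 (cvec s j) := by
      rw [lau_mul_apply]; norm_num
    have h4 : lau 1 (cvec s j) = Complex.exp (Complex.I * s j) := by simp [lau, cvec]
    simp only [cK, Params.cs, Matrix.cons_val_zero, Matrix.cons_val_one, Complex.ofReal_one,
      Complex.ofReal_neg, one_mul, neg_mul, ← h4] at h1 h2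
    rw [h3, show 1 - lau 1 (cvec s j) * lau 1 (cvec s j)
      = (1 - lau 1 (cvec s j)) * (1 + lau 1 (cvec s j)) by ring]
    refine mul_ne_zero (sub_ne_zero.2 (Ne.symm h1)) fun h => h2 ?_
    linear_combination -h
  · rcases hjk.lt_or_gt with h | h
    · exact hcos j k h
    · exact (hcos k j h).symm

/-- The functions that vanish at the regular points. -/
def nullK (p : Params) (n : ℕ) : Submodule ℂ ((Fin n → ℂ) → ℂ) where
  carrier := {f | ∀ x, RegK p x → f x = 0}
  add_mem' ha hb x hx := by simp [ha x hx, hb x hx]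
  zero_mem' _ _ := rfl
  smul_mem' c f hf x hx := by simp [hf x hx]

lemma inner_congr {p : Params} (hp : p.Admissible) {f f' g g' : (Fin n → ℂ) → ℂ}
    (hf : f - f' ∈ nullK p n) (hg : g - g' ∈ nullK p n) : inner p f g = inner p f' g' := by
  rw [inner_eq, inner_eq]
  refine integral_congr_ae (ae_restrict_of_ae ?_)
  filter_upwards [ae_regK hp] with s hs
  simp only [LinearMap.id_apply]
  rw [sub_eq_zero.1 (hf _ hs), sub_eq_zero.1 (hg _ hs)]

/-- Koornwinder's operator as a linear map. -/
def DKL (p : Params) : ((Fin n → ℂ) → ℂ) →ₗ[ℂ] (Fin n → ℂ) → ℂ where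
  toFun := DK p
  map_add' f g := by
    ext x
    simp only [DK, Pi.add_apply, map_add, ← Finset.sum_add_distrib]
    exact Finset.sum_congr rfl fun j _ => Finset.sum_congr rfl fun e _ => by ring
  map_smul' c f := by
    ext x
    simp only [DK, Pi.smul_apply, smul_eq_mul, map_smul, RingHom.id_apply, Finset.mul_sum]
    exact Finset.sum_congr rfl fun j _ => Finset.sum_congr rfl fun e _ => by ring

lemma mono_eq_sum_ex (lam : Fin n → ℤ) :
    mono lam = fun x => ∑ ν ∈ orbitW lam, ex (fun j => ((ν j : ℤ) : ℝ)) x := by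
  ext x
  simp [mono, ex]

lemma mK_mem (μ : DomK n) : mK μ ∈ expSpan (latK n) := by
  have : mK μ = ∑ ν ∈ orbitW μ.1, ex fun j => ((ν j : ℤ) : ℝ) := by
    rw [mK, mono_eq_sum_ex]
    ext x
    rw [Finset.sum_apply]
  rw [this]
  exact Submodule.sum_mem _ fun ν _ => Submodule.subset_span ⟨_, ⟨ν, rfl⟩, rfl⟩

lemma mK_linearIndependent : LinearIndependent ℂ (mK (n := n)) := by
  have h : (mK (n := n)) = fun μ => fun x => ∑ ν ∈ orbitW μ.1, ex (fun j => ((ν j : ℤ) : ℝ)) x := by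
    ext μ x
    rw [mK, mono_eq_sum_ex]
  rw [h]
  refine linearIndependent_orbitSum (e := fun (ν : Fin n → ℤ) j => ((ν j : ℤ) : ℝ))
    (fun ν ν' h => funext fun j => Int.cast_injective (congrFun h j)) (fun μ : DomK n => orbitW μ.1)
    DomK.val fun μ ν => ⟨fun h => ?_, ?_⟩
  · obtain ⟨⟨ε, σ⟩, -, h⟩ := Finset.mem_image.1 h
    have h1 : ν.1 ∘ σ = μ.1 := by
      ext j
      have h2 := congrFun h j
      have h3 := μ.2.2 j
      have h4 := ν.2.2 (σ j)
      simp only [Function.comp] at h2 ⊢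
      rcases Int.units_eq_one_or (ε j) with h5 | h5
      · simpa [h5] using h2
      · simp only [h5, Units.val_neg, Units.val_one, neg_mul, one_mul] at h2
        omega
    exact DomK.ext (antitone_eq_of_comp μ.2.1 ν.2.1 h1)
  · rintro rfl
    exact Finset.mem_image.2 ⟨(1, 1), Finset.mem_univ _, by simp⟩

lemma polyOf_sub_mem {μ : DomK n} {c : (Fin n → ℤ) →₀ ℂ}
    (hc : ∀ lam ∈ c.support, IsDom lam ∧ DomLE lam μ.1) (h1 : c μ.1 = 1) :
    polyOf c - mK μ ∈ Submodule.span ℂ (mK '' Set.Iio μ) := by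
  have hμ : μ.1 ∈ c.support := by simp [h1]
  have e : polyOf c - mK μ = ∑ ν ∈ c.support.erase μ.1, c ν • mono ν := by
    ext x
    rw [Pi.sub_apply, polyOf, Finsupp.sum, ← Finset.add_sum_erase _ _ hμ, h1, one_mul, mK,
      add_sub_cancel_left, Finset.sum_apply]
    rfl
  rw [e]
  refine Submodule.sum_mem _ fun ν hν => Submodule.smul_mem _ _ ?_
  obtain ⟨hne, hν⟩ := Finset.mem_erase.1 hν
  obtain ⟨hd, hle⟩ := hc ν hν
  refine Submodule.subset_span ⟨⟨ν, hd⟩, ?_, rfl⟩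
  exact lt_of_le_of_ne (DomK.le_def.2 hle) fun h => hne (congrArg DomK.val h)

lemma DomK.val_injective : Function.Injective (DomK.val : DomK n → Fin n → ℤ) :=
  fun _ _ h => DomK.ext h

lemma exists_polyOf {μ : DomK n} {u : (Fin n → ℂ) → ℂ}
    (hu : u ∈ Submodule.span ℂ (mK '' Set.Iio μ)) : ∃ c : (Fin n → ℤ) →₀ ℂ,
      (∀ lam ∈ c.support, IsDom lam ∧ DomLE lam μ.1) ∧ c μ.1 = 1 ∧ polyOf c = mK μ + u := by
  obtain ⟨l, hl, hP⟩ := (Finsupp.mem_span_image_iff_linearCombination ℂ).1 hu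
  rw [Finsupp.mem_supported] at hl
  have hμ : l μ = 0 := by
    by_contra h0
    exact lt_irrefl μ (hl (Finsupp.mem_support_iff.2 h0))
  classical
  refine ⟨Finsupp.mapDomain DomK.val (l + Finsupp.single μ 1), fun ν hν => ?_, ?_, ?_⟩
  · obtain ⟨κ, hκ, rfl⟩ := Finset.mem_image.1 (Finsupp.mapDomain_support hν)
    refine ⟨κ.2, DomK.le_def.1 ?_⟩
    rcases Finset.mem_union.1 (Finsupp.support_add hκ) with h1 | h1
    · exact le_of_lt (hl h1)
    · rw [Finset.mem_singleton.1 (Finsupp.support_single_subset h1)]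
  · rw [Finsupp.mapDomain_apply DomK.val_injective]
    simp [hμ]
  · ext x
    rw [polyOf, Finsupp.sum_mapDomain_index (by simp) (by intros; ring), Finsupp.sum_add_index'
      (by simp) (by intros; ring), Finsupp.sum_single_index (by simp), one_mul]
    have h1 := congrFun hP x
    rw [Finsupp.linearCombination_apply, Finsupp.sum, Finset.sum_apply] at h1
    rw [Pi.add_apply, ← h1, add_comm]
    rfl

lemma polyOf_sub (c c' : (Fin n → ℤ) →₀ ℂ) : polyOf (c - c') = polyOf c - polyOf c' := by
  ext x
  rw [polyOf, Finsupp.sum_sub_index (by intros; ring)]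
  rfl

lemma eq_zero_of_polyOf {c : (Fin n → ℤ) →₀ ℂ} (hc : ∀ lam ∈ c.support, IsDom lam)
    (h0 : polyOf c = 0) : c = 0 := by
  have hbij : Set.BijOn (DomK.val : DomK n → Fin n → ℤ) (DomK.val ⁻¹' c.support) c.support :=
    ⟨fun _ h => h, DomK.val_injective.injOn, fun ν hν => ⟨⟨ν, hc ν hν⟩, hν, rfl⟩⟩
  have h1 : Finsupp.linearCombination ℂ mK (Finsupp.comapDomain DomK.val c hbij.injOn) = 0 := by
    rw [← h0]
    ext x
    have h2 := Finsupp.sum_comapDomain DomK.val c (fun lam a => a * mono lam x) hbij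
    rw [polyOf, ← h2, Finsupp.linearCombination_apply, Finsupp.sum, Finset.sum_apply]
    rfl
  have h2 := linearIndependent_iff.1 mK_linearIndependent _ h1
  ext ν
  by_contra hν
  have h3 := DFunLike.congr_fun h2 ⟨ν, hc ν (Finsupp.mem_support_iff.2 hν)⟩
  rw [Finsupp.comapDomain_apply] at h3
  exact hν h3

lemma IsKoornwinder.orth_span {p : Params} {μ : DomK n}
    {c : (Fin n → ℤ) →₀ ℂ} (hc : IsKoornwinder p μ.1 c) {ν : DomK n} (hν : ν < μ) :
    inner p (polyOf c) (mK ν) = 0 :=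
  hc.orth ν.1 ν.2 (DomK.le_def.1 hν.le) fun h => hν.ne (DomK.ext h)

lemma mK_image_subset (s : Set (DomK n)) :
    mK '' s ⊆ (expSpan (latK n) : Set ((Fin n → ℂ) → ℂ)) := by
  rintro _ ⟨κ, -, rfl⟩
  exact mK_mem κ

lemma IsKoornwinder.mem {p : Params} {μ : DomK n} {c : (Fin n → ℤ) →₀ ℂ}
    (hc : IsKoornwinder p μ.1 c) : polyOf c ∈ expSpan (latK n) := by
  have h1 := Submodule.span_le.2 (mK_image_subset _) (polyOf_sub_mem hc.supp hc.monic)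
  simpa using Submodule.add_mem _ h1 (mK_mem μ)

/-- Gram-Schmidt gives existence. Two solutions differ by an element of the lower span orthogonal to
that span, so the functions agree, and independence of the orbit sums gives equality of
coefficients. -/
theorem existsUnique_koornwinder {p : Params} (hp : p.Admissible) {lam : Fin n → ℤ}
    (hlam : IsDom lam) : ∃! c, IsKoornwinder p lam c := by
  obtain ⟨μ, rfl⟩ : ∃ μ : DomK n, μ.1 = lam := ⟨⟨lam, hlam⟩, rfl⟩
  have hB := isFormK (n := n) hp
  have hfin : (Set.Iio μ).Finite := μ.finite_Iic.subset Set.Iio_subset_Iic_self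
  obtain ⟨u, hu, h⟩ := hB.exists_orth mK mK_mem hfin.toFinset (mK μ) (mK_mem μ)
  obtain ⟨c, hc1, hc2, hc3⟩ := exists_polyOf (μ := μ) (u := u) (by simpa using hu)
  refine ⟨c, ⟨hc1, hc2, fun ν hν hle hne => ?_⟩, fun c' hc' => ?_⟩
  · rw [hc3]
    exact h ⟨ν, hν⟩ (by
      rw [Set.Finite.mem_toFinset]
      exact lt_of_le_of_ne hle fun h => hne (congrArg DomK.val h))
  · have hck : IsKoornwinder p μ.1 c := ⟨hc1, hc2, fun ν hν hle hne => by
      rw [hc3]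
      exact h ⟨ν, hν⟩ (by
        rw [Set.Finite.mem_toFinset]
        exact lt_of_le_of_ne hle fun h => hne (congrArg DomK.val h))⟩
    have hd : polyOf c' - polyOf c ∈ Submodule.span ℂ (mK '' Set.Iio μ) := by
      have := Submodule.sub_mem _ (polyOf_sub_mem hc'.supp hc'.monic)
        (polyOf_sub_mem hck.supp hck.monic)
      rwa [sub_sub_sub_cancel_right] at this
    have h0 : polyOf c' - polyOf c = 0 := by
      refine hB.eq_zero_of_orth (mK_image_subset _) hd ?_
      rintro _ ⟨κ, hκ, rfl⟩
      rw [hB.sub_left hc'.mem hck.mem (mK_mem κ), hc'.orth_span hκ, hck.orth_span hκ,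
        sub_zero]
    rw [← polyOf_sub] at h0
    classical
    refine sub_eq_zero.1 (eq_zero_of_polyOf (fun ν hν => ?_) h0)
    rcases Finset.mem_union.1 (Finsupp.support_sub hν) with h1 | h1
    · exact (hc'.supp ν h1).1
    · exact (hck.supp ν h1).1

/-- E is the component of the image of m_μ along m_μ itself; only its existence is used. -/
theorem IsKoornwinder.eigen {p : Params} (hp : p.Admissible) {lam : Fin n → ℤ} (hlam : IsDom lam)
    {c : (Fin n → ℤ) →₀ ℂ} (hc : IsKoornwinder p lam c) :
    ∃ E : ℂ, ∀ x, RegK p x → DK p (polyOf c) x = E * polyOf c x := by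
  obtain ⟨μ, rfl⟩ : ∃ μ : DomK n, μ.1 = lam := ⟨⟨lam, hlam⟩, rfl⟩
  have hB := isFormK (n := n) hp
  have hle : Submodule.span ℂ (Set.range (mK (n := n))) ≤ expSpan (latK n) := by
    rw [← Set.image_univ]
    exact Submodule.span_le.2 (mK_image_subset _)
  have htri : ∀ ν : DomK n, ∃ y ∈ Submodule.span ℂ (mK '' Set.Iic ν),
      DKL p (mK ν) - y ∈ nullK p n := by
    intro ν
    obtain ⟨y, hy, h⟩ := DK_triangular p ν
    exact ⟨y, hy, fun x hx => sub_eq_zero.2 (h x hx)⟩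
  obtain ⟨y, hy, he⟩ := htri μ
  rw [span_Iic_eq] at hy
  obtain ⟨z, hz, y', hy', rfl⟩ := Submodule.mem_sup.1 hy
  obtain ⟨E, rfl⟩ := Submodule.mem_span_singleton.1 hz
  have hu := polyOf_sub_mem hc.supp hc.monic
  have hP : mK μ + (polyOf c - mK μ) = polyOf c := by abel
  have key := hB.eigen mK mK_mem (nullK p n) (DKL p) htri (fun f hf g hg f' _ g' _ h1 h2 => by
      have h := inner_DK hp (hle hf) (hle hg)
      rwa [inner_congr hp (f := DK p f) (f' := f') (g := g) (g' := g) h1 (by simp),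
        inner_congr hp (f := f) (f' := f) (g := DK p g) (g' := g') (by simp) h2] at h)
    hy' he hu (fun ν hν => by rw [hP]; exact hc.orth_span hν)
  rw [hP] at key
  exact ⟨E, fun x hx => sub_eq_zero.1 (key x hx)⟩

end KoornA

end

/-! ### The limit of the Koornwinder polynomials and their identification. -/

noncomputable section

namespace KoornA

variable {n : ℕ}

/-! ### The leading part of a Koornwinder polynomial -/

lemma DomLE.wt_le {lam' lam : Fin n → ℤ} (h : DomLE lam' lam) : wt lam' ≤ wt lam := by
  rcases n with _ | n
  · simp [wt]
  · simpa [wt, ← Fin.top_eq_last] using h (Fin.last n)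

lemma sum_le_wt {lam ν : Fin n → ℤ} (h : IsDom lam) (hν : ν ∈ orbitW lam) :
    ∑ j, ν j ≤ wt lam := by
  obtain ⟨⟨ε, σ⟩, -, rfl⟩ := Finset.mem_image.1 hν
  rw [wt, ← Equiv.sum_comp σ lam]
  refine Finset.sum_le_sum fun j _ => ?_
  have := h.2 (σ j)
  rcases Int.units_eq_one_or (ε j) with h5 | h5 <;> simp [h5]
  omega

/-- A sign flip of a nonzero entry lowers the sum, so the maximum |λ| is attained exactly on the
permutation orbit. -/
lemma orbitW_filter {lam : Fin n → ℤ} (h : IsDom lam) :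
    {ν ∈ orbitW lam | ∑ j, ν j = wt lam} = orbitS lam := by
  ext ν
  rw [Finset.mem_filter, mem_orbitS]
  constructor
  · rintro ⟨hν, hs⟩
    obtain ⟨⟨ε, σ⟩, -, rfl⟩ := Finset.mem_image.1 hν
    refine ⟨σ, ?_⟩
    rw [wt, ← Equiv.sum_comp σ lam] at hs
    have := (Finset.sum_eq_sum_iff_of_le fun j _ => ?_).1 hs
    · exact funext fun j => (this j (Finset.mem_univ j)).symm
    · have := h.2 (σ j)
      rcases Int.units_eq_one_or (ε j) with h5 | h5 <;> simp [h5]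
      omega
  · rintro ⟨σ, rfl⟩
    exact ⟨Finset.mem_image.2 ⟨(1, σ), Finset.mem_univ _, by ext; simp⟩,
      by simpa [wt] using Equiv.sum_comp σ lam⟩

lemma expo_sub_I (ν : Fin n → ℤ) (x : Fin n → ℂ) (R : ℝ) :
    expo (fun j => (ν j : ℂ)) (fun j => x j - Complex.I * R)
      = Complex.exp (R * ∑ j, (ν j : ℂ)) * expo (fun j => (ν j : ℂ)) x := by
  rw [expo, expo, ← Complex.exp_add]
  congr 1
  simp only [mul_sub, Finset.sum_sub_distrib, ← Finset.sum_mul]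
  linear_combination (-(R : ℂ) * ∑ j, (ν j : ℂ)) * Complex.I_sq

lemma tendsto_expo {a : ℤ} {ν : Fin n → ℤ} (h : ∑ j, ν j ≤ a) (x : Fin n → ℂ) :
    Tendsto (fun R : ℝ => (Real.exp (-(R * a)) : ℂ)
        * expo (fun j => (ν j : ℂ)) (fun j => x j - Complex.I * R)) atTop
      (𝓝 (if ∑ j, ν j = a then expo (fun j => (ν j : ℂ)) x else 0)) := by
  have h1 : ∀ R : ℝ, (Real.exp (-(R * a)) : ℂ)
        * expo (fun j => (ν j : ℂ)) (fun j => x j - Complex.I * R)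
      = Complex.exp ((((∑ j, ν j : ℤ) - a : ℝ) : ℂ) * R) * expo (fun j => (ν j : ℂ)) x := by
    intro R
    rw [expo_sub_I, ← mul_assoc]
    push_cast
    rw [← Complex.exp_add]
    ring_nf
  simp only [h1]
  split_ifs with he
  · simp [he]
  · have hlt : ((∑ j, ν j : ℤ) - a : ℝ) < 0 := by
      rw [sub_neg]
      exact_mod_cast lt_of_le_of_ne h he
    simpa using (tendsto_exp_mul_atTop hlt).mul_const (expo (fun j => (ν j : ℂ)) x)

lemma tendsto_mono {lam' lam : Fin n → ℤ} (h : IsDom lam') (hle : DomLE lam' lam)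
    (x : Fin n → ℂ) :
    Tendsto (fun R : ℝ => (Real.exp (-(R * wt lam)) : ℂ)
        * mono lam' (fun j => x j - Complex.I * R)) atTop
      (𝓝 (if wt lam' = wt lam then monoLead lam' x else 0)) := by
  have h1 : (if wt lam' = wt lam then monoLead lam' x else 0)
      = ∑ ν ∈ orbitW lam', if ∑ j, ν j = wt lam then expo (fun j => (ν j : ℂ)) x else 0 := by
    split_ifs with he
    · rw [← Finset.sum_filter, ← he, orbitW_filter h, monoLead]
    · exact (Finset.sum_eq_zero fun ν hν => if_neg fun h2 => he
        (le_antisymm hle.wt_le (h2.symm.trans_le (sum_le_wt h hν)))).symm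
  rw [h1]
  simp only [mono, Finset.mul_sum]
  exact tendsto_finsetSum _ fun ν hν => tendsto_expo ((sum_le_wt h hν).trans hle.wt_le) x

theorem IsKoornwinder.tendsto_pLead {p : Params} {lam : Fin n → ℤ} {c : (Fin n → ℤ) →₀ ℂ}
    (hc : IsKoornwinder p lam c) (x : Fin n → ℂ) :
    Tendsto (fun R : ℝ => (Real.exp (-(R * wt lam)) : ℂ)
        * polyOf c (fun j => x j - Complex.I * R)) atTop (𝓝 (pLead lam c x)) := by
  have h1 : pLead lam c x
      = ∑ lam' ∈ c.support, c lam' * if wt lam' = wt lam then monoLead lam' x else 0 := by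
    simp only [pLead, Finset.sum_filter, mul_ite, mul_zero]
  rw [h1]
  simp only [polyOf, Finsupp.sum, Finset.mul_sum, mul_left_comm _ (c _)]
  exact tendsto_finsetSum _ fun ν hν =>
    (tendsto_mono (hc.supp ν hν).1 (hc.supp ν hν).2 x).const_mul _

/-! ### Limits of the coefficients -/

lemma tendsto_exp_atTop {a : ℝ} (ha : 0 < a) (z : ℂ) :
    Tendsto (fun R : ℝ => Complex.exp (Complex.I * (z + Complex.I * (a * R)))) atTop (𝓝 0) := by
  have h : ∀ R : ℝ, Complex.exp (Complex.I * (z + Complex.I * (a * R)))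
      = Complex.exp (((-a : ℝ) : ℂ) * R) * Complex.exp (Complex.I * z) := by
    intro R
    rw [← Complex.exp_add]
    congr 1
    push_cast
    linear_combination ((a : ℂ) * R) * Complex.I_sq
  simp only [h]
  simpa using (tendsto_exp_mul_atTop (neg_neg_iff_pos.2 ha)).mul_const (Complex.exp (Complex.I * z))

lemma tendsto_vfac_up (p : Params) (c κ : ℝ) {a : ℝ} (ha : 0 < a) (z : ℂ) :
    Tendsto (fun R : ℝ => vfac p c κ (z + Complex.I * (a * R))) atTop
      (𝓝 (Real.exp (p.β * κ / 2) : ℂ)) := by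
  have h := tendsto_exp_atTop ha z
  have h1 := ((((h.const_mul ((c : ℂ) * Real.exp (-p.β * κ))).const_sub 1).div
    ((h.const_mul (c : ℂ)).const_sub 1) (by simp)).const_mul (Real.exp (p.β * κ / 2) : ℂ))
  simpa [vfac] using h1

/-- Rewriting the factor in e^{-iz} inverts c and τ; this reduces the limit Im z → -∞ to Im z → +∞.
-/
lemma vfac_neg (p : Params) {c : ℝ} (hc : c ≠ 0) (κ : ℝ) (z : ℂ) :
    vfac p c κ z = vfac p c⁻¹ (-κ) (-z) := by
  have hc' : (c : ℂ) ≠ 0 := by exact_mod_cast hc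
  have hw := Complex.exp_ne_zero (Complex.I * z)
  have h1 : (Real.exp (-p.β * -κ) : ℂ) = (Real.exp (-p.β * κ) : ℂ)⁻¹ := by
    rw [← Complex.ofReal_inv, ← Real.exp_neg]
    ring_nf
  have h2 : (Real.exp (p.β * -κ / 2) : ℂ)
      = Real.exp (p.β * κ / 2) * Real.exp (-p.β * κ) := by
    rw [← Complex.ofReal_mul, ← Real.exp_add]
    ring_nf
  have h3 : (Real.exp (-p.β * κ) : ℂ) ≠ 0 := by exact_mod_cast (Real.exp_pos _).ne'
  have h4 : 1 - ((c⁻¹ : ℝ) : ℂ) * (Complex.exp (Complex.I * z))⁻¹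
      = -((c : ℂ) * Complex.exp (Complex.I * z))⁻¹
        * (1 - c * Complex.exp (Complex.I * z)) := by
    push_cast
    field_simp
    ring
  have h5 : 1 - ((c⁻¹ : ℝ) : ℂ) * (Real.exp (-p.β * κ) : ℂ)⁻¹ * (Complex.exp (Complex.I * z))⁻¹
      = -((c : ℂ) * Complex.exp (Complex.I * z))⁻¹ * (Real.exp (-p.β * κ) : ℂ)⁻¹
        * (1 - c * Real.exp (-p.β * κ) * Complex.exp (Complex.I * z)) := by
    push_cast
    field_simp
    ring
  have h6 : -((c : ℂ) * Complex.exp (Complex.I * z))⁻¹ ≠ 0 :=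
    neg_ne_zero.2 (inv_ne_zero (mul_ne_zero hc' hw))
  rw [vfac, vfac, mul_neg Complex.I, Complex.exp_neg, h1, h2, h4, h5, mul_assoc (-_) _ (1 - _),
    mul_div_mul_left _ _ h6]
  simp only [mul_assoc, mul_div_assoc, mul_inv_cancel_left₀ h3]

lemma tendsto_vfac_down (p : Params) {c : ℝ} (hc : c ≠ 0) (κ : ℝ) {a : ℝ} (ha : 0 < a) (z : ℂ) :
    Tendsto (fun R : ℝ => vfac p c κ (z - Complex.I * (a * R))) atTop
      (𝓝 (Real.exp (-(p.β * κ / 2)) : ℂ)) := by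
  have h := tendsto_vfac_up p c⁻¹ (-κ) ha (-z)
  have h1 : ∀ R : ℝ, vfac p c κ (z - Complex.I * (a * R))
      = vfac p c⁻¹ (-κ) (-z + Complex.I * (a * R)) := fun R => by
    rw [vfac_neg p hc]
    ring_nf
  simp only [h1]
  convert h using 3
  ring_nf

lemma tendsto_vfac_sgn (p : Params) {c : ℝ} (hc : c ≠ 0) (κ : ℝ) {a : ℝ} (ha : 0 < a) (e : ℤˣ)
    (z : ℂ) :
    Tendsto (fun R : ℝ => vfac p c κ (sgn e * (z - Complex.I * (a * R)))) atTop
      (𝓝 (Real.exp (-((e : ℤ) * (p.β * κ / 2))) : ℂ)) := by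
  rcases Int.units_eq_one_or e with rfl | rfl
  · simpa [sgn] using tendsto_vfac_down p hc κ ha z
  · have h := tendsto_vfac_up p c κ ha (-z)
    simpa [sgn, neg_add_eq_sub] using h

lemma Params.cs_ne_zero (p : Params) (i : Fin 4) : p.cs i ≠ 0 := by
  have h0 := p.sq_pos.ne'
  fin_cases i <;> simp [Params.cs, h0]

/-- Half the total coupling. -/
def Params.asym (p : Params) (n : ℕ) : ℝ := p.β * (∑ i, p.κs i + (n - 1) * p.g) / 2

/-- The product `∏_{k ≠ j} v_a(e(x_j - x_k))`. -/
def coefA (p : Params) (j : Fin n) (e : ℤˣ) (x : Fin n → ℂ) : ℂ :=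
  ∏ k ∈ {j}ᶜ, va p (sgn e * x j - sgn e * x k)

lemma coefK_swap (p : Params) (j : Fin n) (e : ℤˣ) (x : Fin n → ℂ) : coefK p j e x
    = vb p (sgn e * x j) * ∏ k ∈ {j}ᶜ, va p (sgn e * (x j - x k)) * va p (sgn e * (x j + x k)) := by
  rw [coefK]
  congr 1
  refine Finset.prod_congr rfl fun k _ => ?_
  rcases Int.units_eq_one_or e with rfl | rfl
  · rw [mul_comm]
    simp [sgn]
  · simp only [sgn, Units.val_neg, Units.val_one, Int.cast_neg, Int.cast_one, neg_one_mul]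
    ring_nf

/-- Differences x_j - x_k do not feel the translation, while v_b and each v_a(x_j + x_k) tend to
constants, whose exponents add up to -e times `asym`. -/
lemma tendsto_coefK (p : Params) (j : Fin n) (e : ℤˣ) (x : Fin n → ℂ) :
    Tendsto (fun R : ℝ => coefK p j e fun k => x k - Complex.I * R) atTop
      (𝓝 ((Real.exp (-((e : ℤ) * p.asym n)) : ℂ) * coefA p j e x)) := by
  have hb : Tendsto (fun R : ℝ => vb p (sgn e * (x j - Complex.I * R))) atTop
      (𝓝 (∏ i, (Real.exp (-((e : ℤ) * (p.β * p.κs i / 2))) : ℂ))) := by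
    simp only [vb_eq]
    refine tendsto_finsetProd _ fun i _ => ?_
    simpa using tendsto_vfac_sgn p (p.cs_ne_zero i) (p.κs i) one_pos e (x j)
  have ha : ∀ k, Tendsto (fun R : ℝ =>
      va p (sgn e * (x j - Complex.I * R + (x k - Complex.I * R)))) atTop
      (𝓝 (Real.exp (-((e : ℤ) * (p.β * p.g / 2))) : ℂ)) := by
    intro k
    simp only [va_eq]
    convert tendsto_vfac_sgn p one_ne_zero p.g two_pos e (x j + x k) using 4
    push_cast
    ring
  have h := hb.mul (tendsto_finsetProd ({j}ᶜ : Finset (Fin n)) fun k _ =>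
    (ha k).const_mul (va p (sgn e * (x j - x k))))
  have hcard : ((({j}ᶜ : Finset (Fin n)).card : ℕ) : ℝ) = n - 1 := by
    have : 1 ≤ n := j.pos
    simp [Finset.card_compl, this]
  simp only [coefK_swap, sub_sub_sub_cancel_right]
  convert h using 2
  · rw [Finset.prod_mul_distrib, Finset.prod_const, coefA, mul_left_comm, mul_comm]
    simp only [mul_sub]
    congr 1
    rw [← Complex.ofReal_prod, ← Complex.ofReal_pow, ← Complex.ofReal_mul, ← Real.exp_sum,
      ← Real.exp_nat_mul, ← Real.exp_add, hcard, Finset.sum_neg_distrib, ← Finset.mul_sum,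
      ← Finset.sum_div, ← Finset.mul_sum, Params.asym]
    ring_nf

/-- The exponentials e^{-2ix_j} and e^{-i(x_j+x_k)} tend to 0 along the translation and so leave the
finitely many forbidden values. -/
lemma eventually_regK (p : Params) {x : Fin n → ℂ} (hx : RegA x) :
    ∀ᶠ R : ℝ in atTop, RegK p fun j => x j - Complex.I * R := by
  have h2 : ∀ z : ℂ, Tendsto (fun R : ℝ => Complex.exp (Complex.I * (-z + Complex.I * (2 * R))))
      atTop (𝓝 0) := fun z => by simpa using tendsto_exp_atTop two_pos (-z)
  have hq : (p.q : ℂ) ≠ 0 := by exact_mod_cast p.q_pos.ne'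
  refine Filter.Eventually.and (Filter.eventually_all.2 fun j => ?_)
    (Filter.eventually_all.2 fun j => Filter.eventually_all.2 fun k => ?_)
  · have h := h2 (2 * x j)
    filter_upwards [h.eventually_ne zero_ne_one, h.eventually_ne hq.symm,
      h.eventually_ne (inv_ne_zero hq).symm] with R h3 h4 h5
    have h6 : Complex.exp (Complex.I * (-(2 * x j) + Complex.I * (2 * R)))
        = lau (-2) (x j - Complex.I * R) := by
      rw [lau]
      congr 1
      push_cast
      ring
    have h7 : lau 2 (x j - Complex.I * R) * lau (-2) (x j - Complex.I * R) = 1 := by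
      simp [lau_mul_apply, lau_zero]
    rw [h6] at h3 h4 h5
    refine ⟨fun h8 => h3 ?_, fun h8 => h4 ?_, fun h8 => h5 ?_⟩
    · linear_combination h7 + lau (-2) (x j - Complex.I * R) * h8
    · linear_combination (p.q : ℂ) * h7 + lau (-2) (x j - Complex.I * R) * h8
    · refine eq_inv_of_mul_eq_one_right ?_
      linear_combination -h8
  · by_cases hjk : j = k
    · exact Filter.Eventually.of_forall fun R h => absurd hjk h
    filter_upwards [(h2 (x j + x k)).eventually_ne zero_ne_one] with R h3 _ h4
    rw [gsym_one_eq, gsym_one_eq] at h4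
    have h5 := sub_eq_zero.2 (mul_left_cancel₀ two_ne_zero h4)
    rw [Complex.cos_sub_cos, sub_sub_sub_cancel_right] at h5
    -- Equality of cosines leaves the half sum or the half difference; regularity of x, unchanged by
    -- the translation, excludes the latter.
    have h6 := (mul_eq_zero.1 h5).resolve_right (hx j k hjk)
    have h7 := exp_eq_one_of_sin (by simpa using h6)
    apply h3
    rw [← inv_inj, ← Complex.exp_neg, inv_one, ← h7]
    ring_nf

/-- Both sides of the equation for p_λ, scaled by e^{-R|λ|}, converge at x - iRω; uniqueness of
limits concludes. -/
theorem IsKoornwinder.eigen_pLead {p : Params} (hp : p.Admissible) {lam : Fin n → ℤ}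
    (hlam : IsDom lam) {c : (Fin n → ℤ) →₀ ℂ} (hc : IsKoornwinder p lam c) :
    ∃ E : ℂ, ∀ x, RegA x → ∑ j, ∑ e : ℤˣ, (Real.exp (-((e : ℤ) * p.asym n)) : ℂ) * coefA p j e x
      * (shiftL p (dirK j e) (pLead lam c) x - pLead lam c x) = E * pLead lam c x := by
  obtain ⟨E, hE⟩ := hc.eigen hp hlam
  refine ⟨E, fun x hx => ?_⟩
  have h0 := hc.tendsto_pLead x
  have h1 : Tendsto (fun R : ℝ => (Real.exp (-(R * wt lam)) : ℂ)
      * DK p (polyOf c) fun j => x j - Complex.I * R) atTop (𝓝 (E * pLead lam c x)) := by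
    refine (h0.const_mul E).congr' ?_
    filter_upwards [eventually_regK p hx] with R hR
    rw [hE _ hR]
    ring
  refine tendsto_nhds_unique ?_ h1
  simp only [DK, Finset.mul_sum]
  refine tendsto_finsetSum _ fun j _ => tendsto_finsetSum _ fun e _ => ?_
  have h2 := hc.tendsto_pLead fun k => x k + Complex.I * p.β * dirK j e k
  have h3 := (tendsto_coefK p j e x).mul (h2.sub h0)
  refine h3.congr fun R => ?_
  rw [← mul_sub, mul_left_comm]
  simp only [shiftL, LinearMap.coe_mk, AddHom.coe_mk]
  congr 4
  ext k
  ring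

end KoornA

end

noncomputable section

namespace KoornA

variable {n : ℕ}

/-! ### Separating the center of mass -/

lemma sum_projA (hn : 1 ≤ n) (lam : Fin n → ℤ) : ∑ j, projA lam j = 0 := by
  have : (n : ℝ) ≠ 0 := by positivity
  simp only [projA, Finset.sum_sub_distrib, Finset.sum_const, Finset.card_univ, Fintype.card_fin,
    nsmul_eq_mul, wt]
  push_cast
  field_simp
  ring

lemma isDomWeightA_projA (hn : 1 ≤ n) {lam : Fin n → ℤ} (h : Antitone lam) :
    IsDomWeightA (projA lam) := by
  refine isDomWeightA_iff.2 ⟨sum_projA hn lam, fun j k hjk => ⟨(lam j - lam k).toNat, ?_⟩⟩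
  have h1 : ((lam j - lam k).toNat : ℤ) = lam j - lam k :=
    Int.toNat_of_nonneg (sub_nonneg.2 (h hjk))
  have h2 : (((lam j - lam k).toNat : ℤ) : ℝ) = lam j - lam k := by rw [h1]; push_cast; ring
  rw [Int.cast_natCast] at h2
  rw [h2, projA, projA]
  ring

lemma weightLEA_projA (hn : 1 ≤ n) {lam' lam : Fin n → ℤ} (h : DomLE lam' lam)
    (hw : wt lam' = wt lam) : WeightLEA (projA lam') (projA lam) := by
  refine (weightLEA_iff (by rw [sum_projA hn, sum_projA hn])).2 fun k => ?_
  have h0 := sub_nonneg.2 (h k)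
  refine ⟨(∑ j ∈ Finset.Iic k, lam j - ∑ j ∈ Finset.Iic k, lam' j).toNat, ?_⟩
  have h2 : (((∑ j ∈ Finset.Iic k, lam j - ∑ j ∈ Finset.Iic k, lam' j).toNat : ℤ) : ℝ)
      = ∑ j ∈ Finset.Iic k, (lam j : ℝ) - ∑ j ∈ Finset.Iic k, (lam' j : ℝ) := by
    rw [Int.toNat_of_nonneg h0]
    push_cast
    ring
  rw [Int.cast_natCast] at h2
  rw [h2]
  simp only [projA, Finset.sum_sub_distrib, hw]
  ring

lemma exp_mul_monoLead (lam : Fin n → ℤ) (x : Fin n → ℂ) :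
    Complex.exp (-Complex.I * wt lam * (∑ j, x j) / n) * monoLead lam x = monoA (projA lam) x := by
  have h : orbitS (projA lam)
      = (orbitS lam).image fun ν j => (ν j : ℝ) - (wt lam : ℝ) / n := by
    ext κ
    simp only [mem_orbitS, Finset.mem_image]
    constructor
    · rintro ⟨σ, rfl⟩
      exact ⟨_, ⟨σ, rfl⟩, rfl⟩
    · rintro ⟨_, ⟨σ, rfl⟩, rfl⟩
      exact ⟨σ, rfl⟩
  rw [monoA, h, Finset.sum_image, monoLead, Finset.mul_sum]
  · refine Finset.sum_congr rfl fun ν _ => ?_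
    rw [expo, expo, ← Complex.exp_add]
    congr 1
    push_cast
    simp only [sub_mul, Finset.sum_sub_distrib, ← Finset.mul_sum]
    ring
  · intro ν _ ν' _ h
    ext j
    have := congrFun h j
    simp only [sub_left_inj] at this
    exact_mod_cast this

lemma pA_eq (lam : Fin n → ℤ) (c : (Fin n → ℤ) →₀ ℂ) :
    pA lam c = ∑ lam' ∈ c.support with wt lam' = wt lam, c lam' • monoA (projA lam') := by
  ext x
  rw [pA, pLead, Finset.mul_sum, Finset.sum_apply]
  refine Finset.sum_congr rfl fun ν hν => ?_
  rw [Pi.smul_apply, smul_eq_mul, ← exp_mul_monoLead, (Finset.mem_filter.1 hν).2, mul_left_comm]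

lemma projA_injective_of_wt {lam' lam : Fin n → ℤ} (hw : wt lam' = wt lam)
    (h : projA lam' = projA lam) : lam' = lam := by
  ext j
  have := congrFun h j
  simp only [projA, hw, sub_left_inj] at this
  exact_mod_cast this

/-- The projection of a dominant vector to a dominant weight of type `A`. -/
def domProj (hn : 1 ≤ n) {lam : Fin n → ℤ} (h : IsDom lam) : DomA n :=
  ⟨projA lam, isDomWeightA_projA hn h.1⟩

lemma IsKoornwinder.pA_sub_mem (hn : 1 ≤ n) {p : Params} {lam : Fin n → ℤ} (hlam : IsDom lam)
    {c : (Fin n → ℤ) →₀ ℂ} (hc : IsKoornwinder p lam c) :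
    pA lam c - mA (domProj hn hlam) ∈ Submodule.span ℂ (mA '' Set.Iio (domProj hn hlam)) := by
  classical
  have hmem : lam ∈ {lam' ∈ c.support | wt lam' = wt lam} :=
    Finset.mem_filter.2 ⟨Finsupp.mem_support_iff.2 (by simp [hc.monic]), rfl⟩
  rw [pA_eq, ← Finset.add_sum_erase _ _ hmem, hc.monic, one_smul]
  have : monoA (projA lam) = mA (domProj hn hlam) := rfl
  rw [this, add_sub_cancel_left]
  refine Submodule.sum_mem _ fun ν hν => Submodule.smul_mem _ _ ?_
  obtain ⟨hne, hν⟩ := Finset.mem_erase.1 hν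
  obtain ⟨hs, hw⟩ := Finset.mem_filter.1 hν
  obtain ⟨hd, hle⟩ := hc.supp ν hs
  exact Submodule.subset_span ⟨domProj hn hd, lt_of_le_of_ne (weightLEA_projA hn hle hw)
    fun h => hne (projA_injective_of_wt hw (congrArg DomA.val h)), rfl⟩

/-- The functions invariant under translations along `e_1 + ⋯ + e_n`. -/
def transInv (n : ℕ) : Submodule ℂ ((Fin n → ℂ) → ℂ) where
  carrier := {f | ∀ (a : ℂ) (x : Fin n → ℂ), f (fun j => x j + a) = f x}
  add_mem' hf hg a x := by simp [hf a x, hg a x]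
  zero_mem' _ _ := rfl
  smul_mem' c f hf a x := by simp [hf a x]

lemma expSpan_le_transInv : expSpan (latA n) ≤ transInv n := by
  refine Submodule.span_le.2 ?_
  rintro _ ⟨μ, hμ, rfl⟩ a x
  have h0 : ∑ j, (μ j : ℂ) = 0 := by exact_mod_cast hμ.1
  simp only [ex, expo, mul_add, Finset.sum_add_distrib, ← Finset.sum_mul, h0, zero_mul, add_zero]

lemma IsKoornwinder.pA_mem (hn : 1 ≤ n) {p : Params} {lam : Fin n → ℤ} (hlam : IsDom lam)
    {c : (Fin n → ℤ) →₀ ℂ} (hc : IsKoornwinder p lam c) : pA lam c ∈ expSpan (latA n) := by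
  have := Submodule.add_mem _ (span_mA_image_le _ (hc.pA_sub_mem hn hlam))
    (mA_mem (domProj hn hlam))
  rwa [sub_add_cancel] at this

lemma DA_of_transInv (p : Params) (r : ℕ) {f : (Fin n → ℂ) → ℂ} (hf : f ∈ transInv n) :
    DA p r f = Dprime p r f := by
  rw [DA, transl_Dprime]
  congr 1
  ext x
  exact hf _ x

/-! ### The reduced eigenvalue equation -/

lemma Dprime_one (p : Params) (f : (Fin n → ℂ) → ℂ) (x : Fin n → ℂ) :
    Dprime p 1 f x = ∑ j, coefA p j 1 x * shiftL p (dirK j 1) f x := by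
  rw [Dprime, Finset.powersetCard_one, Finset.sum_map]
  refine Finset.sum_congr rfl fun j _ => ?_
  simp only [Function.Embedding.coeFn_mk, Finset.prod_singleton, coefA, sgn, Units.val_one,
    Int.cast_one, one_mul]
  congr 1
  simp only [shiftL, LinearMap.coe_mk, AddHom.coe_mk]
  congr 1
  ext k
  rw [shiftPt_one]
  by_cases h : k = j <;> simp [dirK, h]

/-- A shift along all coordinates except j differs from the backward shift along j by a common
translation, which f does not see. -/
lemma Dprime_pred (hn : 1 ≤ n) (p : Params) {f : (Fin n → ℂ) → ℂ} (hf : f ∈ transInv n) (x : Fin n → ℂ) :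
    Dprime p (n - 1) f x = ∑ j, coefA p j (-1) x * shiftL p (dirK j (-1)) f x := by
  rw [Dprime]
  symm
  refine Finset.sum_bij (fun j _ => {j}ᶜ) (fun j _ => ?_) (fun j _ k _ h => ?_) (fun J hJ => ?_)
    fun j _ => ?_
  · simp [Finset.mem_powersetCard, Finset.card_compl]
  · simpa using h
  · have h1 := (Finset.mem_powersetCard.1 hJ).2
    have h2 : Jᶜ.card = 1 := by
      rw [Finset.card_compl, h1, Fintype.card_fin]
      omega
    obtain ⟨j, hj⟩ := Finset.card_eq_one.1 h2
    exact ⟨j, Finset.mem_univ _, by rw [← hj, compl_compl]⟩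
  · rw [compl_compl]
    simp only [Finset.prod_singleton, coefA, sgn, Units.val_neg, Units.val_one, Int.cast_neg,
      Int.cast_one, neg_one_mul, neg_sub_neg]
    congr 1
    simp only [shiftL, LinearMap.coe_mk, AddHom.coe_mk]
    rw [← hf (Complex.I * p.β)]
    congr 1
    ext k
    rw [shiftPt_one]
    by_cases h : k = j <;> simp [dirK, h]

lemma WeightLEA.sum_mul_nonneg {ν μ : Fin n → ℝ} (h : WeightLEA ν μ) {f : Fin n → ℝ}
    (hf : Antitone f) : 0 ≤ ∑ j, f j * (μ j - ν j) := by
  obtain ⟨a, ha⟩ := h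
  have h1 : ∀ j, μ j - ν j = ∑ i, (a i : ℝ) * simpleRoot i j := fun j => by
    have := congrFun ha j
    simpa using this
  have h2 : ∑ j, f j * (μ j - ν j) = ∑ i, (a i : ℝ) * ∑ j, f j * simpleRoot i j := by
    simp only [h1, Finset.mul_sum]
    rw [Finset.sum_comm]
    exact Finset.sum_congr rfl fun i _ => Finset.sum_congr rfl fun j _ => by ring
  rw [h2]
  refine Finset.sum_nonneg fun i _ => mul_nonneg (Nat.cast_nonneg _) ?_
  rw [sum_mul_simpleRoot, sub_nonneg]
  exact hf (Fin.le_def.2 (by simp))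

/-- The weight `0`. -/
def DomA.zero (n : ℕ) : DomA n := ⟨0, isDomWeightA_iff.2 ⟨by simp, fun _ _ _ => ⟨0, by simp⟩⟩⟩

/-- Pairing 0 - ν with the decreasing vector ν gives -|ν|² ≥ 0. -/
lemma DomA.Iio_zero : Set.Iio (DomA.zero n) = ∅ := by
  refine Set.eq_empty_of_forall_notMem fun ν hν => ?_
  have h1 := WeightLEA.sum_mul_nonneg (le_of_lt hν : ν ≤ DomA.zero n) ν.2.antitone
  have h2 : ∑ j, ν.1 j * ν.1 j = 0 := by
    refine le_antisymm ?_ (Finset.sum_nonneg fun j _ => mul_self_nonneg _)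
    simpa [DomA.zero] using h1
  refine (ne_of_lt hν) (DomA.ext (funext fun j => ?_))
  exact mul_self_eq_zero.1
    ((Finset.sum_eq_zero_iff_of_nonneg fun j _ => mul_self_nonneg _).1 h2 j (Finset.mem_univ j))

/-- Nothing lies below the weight 0, so triangularity leaves only the eigenvalue. This evaluates the
sum of the coefficients of the operator. -/
lemma Dprime_const (p : Params) (r : ℕ) {x : Fin n → ℂ} (hx : RegA x) :
    Dprime p r (fun _ => 1) x = evA p r (0 : Fin n → ℝ) := by
  obtain ⟨y, hy, h⟩ := Dprime_triangular p r (DomA.zero n)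
  rw [DomA.Iio_zero, Set.image_empty, Submodule.span_empty, Submodule.mem_bot] at hy
  have h0 : monoA (DomA.zero n).1 = fun _ => 1 := by
    ext x
    have : orbitS (DomA.zero n).1 = {0} := by
      ext ν
      simp only [mem_orbitS, Finset.mem_singleton]
      exact ⟨fun ⟨σ, h⟩ => h ▸ rfl, fun h => ⟨1, h ▸ rfl⟩⟩
    simp [monoA, this, expo]
  have h1 := h x hx
  rw [h0, hy] at h1
  simpa [evA, DomA.zero] using h1

/-- The combination of `D̂'_1` and `D̂'_{n-1}` obtained as a limit of Koornwinder's operator. -/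
def limL (p : Params) (n : ℕ) (u : ℝ) : ((Fin n → ℂ) → ℂ) →ₗ[ℂ] (Fin n → ℂ) → ℂ :=
  (Real.exp (-u) : ℂ) • DprimeL p 1 + (Real.exp u : ℂ) • DprimeL p (n - 1)

lemma limL_apply (hn : 1 ≤ n) (p : Params) (u : ℝ) {f : (Fin n → ℂ) → ℂ} (hf : f ∈ transInv n)
    (x : Fin n → ℂ) : limL p n u f x
      = ∑ j, ∑ e : ℤˣ, (Real.exp (-((e : ℤ) * u)) : ℂ) * coefA p j e x * shiftL p (dirK j e) f x := by
  simp only [limL, LinearMap.add_apply, LinearMap.smul_apply, Pi.add_apply, Pi.smul_apply,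
    smul_eq_mul, DprimeL, LinearMap.coe_mk, AddHom.coe_mk]
  rw [Dprime_one, Dprime_pred hn p hf, Finset.mul_sum, Finset.mul_sum, ← Finset.sum_add_distrib]
  refine Finset.sum_congr rfl fun j _ => ?_
  rw [UnitsInt.univ, Finset.sum_pair (by decide)]
  simp only [Units.val_one, Units.val_neg, Int.cast_one, Int.cast_neg, one_mul, neg_one_mul,
    neg_neg, mul_assoc]

/-- A shift of one coordinate moves the center of mass too; the resulting factor is the reason for
the summand β|λ|/n in u. -/
lemma shiftL_pLead (p : Params) (lam : Fin n → ℤ) (c : (Fin n → ℤ) →₀ ℂ) (j : Fin n) (e : ℤˣ)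
    (x : Fin n → ℂ) : shiftL p (dirK j e) (pLead lam c) x
      = Complex.exp (Complex.I * wt lam * (∑ k, x k) / n)
        * ((Real.exp (-((e : ℤ) * (p.β * wt lam / n))) : ℂ)
          * shiftL p (dirK j e) (pA lam c) x) := by
  have hs : ∑ k, (x k + Complex.I * p.β * dirK j e k)
      = ∑ k, x k + Complex.I * p.β * (e : ℤ) := by
    rw [Finset.sum_add_distrib, ← Finset.mul_sum]
    simp [dirK, apply_ite]
  simp only [shiftL, LinearMap.coe_mk, AddHom.coe_mk, pA, hs]
  push_cast
  rw [← mul_assoc, ← mul_assoc, ← Complex.exp_add, ← Complex.exp_add]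
  have : Complex.I * wt lam * (∑ k, x k) / n + -(((e : ℤ) : ℂ) * (p.β * wt lam / n))
      + -Complex.I * wt lam * (∑ k, x k + Complex.I * p.β * (e : ℤ)) / n = 0 := by
    linear_combination (-(p.β : ℂ) * (e : ℤ) * wt lam / n) * Complex.I_sq
  rw [this, Complex.exp_zero, one_mul]

/-- The shifts with e = 1 give `D̂'_1`, those with e = -1 give `D̂'_{n-1}`, and the subtracted terms
form a constant that is absorbed in the eigenvalue. -/
theorem IsKoornwinder.limL_eigen (hn : 1 ≤ n) {p : Params} (hp : p.Admissible)
    {lam : Fin n → ℤ} (hlam : IsDom lam) {c : (Fin n → ℤ) →₀ ℂ} (hc : IsKoornwinder p lam c) :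
    ∃ E : ℂ, limL p n (p.asym n + p.β * wt lam / n) (pA lam c) - E • pA lam c ∈ nullA n := by
  obtain ⟨E, hE⟩ := hc.eigen_pLead hp hlam
  have hinv := expSpan_le_transInv (hc.pA_mem hn hlam)
  refine ⟨E + ((Real.exp (-p.asym n) : ℂ) * evA p 1 (0 : Fin n → ℝ)
    + (Real.exp (p.asym n) : ℂ) * evA p (n - 1) (0 : Fin n → ℝ)), fun x hx => ?_⟩
  have h1 := hE x hx
  -- The multiplication part is the operator applied to 1, without the center-of-mass factor in its
  -- exponent.
  have hconst : limL p n (p.asym n) (fun _ => 1) x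
      = (Real.exp (-p.asym n) : ℂ) * evA p 1 (0 : Fin n → ℝ)
        + (Real.exp (p.asym n) : ℂ) * evA p (n - 1) (0 : Fin n → ℝ) := by
    rw [← Dprime_const p 1 hx, ← Dprime_const p (n - 1) hx]
    rfl
  have hφ := Complex.exp_ne_zero (Complex.I * wt lam * (∑ k, x k) / n)
  have hL : pLead lam c x = Complex.exp (Complex.I * wt lam * (∑ k, x k) / n) * pA lam c x := by
    rw [pA, ← mul_assoc, ← Complex.exp_add]
    ring_nf
    simp
  have h2 : ∑ j, ∑ e : ℤˣ, (Real.exp (-((e : ℤ) * p.asym n)) : ℂ) * coefA p j e x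
        * (shiftL p (dirK j e) (pLead lam c) x - pLead lam c x)
      = Complex.exp (Complex.I * wt lam * (∑ k, x k) / n)
        * (limL p n (p.asym n + p.β * wt lam / n) (pA lam c) x
          - limL p n (p.asym n) (fun _ => 1) x * pA lam c x) := by
    rw [limL_apply hn p _ hinv, limL_apply hn p _ (fun _ _ => rfl), Finset.sum_mul,
      ← Finset.sum_sub_distrib, Finset.mul_sum]
    refine Finset.sum_congr rfl fun j _ => ?_
    rw [Finset.sum_mul, ← Finset.sum_sub_distrib, Finset.mul_sum]
    refine Finset.sum_congr rfl fun e _ => ?_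
    have h3 : (Real.exp (-((e : ℤ) * (p.asym n + p.β * wt lam / n))) : ℂ)
        = Real.exp (-((e : ℤ) * p.asym n)) * Real.exp (-((e : ℤ) * (p.β * wt lam / n))) := by
      rw [← Complex.ofReal_mul, ← Real.exp_add]
      ring_nf
    have h4 : shiftL p (dirK j e) (fun _ => 1) x = 1 := rfl
    rw [shiftL_pLead, hL, h3, h4]
    ring
  rw [h2, hL, mul_left_comm] at h1
  have h5 := mul_left_cancel₀ hφ h1
  rw [hconst] at h5
  simp only [Pi.sub_apply, Pi.smul_apply, smul_eq_mul]
  linear_combination h5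

end KoornA

end

noncomputable section

namespace KoornA

variable {n : ℕ}

/-! ### Identification with the Macdonald polynomials -/

lemma esA_one (p : Params) (θ : Fin n → ℝ) : esA p 1 θ = ∑ j, Real.exp (-p.β * θ j) := by
  simp [esA, Finset.powersetCard_one, Finset.sum_map]

lemma esA_pred (hn : 1 ≤ n) (p : Params) {θ : Fin n → ℝ} (h : ∑ j, θ j = 0) :
    esA p (n - 1) θ = ∑ j, Real.exp (p.β * θ j) := by
  rw [esA]
  symm
  refine Finset.sum_bij (fun j _ => {j}ᶜ) (fun j _ => ?_) (fun j _ k _ h => ?_) (fun J hJ => ?_)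
    fun j _ => ?_
  · simp [Finset.mem_powersetCard, Finset.card_compl]
  · simpa using h
  · have h1 := (Finset.mem_powersetCard.1 hJ).2
    have h2 : Jᶜ.card = 1 := by
      rw [Finset.card_compl, h1, Fintype.card_fin]
      omega
    obtain ⟨j, hj⟩ := Finset.card_eq_one.1 h2
    exact ⟨j, Finset.mem_univ _, by rw [← hj, compl_compl]⟩
  · rw [← Real.exp_sum, ← Finset.mul_sum]
    have h1 := Finset.sum_add_sum_compl {j} θ
    rw [h, Finset.sum_singleton] at h1
    rw [← neg_eq_of_add_eq_zero_right h1]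
    ring_nf

lemma exp_tangent_le (u v : ℝ) : Real.exp v * (1 + (u - v)) ≤ Real.exp u := by
  have h := Real.add_one_le_exp (u - v)
  calc Real.exp v * (1 + (u - v)) ≤ Real.exp v * Real.exp (u - v) :=
        mul_le_mul_of_nonneg_left (by linarith) (Real.exp_pos _).le
    _ = Real.exp u := by rw [← Real.exp_add]; ring_nf

lemma exp_tangent_lt {u v : ℝ} (h : u ≠ v) : Real.exp v * (1 + (u - v)) < Real.exp u := by
  have h := Real.add_one_lt_exp (sub_ne_zero.2 h)
  calc Real.exp v * (1 + (u - v)) < Real.exp v * Real.exp (u - v) :=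
        mul_lt_mul_of_pos_left (by linarith) (Real.exp_pos _)
    _ = Real.exp u := by rw [← Real.exp_add]; ring_nf

/-- The eigenvalues of `limL`. -/
def evL (p : Params) (u : ℝ) (μ : DomA n) : ℝ :=
  Real.exp (-u) * evA p 1 μ.1 + Real.exp u * evA p (n - 1) μ.1

lemma evL_eq (hn : 1 ≤ n) (p : Params) (u : ℝ) (μ : DomA n) : evL p u μ
    = ∑ j, (Real.exp (-(p.β * (p.g * rhoHalf n j + μ.1 j) + u))
        + Real.exp (p.β * (p.g * rhoHalf n j + μ.1 j) + u)) := by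
  have h : ∑ j, (p.g * rhoHalf n j + μ.1 j) = 0 := by
    rw [Finset.sum_add_distrib, ← Finset.mul_sum, sum_rhoHalf, μ.2.1, mul_zero, add_zero]
  rw [evL, evA, evA, esA_one, esA_pred hn p h, Finset.mul_sum, Finset.mul_sum,
    ← Finset.sum_add_distrib]
  refine Finset.sum_congr rfl fun j _ => ?_
  rw [← Real.exp_add, ← Real.exp_add]
  ring_nf

/-- The eigenvalue is the sum of 2 cosh θ_j, θ = β(gρ + μ) + u. By strict convexity it exceeds its
tangent approximation at ν, whose slopes 2 sinh θ_j decrease with j and hence pair nonnegatively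
with μ - ν, a sum of simple roots. -/
lemma evL_lt (hn : 1 ≤ n) {p : Params} (hp : p.Admissible) (u : ℝ) {ν μ : DomA n} (h : ν < μ) :
    evL p u ν < evL p u μ := by
  rw [evL_eq hn, evL_eq hn]
  set θ : DomA n → Fin n → ℝ := fun κ j => p.β * (p.g * rhoHalf n j + κ.1 j) + u with hθ
  have hd : ∀ j, θ μ j - θ ν j = p.β * (μ.1 j - ν.1 j) := fun j => by simp only [hθ]; ring
  have hθν : Antitone (θ ν) := fun j k hjk => by
    have h1 := rhoHalf_strictAnti.antitone hjk
    have h2 := ν.2.antitone hjk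
    have h3 := mul_le_mul_of_nonneg_left h1 hp.g_nonneg
    have h4 := mul_le_mul_of_nonneg_left (add_le_add h3 h2) hp.β_pos.le
    simp only [hθ]
    linarith
  have hf : Antitone fun j => Real.exp (θ ν j) - Real.exp (-θ ν j) := fun j k hjk => by
    have h1 := Real.exp_le_exp.2 (hθν hjk)
    have h2 := Real.exp_le_exp.2 (neg_le_neg (hθν hjk))
    simp only
    linarith
  have key : 0 ≤ ∑ j, (Real.exp (θ ν j) - Real.exp (-θ ν j)) * (θ μ j - θ ν j) := by
    simp only [hd, mul_left_comm _ p.β]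
    rw [← Finset.mul_sum]
    exact mul_nonneg hp.β_pos.le (WeightLEA.sum_mul_nonneg (le_of_lt h : ν ≤ μ) hf)
  obtain ⟨k, hk⟩ : ∃ k, θ μ k ≠ θ ν k := by
    by_contra hall
    push Not at hall
    refine h.ne (DomA.ext (funext fun j => ?_))
    have h1 := hd j
    rw [hall j, sub_self] at h1
    exact (sub_eq_zero.1 ((mul_eq_zero.1 h1.symm).resolve_left hp.β_pos.ne')).symm
  have hlt : ∑ j, (Real.exp (-θ ν j) * (1 + (-θ μ j - -θ ν j))
        + Real.exp (θ ν j) * (1 + (θ μ j - θ ν j)))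
      < ∑ j, (Real.exp (-θ μ j) + Real.exp (θ μ j)) :=
    Finset.sum_lt_sum (fun j _ => add_le_add (exp_tangent_le _ _) (exp_tangent_le _ _))
      ⟨k, Finset.mem_univ _, add_lt_add_of_le_of_lt (exp_tangent_le _ _) (exp_tangent_lt hk)⟩
  refine lt_of_le_of_lt ?_ hlt
  have : ∑ j, (Real.exp (-θ ν j) * (1 + (-θ μ j - -θ ν j))
        + Real.exp (θ ν j) * (1 + (θ μ j - θ ν j)))
      = ∑ j, (Real.exp (-θ ν j) + Real.exp (θ ν j))
        + ∑ j, (Real.exp (θ ν j) - Real.exp (-θ ν j)) * (θ μ j - θ ν j) := by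
    rw [← Finset.sum_add_distrib]
    exact Finset.sum_congr rfl fun j _ => by ring
  rw [this]
  exact le_add_of_nonneg_right key

/-- The single operator `limL` need only separate μ from the weights below it, since the difference
from the Macdonald polynomial is a combination of those. -/
theorem IsKoornwinder.pA_eq_macA (hn : 1 ≤ n) {p : Params} (hp : p.Admissible)
    {lam : Fin n → ℤ} (hlam : IsDom lam) {c : (Fin n → ℤ) →₀ ℂ} (hc : IsKoornwinder p lam c) :
    pA lam c = macA hp (domProj hn hlam) := by
  obtain ⟨E, hE⟩ := hc.limL_eigen hn hp hlam
  set u := p.asym n + p.β * wt lam / n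
  refine (isFormA hp).eq_of_eigen (macA hp) (macA_mem hp) (fun _ _ h => macA_orthogonal hp h)
    (macA_ne_zero hp) (nullA n) (fun f hf h0 => eq_zero_of_nullA hp hf h0) (limL p n u)
    (fun μ => (evL p u μ : ℂ)) (fun μ => ?_) (fun ν hν h => ?_) ?_ hE
  · have h1 := Submodule.add_mem _
      (Submodule.smul_mem _ (Real.exp (-u) : ℂ) (macA_eigen hp 1 μ))
      (Submodule.smul_mem _ (Real.exp u : ℂ) (macA_eigen hp (n - 1) μ))
    convert h1 using 1
    simp only [limL, LinearMap.add_apply, LinearMap.smul_apply, evL, smul_sub, smul_smul]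
    push_cast
    rw [add_smul]
    abel
  · exact (evL_lt hn hp u hν).ne (by exact_mod_cast h)
  · rw [span_mac_eq (macA_sub_mem hp)]
    have h1 := Submodule.sub_mem _ (hc.pA_sub_mem hn hlam) (macA_sub_mem hp (domProj hn hlam))
    rwa [sub_sub_sub_cancel_right] at h1

/-- The prefactor distributes over the r factors of each monomial and replaces λ by its projection
to sum zero. -/
lemma eigA_eq (p : Params) (r : ℕ) (lam : Fin n → ℤ) :
    eigA p r (fun j => (lam j : ℝ) + rhoA p j) = evA p r (projA lam) := by
  have hρ : ∀ j, rhoA p j = p.g * rhoHalf n j := fun j => by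
    rw [rhoA, rhoHalf]
    ring
  have hs : ∑ j, ((lam j : ℝ) + p.g * rhoHalf n j) = wt lam := by
    rw [Finset.sum_add_distrib, ← Finset.mul_sum, sum_rhoHalf, wt]
    push_cast
    ring
  simp only [eigA, hρ, hs, evA, esA]
  rw [Finset.mul_sum]
  refine Finset.sum_congr rfl fun J hJ => ?_
  rw [← Real.exp_sum, ← Real.exp_sum, ← Real.exp_add, ← Finset.mul_sum, ← Finset.mul_sum]
  simp only [Finset.sum_add_distrib, projA, Finset.sum_sub_distrib, Finset.sum_const,
    (Finset.mem_powersetCard.1 hJ).2, nsmul_eq_mul]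
  ring_nf

theorem IsKoornwinder.DA_pA (hn : 1 ≤ n) {p : Params} (hp : p.Admissible) {lam : Fin n → ℤ}
    (hlam : IsDom lam) {c : (Fin n → ℤ) →₀ ℂ} (hc : IsKoornwinder p lam c) (r : ℕ)
    {x : Fin n → ℂ} (hx : RegA x) :
    DA p r (pA lam c) x = (eigA p r (fun j => (lam j : ℝ) + rhoA p j) : ℂ) * pA lam c x := by
  rw [DA_of_transInv p r (expSpan_le_transInv (hc.pA_mem hn hlam)), hc.pA_eq_macA hn hp hlam,
    eigA_eq]
  exact sub_eq_zero.1 (macA_eigen hp r (domProj hn hlam) x hx)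

end KoornA

end

theorem mainTheorem10 (n : ℕ) (hn : 1 ≤ n) (p : KoornA.Params) (hp : p.Admissible) :
    -- the leading part as a limit, and its conjugation by `Δ̃₊`
    (∀ r : ℕ, 1 ≤ r → r ≤ n → ∀ f : (Fin n → ℂ) → ℂ,
      (∀ x : Fin n → ℂ,
        Tendsto (fun R : ℝ => (Real.exp (-(r * p.β * R)) : ℂ)
            * ((KoornA.Lam R x)⁻¹ * KoornA.Dhat p r (fun y => KoornA.Lam R y * f y) x))
          atTop (𝓝 (KoornA.Dlead p r f x)))
      ∧ (∀ x : Fin n → ℂ, KoornA.RegularPlus p x →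
          KoornA.tDeltaPlus p x
              * KoornA.Dlead p r (fun y => (KoornA.tDeltaPlus p y)⁻¹ * f y) x
            = KoornA.Dprime p r f x))
    -- splitting off the center of mass, and Macdonald's operators
    ∧ (∀ r : ℕ, 1 ≤ r → r < n → ∀ f : (Fin n → ℂ) → ℂ,
      KoornA.Dprime p r f = KoornA.transl p ((r : ℝ) / n) (KoornA.DA p r f)
      ∧ KoornA.Dprime p r f = KoornA.DA p r (KoornA.transl p ((r : ℝ) / n) f)
      ∧ (∀ x : Fin n → ℂ, KoornA.RegularA p x →
          KoornA.EOp p r f x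
            = (Real.exp (-p.β * p.g * r * (n - r) / 2) : ℂ) * KoornA.DA p r f x))
    -- the polynomials as limits of Koornwinder polynomials, and the eigenvalue equations
    ∧ (∀ lam : Fin n → ℤ, KoornA.IsDom lam →
      (∃! c, KoornA.IsKoornwinder p lam c)
      ∧ ∀ c, KoornA.IsKoornwinder p lam c →
        (∀ x : Fin n → ℂ,
          Tendsto (fun R : ℝ => (Real.exp (-(R * KoornA.wt lam)) : ℂ)
              * KoornA.polyOf c (fun j => x j - Complex.I * R))
            atTop (𝓝 (KoornA.pLead lam c x)))
        ∧ KoornA.pA lam c ≠ 0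
        ∧ (∀ r : ℕ, 1 ≤ r → r < n → ∀ x : Fin n → ℂ,
            (∀ j k : Fin n, j ≠ k → Complex.sin ((x j - x k) / 2) ≠ 0) →
            KoornA.DA p r (KoornA.pA lam c) x
              = (KoornA.eigA p r (fun j => (lam j : ℝ) + KoornA.rhoA p j) : ℂ)
                * KoornA.pA lam c x))
    -- coincidence with the Macdonald polynomials
    ∧ (∃ P, KoornA.IsMacdonaldA (n := n) p P
      ∧ (∀ Q, KoornA.IsMacdonaldA p Q → ∀ μ, KoornA.IsDomWeightA μ → Q μ = P μ)
      ∧ ∀ lam : Fin n → ℤ, KoornA.IsDom lam → ∀ c, KoornA.IsKoornwinder p lam c →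
          KoornA.IsDomWeightA (KoornA.projA lam)
            ∧ KoornA.pA lam c = P (KoornA.projA lam)) := by
  refine ⟨fun r hr _ f => ⟨fun x => KoornA.Dhat_tendsto_Dlead hp hr f x,
      fun x hx => KoornA.tDeltaPlus_conj hp r f x hx⟩,
    fun r _ hr f => ⟨KoornA.Dprime_eq_transl_DA p r f, KoornA.Dprime_eq_DA_transl p r f,
      fun x hx => KoornA.EOp_eq hp hr f x hx⟩,
    fun lam hlam => ⟨KoornA.existsUnique_koornwinder hp hlam, fun c hc =>
      ⟨hc.tendsto_pLead, ?_, fun r _ _ x hx => hc.DA_pA hn hp hlam r hx⟩⟩,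
    KoornA.macFam hp, KoornA.isMacdonaldA_macFam hp,
    fun Q hQ μ hμ => KoornA.macdonaldA_unique hp hQ hμ,
    fun lam hlam c hc => ⟨KoornA.isDomWeightA_projA hn hlam.1, ?_⟩⟩
  · rw [hc.pA_eq_macA hn hp hlam]
    exact KoornA.macA_ne_zero hp _
  · rw [hc.pA_eq_macA hn hp hlam]
    exact (KoornA.macFam_eq hp (KoornA.domProj hn hlam)).symm
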